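/- Let $p\ge 2$ be an integer, $\mathfrak q=e^{i\pi/p}$, $[n]=\frac{\mathfrak q^n-\mathfrak q^{-n}}{\mathfrak q-\mathfrak q^{-1}}$, $[n]!=[1][2]\cdots[n]$. **The quantum group.** Let $LU$ be the associative unital $\mathbb C$-algebra with generators $E,F,K,e,f,h$ and relations $$KEK^{-1}=\mathfrak q^2E,\quad KFK^{-1}=\mathfrak q^{-2}F,\quad [E,F]=\tfrac{K-K^{-1}}{\mathfrak q-\mathfrak q^{-1}},\quad E^p=F^p=0,\quad K^{2p}=1,$$ $$[h,e]=e,\quad [h,f]=-f,\quad [e,f]=2h,\quad [h,K]=[E,e]=[K,e]=[F,f]=[K,f]=0,$$ $$[F,e]=\tfrac1{[p-1]!}K^p\,\tfrac{\mathfrak qK-\mathfrak q^{-1}K^{-1}}{\mathfrak q-\mathfrak q^{-1}}\,E^{p-1},\qquad [E,f]=\tfrac{(-1)^{p+1}}{[p-1]!}F^{p-1}\,\tfrac{\mathfrak qK-\mathfrak q^{-1}K^{-1}}{\mathfrak q-\mathfrak q^{-1}},$$ $$[h,E]=\tfrac12EA,\qquad [h,F]=-\tfrac12AF.$$ Here $$A=\sum_{s=1}^{p-1}\frac{(u_s(\mathfrak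 q^{-s-1})-u_s(\mathfrak q^{s-1}))K+\mathfrak q^{s-1}u_s(\mathfrak q^{s-1})-\mathfrak q^{-s-1}u_s(\mathfrak q^{-s-1})}{(\mathfrak q^{s-1}-\mathfrak q^{-s-1})\,u_s(\mathfrak q^{-s-1})\,u_s(\mathfrak q^{s-1})}\;u_s(K)\,\boldsymbol e_s,\qquad u_s(x)=\prod_{1\le n\le p-1,\,n\ne s}(x-\mathfrak q^{s-1-2n}),$$ where, with $\beta_j=\mathfrak q^j+\mathfrak q^{-j}$, $C=(\mathfrak q-\mathfrak q^{-1})^2EF+\mathfrak q^{-1}K+\mathfrak qK^{-1}$ and $\psi_s(x)=(x-\beta_0)(x-\beta_p)\prod_{1\le j\le p-1,\,j\neq s}(x-\beta_j)^2$, $$\boldsymbol e_s=\tfrac1{\psi_s(\beta_s)}\Bigl(\psi_s(C)-\tfrac{\psi_s'(\beta_s)}{\psi_s(\beta_s)}(C-\beta_s)\psi_s(C)\Bigr).$$ On a tensor product of modules (over $\mathbb C$) the generators act through $$\Delta(E)=1\otimes E+E\otimes K,\quad \Delta(F)=K^{-1}\otimes F+F\otimes 1,\quad \Delta(K)=K\otimes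 K,\quad \Delta(h)=\tfrac12[\Delta(e),\Delta(f)],$$ $$\Delta(e)=e\otimes1+K^p\otimes e+\tfrac1{[p-1]!}\sum_{r=1}^{p-1}\tfrac{\mathfrak q^{r(p-r)}}{[r]}K^pE^{p-r}\otimes E^rK^{-r},$$ $$\Delta(f)=f\otimes1+K^p\otimes f+\tfrac{(-1)^p}{[p-1]!}\sum_{s=1}^{p-1}\tfrac{\mathfrak q^{-s(p-s)}}{[s]}K^{p+s}F^s\otimes F^{p-s}.$$ **The modules.** Let $\alpha=\pm1$, $1\le s\le p$, $r\ge1$. The irreducible module $\mathscr X^\alpha_{s,r}$ has basis $a_{n,m}$, $0\le n\le s-1$, $0\le m\le r-1$, and action $$Ka_{n,m}=\alpha\mathfrak q^{s-1-2n}a_{n,m},\quad Ea_{n,m}=\alpha[n][s-n]a_{n-1,m},\quad Fa_{n,m}=a_{n+1,m},$$ $$ha_{n,m}=\tfrac12(r-1-2m)a_{n,m},\quad ea_{n,m}=m(r-m)a_{n,m-1},\quad fa_{n,m}=a_{n,m+1},$$ where a basis vector with an index out of range is $0$ (here and below). The projective cover $\mathscr P^\alpha_{s,r}$ of $\mathscr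 X^\alpha_{s,r}$ is $\mathscr P^\alpha_{p,r}=\mathscr X^\alpha_{p,r}$ for $s=p$. For $1\le s\le p-1$ it has basis $t_{n,m},b_{n,m}$ ($0\le n\le s-1$, $0\le m\le r-1$), $l_{k,m}$ ($0\le k\le p-s-1$, $1\le m\le r-1$), $r_{k,m}$ ($0\le k\le p-s-1$, $0\le m\le r$). With $g=(-1)^p[s]/[p-1]!$ the action is as follows. - $K$ multiplies $t_{n,m}$ and $b_{n,m}$ by $\alpha\mathfrak q^{s-1-2n}$, and $l_{k,m}$ and $r_{k,m}$ by $-\alpha\mathfrak q^{p-s-1-2k}$. - $Et_{n,m}=\alpha[n][s-n]t_{n-1,m}+\alpha g\,b_{n-1,m}$ for $n\ge1$, and $Et_{0,m}=\alpha g\frac{r-m}{r}r_{p-s-1,m}+\alpha g\frac mr l_{p-s-1,m}$. - $El_{k,m}=-\alpha[k][p-s-k]l_{k-1,m}$ for $k\ge1$, and $El_{0,m}=\alpha g(m-r)b_{s-1,m-1}$. - $Er_{k,m}=-\alpha[k][p-s-k]r_{k-1,m}$ for $k\ge1$, and $Er_{0,m}=\alpha g\,m\,b_{s-1,m-1}$.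 - $Eb_{n,m}=\alpha[n][s-n]b_{n-1,m}$. - $Ft_{n,m}=t_{n+1,m}$ for $n\le s-2$, and $Ft_{s-1,m}=\frac1r r_{0,m+1}-\frac1r l_{0,m+1}$. - $Fl_{k,m}=l_{k+1,m}$ and $Fr_{k,m}=r_{k+1,m}$ for $k\le p-s-2$, and $Fl_{p-s-1,m}=Fr_{p-s-1,m}=b_{0,m}$. - $Fb_{n,m}=b_{n+1,m}$. - $h$ multiplies $t_{n,m},b_{n,m}$ by $\frac12(r-1-2m)$ and $l_{k,m},r_{k,m}$ by $\frac12(r-2m)$. - $e$ sends $t_{n,m},b_{n,m},l_{k,m},r_{k,m}$ to $m(r-m)t_{n,m-1}$, $m(r-m)b_{n,m-1}$, $(m-1)(r-m)l_{k,m-1}$, $m(r+1-m)r_{k,m-1}$ respectively. - $f$ raises $m$ by one. Put $\mathscr P^\alpha_{s,r}=0$ for $r\le0$. **Notation.** All sums below run over $r$, respectively $s$, from the lower limit in steps of $2$ up to the upper limit (and are zero if the upper limit is below the lower one). The modified sums are $$\mathop{{\bigoplus}'}_{r=a}^{b}f(r)=\bigoplus_{r=a}^b\bigl(1-\tfrac12\delta_{r,a}-\tfrac12\delta_{r,b}\bigr)f(r),$$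 $$\mathop{{\bigoplus}''}_{r=a}^{b}f(r)=\bigoplus_{r=a}^b\bigl(1-\tfrac34\delta_{r,a}-\tfrac14\delta_{r,a+2}(1+\delta_{a,-1})-\tfrac14\delta_{r,b-2}-\tfrac34\delta_{r,b}\bigr)f(r);$$ they only occur with prefactors $2$ and $4$ that make the multiplicities integers. Let $\gamma_1,\gamma_2\in\{0,1\}$ be the residues modulo $2$ of $s_1+s_2+1$ and $s_1+s_2+p+1$. **Theorem.** All $\mathscr X^\alpha_{s,r}$ and $\mathscr P^\alpha_{s,r}$ ($1\le s\le p$, $r\ge1$) are $LU$-modules, and for all signs $\alpha,\beta$ and all integers $r_1,r_2\ge1$ there are the following isomorphisms of $LU$-modules. (1) For $1\le s_1,s_2\le p$: $$\mathscr X^\alpha_{s_1,r_1}\otimes\mathscr X^\beta_{s_2,r_2}\cong\bigoplus_{r=|r_1-r_2|+1}^{r_1+r_2-1}\Bigl(\bigoplus_{s=|s_1-s_2|+1}^{\min(s_1+s_2-1,\,2p-s_1-s_2-1)}\mathscr X^{\alpha\beta}_{s,r}\;\oplus\bigoplus_{s=2p-s_1-s_2+1}^{p-\gamma_2}\mathscr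 P^{\alpha\beta}_{s,r}\Bigr).$$ (2) For $1\le s_1\le p$ and $1\le s_2\le p-1$: $$\mathscr X^\alpha_{s_1,r_1}\otimes\mathscr P^\beta_{s_2,r_2}\cong\bigoplus_{r=|r_1-r_2|+1}^{r_1+r_2-1}\Bigl(\bigoplus_{s=|s_1-s_2|+1}^{\min(s_1+s_2-1,\,2p-s_1-s_2-1)}\mathscr P^{\alpha\beta}_{s,r}\oplus2\bigoplus_{s=2p-s_1-s_2+1}^{p-\gamma_2}\mathscr P^{\alpha\beta}_{s,r}\Bigr)\oplus2\mathop{{\bigoplus}'}_{r=|r_1-r_2|}^{r_1+r_2}\ \bigoplus_{s=p-s_1+s_2+1}^{p-\gamma_1}\mathscr P^{-\alpha\beta}_{s,r}.$$ (3) For $1\le s_1,s_2\le p-1$: $$\mathscr P^\alpha_{s_1,r_1}\otimes\mathscr P^\beta_{s_2,r_2}\cong2\bigoplus_{r=|r_1-r_2|+1}^{r_1+r_2-1}\Bigl(\bigoplus_{s=|s_1-s_2|+1}^{\min(s_1+s_2-1,\,2p-s_1-s_2-1)}\mathscr P^{\alpha\beta}_{s,r}\oplus2\bigoplus_{s=2p-s_1-s_2+1}^{p-\gamma_2}\mathscr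 P^{\alpha\beta}_{s,r}\Bigr)$$ $$\oplus\,2\mathop{{\bigoplus}'}_{r=|r_1-r_2|}^{r_1+r_2}\Bigl(\bigoplus_{s=|p-s_1-s_2|+1}^{\min(p-s_1+s_2-1,\,p+s_1-s_2-1)}\mathscr P^{-\alpha\beta}_{s,r}\oplus2\bigoplus_{s=\min(p-s_1+s_2+1,\,p+s_1-s_2+1)}^{p-\gamma_1}\mathscr P^{-\alpha\beta}_{s,r}\Bigr)\oplus4\mathop{{\bigoplus}''}_{r=|r_1-r_2|-1}^{r_1+r_2+1}\ \bigoplus_{s=s_1+s_2+1}^{p-\gamma_2}\mathscr P^{\alpha\beta}_{s,r}.$$ -/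

import Mathlib

open scoped TensorProduct

namespace LusztigLimit

noncomputable section

/-! ### Quantum integers -/

/-- The root of unity `q = exp(iπ/p)`. -/
def q (p : ℕ) : ℂ := Complex.exp (Complex.I * Real.pi / p)

/-- The quantum integer `[n] = (q^n - q^(-n)) / (q - q^(-1))`. -/
def qInt (p : ℕ) (n : ℤ) : ℂ := (q p ^ n - q p ^ (-n)) / (q p - (q p)⁻¹)

/-- The quantum factorial `[n]! = [1][2]⋯[n]`. -/
def qFact (p n : ℕ) : ℂ := ∏ i ∈ Finset.Icc 1 n, qInt p i

/-! ### The central idempotents and the element `A` -/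

/-- `β_j = q^j + q^(-j)`. -/
def casimirValue (p : ℕ) (j : ℤ) : ℂ := q p ^ j + q p ^ (-j)

/-- `ψ_s(x) = (x - β_0)(x - β_p) ∏_{1 ≤ j ≤ p-1, j ≠ s} (x - β_j)²` (used for `1 ≤ s ≤ p-1`). -/
def psi (p s : ℕ) : Polynomial ℂ :=
  (Polynomial.X - Polynomial.C (casimirValue p 0)) *
    (Polynomial.X - Polynomial.C (casimirValue p p)) *
    ∏ j ∈ (Finset.Icc 1 (p - 1)).erase s,
      (Polynomial.X - Polynomial.C (casimirValue p j)) ^ 2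

/-- The polynomial whose value at the Casimir element is the central idempotent `e_s`:
`(1/ψ_s(β_s)) (ψ_s(x) - (ψ_s'(β_s)/ψ_s(β_s)) (x - β_s) ψ_s(x))`. -/
def idemPoly (p s : ℕ) : Polynomial ℂ :=
  Polynomial.C (1 / (psi p s).eval (casimirValue p s)) *
    (psi p s -
      Polynomial.C ((psi p s).derivative.eval (casimirValue p s) /
          (psi p s).eval (casimirValue p s)) *
        (Polynomial.X - Polynomial.C (casimirValue p s)) * psi p s)

/-- `u_s(x) = ∏_{1 ≤ n ≤ p-1, n ≠ s} (x - q^(s-1-2n))`. -/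
def uPoly (p s : ℕ) : Polynomial ℂ :=
  ∏ n ∈ (Finset.Icc 1 (p - 1)).erase s,
    (Polynomial.X - Polynomial.C (q p ^ ((s : ℤ) - 1 - 2 * n)))

/-- The polynomial in `K` that multiplies `e_s` in the definition of `A`. -/
def aPoly (p s : ℕ) : Polynomial ℂ :=
  let x : ℂ := q p ^ ((s : ℤ) - 1)
  let y : ℂ := q p ^ (-(s : ℤ) - 1)
  let ux : ℂ := (uPoly p s).eval x
  let uy : ℂ := (uPoly p s).eval y
  Polynomial.C (1 / ((x - y) * uy * ux)) *
    (Polynomial.C (uy - ux) * Polynomial.X + Polynomial.C (x * ux - y * uy)) * uPoly p s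

section Algebra

variable {R : Type} [Ring R] [Algebra ℂ R]

/-- `K⁻¹`, written as `K^(2p-1)`; the relation `K^(2p) = 1` is always imposed. -/
def invK (p : ℕ) (K : R) : R := K ^ (2 * p - 1)

/-- The Casimir element `C = (q - q⁻¹)² E F + q⁻¹ K + q K⁻¹`. -/
def casimir (p : ℕ) (E F K : R) : R :=
  ((q p - (q p)⁻¹) ^ 2) • (E * F) + (q p)⁻¹ • K + q p • invK p K

/-- The element `A = ∑_{s=1}^{p-1} (linear polynomial in K) u_s(K) e_s`. -/
def elementA (p : ℕ) (E F K : R) : R :=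
  ∑ s ∈ Finset.Icc 1 (p - 1),
    Polynomial.aeval K (aPoly p s) * Polynomial.aeval (casimir p E F K) (idemPoly p s)

/-- `(q K - q⁻¹ K⁻¹) / (q - q⁻¹)`. -/
def shiftedCartan (p : ℕ) (K : R) : R :=
  (q p - (q p)⁻¹)⁻¹ • (q p • K - (q p)⁻¹ • invK p K)

end Algebra

/-! ### The quantum group as an algebra -/

/-- Names of the six generators. -/
inductive Gen : Type
  | E | F | K | e | f | h

/-- A generator of the free algebra. -/
abbrev x (g : Gen) : FreeAlgebra ℂ Gen := FreeAlgebra.ι ℂ g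

/-- The defining relations of the Lusztig limit. -/
inductive Rel (p : ℕ) : FreeAlgebra ℂ Gen → FreeAlgebra ℂ Gen → Prop
  | KE : Rel p (x .K * x .E * invK p (x .K)) ((q p ^ 2) • x .E)
  | KF : Rel p (x .K * x .F * invK p (x .K)) ((q p ^ (-2 : ℤ)) • x .F)
  | EF : Rel p (x .E * x .F - x .F * x .E) ((q p - (q p)⁻¹)⁻¹ • (x .K - invK p (x .K)))
  | E_pow : Rel p (x .E ^ p) 0
  | F_pow : Rel p (x .F ^ p) 0
  | K_pow : Rel p (x .K ^ (2 * p)) 1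
  | he : Rel p (x .h * x .e - x .e * x .h) (x .e)
  | hf : Rel p (x .h * x .f - x .f * x .h) (-x .f)
  | ef : Rel p (x .e * x .f - x .f * x .e) ((2 : ℂ) • x .h)
  | hK : Rel p (x .h * x .K) (x .K * x .h)
  | Ee : Rel p (x .E * x .e) (x .e * x .E)
  | Ke : Rel p (x .K * x .e) (x .e * x .K)
  | Ff : Rel p (x .F * x .f) (x .f * x .F)
  | Kf : Rel p (x .K * x .f) (x .f * x .K)
  | Fe : Rel p (x .F * x .e - x .e * x .F)
      ((1 / qFact p (p - 1)) • (x .K ^ p * shiftedCartan p (x .K) * x .E ^ (p - 1)))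
  | Ef : Rel p (x .E * x .f - x .f * x .E)
      (((-1) ^ (p + 1) / qFact p (p - 1)) • (x .F ^ (p - 1) * shiftedCartan p (x .K)))
  | hE : Rel p (x .h * x .E - x .E * x .h)
      ((1 / 2 : ℂ) • (x .E * elementA p (x .E) (x .F) (x .K)))
  | hF : Rel p (x .h * x .F - x .F * x .h)
      ((-1 / 2 : ℂ) • (elementA p (x .E) (x .F) (x .K) * x .F))

/-- The Lusztig limit of quantum `sl(2)` at `q = exp(iπ/p)`, as a `ℂ`-algebra. -/
abbrev LU (p : ℕ) : Type := RingQuot (Rel p)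

/-- The generators of the quantum group. -/
def LU.gen (p : ℕ) (g : Gen) : LU p := RingQuot.mkAlgHom ℂ (Rel p) (x g)

/-! ### Modules, given by the action of the generators -/

/-- A complex vector space with an operator for each of the six generators. -/
structure GenAction where
  V : Type
  [addCommGroup : AddCommGroup V]
  [module : Module ℂ V]
  act : Gen → Module.End ℂ V

attribute [instance] GenAction.addCommGroup GenAction.module

namespace GenAction

/-- The operators define a module over the quantum group, i.e. they are the action of the
generators under an algebra homomorphism (necessarily unique). -/
def IsModule (p : ℕ) (M : GenAction) : Prop :=
  ∃ π : LU p →ₐ[ℂ] Module.End ℂ M.V, ∀ g, π (LU.gen p g) = M.act g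

/-- Isomorphism: a linear isomorphism that intertwines the actions of all generators.
In particular, anything isomorphic to a module is a module. -/
def Iso (M N : GenAction) : Prop :=
  ∃ φ : M.V ≃ₗ[ℂ] N.V, ∀ g v, φ (M.act g v) = N.act g (φ v)

/-- The zero module. -/
abbrev zero : GenAction where
  V := PUnit
  act := fun _ => 0

/-- The direct sum of two modules. -/
abbrev add (M N : GenAction) : GenAction where
  V := M.V × N.V
  act := fun g => (M.act g).prodMap (N.act g)

/-- The direct sum of a finite family of modules. -/
abbrev sum {ι : Type} (S : Finset ι) (M : ι → GenAction) : GenAction where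
  V := ∀ i : {i // i ∈ S}, (M i.1).V
  act := fun g => LinearMap.pi fun i => (M i.1).act g ∘ₗ LinearMap.proj i

/-- The direct sum of `n` copies of a module. -/
abbrev copies (n : ℕ) (M : GenAction) : GenAction where
  V := Fin n → M.V
  act := fun g => LinearMap.pi fun i => M.act g ∘ₗ LinearMap.proj i

/-! ### Tensor products, through the comultiplication -/

section Tensor

variable (p : ℕ) (M N : GenAction)

/-- `Δ(e) = e ⊗ 1 + K^p ⊗ e
  + (1/[p-1]!) ∑_{r=1}^{p-1} (q^{r(p-r)}/[r]) K^p E^{p-r} ⊗ E^r K^{-r}`. -/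
def tensor_e : Module.End ℂ (M.V ⊗[ℂ] N.V) :=
  TensorProduct.map (M.act .e) 1 + TensorProduct.map (M.act .K ^ p) (N.act .e) +
    (1 / qFact p (p - 1)) • ∑ r ∈ Finset.Icc 1 (p - 1),
      (q p ^ (r * (p - r)) / qInt p r) •
        TensorProduct.map (M.act .K ^ p * M.act .E ^ (p - r))
          (N.act .E ^ r * invK p (N.act .K) ^ r)

/-- `Δ(f) = f ⊗ 1 + K^p ⊗ f
  + ((-1)^p/[p-1]!) ∑_{s=1}^{p-1} (q^{-s(p-s)}/[s]) K^{p+s} F^s ⊗ F^{p-s}`. -/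
def tensor_f : Module.End ℂ (M.V ⊗[ℂ] N.V) :=
  TensorProduct.map (M.act .f) 1 + TensorProduct.map (M.act .K ^ p) (N.act .f) +
    ((-1) ^ p / qFact p (p - 1)) • ∑ s ∈ Finset.Icc 1 (p - 1),
      ((q p)⁻¹ ^ (s * (p - s)) / qInt p s) •
        TensorProduct.map (M.act .K ^ (p + s) * M.act .F ^ s) (N.act .F ^ (p - s))

/-- The action of the generators on a tensor product: `Δ(E) = 1 ⊗ E + E ⊗ K`,
`Δ(F) = K⁻¹ ⊗ F + F ⊗ 1`, `Δ(K) = K ⊗ K`, the formulas for `Δ(e)` and `Δ(f)` above, and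
`Δ(h) = (1/2) [Δ(e), Δ(f)]`. -/
def tensorAct : Gen → Module.End ℂ (M.V ⊗[ℂ] N.V)
  | .E => TensorProduct.map 1 (N.act .E) + TensorProduct.map (M.act .E) (N.act .K)
  | .F => TensorProduct.map (invK p (M.act .K)) (N.act .F) + TensorProduct.map (M.act .F) 1
  | .K => TensorProduct.map (M.act .K) (N.act .K)
  | .e => tensor_e p M N
  | .f => tensor_f p M N
  | .h => (1 / 2 : ℂ) •
      (tensor_e p M N * tensor_f p M N - tensor_f p M N * tensor_e p M N)

/-- The tensor product of two modules. -/
abbrev tensor : GenAction where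
  V := M.V ⊗[ℂ] N.V
  act := tensorAct p M N

end Tensor

end GenAction

/-! ### Irreducible and projective modules -/

/-- The vector space with basis the labels satisfying `S`. -/
abbrev Span {ι : Type} (S : ι → Prop) : Type := {i // S i} →₀ ℂ

open Classical in
/-- The basis vector with label `i`, understood as `0` when the label is out of range. -/
def vec {ι : Type} (S : ι → Prop) (i : ι) : Span S :=
  if hi : S i then Finsupp.single ⟨i, hi⟩ 1 else 0

/-- The linear operator with prescribed values on the basis vectors. -/
def opOf {ι : Type} (S : ι → Prop) (φ : ι → Span S) : Module.End ℂ (Span S) :=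
  Finsupp.linearCombination ℂ fun i : {i // S i} => φ i.1

/-- The sign `α = ±1` as a complex number. -/
def sgn (α : ℤˣ) : ℂ := ((α : ℤ) : ℂ)

/-- Labels `(n, m)` of the basis `a_{n,m}`, `0 ≤ n ≤ s-1`, `0 ≤ m ≤ r-1`. -/
def XLabel (s r : ℤ) (i : ℤ × ℤ) : Prop := 0 ≤ i.1 ∧ i.1 ≤ s - 1 ∧ 0 ≤ i.2 ∧ i.2 ≤ r - 1

/-- The action of the generators on `X^α_{s,r}`. -/
def XAct (p : ℕ) (α : ℤˣ) (s r : ℤ) (g : Gen) : Module.End ℂ (Span (XLabel s r)) :=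
  opOf (XLabel s r) fun (n, m) =>
    let a : ℤ → ℤ → Span (XLabel s r) := fun n m => vec (XLabel s r) (n, m)
    match g with
    | .K => (sgn α * q p ^ (s - 1 - 2 * n)) • a n m
    | .E => (sgn α * qInt p n * qInt p (s - n)) • a (n - 1) m
    | .F => a (n + 1) m
    | .h => (1 / 2 * ((r : ℂ) - 1 - 2 * m)) • a n m
    | .e => ((m : ℂ) * (r - m)) • a n (m - 1)
    | .f => a n (m + 1)

/-- The `sr`-dimensional irreducible module `X^α_{s,r}`. -/
abbrev X (p : ℕ) (α : ℤˣ) (s r : ℤ) : GenAction where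
  V := Span (XLabel s r)
  act := XAct p α s r

/-- The four parts (top, bottom, left, right) of the basis of a projective module. -/
inductive Part : Type
  | t | b | l | r

/-- Labels of the basis `t_{n,m}`, `b_{n,m}` (`0 ≤ n ≤ s-1`, `0 ≤ m ≤ r-1`),
`l_{k,m}` (`0 ≤ k ≤ p-s-1`, `1 ≤ m ≤ r-1`), `r_{k,m}` (`0 ≤ k ≤ p-s-1`, `0 ≤ m ≤ r`). -/
def PLabel (p : ℕ) (s r : ℤ) : Part × ℤ × ℤ → Prop
  | (.t, n, m) => 0 ≤ n ∧ n ≤ s - 1 ∧ 0 ≤ m ∧ m ≤ r - 1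
  | (.b, n, m) => 0 ≤ n ∧ n ≤ s - 1 ∧ 0 ≤ m ∧ m ≤ r - 1
  | (.l, k, m) => 0 ≤ k ∧ k ≤ p - s - 1 ∧ 1 ≤ m ∧ m ≤ r - 1
  | (.r, k, m) => 0 ≤ k ∧ k ≤ p - s - 1 ∧ 0 ≤ m ∧ m ≤ r

/-- The constant `g = (-1)^p [s] / [p-1]!`. -/
def gConst (p : ℕ) (s : ℤ) : ℂ := (-1) ^ p * qInt p s / qFact p (p - 1)

/-- The action of the generators on `P^α_{s,r}` for `1 ≤ s ≤ p-1` and `r ≥ 1`.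
The generators `e`, `f`, `h` act as in the direct sum of `X^α_{s,r}` (twice), `X^{-α}_{p-s,r-1}`
(whose index `m` is shifted by one) and `X^{-α}_{p-s,r+1}`. -/
def PAct (p : ℕ) (α : ℤˣ) (s r : ℤ) (g : Gen) : Module.End ℂ (Span (PLabel p s r)) :=
  opOf (PLabel p s r) fun (part, n, m) =>
    let ve : Part → ℤ → ℤ → Span (PLabel p s r) := fun c n m => vec (PLabel p s r) (c, n, m)
    let ε : ℂ := sgn α
    let γ : ℂ := gConst p s
    match g, part with
    | .K, .t => (ε * q p ^ (s - 1 - 2 * n)) • ve .t n m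
    | .K, .b => (ε * q p ^ (s - 1 - 2 * n)) • ve .b n m
    | .K, .l => (-ε * q p ^ (p - s - 1 - 2 * n)) • ve .l n m
    | .K, .r => (-ε * q p ^ (p - s - 1 - 2 * n)) • ve .r n m
    | .E, .t =>
        if n = 0 then
          (ε * γ * ((r : ℂ) - m) / r) • ve .r (p - s - 1) m +
            (ε * γ * m / r) • ve .l (p - s - 1) m
        else (ε * qInt p n * qInt p (s - n)) • ve .t (n - 1) m + (ε * γ) • ve .b (n - 1) m
    | .E, .l =>
        if n = 0 then (ε * γ * ((m : ℂ) - r)) • ve .b (s - 1) (m - 1)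
        else (-ε * qInt p n * qInt p (p - s - n)) • ve .l (n - 1) m
    | .E, .r =>
        if n = 0 then (ε * γ * m) • ve .b (s - 1) (m - 1)
        else (-ε * qInt p n * qInt p (p - s - n)) • ve .r (n - 1) m
    | .E, .b => (ε * qInt p n * qInt p (s - n)) • ve .b (n - 1) m
    | .F, .t =>
        if n = s - 1 then (1 / (r : ℂ)) • ve .r 0 (m + 1) - (1 / (r : ℂ)) • ve .l 0 (m + 1)
        else ve .t (n + 1) m
    | .F, .l => if n = p - s - 1 then ve .b 0 m else ve .l (n + 1) m
    | .F, .r => if n = p - s - 1 then ve .b 0 m else ve .r (n + 1) m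
    | .F, .b => ve .b (n + 1) m
    | .h, .t => (1 / 2 * ((r : ℂ) - 1 - 2 * m)) • ve .t n m
    | .h, .b => (1 / 2 * ((r : ℂ) - 1 - 2 * m)) • ve .b n m
    | .h, .l => (1 / 2 * ((r : ℂ) - 2 * m)) • ve .l n m
    | .h, .r => (1 / 2 * ((r : ℂ) - 2 * m)) • ve .r n m
    | .e, .t => ((m : ℂ) * (r - m)) • ve .t n (m - 1)
    | .e, .b => ((m : ℂ) * (r - m)) • ve .b n (m - 1)
    | .e, .l => (((m : ℂ) - 1) * (r - m)) • ve .l n (m - 1)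
    | .e, .r => ((m : ℂ) * (r + 1 - m)) • ve .r n (m - 1)
    | .f, c => ve c n (m + 1)

/-- The `2pr`-dimensional module `P^α_{s,r}` for `1 ≤ s ≤ p-1` and `r ≥ 1`. -/
abbrev PNonSimple (p : ℕ) (α : ℤˣ) (s r : ℤ) : GenAction where
  V := Span (PLabel p s r)
  act := PAct p α s r

/-- The projective cover `P^α_{s,r}` of `X^α_{s,r}`, with `P^α_{p,r} = X^α_{p,r}` and the
convention `P^α_{s,r} = 0` for `r ≤ 0`. -/
def P (p : ℕ) (α : ℤˣ) (s r : ℤ) : GenAction :=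
  if r ≤ 0 then GenAction.zero
  else if s = p then X p α s r
  else PNonSimple p α s r

/-! ### Summation ranges and multiplicities -/

/-- The integers `a, a + 2, a + 4, …` not exceeding `b` (none if `b < a`). -/
def stepTwo (a b : ℤ) : Finset ℤ := (Finset.Icc a b).filter fun i => (i - a) % 2 = 0

/-- Twice the coefficient `1 - δ_{r,a}/2 - δ_{r,b}/2` of the primed sum from `a` to `b`. -/
def twicePrime (a b r : ℤ) : ℕ :=
  ((2 : ℤ) - (if r = a then 1 else 0) - (if r = b then 1 else 0)).toNat

/-- Four times the coefficient
`1 - 3δ_{r,a}/4 - δ_{r,a+2}(1 + δ_{a,-1})/4 - δ_{r,b-2}/4 - 3δ_{r,b}/4`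
of the doubly primed sum from `a` to `b`. -/
def fourTimesDoublePrime (a b r : ℤ) : ℕ :=
  ((4 : ℤ) - 3 * (if r = a then 1 else 0)
    - (if r = a + 2 then 1 else 0) * (1 + if a = -1 then 1 else 0)
    - (if r = b - 2 then 1 else 0) - 3 * (if r = b then 1 else 0)).toNat

end

end LusztigLimit

set_option linter.unusedSimpArgs false

namespace LusztigLimit

noncomputable section

/-! ### Isomorphisms, direct sums, and cancellation of finite-dimensional modules. -/

namespace GenAction

/-! The tensor products are computed in a ring of isomorphism classes, where the three
decompositions become identities between Chebyshev polynomials.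

The ring. A module is `Good` if it is finite-dimensional and satisfies just the relations that make
tensor products behave: `K` scales `E` and `F`, `K^(2p) = 1`, and `h = [e,f]/2`. With `K^p e` and
`(-1)^p f` in the role of the `p`-th divided powers of `E` and `F`, the formulas for `Δ(e)` and
`Δ(f)` are the case `n = p` of the q-binomial formula (`tensor_divE`, `tensor_divF`), and so the
tensor product is associative (`tensor_assoc_iso`). Finite-dimensional modules cancel from direct
sums (`iso_of_add_iso_add`). Hence the semiring of isomorphism classes embeds into a ring, the
endomorphisms of its Grothendieck group, and equality in that ring means isomorphism (`cl_eq_iff`).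

The classes. Let `x`, `σ`, `v` be the classes of `X^+_{2,1}`, `X^-_{1,1}`, `X^+_{1,2}`. They
commute, because `X_{s,1}` and `X_{1,r}` have the same product in either order. Let `Y_n` and `C_n`
solve `f(n+1) = x f(n) - f(n-1)` with `Y_0 = 0`, `Y_1 = 1` and `C_0 = 2`, `C_1 = x`. Tensoring
simple modules by a two-dimensional one (`X2_tensor_X_iso`, `X_one_two_tensor_iso`) shows that
`X^α_{s,r}` has class `Y_s(x) Y_r(v)`, times `σ` if `α = -1`. For the projective modules there is a
model `T_s` of `P^+_{s,1}` made of two `F`-strings of length `p`, which makes sense for all `0 ≤ s ≤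
p`. It satisfies `T_p = 2 X_{p,1}`, `X_{2,1} ⊗ X_{p,1} = T_{p-1}` and `X_{2,1} ⊗ T_s = T_{s+1} ⊕
T_{s-1}`, so its class is `C_{p-s}(x) Y_p(x)`; and `P^α_{s,r} = T_s ⊗ X^α_{1,r}` (`P_iso`). The
boundary case `T_0 = X^-_{p,2}` yields the relation `C_p(x) Y_p(x) = σ v Y_p(x)`. This and `σ² = 1`
are all that is needed.

The identities. Products are expanded by `Y_a C_j = Y_{a+j} + Y_{a-j}`, and sums of classes of
projective modules telescope. Next to a factor `Y_p`, the relation folds `Y_{p+n}` into `Y_{p-n} + σ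
v Y_n`; this produces the summands of opposite sign. Multiplication by `v` and by `v²` gives the
singly and doubly primed sums (`sum_twicePrime`, `sum_fourTimesDoublePrime`).

The module structures. On `X^α_{1,r}` the generators `E` and `F` vanish and `K` is the sign `α`. So
tensoring `M` by it multiplies `E` and `K` by `α` and adds a commuting action of `sl(2)` to `e`,
`f`, `h` (`hasAct_tensor`). Only `r = 1` remains, where the relations are checked on basis vectors.
There the element `A` acts on the weight vector of index `n` by 1 if `n = 0` or `n = s`, and by 0
otherwise (`elementA_apply`). -/

theorem Iso.refl (M : GenAction) : Iso M M := ⟨LinearEquiv.refl ℂ M.V, fun _ _ => rfl⟩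

theorem Iso.symm {M N : GenAction} (h : Iso M N) : Iso N M := by
  obtain ⟨φ, hφ⟩ := h
  exact ⟨φ.symm, fun g v => by rw [LinearEquiv.symm_apply_eq, hφ, LinearEquiv.apply_symm_apply]⟩

theorem Iso.trans {M N L : GenAction} (h : Iso M N) (h' : Iso N L) : Iso M L := by
  obtain ⟨φ, hφ⟩ := h
  obtain ⟨ψ, hψ⟩ := h'
  exact ⟨φ.trans ψ, fun g v => by simp [hφ, hψ]⟩

theorem Iso.add_congr {M M' N N' : GenAction} (h : Iso M M') (h' : Iso N N') :
    Iso (add M N) (add M' N') := by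
  obtain ⟨φ, hφ⟩ := h
  obtain ⟨ψ, hψ⟩ := h'
  exact ⟨LinearEquiv.prodCongr φ ψ, fun g v => by simp [hφ, hψ]⟩

theorem add_comm_iso (M N : GenAction) : Iso (add M N) (add N M) :=
  ⟨LinearEquiv.prodComm ℂ M.V N.V, fun _ _ => rfl⟩

theorem add_assoc_iso (M N L : GenAction) : Iso (add (add M N) L) (add M (add N L)) :=
  ⟨LinearEquiv.prodAssoc ℂ M.V N.V L.V, fun _ _ => rfl⟩

theorem zero_add_iso (M : GenAction) : Iso (add zero M) M :=
  ⟨LinearEquiv.uniqueProd, fun _ _ => rfl⟩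

/-- The submodule on an invariant subspace. -/
abbrev sub (M : GenAction) (W : Submodule ℂ M.V) (hW : ∀ g, ∀ v ∈ W, M.act g v ∈ W) :
    GenAction where
  V := W
  act := fun g => (M.act g).restrict (hW g)

theorem iso_add_sub (M : GenAction) (W W' : Submodule ℂ M.V) (hW : ∀ g, ∀ v ∈ W, M.act g v ∈ W)
    (hW' : ∀ g, ∀ v ∈ W', M.act g v ∈ W') (h : IsCompl W W') :
    Iso (add (sub M W hW) (sub M W' hW')) M :=
  ⟨Submodule.prodEquivOfIsCompl W W' h, fun g v => by
    simp [Submodule.coe_prodEquivOfIsCompl']⟩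

/-- An endomorphism of a module. -/
def IsEndo (M : GenAction) (a : Module.End ℂ M.V) : Prop := ∀ g v, a (M.act g v) = M.act g (a v)

theorem IsEndo.pow {M : GenAction} {a : Module.End ℂ M.V} (h : IsEndo M a) (n : ℕ) :
    IsEndo M (a ^ n) := by
  induction n with
  | zero => intro g v; rfl
  | succ n ih => intro g v; simp only [pow_succ, Module.End.mul_apply, h g v, ih g]

/-- Block elimination: if the corner `C → C` of the isomorphism is invertible, its Schur complement
is an isomorphism `A → B`. It commutes with the generators because the corner and its inverse do. -/
theorem iso_of_iso_of_isUnit {A B C : GenAction} (φ : (A.V × C.V) ≃ₗ[ℂ] (B.V × C.V))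
    (hφ : ∀ g v, φ ((add A C).act g v) = (add B C).act g (φ v))
    (a : (Module.End ℂ C.V)ˣ) (ha : ∀ z, (φ (0, z)).2 = (a : Module.End ℂ C.V) z) :
    Iso A B := by
  let ainv : Module.End ℂ C.V := ((a⁻¹ : (Module.End ℂ C.V)ˣ) : Module.End ℂ C.V)
  have h1 : ∀ z, (a : Module.End ℂ C.V) (ainv z) = z := fun z => by
    rw [← Module.End.mul_apply]; simp [ainv]
  have h2 : ∀ z, ainv ((a : Module.End ℂ C.V) z) = z := fun z => by
    rw [← Module.End.mul_apply]; simp [ainv]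
  have hadd : ∀ x z, φ (x, z) = φ (x, 0) + φ (0, z) := fun x z => by
    rw [← map_add]; simp
  have ha_act : ∀ g z, (a : Module.End ℂ C.V) (C.act g z) = C.act g ((a : Module.End ℂ C.V) z) := by
    intro g z
    rw [← ha, ← ha]
    have := hφ g (0, z)
    simp only [LinearMap.prodMap_apply, map_zero] at this
    rw [this]
  have hai_act : ∀ g z, ainv (C.act g z) = C.act g (ainv z) := by
    intro g z
    rw [← h2 (C.act g (ainv z)), ha_act, h1]
  -- The `C`-component is chosen so that `φ ∘ s` has none; `θ` is then the Schur complement.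
  let s : A.V →ₗ[ℂ] A.V × C.V :=
    LinearMap.id.prod (-(ainv ∘ₗ LinearMap.snd ℂ B.V C.V ∘ₗ φ.toLinearMap ∘ₗ LinearMap.inl ℂ A.V C.V))
  have hs : ∀ x, s x = (x, -ainv (φ (x, 0)).2) := fun x => rfl
  let θ : A.V →ₗ[ℂ] B.V := LinearMap.fst ℂ B.V C.V ∘ₗ φ.toLinearMap ∘ₗ s
  have hθ : ∀ x, φ (s x) = (θ x, 0) := by
    intro x
    refine Prod.ext rfl ?_
    rw [hs, hadd, Prod.snd_add, ha, map_neg, h1, add_neg_cancel]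
  have hinj : Function.Injective θ := by
    rw [← LinearMap.ker_eq_bot, LinearMap.ker_eq_bot']
    intro x hx
    have := hθ x
    rw [hx, show ((0 : B.V), (0 : C.V)) = 0 from rfl, LinearEquiv.map_eq_zero_iff] at this
    exact congrArg Prod.fst this
  have hsurj : Function.Surjective θ := by
    intro y
    obtain ⟨⟨x, z⟩, hxz⟩ := φ.surjective (y, 0)
    refine ⟨x, ?_⟩
    have hz : z = -ainv (φ (x, 0)).2 := by
      have := congrArg Prod.snd hxz
      rw [hadd, Prod.snd_add, ha] at this
      have h3 := congrArg ainv this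
      rw [map_add, h2, map_zero] at h3
      exact eq_neg_of_add_eq_zero_right h3
    have := hθ x
    rw [hs, ← hz, hxz] at this
    exact (congrArg Prod.fst this).symm
  refine ⟨LinearEquiv.ofBijective θ ⟨hinj, hsurj⟩, fun g v => ?_⟩
  have h4 : s (A.act g v) = (add A C).act g (s v) := by
    have h5 := hφ g (v, 0)
    simp only [LinearMap.prodMap_apply, map_zero] at h5
    rw [hs, hs, h5]
    simp [hai_act]
  have := hθ (A.act g v)
  rw [h4, hφ, hθ] at this
  exact (congrArg Prod.fst this).symm

/-- Finite-dimensional modules cancel from direct sums. -/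
theorem iso_of_add_iso_add (C : GenAction) [FiniteDimensional ℂ C.V] {A B : GenAction}
    (h : Iso (add A C) (add B C)) : Iso A B := by
  induction hn : Module.finrank ℂ C.V using Nat.strong_induction_on generalizing C A B with
  | _ n ih =>
  -- Either the endomorphisms of `C` are local, which forces an invertible corner block, or `C`
  -- splits into two smaller modules.
  by_cases hloc : ∀ a, IsEndo C a → IsUnit a ∨ IsUnit (1 - a)
  · obtain ⟨φ, hφ⟩ := h
    have hψ : ∀ g v, φ.symm ((add B C).act g v) = (add A C).act g (φ.symm v) := fun g v => by
      rw [LinearEquiv.symm_apply_eq, hφ, LinearEquiv.apply_symm_apply]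
    let a : Module.End ℂ C.V :=
      LinearMap.snd ℂ B.V C.V ∘ₗ φ.toLinearMap ∘ₗ LinearMap.inr ℂ A.V C.V
    let c : C.V →ₗ[ℂ] B.V :=
      LinearMap.fst ℂ B.V C.V ∘ₗ φ.toLinearMap ∘ₗ LinearMap.inr ℂ A.V C.V
    let a' : Module.End ℂ C.V :=
      LinearMap.snd ℂ A.V C.V ∘ₗ φ.symm.toLinearMap ∘ₗ LinearMap.inr ℂ B.V C.V
    let b' : B.V →ₗ[ℂ] C.V :=
      LinearMap.snd ℂ A.V C.V ∘ₗ φ.symm.toLinearMap ∘ₗ LinearMap.inl ℂ B.V C.V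
    have ha : ∀ z, (φ (0, z)).2 = a z := fun _ => rfl
    have hc : ∀ z, (φ (0, z)).1 = c z := fun _ => rfl
    have hφ0 : ∀ g z, φ (0, C.act g z) = (add B C).act g (φ (0, z)) := fun g z => by
      rw [← hφ]; simp
    have ha_e : IsEndo C a := fun g z => by rw [← ha, hφ0, ← ha]; rfl
    have hc_e : ∀ g z, c (C.act g z) = B.act g (c z) := fun g z => by rw [← hc, hφ0, ← hc]; rfl
    have ha'_e : IsEndo C a' := fun g z => by
      have := hψ g (0, z)
      simp only [LinearMap.prodMap_apply, map_zero] at this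
      exact congrArg Prod.snd this
    have hb'_e : ∀ g z, b' (B.act g z) = C.act g (b' z) := fun g z => by
      have := hψ g (z, 0)
      simp only [LinearMap.prodMap_apply, map_zero] at this
      exact congrArg Prod.snd this
    have hsum : a' * a + b' ∘ₗ c = 1 := by
      ext z
      have h1 : φ.symm (φ (0, z)) = (0, z) := φ.symm_apply_apply _
      have h2 : φ (0, z) = (0, a z) + (c z, 0) := by
        refine Prod.ext ?_ ?_ <;> simp [← ha, ← hc]
      rw [h2, map_add] at h1
      exact congrArg Prod.snd h1
    -- Locality is used twice on `a' a + b' c = 1`. If `a' a` is invertible, `a` is injective and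
    -- hence invertible. Otherwise `y = b' c` is invertible, and locality for `y⁻¹ a` makes `a` or
    -- `a - y` invertible.
    have key : IsUnit a ∨ IsUnit (a - b' ∘ₗ c) := by
      have hinj : ∀ y : Module.End ℂ C.V, IsUnit (y * a) → IsUnit a := fun y hy => by
        rw [LinearMap.isUnit_iff_ker_eq_bot] at hy ⊢
        exact le_bot_iff.1 (hy ▸ LinearMap.ker_le_ker_comp a y)
      rcases hloc (a' * a) (fun g v => by simp only [Module.End.mul_apply, ha_e g, ha'_e g]) with h1 | h1
      · exact Or.inl (hinj _ h1)
      · rw [← hsum, add_sub_cancel_left] at h1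
        obtain ⟨y, hy⟩ := h1
        have hy_e : ∀ g v, (↑y⁻¹ : Module.End ℂ C.V) (C.act g v) =
            C.act g ((↑y⁻¹ : Module.End ℂ C.V) v) := by
          intro g v
          have h1 : ∀ w, (y : Module.End ℂ C.V) ((↑y⁻¹ : Module.End ℂ C.V) w) = w := fun w => by
            rw [← Module.End.mul_apply]; simp
          have h2 : ∀ w, (↑y⁻¹ : Module.End ℂ C.V) ((y : Module.End ℂ C.V) w) = w := fun w => by
            rw [← Module.End.mul_apply]; simp
          have h3 : ∀ w, (y : Module.End ℂ C.V) (C.act g w) = C.act g ((y : Module.End ℂ C.V) w) := by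
            intro w; rw [hy]; simp only [LinearMap.comp_apply, hc_e, hb'_e]
          rw [← h2 (C.act g ((↑y⁻¹ : Module.End ℂ C.V) v)), h3, h1]
        rcases hloc (↑y⁻¹ * a) (fun g v => by
          simp only [Module.End.mul_apply, ha_e g, hy_e]) with h2 | h2
        · exact Or.inl (hinj _ h2)
        · right
          have h3 := (y.isUnit.mul h2).neg
          rw [mul_sub, mul_one, y.mul_inv_cancel_left, neg_sub, hy] at h3
          exact h3
    rcases key with ⟨u, hu⟩ | ⟨u, hu⟩
    · exact iso_of_iso_of_isUnit φ hφ u (fun z => by rw [hu, ha])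
    -- The shear `(u, w) ↦ (u, w - b' u)` changes the corner block from `a` to `a - b' c`.
    · let τ : (B.V × C.V) ≃ₗ[ℂ] (B.V × C.V) :=
        LinearEquiv.skewProd (LinearEquiv.refl ℂ B.V) (LinearEquiv.refl ℂ C.V) (-b')
      refine iso_of_iso_of_isUnit (φ.trans τ) (fun g v => ?_) u (fun z => ?_)
      · rw [LinearEquiv.trans_apply, hφ, LinearEquiv.trans_apply]
        refine Prod.ext ?_ ?_ <;> simp [τ, hb'_e]
      · rw [hu]
        simp [τ, ← ha, ← hc, sub_eq_add_neg]
  -- Fitting decomposition for an endomorphism such that neither `a` nor `1 - a` is a unit. For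
  -- large `k` the kernel and range of `a^k` are complementary; the kernel is nonzero since `a` is
  -- not invertible, and proper since `a` is not nilpotent.
  · push Not at hloc
    obtain ⟨a, ha, ha1, ha2⟩ := hloc
    obtain ⟨k, hk1, hk⟩ := ((Filter.eventually_ge_atTop 1).and
      (LinearMap.eventually_isCompl_ker_pow_range_pow a)).exists
    have hap := ha.pow k
    have hW : ∀ g, ∀ v ∈ LinearMap.ker (a ^ k), C.act g v ∈ LinearMap.ker (a ^ k) := by
      intro g v hv
      rw [LinearMap.mem_ker] at hv ⊢
      rw [hap g v, hv, map_zero]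
    have hW' : ∀ g, ∀ v ∈ LinearMap.range (a ^ k), C.act g v ∈ LinearMap.range (a ^ k) := by
      rintro g _ ⟨v, rfl⟩
      exact ⟨C.act g v, hap g v⟩
    have hne : LinearMap.ker (a ^ k) ≠ ⊥ := by
      intro h0
      rw [← LinearMap.isUnit_iff_ker_eq_bot] at h0
      exact ha1 ((isUnit_pow_iff (by omega)).1 h0)
    have hne' : LinearMap.ker (a ^ k) ≠ ⊤ := by
      intro h0
      rw [LinearMap.ker_eq_top] at h0
      exact ha2 (IsNilpotent.isUnit_one_sub ⟨k, h0⟩)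
    have hdim := Submodule.finrank_add_eq_of_isCompl hk
    have hlt : Module.finrank ℂ (LinearMap.ker (a ^ k)) < n :=
      hn ▸ Submodule.finrank_lt hne'
    have hpos : 0 < Module.finrank ℂ (LinearMap.ker (a ^ k)) := by
      rw [Nat.pos_iff_ne_zero, Ne, Submodule.finrank_eq_zero]; exact hne
    have hlt' : Module.finrank ℂ (LinearMap.range (a ^ k)) < n := by omega
    have hC := (iso_add_sub C _ _ hW hW' hk).symm
    -- The range is cancelled first, with the kernel regarded as part of the other summand; then the
    -- kernel.
    refine ih _ hlt (sub C _ hW) (ih _ hlt' (sub C _ hW') ?_ rfl) rfl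
    exact ((add_assoc_iso _ _ _).trans ((Iso.refl A).add_congr hC.symm)).trans
      (h.trans (((Iso.refl B).add_congr hC).trans (add_assoc_iso _ _ _).symm))

end GenAction
end

noncomputable section

/-! ### Quantum integers at a root of unity -/

theorem q_ne_zero (p : ℕ) : q p ≠ 0 := Complex.exp_ne_zero _

theorem q_pow_self {p : ℕ} (hp : 2 ≤ p) : q p ^ p = -1 := by
  rw [q, ← Complex.exp_nat_mul, mul_div_cancel₀ _ (by exact_mod_cast (by omega : p ≠ 0) : (p : ℂ) ≠ 0), mul_comm,
    Complex.exp_pi_mul_I]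

theorem q_isPrimitiveRoot {p : ℕ} (hp : 2 ≤ p) : IsPrimitiveRoot (q p) (2 * p) := by
  have h := Complex.isPrimitiveRoot_exp (2 * p) (by omega)
  have e : q p = Complex.exp (2 * Real.pi * Complex.I / ((2 * p : ℕ) : ℂ)) := by
    rw [q]
    congr 1
    have : (p : ℂ) ≠ 0 := by exact_mod_cast (by omega : p ≠ 0)
    push_cast
    field_simp
  rw [e]; exact h

/-- Exponents of `q` count modulo `2p`. This is the test behind the nonvanishing of quantum integers
and the separation of weights and of Casimir eigenvalues. -/
theorem q_zpow_eq_iff {p : ℕ} (hp : 2 ≤ p) (a b : ℤ) :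
    q p ^ a = q p ^ b ↔ (2 * p : ℤ) ∣ a - b := by
  have h := (q_isPrimitiveRoot hp).zpow_eq_one_iff_dvd (a - b)
  rw [zpow_sub₀ (q_ne_zero p), div_eq_one_iff_eq (zpow_ne_zero _ (q_ne_zero p))] at h
  simpa using h

theorem q_zpow_self {p : ℕ} (hp : 2 ≤ p) : q p ^ (p : ℤ) = -1 := by
  rw [zpow_natCast, q_pow_self hp]

theorem q_zpow_two_mul {p : ℕ} (hp : 2 ≤ p) : q p ^ (2 * p : ℤ) = 1 := by
  rw [mul_comm, zpow_mul, q_zpow_self hp]; norm_num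

theorem q_sub_inv_ne_zero {p : ℕ} (hp : 2 ≤ p) : q p - (q p)⁻¹ ≠ 0 := by
  intro h
  have := (q_zpow_eq_iff hp 1 (-1)).1 (by rw [zpow_one, zpow_neg_one]; exact sub_eq_zero.1 h)
  have := Int.le_of_dvd (by norm_num) this
  omega

theorem qInt_zero (p : ℕ) : qInt p 0 = 0 := by simp [qInt]

theorem qInt_one {p : ℕ} (hp : 2 ≤ p) : qInt p 1 = 1 := by
  simp [qInt, div_self (q_sub_inv_ne_zero hp)]

theorem qInt_neg (p : ℕ) (n : ℤ) : qInt p (-n) = -qInt p n := by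
  simp only [qInt, neg_neg]; ring

theorem qInt_add (p : ℕ) (a b : ℤ) :
    qInt p (a + b) = q p ^ b * qInt p a + q p ^ (-a) * qInt p b := by
  simp only [qInt, neg_add, zpow_add₀ (q_ne_zero p)]
  ring

theorem qInt_add_self {p : ℕ} (hp : 2 ≤ p) (n : ℤ) : qInt p (n + p) = -qInt p n := by
  simp only [qInt, neg_add, zpow_add₀ (q_ne_zero p), zpow_neg, q_zpow_self hp]
  ring

theorem qInt_self {p : ℕ} (hp : 2 ≤ p) : qInt p p = 0 := by
  simpa [qInt_zero] using qInt_add_self hp 0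

theorem qInt_self_sub {p : ℕ} (hp : 2 ≤ p) (n : ℤ) : qInt p (p - n) = qInt p n := by
  rw [sub_eq_add_neg, add_comm, qInt_add_self hp, qInt_neg, neg_neg]

theorem qInt_ne_zero {p : ℕ} (hp : 2 ≤ p) {n : ℤ} (h0 : 0 < n) (h1 : n < p) : qInt p n ≠ 0 := by
  intro h
  rw [qInt, div_eq_zero_iff, or_iff_left (q_sub_inv_ne_zero hp), sub_eq_zero,
    q_zpow_eq_iff hp] at h
  obtain ⟨c, hc⟩ := h
  have h2 : n = p * c := by linarith
  rcases lt_or_ge c 1 with h3 | h3 <;> nlinarith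

theorem qFact_zero (p : ℕ) : qFact p 0 = 1 := by simp [qFact]

theorem qFact_succ (p n : ℕ) : qFact p (n + 1) = qFact p n * qInt p (n + 1) := by
  simp [qFact, Finset.prod_Icc_succ_top]

theorem qFact_ne_zero {p : ℕ} (hp : 2 ≤ p) {n : ℕ} (hn : n < p) : qFact p n ≠ 0 := by
  rw [qFact, Finset.prod_ne_zero_iff]
  intro i hi
  rw [Finset.mem_Icc] at hi
  exact qInt_ne_zero hp (by omega) (by omega)

/-- The reflection `[p-n] = [n]` moves a factor from one factorial to the other. With it the
coefficients `1/([p-1]! [r])` in `Δ(e)` and `Δ(f)` become `1/([r]! [p-r]!)`, as a binomial formula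
demands. -/
theorem qFact_mul_qFact {p : ℕ} (hp : 2 ≤ p) {a b : ℕ} (h : a + b + 1 = p) :
    qFact p a * qFact p b = qFact p (p - 1) := by
  induction b generalizing a with
  | zero =>
    obtain rfl : a + 1 = p := by omega
    rw [qFact_zero, mul_one, add_tsub_cancel_right]
  | succ b ih =>
    rw [← ih (a := a + 1) (by omega), qFact_succ, qFact_succ]
    have h3 : qInt p (a + 1) = qInt p (b + 1) := by
      rw [← qInt_self_sub hp]; congr 1; omega
    rw [h3]; ring

/-! ### Divided powers -/

section DividedPowers

variable {A : Type*} [Ring A] [Algebra ℂ A]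

/-- The divided power `u^n/[n]!`. -/
def dpow (p : ℕ) (u : A) (n : ℕ) : A := (1 / qFact p n) • u ^ n

theorem dpow_zero (p : ℕ) (u : A) : dpow p u 0 = 1 := by simp [dpow, qFact_zero]

theorem mul_dpow {p : ℕ} (hp : 2 ≤ p) (u : A) {n : ℕ} (hn : n + 1 < p) :
    u * dpow p u n = qInt p (n + 1) • dpow p u (n + 1) := by
  rw [dpow, dpow, mul_smul_comm, ← pow_succ', smul_smul, qFact_succ]
  have := qInt_ne_zero hp (n := n + 1) (by positivity) (by omega)
  congr 1
  field_simp

theorem qcomm_mul_dpow {p : ℕ} {u w : A} (h : w * u = q p ^ 2 • (u * w)) (n : ℕ) :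
    w * dpow p u n = q p ^ (2 * n : ℤ) • (dpow p u n * w) := by
  have : w * u ^ n = q p ^ (2 * n : ℤ) • (u ^ n * w) := by
    induction n with
    | zero => simp
    | succ n ih =>
      rw [pow_succ, ← mul_assoc, ih, smul_mul_assoc, mul_assoc, h, mul_smul_comm, smul_smul,
        mul_assoc]
      congr 1
      rw [← zpow_natCast (q p) 2, ← zpow_add₀ (q_ne_zero p)]
      congr 1
  rw [dpow, mul_smul_comm, this, smul_comm, smul_mul_assoc]

/-- The q-binomial theorem. The bound `n < p` keeps the quantum factorials invertible, so the
induction may multiply by `[n+1]` and cancel it at the end. -/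
theorem dpow_add {p : ℕ} (hp : 2 ≤ p) {u w : A} (h : w * u = q p ^ 2 • (u * w)) {n : ℕ}
    (hn : n < p) :
    dpow p (u + w) n = ∑ ab ∈ Finset.HasAntidiagonal.antidiagonal n,
      q p ^ ((ab.1 : ℤ) * ab.2) • (dpow p u ab.1 * dpow p w ab.2) := by
  induction n with
  | zero => simp [dpow_zero]
  | succ n ih =>
    have hne := qInt_ne_zero hp (n := n + 1) (by positivity) (by omega)
    have h1 : qInt p (n + 1) • dpow p (u + w) (n + 1) = qInt p (n + 1) •
        ∑ ab ∈ Finset.HasAntidiagonal.antidiagonal (n + 1),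
          q p ^ ((ab.1 : ℤ) * ab.2) • (dpow p u ab.1 * dpow p w ab.2) := by
      rw [← mul_dpow hp _ hn, ih (by omega), add_mul, Finset.mul_sum, Finset.mul_sum,
        Finset.smul_sum]
      have e1 : ∑ ab ∈ Finset.HasAntidiagonal.antidiagonal n,
          u * (q p ^ ((ab.1 : ℤ) * ab.2) • (dpow p u ab.1 * dpow p w ab.2)) =
          ∑ ab ∈ Finset.HasAntidiagonal.antidiagonal (n + 1), (q p ^ (((ab.1 : ℤ) - 1) * ab.2) * qInt p ab.1) •
            (dpow p u ab.1 * dpow p w ab.2) := by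
        rw [Finset.Nat.sum_antidiagonal_succ]
        simp only [Nat.cast_zero, qInt_zero, mul_zero, zero_smul, zero_add]
        refine Finset.sum_congr rfl fun ab hab => ?_
        rw [Finset.HasAntidiagonal.mem_antidiagonal] at hab
        rw [mul_smul_comm, ← mul_assoc, mul_dpow hp _ (by omega), smul_mul_assoc, smul_smul]
        push_cast
        rw [add_sub_cancel_right]
      have e2 : ∑ ab ∈ Finset.HasAntidiagonal.antidiagonal n,
          w * (q p ^ ((ab.1 : ℤ) * ab.2) • (dpow p u ab.1 * dpow p w ab.2)) =
          ∑ ab ∈ Finset.HasAntidiagonal.antidiagonal (n + 1),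
            (q p ^ ((ab.1 : ℤ) * ab.2 + ab.1) * qInt p ab.2) •
            (dpow p u ab.1 * dpow p w ab.2) := by
        rw [Finset.Nat.sum_antidiagonal_succ']
        simp only [Nat.cast_zero, qInt_zero, mul_zero, zero_smul, zero_add]
        refine Finset.sum_congr rfl fun ab hab => ?_
        rw [Finset.HasAntidiagonal.mem_antidiagonal] at hab
        rw [mul_smul_comm, ← mul_assoc, qcomm_mul_dpow h, smul_mul_assoc, mul_assoc,
          mul_dpow hp _ (by omega), mul_smul_comm, smul_smul, smul_smul,
          ← zpow_add₀ (q_ne_zero p)]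
        push_cast
        congr 3
        ring
      rw [e1, e2, ← Finset.sum_add_distrib]
      refine Finset.sum_congr rfl fun ab hab => ?_
      rw [Finset.HasAntidiagonal.mem_antidiagonal] at hab
      rw [← add_smul, smul_smul]
      congr 1
      -- The q-Pascal rule `[a+b] = q^a [b] + q^(-b) [a]`.
      have : (n : ℤ) + 1 = ab.2 + ab.1 := by omega
      rw [this, qInt_add, sub_mul, sub_eq_add_neg, zpow_add₀ (q_ne_zero p),
        zpow_add₀ (q_ne_zero p), one_mul]
      ring
    have h2 := congrArg (fun z => (qInt p (n + 1))⁻¹ • z) h1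
    simpa only [inv_smul_smul₀ hne] using h2

theorem pow_mul_pow_of_mul_eq {p : ℕ} {u K : A} (c : ℤ) (h : K * u = q p ^ c • (u * K))
    (m n : ℕ) : K ^ m * u ^ n = q p ^ (c * m * n) • (u ^ n * K ^ m) := by
  have h1 : ∀ n : ℕ, K * u ^ n = q p ^ (c * n) • (u ^ n * K) := by
    intro n
    induction n with
    | zero => simp
    | succ n ih =>
      rw [pow_succ, ← mul_assoc, ih, smul_mul_assoc, mul_assoc, h, mul_smul_comm, smul_smul,
        mul_assoc, ← zpow_add₀ (q_ne_zero p)]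
      congr 2
      push_cast; ring
  induction m with
  | zero => simp
  | succ m ih =>
    rw [pow_succ, mul_assoc, h1, mul_smul_comm, ← mul_assoc, ih, smul_mul_assoc, smul_smul,
      mul_assoc (u ^ n), ← zpow_add₀ (q_ne_zero p)]
    congr 2
    push_cast; ring

end DividedPowers

theorem sum_antidiagonal_assoc {A : Type*} [AddCommMonoid A] (n : ℕ) (f : ℕ → ℕ → ℕ → A) :
    ∑ ab ∈ Finset.HasAntidiagonal.antidiagonal n, ∑ cd ∈ Finset.HasAntidiagonal.antidiagonal ab.1, f cd.1 cd.2 ab.2 =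
      ∑ ab ∈ Finset.HasAntidiagonal.antidiagonal n, ∑ cd ∈ Finset.HasAntidiagonal.antidiagonal ab.2, f ab.1 cd.1 cd.2 := by
  rw [Finset.sum_sigma', Finset.sum_sigma']
  refine Finset.sum_nbij' (fun x => ⟨(x.2.1, x.2.2 + x.1.2), (x.2.2, x.1.2)⟩)
    (fun x => ⟨(x.1.1 + x.2.1, x.2.2), (x.1.1, x.2.1)⟩) ?_ ?_ ?_ ?_ ?_
  · rintro ⟨⟨a, b⟩, ⟨c, d⟩⟩ h
    simp only [Finset.mem_sigma, Finset.HasAntidiagonal.mem_antidiagonal] at h ⊢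
    exact ⟨by omega, trivial⟩
  · rintro ⟨⟨a, b⟩, ⟨c, d⟩⟩ h
    simp only [Finset.mem_sigma, Finset.HasAntidiagonal.mem_antidiagonal] at h ⊢
    exact ⟨by omega, trivial⟩
  · rintro ⟨⟨a, b⟩, ⟨c, d⟩⟩ h
    simp only [Finset.mem_sigma, Finset.HasAntidiagonal.mem_antidiagonal] at h
    obtain ⟨h1, rfl⟩ := h
    rfl
  · rintro ⟨⟨a, b⟩, ⟨c, d⟩⟩ h
    simp only [Finset.mem_sigma, Finset.HasAntidiagonal.mem_antidiagonal] at h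
    obtain ⟨h1, rfl⟩ := h
    rfl
  · rintro ⟨⟨a, b⟩, ⟨c, d⟩⟩ h
    rfl

end

/-! ### The comultiplication as a formula for divided powers. -/

noncomputable section

open Finset.HasAntidiagonal (antidiagonal mem_antidiagonal)

theorem pow_mod_two_mul {A : Type*} [Ring A] {p : ℕ} {K : A} (hK : K ^ (2 * p) = 1) {a b : ℕ}
    (h : a ≡ b [MOD 2 * p]) : K ^ a = K ^ b := pow_eq_pow_of_modEq h hK

theorem invK_pow {A : Type} [Ring A] {p : ℕ} (K : A) (n : ℕ) :
    invK p K ^ n = K ^ ((2 * p - 1) * n) := by rw [invK, pow_mul]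

namespace GenAction

/-- The relations needed for the tensor product to behave well, and finite-dimensionality. -/
structure Good (p : ℕ) (M : GenAction) : Prop where
  fin : FiniteDimensional ℂ M.V
  KE : M.act .K * M.act .E = q p ^ (2 : ℤ) • (M.act .E * M.act .K)
  KF : M.act .K * M.act .F = q p ^ (-2 : ℤ) • (M.act .F * M.act .K)
  K_pow : M.act .K ^ (2 * p) = 1
  h_eq : M.act .h = (1 / 2 : ℂ) • (M.act .e * M.act .f - M.act .f * M.act .e)

variable {p : ℕ} {M N L : GenAction}

/-- The divided powers of `E`, where `K^p e` takes the role of the `p`-th one. -/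
def divE (p : ℕ) (M : GenAction) (n : ℕ) : Module.End ℂ M.V :=
  if n = p then M.act .K ^ p * M.act .e else dpow p (M.act .E) n

/-- The divided powers of `F`, where `(-1)^p f` takes the role of the `p`-th one. -/
def divF (p : ℕ) (M : GenAction) (n : ℕ) : Module.End ℂ M.V :=
  if n = p then (-1 : ℂ) ^ p • M.act .f else dpow p (M.act .F) n

theorem divE_of_lt {n : ℕ} (h : n < p) : divE p M n = dpow p (M.act .E) n := if_neg h.ne
theorem divF_of_lt {n : ℕ} (h : n < p) : divF p M n = dpow p (M.act .F) n := if_neg h.ne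
theorem divE_self : divE p M p = M.act .K ^ p * M.act .e := if_pos rfl
theorem divF_self : divF p M p = (-1 : ℂ) ^ p • M.act .f := if_pos rfl

theorem Good.K_pow_mul_E_pow (hM : Good p M) (m n : ℕ) :
    M.act .K ^ m * M.act .E ^ n = q p ^ (2 * m * n : ℤ) • (M.act .E ^ n * M.act .K ^ m) :=
  pow_mul_pow_of_mul_eq 2 hM.KE m n

theorem Good.K_pow_mul_F_pow (hM : Good p M) (m n : ℕ) :
    M.act .K ^ m * M.act .F ^ n = q p ^ (-2 * m * n : ℤ) • (M.act .F ^ n * M.act .K ^ m) :=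
  pow_mul_pow_of_mul_eq (-2) hM.KF m n

theorem Good.e_eq (hM : Good p M) : M.act .e = M.act .K ^ p * divE p M p := by
  rw [divE_self, ← mul_assoc, ← pow_add, ← two_mul, hM.K_pow, one_mul]

theorem f_eq : M.act .f = (-1 : ℂ) ^ p • divF p M p := by
  rw [divF_self, smul_smul, ← mul_pow]; norm_num

theorem sum_antidiagonal_eq_sum_Icc {A : Type*} [AddCommMonoid A] {n : ℕ} (hn : 1 ≤ n)
    (f : ℕ → ℕ → A) : ∑ ab ∈ antidiagonal n, f ab.1 ab.2 =
      f n 0 + f 0 n + ∑ s ∈ Finset.Icc 1 (n - 1), f s (n - s) := by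
  obtain ⟨n, rfl⟩ : ∃ m, n = m + 1 := ⟨n - 1, by omega⟩
  rw [Finset.Nat.sum_antidiagonal_eq_sum_range_succ f, Finset.sum_range_succ,
    Finset.range_eq_Ico, Finset.sum_eq_sum_Ico_succ_bot (by omega), add_tsub_cancel_right,
    Nat.sub_self, Nat.sub_zero]
  have : Finset.Ico 1 (n + 1) = Finset.Icc 1 n := by ext; simp
  rw [this, add_comm, ← add_assoc]

/-- For `n < p` this is the q-binomial theorem for `Δ(E) = 1 ⊗ E + E ⊗ K`. For `n = p` it is the
definition of `Δ(e)` multiplied by `K^p ⊗ K^p`. That one formula covers both cases is what makes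
`Δ(e)` coassociative; no relation between `e` and the other generators is needed. -/
theorem tensor_divE (hp : 2 ≤ p) (hM : Good p M) (hN : Good p N) {n : ℕ} (hn : n ≤ p) :
    divE p (tensor p M N) n = ∑ ab ∈ antidiagonal n, q p ^ ((ab.1 : ℤ) * ab.2) •
      TensorProduct.map (divE p M ab.1) (divE p N ab.2 * N.act .K ^ ab.1) := by
  rcases hn.lt_or_eq with hn | rfl
  · rw [divE_of_lt hn]
    have hc : TensorProduct.map (M.act .E) (N.act .K) * TensorProduct.map 1 (N.act .E) =
        q p ^ 2 • (TensorProduct.map 1 (N.act .E) * TensorProduct.map (M.act .E) (N.act .K)) := by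
      rw [← TensorProduct.map_mul, ← TensorProduct.map_mul, hN.KE, one_mul, mul_one,
        TensorProduct.map_smul_right, zpow_ofNat]
    refine (dpow_add hp hc hn).trans ?_
    -- `dpow_add` lists the power of `1 ⊗ E` first, whereas the first index here belongs to the left
    -- tensor factor.
    rw [← Finset.Nat.sum_antidiagonal_swap]
    refine Finset.sum_congr rfl fun ab hab => ?_
    rw [mem_antidiagonal] at hab
    rw [divE_of_lt (by omega), divE_of_lt (by omega)]
    simp only [Prod.fst_swap, Prod.snd_swap, dpow, mul_smul_comm, TensorProduct.map_pow,
      one_pow, ← TensorProduct.map_mul, one_mul, TensorProduct.map_smul_left,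
      TensorProduct.map_smul_right, smul_mul_assoc, smul_smul]
    congr 1
    ring_nf
  · rw [divE_self, sum_antidiagonal_eq_sum_Icc (by omega)
      (fun a b => q n ^ ((a : ℤ) * b) •
        TensorProduct.map (divE n M a) (divE n N b * N.act .K ^ a))]
    change TensorProduct.map (M.act .K) (N.act .K) ^ n * tensor_e n M N = _
    rw [tensor_e, mul_add, mul_add, TensorProduct.map_pow, ← TensorProduct.map_mul,
      ← TensorProduct.map_mul, mul_one, ← pow_add, ← two_mul, hM.K_pow, divE_self, divE_self,
      divE_of_lt (by omega), divE_of_lt (by omega), dpow_zero, dpow_zero]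
    congr 1
    · simp
    · rw [mul_smul_comm, Finset.mul_sum, Finset.smul_sum]
      -- The sum in `Δ(e)` is indexed by the exponent on the right factor, this one by the exponent
      -- on the left.
      refine Finset.sum_nbij' (fun r => n - r) (fun r => n - r) ?_ ?_ ?_ ?_ ?_
      · intro r hr; rw [Finset.mem_Icc] at hr ⊢; omega
      · intro r hr; rw [Finset.mem_Icc] at hr ⊢; omega
      · intro r hr; rw [Finset.mem_Icc] at hr; omega
      · intro r hr; rw [Finset.mem_Icc] at hr; omega
      · intro r hr
        rw [Finset.mem_Icc] at hr
        have h1 : M.act .K ^ n * (M.act .K ^ n * M.act .E ^ (n - r)) = M.act .E ^ (n - r) := by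
          rw [← mul_assoc, ← pow_add, ← two_mul, hM.K_pow, one_mul]
        have h2 : N.act .K ^ n * (N.act .E ^ r * invK n (N.act .K) ^ r) =
            N.act .E ^ r * N.act .K ^ (n - r) := by
          have e1 : q n ^ (2 * n * r : ℤ) = 1 := by rw [zpow_mul, q_zpow_two_mul hp, one_zpow]
          rw [← mul_assoc, hN.K_pow_mul_E_pow, e1, one_smul, mul_assoc, invK_pow, ← pow_add]
          congr 1
          refine pow_mod_two_mul hN.K_pow ?_
          have : n + (2 * n - 1) * r = (n - r) + 2 * n * r := by
            zify [show 1 ≤ 2 * n by omega, show r ≤ n by omega]; ring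
          rw [this]
          exact Nat.modEq_iff_dvd.2 ⟨-r, by push_cast; ring⟩
        rw [mul_smul_comm, ← TensorProduct.map_mul, h1, h2, divE_of_lt (by omega),
          divE_of_lt (by omega), Nat.sub_sub_self (by omega)]
        simp only [dpow, TensorProduct.map_smul_left, TensorProduct.map_smul_right,
          smul_mul_assoc, smul_smul]
        congr 1
        have h3 := qFact_mul_qFact hp (a := n - r) (b := r - 1) (by omega)
        have h4 : qFact n r = qFact n (r - 1) * qInt n r := by
          obtain ⟨t, rfl⟩ : ∃ t, r = t + 1 := ⟨r - 1, by omega⟩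
          rw [qFact_succ]; simp
        have h5 := qFact_ne_zero hp (n := n - r) (by omega)
        have h6 := qFact_ne_zero hp (n := r - 1) (by omega)
        have h7 := qInt_ne_zero hp (n := r) (by omega) (by omega)
        rw [h4, ← h3, ← zpow_natCast]
        push_cast [show r ≤ n by omega]
        field_simp
        congr 1; ring

/-- The mechanism of `tensor_divE`, with `(-1)^p f` as the `p`-th divided power of `F`. Inverses of
`K` are positive powers, so exponents of `K` are compared modulo `2p`. -/
theorem tensor_divF (hp : 2 ≤ p) (hM : Good p M) (hN : Good p N) {n : ℕ} (hn : n ≤ p) :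
    divF p (tensor p M N) n = ∑ ab ∈ antidiagonal n, q p ^ ((ab.1 : ℤ) * ab.2) •
      TensorProduct.map (divF p M ab.1 * M.act .K ^ ((2 * p - 1) * ab.2)) (divF p N ab.2) := by
  rcases hn.lt_or_eq with hn | rfl
  · rw [divF_of_lt hn]
    have hc : TensorProduct.map (invK p (M.act .K)) (N.act .F) * TensorProduct.map (M.act .F) 1 =
        q p ^ 2 • (TensorProduct.map (M.act .F) 1 *
          TensorProduct.map (invK p (M.act .K)) (N.act .F)) := by
      have h1 := hM.K_pow_mul_F_pow (2 * p - 1) 1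
      have h2 : q p ^ (-2 * (2 * p - 1 : ℕ) * (1 : ℕ) : ℤ) = q p ^ 2 := by
        rw [← zpow_natCast, q_zpow_eq_iff hp]
        exact ⟨-2, by push_cast [show 1 ≤ 2 * p by omega]; ring⟩
      rw [pow_one, h2] at h1
      rw [← TensorProduct.map_mul, ← TensorProduct.map_mul, invK, h1, one_mul, mul_one,
        TensorProduct.map_smul_left]
    have := (dpow_add hp hc hn)
    rw [add_comm] at this
    refine this.trans ?_
    refine Finset.sum_congr rfl fun ab hab => ?_
    rw [mem_antidiagonal] at hab
    rw [divF_of_lt (by omega), divF_of_lt (by omega)]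
    simp only [dpow, mul_smul_comm, TensorProduct.map_pow, invK_pow,
      one_pow, ← TensorProduct.map_mul, one_mul, TensorProduct.map_smul_left,
      TensorProduct.map_smul_right, smul_mul_assoc, smul_smul]
  · rw [divF_self, sum_antidiagonal_eq_sum_Icc (by omega)
      (fun a b => q n ^ ((a : ℤ) * b) •
        TensorProduct.map (divF n M a * M.act .K ^ ((2 * n - 1) * b)) (divF n N b))]
    change (-1 : ℂ) ^ n • tensor_f n M N = _
    rw [tensor_f, smul_add, smul_add, divF_self, divF_self, divF_of_lt (by omega),
      divF_of_lt (by omega), dpow_zero, dpow_zero]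
    congr 1
    · rw [pow_mod_two_mul hM.K_pow (show (2 * n - 1) * n ≡ n [MOD 2 * n] from ?_)]
      · simp [TensorProduct.map_smul_left, TensorProduct.map_smul_right]
      · have : (2 * n - 1) * n = n + 2 * n * (n - 1) := by
          zify [show 1 ≤ 2 * n by omega, show 1 ≤ n by omega]; ring
        rw [this]
        exact Nat.modEq_iff_dvd.2 ⟨-(n - 1 : ℕ), by push_cast; ring⟩
    · rw [smul_smul, Finset.smul_sum]
      refine Finset.sum_congr rfl fun s hs => ?_
      rw [Finset.mem_Icc] at hs
      have h1 : M.act .K ^ (n + s) * M.act .F ^ s =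
          q n ^ (-2 * (n + s : ℕ) * s : ℤ) • (M.act .F ^ s * M.act .K ^ ((2 * n - 1) * (n - s))) := by
        rw [hM.K_pow_mul_F_pow]
        congr 2
        refine pow_mod_two_mul hM.K_pow ?_
        have : (2 * n - 1) * (n - s) = (n + s) + 2 * n * (n - s - 1) := by
          zify [show 1 ≤ 2 * n by omega, show s ≤ n by omega, show 1 ≤ n - s by omega]; ring
        rw [this]
        exact Nat.modEq_iff_dvd.2 ⟨(n - s - 1 : ℕ), by push_cast; ring⟩
      rw [h1, divF_of_lt (by omega), divF_of_lt (by omega)]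
      simp only [dpow, TensorProduct.map_smul_left, TensorProduct.map_smul_right,
        smul_mul_assoc, smul_smul]
      congr 1
      have h3 := qFact_mul_qFact hp (a := n - s) (b := s - 1) (by omega)
      have h4 : qFact n s = qFact n (s - 1) * qInt n s := by
        obtain ⟨t, rfl⟩ : ∃ t, s = t + 1 := ⟨s - 1, by omega⟩
        rw [qFact_succ]; simp
      have h5 := qFact_ne_zero hp (n := n - s) (by omega)
      have h6 := qFact_ne_zero hp (n := s - 1) (by omega)
      have h7 := qInt_ne_zero hp (n := s) (by omega) (by omega)
      -- Moving `K^(n+s)` past `F^s` inverts the power of `q` in `Δ(f)`: the two exponents differ by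
      -- `-4sn`, a multiple of `2n`.
      have h8 : (q n)⁻¹ ^ (s * (n - s)) * q n ^ (-2 * (n + s : ℕ) * s : ℤ) =
          q n ^ ((s : ℤ) * (n - s : ℕ)) := by
        rw [← zpow_natCast, inv_zpow', ← zpow_add₀ (q_ne_zero n), q_zpow_eq_iff hp]
        exact ⟨-2 * s, by push_cast [show s ≤ n by omega]; ring⟩
      have h9 : ((-1 : ℂ) ^ n) * (-1) ^ n = 1 := by rw [← mul_pow]; norm_num
      rw [h4, ← h3, ← h8]
      field_simp
      linear_combination ((q n)⁻¹ ^ (s * (n - s)) * q n ^ (-2 * (n + s : ℕ) * s : ℤ)) * h9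

end GenAction
end

/-! ### Functoriality and additivity of the tensor product; stability of good modules;
associativity. -/

noncomputable section

open Finset.HasAntidiagonal (antidiagonal mem_antidiagonal)

namespace GenAction

variable {p : ℕ} {M N L M' N' : GenAction}

/-- A linear map that intertwines the actions of the generators. -/
def IsHom (M N : GenAction) (φ : M.V →ₗ[ℂ] N.V) : Prop := ∀ g v, φ (M.act g v) = N.act g (φ v)

theorem IsHom.pow {φ : M.V →ₗ[ℂ] N.V} (h : IsHom M N φ) (g : Gen) (n : ℕ) (v : M.V) :
    φ ((M.act g ^ n) v) = (N.act g ^ n) (φ v) := by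
  induction n with
  | zero => rfl
  | succ n ih => rw [pow_succ', pow_succ', Module.End.mul_apply, Module.End.mul_apply, h, ih]

theorem tensor_e_tmul (u : M.V) (v : N.V) : tensorAct p M N .e (u ⊗ₜ v) =
    M.act .e u ⊗ₜ v + (M.act .K ^ p) u ⊗ₜ N.act .e v + (1 / qFact p (p - 1)) •
      ∑ r ∈ Finset.Icc 1 (p - 1), (q p ^ (r * (p - r)) / qInt p r) •
        ((M.act .K ^ p) ((M.act .E ^ (p - r)) u) ⊗ₜ[ℂ]
          (N.act .E ^ r) ((N.act .K ^ ((2 * p - 1) * r)) v)) := by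
  simp [tensorAct, tensor_e, LinearMap.sum_apply, invK_pow]

theorem tensor_f_tmul (u : M.V) (v : N.V) : tensorAct p M N .f (u ⊗ₜ v) =
    M.act .f u ⊗ₜ v + (M.act .K ^ p) u ⊗ₜ N.act .f v + ((-1) ^ p / qFact p (p - 1)) •
      ∑ s ∈ Finset.Icc 1 (p - 1), ((q p)⁻¹ ^ (s * (p - s)) / qInt p s) •
        ((M.act .K ^ (p + s)) ((M.act .F ^ s) u) ⊗ₜ[ℂ] (N.act .F ^ (p - s)) v) := by
  simp [tensorAct, tensor_f, LinearMap.sum_apply]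

theorem tensor_E_tmul (u : M.V) (v : N.V) : tensorAct p M N .E (u ⊗ₜ v) =
    u ⊗ₜ N.act .E v + M.act .E u ⊗ₜ N.act .K v := rfl

theorem tensor_F_tmul (u : M.V) (v : N.V) : tensorAct p M N .F (u ⊗ₜ v) =
    (M.act .K ^ (2 * p - 1)) u ⊗ₜ N.act .F v + M.act .F u ⊗ₜ v := rfl

theorem tensor_K_tmul (u : M.V) (v : N.V) : tensorAct p M N .K (u ⊗ₜ v) =
    M.act .K u ⊗ₜ N.act .K v := rfl

theorem tensor_h : tensorAct p M N .h = (1 / 2 : ℂ) •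
    (tensorAct p M N .e * tensorAct p M N .f - tensorAct p M N .f * tensorAct p M N .e) := rfl

theorem IsHom.tensor {φ : M.V →ₗ[ℂ] M'.V} {ψ : N.V →ₗ[ℂ] N'.V} (hφ : IsHom M M' φ)
    (hψ : IsHom N N' ψ) : IsHom (tensor p M N) (tensor p M' N') (TensorProduct.map φ ψ) := by
  have ext : ∀ g, (∀ u v, TensorProduct.map φ ψ (tensorAct p M N g (u ⊗ₜ v)) =
      tensorAct p M' N' g (φ u ⊗ₜ ψ v)) → ∀ z, TensorProduct.map φ ψ (tensorAct p M N g z) =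
      tensorAct p M' N' g (TensorProduct.map φ ψ z) := by
    intro g h z
    induction z using TensorProduct.induction_on with
    | zero => simp only [map_zero]
    | add x y hx hy => simp only [map_add, hx, hy]
    | tmul u v => exact h u v
  have he := ext .e fun u v => by
    simp only [tensor_e_tmul, map_add, map_smul, map_sum, TensorProduct.map_tmul, hφ.pow, hψ.pow,
      hφ _, hψ _]
  have hf := ext .f fun u v => by
    simp only [tensor_f_tmul, map_add, map_smul, map_sum, TensorProduct.map_tmul, hφ.pow, hψ.pow,
      hφ _, hψ _]
  intro g z
  change TensorProduct.map φ ψ (tensorAct p M N g z) =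
      tensorAct p M' N' g (TensorProduct.map φ ψ z)
  match g with
  | .e => exact he z
  | .f => exact hf z
  | .h => simp only [tensor_h, LinearMap.smul_apply, LinearMap.sub_apply, Module.End.mul_apply,
      map_smul, map_sub, he, hf]
  | .E => exact ext .E (fun u v => by
      simp only [tensor_E_tmul, map_add, TensorProduct.map_tmul, hφ _, hψ _]) z
  | .F => exact ext .F (fun u v => by
      simp only [tensor_F_tmul, map_add, TensorProduct.map_tmul, hφ.pow, hφ _, hψ _]) z
  | .K => exact ext .K (fun u v => by
      simp only [tensor_K_tmul, TensorProduct.map_tmul, hφ _, hψ _]) z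

theorem Iso.tensor_congr (h : Iso M M') (h' : Iso N N') :
    Iso (tensor p M N) (tensor p M' N') := by
  obtain ⟨φ, hφ⟩ := h
  obtain ⟨ψ, hψ⟩ := h'
  exact ⟨TensorProduct.congr φ ψ, IsHom.tensor (φ := φ.toLinearMap) (ψ := ψ.toLinearMap) hφ hψ⟩

theorem isHom_id (M : GenAction) : IsHom M M LinearMap.id := fun _ _ => rfl
theorem isHom_fst (M N : GenAction) : IsHom (add M N) M (LinearMap.fst ℂ M.V N.V) := fun _ _ => rfl
theorem isHom_snd (M N : GenAction) : IsHom (add M N) N (LinearMap.snd ℂ M.V N.V) := fun _ _ => rfl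

theorem add_tensor_iso (M M' N : GenAction) :
    Iso (tensor p (add M M') N) (add (tensor p M N) (tensor p M' N)) := by
  refine ⟨TensorProduct.prodLeft ℂ ℂ M.V M'.V N.V, fun g z => ?_⟩
  have key : ∀ z, TensorProduct.prodLeft ℂ ℂ M.V M'.V N.V z =
      (TensorProduct.map (LinearMap.fst ℂ M.V M'.V) LinearMap.id z,
        TensorProduct.map (LinearMap.snd ℂ M.V M'.V) LinearMap.id z) := by
    intro z
    induction z using TensorProduct.induction_on with
    | zero => simp only [map_zero]; rfl
    | add x y hx hy => simp only [map_add, hx, hy]; rfl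
    | tmul u v => rfl
  rw [key, key, (isHom_fst M M').tensor (isHom_id N), (isHom_snd M M').tensor (isHom_id N)]
  rfl

theorem tensor_add_iso (M N N' : GenAction) :
    Iso (tensor p M (add N N')) (add (tensor p M N) (tensor p M N')) := by
  refine ⟨TensorProduct.prodRight ℂ ℂ M.V N.V N'.V, fun g z => ?_⟩
  have key : ∀ z, TensorProduct.prodRight ℂ ℂ M.V N.V N'.V z =
      (TensorProduct.map LinearMap.id (LinearMap.fst ℂ N.V N'.V) z,
        TensorProduct.map LinearMap.id (LinearMap.snd ℂ N.V N'.V) z) := by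
    intro z
    induction z using TensorProduct.induction_on with
    | zero => simp only [map_zero]; rfl
    | add x y hx hy => simp only [map_add, hx, hy]; rfl
    | tmul u v => rfl
  rw [key, key, (isHom_id M).tensor (isHom_fst N N'), (isHom_id M).tensor (isHom_snd N N')]
  rfl

theorem iso_zero_of_subsingleton (M : GenAction) [Subsingleton M.V] : Iso M zero :=
  ⟨{ toFun := fun _ => 0, invFun := fun _ => 0, map_add' := fun _ _ => rfl,
     map_smul' := fun _ _ => rfl, left_inv := fun _ => Subsingleton.elim _ _,
     right_inv := fun _ => rfl }, fun _ _ => rfl⟩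

theorem zero_tensor_iso (M : GenAction) : Iso (tensor p zero M) zero :=
  haveI : Subsingleton (tensor p zero M).V :=
    inferInstanceAs (Subsingleton (PUnit ⊗[ℂ] M.V))
  iso_zero_of_subsingleton _

theorem tensor_zero_iso (M : GenAction) : Iso (tensor p M zero) zero :=
  haveI : Subsingleton (tensor p M zero).V :=
    inferInstanceAs (Subsingleton (M.V ⊗[ℂ] PUnit))
  iso_zero_of_subsingleton _

/-! ### Stability of good modules -/

theorem good_zero : Good p zero where
  fin := inferInstanceAs (FiniteDimensional ℂ PUnit)
  KE := by ext
  KF := by ext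
  K_pow := by ext
  h_eq := by ext

theorem Good.add (hM : Good p M) (hN : Good p N) : Good p (add M N) where
  fin := by
    have := hM.fin
    have := hN.fin
    exact inferInstanceAs (FiniteDimensional ℂ (M.V × N.V))
  KE := by
    refine LinearMap.ext fun z => Prod.ext ?_ ?_
    · exact congrArg (fun t => t z.1) hM.KE
    · exact congrArg (fun t => t z.2) hN.KE
  KF := by
    refine LinearMap.ext fun z => Prod.ext ?_ ?_
    · exact congrArg (fun t => t z.1) hM.KF
    · exact congrArg (fun t => t z.2) hN.KF
  K_pow := by
    refine LinearMap.ext fun z => ?_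
    refine Prod.ext ?_ ?_
    · exact ((isHom_fst M N).pow .K _ z).trans (by rw [hM.K_pow]; rfl)
    · exact ((isHom_snd M N).pow .K _ z).trans (by rw [hN.K_pow]; rfl)
  h_eq := by
    refine LinearMap.ext fun z => ?_
    refine Prod.ext ?_ ?_
    · exact (congrArg (fun t => t z.1) hM.h_eq)
    · exact (congrArg (fun t => t z.2) hN.h_eq)

theorem Good.tensor (hM : Good p M) (hN : Good p N) : Good p (tensor p M N) where
  fin := by
    have := hM.fin
    have := hN.fin
    exact inferInstanceAs (FiniteDimensional ℂ (M.V ⊗[ℂ] N.V))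
  KE := by
    change TensorProduct.map _ _ * (TensorProduct.map _ _ + TensorProduct.map _ _) =
      _ • ((TensorProduct.map _ _ + TensorProduct.map _ _) * TensorProduct.map _ _)
    rw [mul_add, add_mul, smul_add]
    simp only [← TensorProduct.map_mul, hM.KE, hN.KE, TensorProduct.map_smul_left,
      TensorProduct.map_smul_right, one_mul, mul_one]
  KF := by
    change TensorProduct.map _ _ * (TensorProduct.map _ _ + TensorProduct.map _ _) =
      _ • ((TensorProduct.map _ _ + TensorProduct.map _ _) * TensorProduct.map _ _)
    rw [mul_add, add_mul, smul_add]
    simp only [← TensorProduct.map_mul, hM.KF, hN.KF, TensorProduct.map_smul_left,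
      TensorProduct.map_smul_right, one_mul, mul_one, invK, ← pow_succ, ← pow_succ']
  K_pow := by
    change TensorProduct.map _ _ ^ _ = _
    rw [TensorProduct.map_pow, hM.K_pow, hN.K_pow, TensorProduct.map_one]
  h_eq := rfl

theorem Good.of_iso (hM : Good p M) (h : Iso M N) : Good p N := by
  obtain ⟨φ, hφ⟩ := h
  have hh : IsHom M N φ.toLinearMap := hφ
  have := hM.fin
  have hact : ∀ g w, N.act g w = φ (M.act g (φ.symm w)) := fun g w => by
    rw [hφ, LinearEquiv.apply_symm_apply]
  refine ⟨LinearEquiv.finiteDimensional φ, ?_, ?_, ?_, ?_⟩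
  · refine LinearMap.ext fun w => ?_
    have := congrArg (fun t => φ (t (φ.symm w))) hM.KE
    simpa [hact] using this
  · refine LinearMap.ext fun w => ?_
    have := congrArg (fun t => φ (t (φ.symm w))) hM.KF
    simpa [hact] using this
  · refine LinearMap.ext fun w => ?_
    have h1 := hh.pow .K (2 * p) (φ.symm w)
    rw [hM.K_pow] at h1
    simpa using h1.symm
  · refine LinearMap.ext fun w => ?_
    have := congrArg (fun t => φ (t (φ.symm w))) hM.h_eq
    simpa [hact] using this

/-- For good modules the compatibility with `h` is automatic. -/
theorem IsHom.of_good (hM : Good p M) (hN : Good p N) {φ : M.V →ₗ[ℂ] N.V}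
    (h : ∀ g, g ≠ .h → ∀ v, φ (M.act g v) = N.act g (φ v)) : IsHom M N φ := by
  intro g v
  by_cases hg : g = .h
  · subst hg
    rw [hM.h_eq, hN.h_eq]
    simp [h .e (by simp), h .f (by simp)]
  · exact h g hg v

/-! ### Associativity of the tensor product -/

/-- Under either bracketing the `n`-th divided power of `E` becomes the sum over `i + j + k = n` of
`q^(ij+ik+jk) E^(i) ⊗ E^(j) K^i ⊗ E^(k) K^(i+j)`, and similarly for `F`. The associator of vector
spaces therefore respects all of them; `n = 1` gives `E` and `F`, `n = p` gives `e` and `f`, and `h`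
is determined by these two. -/
theorem tensor_assoc_iso (hp : 2 ≤ p) (hM : Good p M) (hN : Good p N) (hL : Good p L) :
    Iso (GenAction.tensor p (GenAction.tensor p M N) L)
      (GenAction.tensor p M (GenAction.tensor p N L)) := by
  let φ := TensorProduct.assoc ℂ M.V N.V L.V
  -- Conjugation by the associator is an algebra isomorphism, so intertwining becomes an equality of
  -- operators.
  let c := φ.conjAlgEquiv ℂ
  have hc : ∀ a b d, c (TensorProduct.map (TensorProduct.map a b) d) =
      TensorProduct.map a (TensorProduct.map b d) := by
    intro a b d
    refine TensorProduct.ext_threefold' fun x y z => ?_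
    rfl
  have hMN := hM.tensor hN
  have hNL := hN.tensor hL
  have hE : ∀ n ≤ p, c (divE p (GenAction.tensor p (GenAction.tensor p M N) L) n) =
      divE p (GenAction.tensor p M (GenAction.tensor p N L)) n := by
    intro n hn
    rw [tensor_divE hp hMN hL hn, tensor_divE hp hM hNL hn, map_sum]
    have e1 : ∀ ab ∈ antidiagonal n, c (q p ^ ((ab.1 : ℤ) * ab.2) • TensorProduct.map
        (divE p (GenAction.tensor p M N) ab.1) (divE p L ab.2 * L.act .K ^ ab.1)) =
        ∑ cd ∈ antidiagonal ab.1,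
          q p ^ ((cd.1 : ℤ) * cd.2 + cd.1 * ab.2 + cd.2 * ab.2) • TensorProduct.map (divE p M cd.1)
            (TensorProduct.map (divE p N cd.2 * N.act .K ^ cd.1)
              (divE p L ab.2 * L.act .K ^ (cd.1 + cd.2))) := by
      intro ab hab
      rw [mem_antidiagonal] at hab
      rw [tensor_divE hp hM hN (by omega), map_smul, ← TensorProduct.mapBilinear_apply (R := ℂ),
        map_sum, LinearMap.sum_apply, map_sum, Finset.smul_sum]
      refine Finset.sum_congr rfl fun cd hcd => ?_
      rw [mem_antidiagonal] at hcd
      rw [map_smul, LinearMap.smul_apply, TensorProduct.mapBilinear_apply, map_smul, hc, smul_smul,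
        ← zpow_add₀ (q_ne_zero p), hcd, ← hcd]
      congr 2
      push_cast; ring
    have e2 : ∀ ab ∈ antidiagonal n, q p ^ ((ab.1 : ℤ) * ab.2) • TensorProduct.map
        (divE p M ab.1) (divE p (GenAction.tensor p N L) ab.2 *
          (GenAction.tensor p N L).act .K ^ ab.1) =
        ∑ cd ∈ antidiagonal ab.2,
          q p ^ ((ab.1 : ℤ) * cd.1 + ab.1 * cd.2 + cd.1 * cd.2) • TensorProduct.map (divE p M ab.1)
            (TensorProduct.map (divE p N cd.1 * N.act .K ^ ab.1)
              (divE p L cd.2 * L.act .K ^ (ab.1 + cd.1))) := by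
      intro ab hab
      rw [mem_antidiagonal] at hab
      have hK : (GenAction.tensor p N L).act .K ^ ab.1 =
        TensorProduct.map (N.act .K ^ ab.1) (L.act .K ^ ab.1) := TensorProduct.map_pow ..
      rw [tensor_divE hp hN hL (by omega), Finset.sum_mul, hK,
        ← TensorProduct.mapBilinear_apply (R := ℂ), map_sum, Finset.smul_sum]
      refine Finset.sum_congr rfl fun cd hcd => ?_
      rw [mem_antidiagonal] at hcd
      rw [smul_mul_assoc, map_smul, TensorProduct.mapBilinear_apply, ← TensorProduct.map_mul,
        smul_smul, ← zpow_add₀ (q_ne_zero p), mul_assoc, ← pow_add, add_comm cd.1 ab.1, ← hcd]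
      congr 2
      push_cast; ring
    rw [Finset.sum_congr rfl e1, Finset.sum_congr rfl e2, sum_antidiagonal_assoc n fun i j k =>
      q p ^ ((i : ℤ) * j + i * k + j * k) • TensorProduct.map (divE p M i)
            (TensorProduct.map (divE p N j * N.act .K ^ i)
              (divE p L k * L.act .K ^ (i + j)))]
  have hF : ∀ n ≤ p, c (divF p (GenAction.tensor p (GenAction.tensor p M N) L) n) =
      divF p (GenAction.tensor p M (GenAction.tensor p N L)) n := by
    intro n hn
    rw [tensor_divF hp hMN hL hn, tensor_divF hp hM hNL hn, map_sum]
    have e1 : ∀ ab ∈ antidiagonal n, c (q p ^ ((ab.1 : ℤ) * ab.2) • TensorProduct.map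
        (divF p (GenAction.tensor p M N) ab.1 *
          (GenAction.tensor p M N).act .K ^ ((2 * p - 1) * ab.2)) (divF p L ab.2)) =
        ∑ cd ∈ antidiagonal ab.1,
          q p ^ ((cd.1 : ℤ) * cd.2 + cd.1 * ab.2 + cd.2 * ab.2) • TensorProduct.map
            (divF p M cd.1 * M.act .K ^ ((2 * p - 1) * (cd.2 + ab.2)))
            (TensorProduct.map (divF p N cd.2 * N.act .K ^ ((2 * p - 1) * ab.2))
              (divF p L ab.2)) := by
      intro ab hab
      rw [mem_antidiagonal] at hab
      have hK : (GenAction.tensor p M N).act .K ^ ((2 * p - 1) * ab.2) =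
        TensorProduct.map (M.act .K ^ ((2 * p - 1) * ab.2)) (N.act .K ^ ((2 * p - 1) * ab.2)) :=
          TensorProduct.map_pow ..
      rw [tensor_divF hp hM hN (by omega), map_smul, hK, Finset.sum_mul,
        ← TensorProduct.mapBilinear_apply (R := ℂ),
        map_sum, LinearMap.sum_apply, map_sum, Finset.smul_sum]
      refine Finset.sum_congr rfl fun cd hcd => ?_
      rw [mem_antidiagonal] at hcd
      rw [smul_mul_assoc, ← TensorProduct.map_mul, map_smul, LinearMap.smul_apply,
        TensorProduct.mapBilinear_apply, map_smul, hc, smul_smul,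
        ← zpow_add₀ (q_ne_zero p), mul_assoc, ← pow_add, ← mul_add, ← hcd]
      congr 2
      push_cast; ring
    have e2 : ∀ ab ∈ antidiagonal n, q p ^ ((ab.1 : ℤ) * ab.2) • TensorProduct.map
        (divF p M ab.1 * M.act .K ^ ((2 * p - 1) * ab.2))
          (divF p (GenAction.tensor p N L) ab.2) =
        ∑ cd ∈ antidiagonal ab.2,
          q p ^ ((ab.1 : ℤ) * cd.1 + ab.1 * cd.2 + cd.1 * cd.2) • TensorProduct.map
            (divF p M ab.1 * M.act .K ^ ((2 * p - 1) * (cd.1 + cd.2)))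
            (TensorProduct.map (divF p N cd.1 * N.act .K ^ ((2 * p - 1) * cd.2))
              (divF p L cd.2)) := by
      intro ab hab
      rw [mem_antidiagonal] at hab
      rw [tensor_divF hp hN hL (by omega),
        ← TensorProduct.mapBilinear_apply (R := ℂ), map_sum, Finset.smul_sum]
      refine Finset.sum_congr rfl fun cd hcd => ?_
      rw [mem_antidiagonal] at hcd
      rw [map_smul, TensorProduct.mapBilinear_apply, smul_smul, ← zpow_add₀ (q_ne_zero p), ← hcd]
      congr 2
      push_cast; ring
    rw [Finset.sum_congr rfl e1, Finset.sum_congr rfl e2, sum_antidiagonal_assoc n fun i j k =>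
      q p ^ ((i : ℤ) * j + i * k + j * k) • TensorProduct.map
            (divF p M i * M.act .K ^ ((2 * p - 1) * (j + k)))
            (TensorProduct.map (divF p N j * N.act .K ^ ((2 * p - 1) * k)) (divF p L k))]
  have hK : c ((GenAction.tensor p (GenAction.tensor p M N) L).act .K) =
      (GenAction.tensor p M (GenAction.tensor p N L)).act .K := hc _ _ _
  have hact : ∀ g, g ≠ .h → c ((GenAction.tensor p (GenAction.tensor p M N) L).act g) =
      (GenAction.tensor p M (GenAction.tensor p N L)).act g := by
    intro g hg
    match g with
    | .K => exact hK
    | .E =>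
      have h1 := hE 1 (by omega)
      simpa [divE_of_lt (show 1 < p by omega), dpow, qFact, qInt_one hp] using h1
    | .F =>
      have h1 := hF 1 (by omega)
      simpa [divF_of_lt (show 1 < p by omega), dpow, qFact, qInt_one hp] using h1
    | .e => rw [(hMN.tensor hL).e_eq, (hM.tensor hNL).e_eq, map_mul, map_pow, hK, hE p le_rfl]
    | .f =>
      rw [f_eq (p := p), f_eq (p := p) (M := GenAction.tensor p M (GenAction.tensor p N L)),
        map_smul, hF p le_rfl]
  refine ⟨φ, IsHom.of_good (φ := φ.toLinearMap) (hMN.tensor hL) (hM.tensor hNL) fun g hg v => ?_⟩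
  rw [← hact g hg]
  change _ = φ _
  simp only [LinearEquiv.coe_coe]
  exact congrArg _ (congrArg _ (φ.symm_apply_apply v).symm)

end GenAction
end

/-! ### The trivial module, and comultiplication when `E` or `F` vanishes on one factor. -/

noncomputable section

namespace GenAction

variable {p : ℕ}

/-- The trivial module. -/
abbrev triv : GenAction where
  V := ℂ
  act := fun g => match g with
    | .K => 1
    | _ => 0

theorem good_triv : Good p triv where
  fin := inferInstanceAs (FiniteDimensional ℂ ℂ)
  KE := by simp
  KF := by simp
  K_pow := one_pow _
  h_eq := by simp

theorem sum_Icc_smul_tmul_zero_left {V W : Type} [AddCommGroup V] [Module ℂ V] [AddCommGroup W]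
    [Module ℂ W] (c : ℕ → ℂ) (a : ℕ → V) (b : ℕ → W) (n : ℕ)
    (h : ∀ r, 1 ≤ r → r ≤ n → a r ⊗ₜ[ℂ] b r = 0) :
    ∑ r ∈ Finset.Icc 1 n, c r • (a r ⊗ₜ[ℂ] b r) = 0 := by
  refine Finset.sum_eq_zero fun r hr => ?_
  rw [Finset.mem_Icc] at hr
  rw [h r hr.1 hr.2, smul_zero]

/-- If `E` and `F` vanish on the first factor, the comultiplication takes a simple form. -/
theorem tensor_e_tmul_of_left {M N : GenAction} (hE : M.act .E = 0) (u : M.V) (v : N.V) :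
    tensorAct p M N .e (u ⊗ₜ v) = M.act .e u ⊗ₜ v + (M.act .K ^ p) u ⊗ₜ N.act .e v := by
  rw [tensor_e_tmul, sum_Icc_smul_tmul_zero_left, smul_zero, add_zero]
  intro r h1 h2
  rw [hE, zero_pow (by omega), LinearMap.zero_apply, map_zero, TensorProduct.zero_tmul]

theorem tensor_f_tmul_of_left {M N : GenAction} (hF : M.act .F = 0) (u : M.V) (v : N.V) :
    tensorAct p M N .f (u ⊗ₜ v) = M.act .f u ⊗ₜ v + (M.act .K ^ p) u ⊗ₜ N.act .f v := by
  rw [tensor_f_tmul, sum_Icc_smul_tmul_zero_left, smul_zero, add_zero]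
  intro r h1 h2
  rw [hF, zero_pow (by omega), LinearMap.zero_apply, map_zero, TensorProduct.zero_tmul]

theorem tensor_e_tmul_of_right {M N : GenAction} (hE : N.act .E = 0) (u : M.V) (v : N.V) :
    tensorAct p M N .e (u ⊗ₜ v) = M.act .e u ⊗ₜ v + (M.act .K ^ p) u ⊗ₜ N.act .e v := by
  rw [tensor_e_tmul, sum_Icc_smul_tmul_zero_left, smul_zero, add_zero]
  intro r h1 h2
  rw [hE, zero_pow (by omega), LinearMap.zero_apply, TensorProduct.tmul_zero]

theorem tensor_f_tmul_of_right {M N : GenAction} (hF : N.act .F = 0) (u : M.V) (v : N.V) :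
    tensorAct p M N .f (u ⊗ₜ v) = M.act .f u ⊗ₜ v + (M.act .K ^ p) u ⊗ₜ N.act .f v := by
  rw [tensor_f_tmul, sum_Icc_smul_tmul_zero_left, smul_zero, add_zero]
  intro r h1 h2
  rw [hF, zero_pow (by omega), LinearMap.zero_apply, TensorProduct.tmul_zero]

/-- A map out of a tensor product is a homomorphism if it is one on pure tensors. -/
theorem isHom_of_tmul {M N L : GenAction} (hM : Good p M) (hN : Good p N) (hL : Good p L)
    {φ : M.V ⊗[ℂ] N.V →ₗ[ℂ] L.V} (h : ∀ g, g ≠ .h → ∀ u v,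
      φ (tensorAct p M N g (u ⊗ₜ v)) = L.act g (φ (u ⊗ₜ v))) : IsHom (tensor p M N) L φ := by
  refine IsHom.of_good (hM.tensor hN) hL fun g hg z => ?_
  change φ (tensorAct p M N g z) = _
  induction z using TensorProduct.induction_on with
  | zero => simp only [map_zero]
  | add x y hx hy => simp only [map_add, hx, hy]
  | tmul u v => exact h g hg u v

theorem triv_tensor_iso {M : GenAction} (hM : Good p M) : Iso (tensor p triv M) M := by
  refine ⟨TensorProduct.lid ℂ M.V, isHom_of_tmul (φ := (TensorProduct.lid ℂ M.V).toLinearMap)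
    good_triv hM hM fun g hg u v => ?_⟩
  match g with
  | .K => rw [tensor_K_tmul]; simp
  | .E => rw [tensor_E_tmul]; simp
  | .F => rw [tensor_F_tmul]; simp
  | .e => rw [tensor_e_tmul_of_left rfl]; simp
  | .f => rw [tensor_f_tmul_of_left rfl]; simp

theorem tensor_triv_iso {M : GenAction} (hM : Good p M) : Iso (tensor p M triv) M := by
  refine ⟨TensorProduct.rid ℂ M.V, isHom_of_tmul (φ := (TensorProduct.rid ℂ M.V).toLinearMap)
    hM good_triv hM fun g hg u v => ?_⟩
  match g with
  | .K => rw [tensor_K_tmul]; simp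
  | .E => rw [tensor_E_tmul]; simp
  | .F => rw [tensor_F_tmul]; simp
  | .e => rw [tensor_e_tmul_of_right rfl]; simp
  | .f => rw [tensor_f_tmul_of_right rfl]; simp

/-! ### The ring of isomorphism classes -/

/-- Good modules up to isomorphism. -/
instance isoSetoid (p : ℕ) : Setoid {M : GenAction // Good p M} where
  r M N := Iso M.1 N.1
  iseqv := ⟨fun M => Iso.refl M.1, fun h => h.symm, fun h h' => h.trans h'⟩

/-- The isomorphism classes of good modules. -/
def IsoClass (p : ℕ) : Type 1 := Quotient (isoSetoid p)

/-- The isomorphism class of a good module. -/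
def IsoClass.mk {M : GenAction} (h : Good p M) : IsoClass p := Quotient.mk _ ⟨M, h⟩

theorem IsoClass.mk_eq_mk {M N : GenAction} (hM : Good p M) (hN : Good p N) :
    IsoClass.mk hM = IsoClass.mk hN ↔ Iso M N := Quotient.eq

namespace IsoClass

variable [hp : Fact (2 ≤ p)]

instance : Zero (IsoClass p) := ⟨Quotient.mk _ ⟨zero, good_zero⟩⟩
instance : One (IsoClass p) := ⟨Quotient.mk _ ⟨triv, good_triv⟩⟩
instance : Add (IsoClass p) :=
  ⟨Quotient.map₂ (fun M N => ⟨GenAction.add M.1 N.1, M.2.add N.2⟩)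
    fun _ _ h _ _ h' => Iso.add_congr h h'⟩
instance : Mul (IsoClass p) :=
  ⟨Quotient.map₂ (fun M N => ⟨GenAction.tensor p M.1 N.1, M.2.tensor N.2⟩)
    fun _ _ h _ _ h' => Iso.tensor_congr h h'⟩

instance : Semiring (IsoClass p) where
  add_assoc := by
    rintro ⟨a⟩ ⟨b⟩ ⟨c⟩
    exact Quotient.sound (add_assoc_iso _ _ _)
  zero_add := by
    rintro ⟨a⟩
    exact Quotient.sound (zero_add_iso _)
  add_zero := by
    rintro ⟨a⟩
    exact Quotient.sound ((add_comm_iso _ _).trans (zero_add_iso _))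
  add_comm := by
    rintro ⟨a⟩ ⟨b⟩
    exact Quotient.sound (add_comm_iso _ _)
  left_distrib := by
    rintro ⟨a⟩ ⟨b⟩ ⟨c⟩
    exact Quotient.sound (tensor_add_iso _ _ _)
  right_distrib := by
    rintro ⟨a⟩ ⟨b⟩ ⟨c⟩
    exact Quotient.sound (add_tensor_iso _ _ _)
  zero_mul := by
    rintro ⟨a⟩
    exact Quotient.sound (zero_tensor_iso _)
  mul_zero := by
    rintro ⟨a⟩
    exact Quotient.sound (tensor_zero_iso _)
  mul_assoc := by
    rintro ⟨a⟩ ⟨b⟩ ⟨c⟩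
    exact Quotient.sound (tensor_assoc_iso hp.out a.2 b.2 c.2)
  one_mul := by
    rintro ⟨a⟩
    exact Quotient.sound (triv_tensor_iso a.2)
  mul_one := by
    rintro ⟨a⟩
    exact Quotient.sound (tensor_triv_iso a.2)
  nsmul := nsmulRec

/-- This is where the finite dimension of good modules enters. Without cancellation, passing to
differences of classes would lose information. -/
instance : IsCancelAdd (IsoClass p) :=
  have h : IsRightCancelAdd (IsoClass p) := ⟨by
    rintro ⟨c⟩ ⟨a⟩ ⟨b⟩ h
    have := c.2.fin
    exact Quotient.sound (iso_of_add_iso_add c.1 (Quotient.exact h))⟩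
  AddCommMagma.IsRightCancelAdd.toIsCancelAdd _

end IsoClass

/-- Left multiplications on the Grothendieck group of good modules. -/
abbrev ClassRing (p : ℕ) [Fact (2 ≤ p)] : Type 1 :=
  AddMonoid.End (Algebra.GrothendieckAddGroup (IsoClass p))

variable [hp : Fact (2 ≤ p)]

theorem lift_of (f : IsoClass p →+ Algebra.GrothendieckAddGroup (IsoClass p)) (a : IsoClass p) :
    Algebra.GrothendieckAddGroup.lift f (Algebra.GrothendieckAddGroup.of a) = f a :=
  DFunLike.congr_fun (Algebra.GrothendieckAddGroup.lift.symm_apply_apply f) a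

theorem grothendieck_ext {f g : ClassRing p} (h : ∀ a : IsoClass p,
    f (Algebra.GrothendieckAddGroup.of a) = g (Algebra.GrothendieckAddGroup.of a)) : f = g :=
  Algebra.GrothendieckAddGroup.lift.symm.injective (AddMonoidHom.ext h)

/-- Left multiplication on the Grothendieck group. -/
def leftMul (a : IsoClass p) : ClassRing p :=
  Algebra.GrothendieckAddGroup.lift
    (Algebra.GrothendieckAddGroup.of.comp (AddMonoidHom.mulLeft a))

theorem leftMul_of (a b : IsoClass p) : leftMul a (Algebra.GrothendieckAddGroup.of b) =
    Algebra.GrothendieckAddGroup.of (a * b) := lift_of _ _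

/-- The class of a good module, acting on the Grothendieck group by left multiplication. -/
def isoClassHom (p : ℕ) [Fact (2 ≤ p)] : IsoClass p →+* ClassRing p where
  toFun := leftMul
  map_one' := grothendieck_ext fun b => by
    rw [leftMul_of, one_mul, AddMonoid.End.one_apply]
  map_mul' a a' := grothendieck_ext fun b => by
    refine (leftMul_of _ _).trans ?_
    rw [mul_assoc, ← leftMul_of, ← leftMul_of]
    rfl
  map_zero' := grothendieck_ext fun b => by
    rw [leftMul_of, zero_mul, map_zero, AddMonoid.End.zero_apply]
  map_add' a a' := grothendieck_ext fun b => by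
    refine (leftMul_of _ _).trans ?_
    rw [add_mul, map_add, ← leftMul_of, ← leftMul_of]
    rfl

/-- Left multiplication by a class is recovered from its value at the class of the trivial module,
and the map to the Grothendieck group is injective by cancellation. Hence identities proved with
subtraction descend to isomorphisms of modules. -/
theorem isoClassHom_injective : Function.Injective (isoClassHom p) := by
  intro a b h
  have h1 : leftMul a (Algebra.GrothendieckAddGroup.of 1) =
    leftMul b (Algebra.GrothendieckAddGroup.of 1) := DFunLike.congr_fun h _
  rw [leftMul_of, leftMul_of, mul_one, mul_one] at h1
  exact Algebra.GrothendieckAddGroup.of_injective h1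

open Classical in
/-- The class of a module (zero unless the module is good). -/
def cl (p : ℕ) [Fact (2 ≤ p)] (M : GenAction) : ClassRing p :=
  if h : Good p M then isoClassHom p (IsoClass.mk h) else 0

theorem cl_of_good {M : GenAction} (h : Good p M) :
    cl p M = isoClassHom p (IsoClass.mk h) := dif_pos h

theorem cl_eq_iff {M N : GenAction} (hM : Good p M) (hN : Good p N) :
    cl p M = cl p N ↔ Iso M N := by
  rw [cl_of_good hM, cl_of_good hN, isoClassHom_injective.eq_iff, IsoClass.mk_eq_mk]

theorem cl_congr {M N : GenAction} (hM : Good p M) (h : Iso M N) : cl p M = cl p N :=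
  (cl_eq_iff hM (hM.of_iso h)).2 h

theorem cl_add {M N : GenAction} (hM : Good p M) (hN : Good p N) :
    cl p (add M N) = cl p M + cl p N := by
  rw [cl_of_good hM, cl_of_good hN, cl_of_good (hM.add hN), ← map_add]
  rfl

theorem cl_tensor {M N : GenAction} (hM : Good p M) (hN : Good p N) :
    cl p (tensor p M N) = cl p M * cl p N := by
  rw [cl_of_good hM, cl_of_good hN, cl_of_good (hM.tensor hN), ← map_mul]
  rfl

theorem cl_zero : cl p zero = 0 := by
  rw [cl_of_good good_zero]
  exact map_zero (isoClassHom p)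

theorem cl_triv : cl p triv = 1 := by
  rw [cl_of_good good_triv]
  exact map_one (isoClassHom p)

/-! ### Classes of finite direct sums and of multiples. -/

theorem sum_empty_iso {ι : Type} (M : ι → GenAction) : Iso (sum ∅ M) zero :=
  haveI : Subsingleton (sum ∅ M).V := ⟨fun _ _ => funext fun i => (Finset.notMem_empty _ i.2).elim⟩
  iso_zero_of_subsingleton _

theorem sum_insert_iso {ι : Type} [DecidableEq ι] {S : Finset ι} {i : ι} (hi : i ∉ S)
    (M : ι → GenAction) : Iso (sum (insert i S) M) (add (M i) (sum S M)) := by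
  let φ : (∀ j : {j // j ∈ insert i S}, (M j.1).V) →ₗ[ℂ] (M i).V × (∀ j : {j // j ∈ S}, (M j.1).V) :=
    let π (j : {j // j ∈ insert i S}) :=
      LinearMap.proj (R := ℂ) (φ := fun j : {j // j ∈ insert i S} => (M j.1).V) j
    (π ⟨i, Finset.mem_insert_self i S⟩).prod
      (LinearMap.pi fun j : {j // j ∈ S} => π ⟨j.1, Finset.mem_insert_of_mem j.2⟩)
  have hφ : Function.Bijective φ := by
    constructor
    · rw [← LinearMap.ker_eq_bot, LinearMap.ker_eq_bot']
      intro v hv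
      funext j
      obtain ⟨j, hj⟩ := j
      rcases Finset.mem_insert.1 hj with rfl | hj'
      · exact congrArg Prod.fst hv
      · exact congrFun (congrArg Prod.snd hv) ⟨j, hj'⟩
    · rintro ⟨u, w⟩
      refine ⟨fun j => if h : j.1 = i then
        cast (congrArg (fun k => (M k).V) h.symm) u else
        w ⟨j.1, (Finset.mem_insert.1 j.2).resolve_left h⟩, ?_⟩
      refine Prod.ext ?_ (funext fun j => ?_)
      · simp [φ]
      · have : j.1 ≠ i := fun h => hi (h ▸ j.2)
        simp [φ, this]
  exact ⟨LinearEquiv.ofBijective φ hφ, fun _ _ => rfl⟩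

theorem copies_zero_iso (M : GenAction) : Iso (copies 0 M) zero :=
  haveI : Subsingleton (copies 0 M).V := ⟨fun _ _ => funext fun i => i.elim0⟩
  iso_zero_of_subsingleton _

theorem copies_succ_iso (n : ℕ) (M : GenAction) :
    Iso (copies (n + 1) M) (add M (copies n M)) :=
  ⟨(Fin.consLinearEquiv ℂ fun _ => M.V).symm, fun _ _ => rfl⟩

theorem good_and_cl_sum {ι : Type} (S : Finset ι) (M : ι → GenAction) (h : ∀ i ∈ S, Good p (M i)) :
    Good p (sum S M) ∧ cl p (sum S M) = ∑ i ∈ S, cl p (M i) := by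
  classical
  induction S using Finset.induction_on with
  | empty =>
    have h1 := good_zero.of_iso (sum_empty_iso M).symm (p := p)
    exact ⟨h1, by rw [cl_congr h1 (sum_empty_iso M), cl_zero, Finset.sum_empty]⟩
  | insert i S hi ih =>
    obtain ⟨h1, h2⟩ := ih fun j hj => h j (Finset.mem_insert_of_mem hj)
    have h0 := h i (Finset.mem_insert_self i S)
    have h3 := (h0.add h1).of_iso (sum_insert_iso hi M).symm
    exact ⟨h3, by rw [cl_congr h3 (sum_insert_iso hi M), cl_add h0 h1, h2, Finset.sum_insert hi]⟩

theorem good_and_cl_copies (n : ℕ) {M : GenAction} (h : Good p M) :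
    Good p (copies n M) ∧ cl p (copies n M) = n * cl p M := by
  induction n with
  | zero =>
    have h1 := good_zero.of_iso (copies_zero_iso M).symm (p := p)
    exact ⟨h1, by rw [cl_congr h1 (copies_zero_iso M), cl_zero, Nat.cast_zero, zero_mul]⟩
  | succ n ih =>
    obtain ⟨h1, h2⟩ := ih
    have h3 := (h.add h1).of_iso (copies_succ_iso n M).symm
    exact ⟨h3, by rw [cl_congr h3 (copies_succ_iso n M), cl_add h h1, h2]; push_cast; noncomm_ring⟩

end GenAction
end

noncomputable section

/-! ### Spans of labelled basis vectors -/

section Span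

variable {ι : Type} {S : ι → Prop}

theorem vec_of_mem {i : ι} (hi : S i) : vec S i = Finsupp.single ⟨i, hi⟩ 1 := dif_pos hi

theorem vec_of_not_mem {i : ι} (hi : ¬S i) : vec S i = 0 := dif_neg hi

theorem linearCombination_vec {W : Type} [AddCommGroup W] [Module ℂ W] (φ : ι → W) {i : ι}
    (hi : S i) : Finsupp.linearCombination ℂ (fun j : {j // S j} => φ j.1) (vec S i) = φ i := by
  rw [vec_of_mem hi, Finsupp.linearCombination_single, one_smul]

theorem opOf_vec (φ : ι → Span S) {i : ι} (hi : S i) : opOf S φ (vec S i) = φ i :=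
  linearCombination_vec φ hi

theorem span_hom_ext {W : Type} [AddCommGroup W] [Module ℂ W] {φ ψ : Span S →ₗ[ℂ] W}
    (h : ∀ i, S i → φ (vec S i) = ψ (vec S i)) : φ = ψ := by
  refine Finsupp.lhom_ext' fun i => LinearMap.ext_ring ?_
  have := h i.1 i.2
  rwa [vec_of_mem i.2] at this

theorem eq_top_of_vec_mem {W : Submodule ℂ (Span S)} (h : ∀ i, S i → vec S i ∈ W) : W = ⊤ := by
  refine eq_top_iff.2 fun v _ => ?_
  induction v using Finsupp.induction_linear with
  | zero => exact W.zero_mem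
  | add x y hx hy => exact W.add_mem (hx trivial) (hy trivial)
  | single i c =>
    have := W.smul_mem c (h i.1 i.2)
    rwa [vec_of_mem i.2, Finsupp.smul_single, smul_eq_mul, mul_one] at this

theorem eq_top_of_vec_tmul_vec_mem {ι' : Type} {S' : ι' → Prop}
    {W : Submodule ℂ (Span S ⊗[ℂ] Span S')}
    (h : ∀ i j, S i → S' j → vec S i ⊗ₜ[ℂ] vec S' j ∈ W) : W = ⊤ := by
  have h1 : ∀ i, S i → ∀ v, vec S i ⊗ₜ[ℂ] v ∈ W := by
    intro i hi
    have : W.comap (TensorProduct.mk ℂ (Span S) (Span S') (vec S i)) = ⊤ :=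
      eq_top_of_vec_mem fun j hj => h i j hi hj
    exact fun v => this.ge (Submodule.mem_top (x := v))
  have h2 : ∀ u v, u ⊗ₜ[ℂ] v ∈ W := by
    intro u v
    have : W.comap ((TensorProduct.mk ℂ (Span S) (Span S')).flip v) = ⊤ :=
      eq_top_of_vec_mem fun i hi => h1 i hi v
    exact this.ge (Submodule.mem_top (x := u))
  refine eq_top_iff.2 fun z _ => ?_
  induction z using TensorProduct.induction_on with
  | zero => exact W.zero_mem
  | add x y hx hy => exact W.add_mem (hx trivial) (hy trivial)
  | tmul u v => exact h2 u v

theorem finrank_span (s : Finset ι) (h : ∀ i, S i ↔ i ∈ s) :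
    FiniteDimensional ℂ (Span S) ∧ Module.finrank ℂ (Span S) = s.card := by
  let e : {i // S i} ≃ s := Equiv.subtypeEquivRight h
  have : Fintype {i // S i} := Fintype.ofEquiv _ e.symm
  refine ⟨inferInstance, ?_⟩
  rw [Module.finrank_finsupp_self, Fintype.card_congr e, Fintype.card_coe]

end Span

namespace GenAction

variable {p : ℕ}

/-- A surjective homomorphism between modules of the same dimension is an isomorphism. -/
theorem iso_of_surjective {M N : GenAction} [FiniteDimensional ℂ M.V] [FiniteDimensional ℂ N.V]
    {φ : M.V →ₗ[ℂ] N.V} (hφ : IsHom M N φ) (hs : Function.Surjective φ)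
    (hd : Module.finrank ℂ M.V = Module.finrank ℂ N.V) : Iso M N :=
  ⟨LinearEquiv.ofBijective φ ⟨(LinearMap.injective_iff_surjective_of_finrank_eq_finrank hd).2 hs,
    hs⟩, hφ⟩

end GenAction

open GenAction

variable {p : ℕ}

/-! ### Modules `X` with `r = 1` and tensoring by the two-dimensional module -/

theorem finrank_X (s r : ℕ) : FiniteDimensional ℂ (Span (XLabel s r)) ∧
    Module.finrank ℂ (Span (XLabel s r)) = s * r := by
  have := finrank_span (S := XLabel s r) (Finset.Icc 0 ((s : ℤ) - 1) ×ˢ Finset.Icc 0 ((r : ℤ) - 1))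
    (fun i => by simp [XLabel, and_assoc])
  simpa using this

section X

variable (α : ℤˣ) {s r n m : ℤ}

theorem X_K (hn : 0 ≤ n ∧ n ≤ s - 1) (hm : 0 ≤ m ∧ m ≤ r - 1) :
    XAct p α s r .K (vec _ (n, m)) = (sgn α * q p ^ (s - 1 - 2 * n)) • vec _ (n, m) :=
  opOf_vec _ (i := (n, m)) ⟨hn.1, hn.2, hm.1, hm.2⟩

theorem X_E (hn : 0 ≤ n ∧ n ≤ s - 1) (hm : 0 ≤ m ∧ m ≤ r - 1) :
    XAct p α s r .E (vec _ (n, m)) = (sgn α * qInt p n * qInt p (s - n)) • vec _ (n - 1, m) :=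
  opOf_vec _ (i := (n, m)) ⟨hn.1, hn.2, hm.1, hm.2⟩

theorem X_F (hn : 0 ≤ n ∧ n ≤ s - 1) (hm : 0 ≤ m ∧ m ≤ r - 1) :
    XAct p α s r .F (vec _ (n, m)) = vec _ (n + 1, m) :=
  opOf_vec _ (i := (n, m)) ⟨hn.1, hn.2, hm.1, hm.2⟩

theorem X_h (hn : 0 ≤ n ∧ n ≤ s - 1) (hm : 0 ≤ m ∧ m ≤ r - 1) :
    XAct p α s r .h (vec _ (n, m)) = (1 / 2 * ((r : ℂ) - 1 - 2 * m)) • vec _ (n, m) :=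
  opOf_vec _ (i := (n, m)) ⟨hn.1, hn.2, hm.1, hm.2⟩

theorem X_e (hn : 0 ≤ n ∧ n ≤ s - 1) (hm : 0 ≤ m ∧ m ≤ r - 1) :
    XAct p α s r .e (vec _ (n, m)) = ((m : ℂ) * (r - m)) • vec _ (n, m - 1) :=
  opOf_vec _ (i := (n, m)) ⟨hn.1, hn.2, hm.1, hm.2⟩

theorem X_f (hn : 0 ≤ n ∧ n ≤ s - 1) (hm : 0 ≤ m ∧ m ≤ r - 1) :
    XAct p α s r .f (vec _ (n, m)) = vec _ (n, m + 1) :=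
  opOf_vec _ (i := (n, m)) ⟨hn.1, hn.2, hm.1, hm.2⟩

end X

theorem sgn_mul_self (α : ℤˣ) : sgn α * sgn α = 1 := by
  rcases Int.units_eq_one_or α with rfl | rfl <;> simp [sgn]

theorem pow_smul_vec {ι : Type} {S : ι → Prop} {A : Module.End ℂ (Span S)} {i : ι} {c : ℂ}
    (h : A (vec S i) = c • vec S i) (n : ℕ) : (A ^ n) (vec S i) = c ^ n • vec S i := by
  induction n with
  | zero => simp
  | succ n ih => rw [pow_succ', Module.End.mul_apply, ih, map_smul, h, smul_smul, pow_succ]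

theorem good_X (hp : 2 ≤ p) (α : ℤˣ) {s r : ℤ} (hs : 0 ≤ s) (hr : 0 ≤ r) : Good p (X p α s r) := by
  have hq := q_ne_zero p
  obtain ⟨s, rfl⟩ := Int.eq_ofNat_of_zero_le hs
  obtain ⟨r, rfl⟩ := Int.eq_ofNat_of_zero_le hr
  have hK : ∀ n m : ℤ, XAct p α s r .K (vec _ (n, m)) =
      (sgn α * q p ^ ((s : ℤ) - 1 - 2 * n)) • vec _ (n, m) := by
    intro n m
    by_cases h : XLabel s r (n, m)
    · exact X_K α ⟨h.1, h.2.1⟩ h.2.2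
    · rw [vec_of_not_mem h, map_zero, smul_zero]
  refine ⟨(finrank_X s r).1, ?_, ?_, ?_, ?_⟩ <;> refine span_hom_ext ?_ <;> rintro ⟨n, m⟩ h <;>
    have hn : 0 ≤ n ∧ n ≤ (s : ℤ) - 1 := ⟨h.1, h.2.1⟩ <;>
    have hm : 0 ≤ m ∧ m ≤ (r : ℤ) - 1 := h.2.2
  · rw [LinearMap.smul_apply, Module.End.mul_apply, Module.End.mul_apply, X_E α hn hm, map_smul,
      hK, hK, map_smul, X_E α hn hm, smul_smul, smul_smul, smul_smul]
    congr 1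
    rw [show (s : ℤ) - 1 - 2 * (n - 1) = (s - 1 - 2 * n) + 2 by ring, zpow_add₀ hq]
    ring
  · rw [LinearMap.smul_apply, Module.End.mul_apply, Module.End.mul_apply, X_F α hn hm,
      hK, hK, map_smul, X_F α hn hm, smul_smul]
    congr 1
    rw [show (s : ℤ) - 1 - 2 * (n + 1) = (s - 1 - 2 * n) + (-2) by ring, zpow_add₀ hq]
    ring
  · rw [pow_smul_vec (hK n m), mul_pow, pow_mul, pow_two, sgn_mul_self, one_pow, one_mul,
      ← zpow_natCast, ← zpow_mul, mul_comm, zpow_mul, Nat.cast_mul, Nat.cast_two,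
      q_zpow_two_mul hp, one_zpow, one_smul, Module.End.one_apply]
  · rw [LinearMap.smul_apply, LinearMap.sub_apply, Module.End.mul_apply, Module.End.mul_apply,
      X_h α hn hm, X_f α hn hm, X_e α hn hm, map_smul]
    have h1 : XAct p α s r .e (vec _ (n, m + 1)) =
        (((m : ℂ) + 1) * ((r : ℂ) - m - 1)) • vec _ (n, m) := by
      by_cases h1 : m + 1 ≤ (r : ℤ) - 1
      · rw [X_e α hn ⟨by omega, h1⟩, add_sub_cancel_right]
        push_cast
        congr 1; ring
      · have h2 : (r : ℤ) = m + 1 := by omega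
        have h3 : (r : ℂ) = m + 1 := by exact_mod_cast h2
        rw [vec_of_not_mem (fun h : XLabel s r (n, m + 1) => h1 h.2.2.2), map_zero, h3]
        simp
    have h2 : ((m : ℂ) * ((r : ℤ) - m)) • XAct p α s r .f (vec _ (n, m - 1)) =
        ((m : ℂ) * ((r : ℂ) - m)) • vec _ (n, m) := by
      by_cases h1 : m = 0
      · simp [h1]
      · rw [X_f α hn ⟨by omega, by omega⟩, sub_add_cancel]; simp
    rw [h1, h2, ← sub_smul, smul_smul]
    congr 1
    push_cast
    ring

/-- A homomorphism out of `X^α_{s,r}`, given by the images of the basis vectors. -/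
theorem exists_hom_X (hp : 2 ≤ p) (α : ℤˣ) {s r : ℤ} (hs : 0 ≤ s) (hr : 0 ≤ r) {W : GenAction}
    (hW : Good p W) (a : ℤ → ℤ → W.V) (h0 : ∀ n m, s ≤ n ∨ r ≤ m → a n m = 0)
    (hK : ∀ n m, 0 ≤ n → 0 ≤ m → n < s → m < r →
      W.act .K (a n m) = (sgn α * q p ^ (s - 1 - 2 * n)) • a n m)
    (hE : ∀ n m, 0 ≤ n → 0 ≤ m → n < s → m < r →
      W.act .E (a n m) = (sgn α * qInt p n * qInt p (s - n)) • a (n - 1) m)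
    (hF : ∀ n m, 0 ≤ n → 0 ≤ m → n < s → m < r → W.act .F (a n m) = a (n + 1) m)
    (he : ∀ n m, 0 ≤ n → 0 ≤ m → n < s → m < r →
      W.act .e (a n m) = ((m : ℂ) * (r - m)) • a n (m - 1))
    (hf : ∀ n m, 0 ≤ n → 0 ≤ m → n < s → m < r → W.act .f (a n m) = a n (m + 1)) :
    ∃ φ : Span (XLabel s r) →ₗ[ℂ] W.V, IsHom (X p α s r) W φ ∧
      ∀ n m, 0 ≤ n → 0 ≤ m → φ (vec _ (n, m)) = a n m := by
  let φ : Span (XLabel s r) →ₗ[ℂ] W.V :=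
    Finsupp.linearCombination ℂ fun i : {i // XLabel s r i} => a i.1.1 i.1.2
  have hφ : ∀ n m, 0 ≤ n → 0 ≤ m → φ (vec _ (n, m)) = a n m := by
    intro n m hn hm
    by_cases h : n ≤ s - 1 ∧ m ≤ r - 1
    · exact linearCombination_vec (S := XLabel s r) (fun i => a i.1 i.2) (i := (n, m))
        ⟨hn, h.1, hm, h.2⟩
    · rw [vec_of_not_mem (fun h' : XLabel s r (n, m) => h ⟨h'.2.1, h'.2.2.2⟩), map_zero, h0]
      omega
  refine ⟨φ, IsHom.of_good (good_X hp α hs hr) hW fun g hg v => ?_, hφ⟩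
  refine LinearMap.congr_fun (f := φ ∘ₗ XAct p α s r g) (g := W.act g ∘ₗ φ) ?_ v
  refine span_hom_ext ?_
  rintro ⟨n, m⟩ ⟨h1, h2, h3, h4⟩
  dsimp only at h1 h2 h3 h4
  rw [LinearMap.comp_apply, LinearMap.comp_apply, hφ n m h1 h3]
  match g with
  | .K => rw [X_K α ⟨h1, h2⟩ ⟨h3, h4⟩, map_smul, hφ n m h1 h3, hK n m] <;> omega
  | .E =>
    rw [X_E α ⟨h1, h2⟩ ⟨h3, h4⟩, map_smul, hE n m h1 h3 (by omega) (by omega)]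
    by_cases hn : n = 0
    · simp [hn, qInt_zero]
    · rw [hφ _ _ (by omega) h3]
  | .F => rw [X_F α ⟨h1, h2⟩ ⟨h3, h4⟩, hφ _ _ (by omega) h3, hF n m] <;> omega
  | .e =>
    rw [X_e α ⟨h1, h2⟩ ⟨h3, h4⟩, map_smul, he n m h1 h3 (by omega) (by omega)]
    by_cases hm : m = 0
    · simp [hm]
    · rw [hφ _ _ h1 (by omega)]
  | .f => rw [X_f α ⟨h1, h2⟩ ⟨h3, h4⟩, hφ _ _ h1 (by omega), hf n m] <;> omega

/-! ### A uniform model of the projective modules with `r = 1` -/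

/-- Labels of the basis `τ_n` (`(false, n)`), `β_n` (`(true, n)`), `0 ≤ n ≤ p-1`. -/
def TLabel (p : ℕ) (i : Bool × ℤ) : Prop := 0 ≤ i.2 ∧ i.2 ≤ p - 1

/-- The action of the generators on the model of `P^+_{s,1}`. For `s = p` this is
`X^+_{p,1} ⊕ X^+_{p,1}`, and for `s = 0` it is `X^-_{p,2}`. -/
def TActAux (p : ℕ) (s : ℤ) (g : Gen) : Module.End ℂ (Span (TLabel p)) :=
  opOf (TLabel p) fun (c, n) =>
    match g, c with
    | .K, false => q p ^ (s - 1 - 2 * n) • vec (TLabel p) (false, n)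
    | .K, true => q p ^ (-s - 1 - 2 * n) • vec (TLabel p) (true, n)
    | .E, false => (qInt p n * qInt p (s - n)) • vec (TLabel p) (false, n - 1) +
        gConst p s • vec (TLabel p) (true, n + p - s - 1)
    | .E, true => (qInt p n * qInt p (-s - n)) • vec (TLabel p) (true, n - 1)
    | .F, c => vec (TLabel p) (c, n + 1)
    | .e, false => vec (TLabel p) (true, n - s)
    | .e, true => 0
    | .f, false => 0
    | .f, true => vec (TLabel p) (false, n + s)
    | .h, _ => 0

/-- The model of `P^+_{s,1}`. -/
abbrev T (p : ℕ) (s : ℤ) : GenAction where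
  V := Span (TLabel p)
  act := fun g => match g with
    | .h => (1 / 2 : ℂ) • (TActAux p s .e * TActAux p s .f - TActAux p s .f * TActAux p s .e)
    | g => TActAux p s g

theorem finrank_T (p : ℕ) : FiniteDimensional ℂ (Span (TLabel p)) ∧
    Module.finrank ℂ (Span (TLabel p)) = 2 * p := by
  have := finrank_span (S := TLabel p) (Finset.univ ×ˢ Finset.Icc 0 ((p : ℤ) - 1))
    (fun i => by simp [TLabel])
  simpa using this

/-- The basis vector `τ_n`. -/
abbrev tau (p : ℕ) (n : ℤ) : Span (TLabel p) := vec (TLabel p) (false, n)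
/-- The basis vector `β_n`. -/
abbrev beta (p : ℕ) (n : ℤ) : Span (TLabel p) := vec (TLabel p) (true, n)

theorem tau_eq_zero {n : ℤ} (h : n < 0 ∨ p ≤ n) : tau p n = 0 :=
  vec_of_not_mem fun h' => by have := h'.1; have := h'.2; dsimp only at *; omega

theorem beta_eq_zero {n : ℤ} (h : n < 0 ∨ p ≤ n) : beta p n = 0 :=
  vec_of_not_mem fun h' => by have := h'.1; have := h'.2; dsimp only at *; omega

theorem TLabel_cases {P : Bool × ℤ → Prop} (ht : ∀ n : ℤ, 0 ≤ n → n < p → P (false, n))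
    (hb : ∀ n : ℤ, 0 ≤ n → n < p → P (true, n)) : ∀ i, TLabel p i → P i := by
  rintro ⟨⟨⟩, n⟩ ⟨h1, h2⟩
  · exact ht n h1 (by dsimp only at h2; omega)
  · exact hb n h1 (by dsimp only at h2; omega)

section T

variable {s : ℤ}

theorem T_K_tau (n : ℤ) : TActAux p s .K (tau p n) = q p ^ (s - 1 - 2 * n) • tau p n := by
  by_cases h : TLabel p (false, n)
  · exact opOf_vec _ h
  · rw [tau, vec_of_not_mem h, map_zero, smul_zero]

theorem T_K_beta (n : ℤ) : TActAux p s .K (beta p n) = q p ^ (-s - 1 - 2 * n) • beta p n := by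
  by_cases h : TLabel p (true, n)
  · exact opOf_vec _ h
  · rw [beta, vec_of_not_mem h, map_zero, smul_zero]

theorem T_F_tau {n : ℤ} (hn : 0 ≤ n) : TActAux p s .F (tau p n) = tau p (n + 1) := by
  by_cases h : TLabel p (false, n)
  · exact opOf_vec _ h
  · rw [tau, vec_of_not_mem h, map_zero, tau_eq_zero]
    simp only [TLabel] at h; omega

theorem T_F_beta {n : ℤ} (hn : 0 ≤ n) : TActAux p s .F (beta p n) = beta p (n + 1) := by
  by_cases h : TLabel p (true, n)
  · exact opOf_vec _ h
  · rw [beta, vec_of_not_mem h, map_zero, beta_eq_zero]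
    simp only [TLabel] at h; omega

theorem gConst_self (hp : 2 ≤ p) : gConst p p = 0 := by simp [gConst, qInt_self hp]

/-- The formula persists beyond the range of labels: at `n = p` the first coefficient contains `[p]
= 0`, and the second term has an index out of range unless `s = p`, where its constant vanishes.
Such formulas without boundary spare many case distinctions. -/
theorem T_E_tau (hp : 2 ≤ p) (hs : s ≤ p) {n : ℤ} (hn : 0 ≤ n) : TActAux p s .E (tau p n) =
    (qInt p n * qInt p (s - n)) • tau p (n - 1) + gConst p s • beta p (n + p - s - 1) := by
  by_cases h : TLabel p (false, n)
  · exact opOf_vec _ h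
  · rw [tau, vec_of_not_mem h, map_zero]
    simp only [TLabel] at h
    have h1 : qInt p n • tau p (n - 1) = 0 := by
      rcases eq_or_ne n p with rfl | h2
      · rw [qInt_self hp, zero_smul]
      · rw [tau_eq_zero (by omega), smul_zero]
    have h2 : gConst p s • beta p (n + p - s - 1) = 0 := by
      rcases eq_or_ne s p with rfl | h2
      · rw [gConst_self hp, zero_smul]
      · rw [beta_eq_zero (by omega), smul_zero]
    rw [mul_comm, mul_smul, h1, h2, smul_zero, add_zero]

theorem T_E_beta (hp : 2 ≤ p) (n : ℤ) : TActAux p s .E (beta p n) =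
    (qInt p n * qInt p (-s - n)) • beta p (n - 1) := by
  by_cases h : TLabel p (true, n)
  · exact opOf_vec _ h
  · rw [beta, vec_of_not_mem h, map_zero]
    simp only [TLabel] at h
    rcases eq_or_ne n p with rfl | h2
    · rw [qInt_self hp, zero_mul, zero_smul]
    · rw [beta_eq_zero (by omega), smul_zero]

theorem T_e_tau {n : ℤ} (hn : n < p) (hs : 0 ≤ s) :
    TActAux p s .e (tau p n) = beta p (n - s) := by
  by_cases h : TLabel p (false, n)
  · exact opOf_vec _ h
  · rw [tau, vec_of_not_mem h, map_zero, beta_eq_zero]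
    simp only [TLabel] at h; omega

theorem T_e_beta (n : ℤ) : TActAux p s .e (beta p n) = 0 := by
  by_cases h : TLabel p (true, n)
  · exact opOf_vec _ h
  · rw [beta, vec_of_not_mem h, map_zero]

theorem T_f_tau (n : ℤ) : TActAux p s .f (tau p n) = 0 := by
  by_cases h : TLabel p (false, n)
  · exact opOf_vec _ h
  · rw [tau, vec_of_not_mem h, map_zero]

theorem T_f_beta {n : ℤ} (hn : 0 ≤ n) (hs : 0 ≤ s) :
    TActAux p s .f (beta p n) = tau p (n + s) := by
  by_cases h : TLabel p (true, n)
  · exact opOf_vec _ h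
  · rw [beta, vec_of_not_mem h, map_zero, tau_eq_zero]
    simp only [TLabel] at h; omega

theorem q_zpow_sub_two_mul (hp : 2 ≤ p) (n : ℤ) : q p ^ (n - 2 * p) = q p ^ n := by
  rw [zpow_sub₀ (q_ne_zero p), q_zpow_two_mul hp, div_one]

/-- The coupling term respects weights because `β_{n+p-s-1}` and `τ_{n-1}` have `K`-eigenvalues
whose exponents differ by `2p`. -/
theorem good_T (hp : 2 ≤ p) (hs : s ≤ p) : Good p (T p s) := by
  have hq := q_ne_zero p
  refine ⟨(finrank_T p).1, ?_, ?_, ?_, rfl⟩ <;> refine span_hom_ext (TLabel_cases ?_ ?_) <;>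
    intro n hn hn'
  · change TActAux p s .K (TActAux p s .E _) = q p ^ 2 • TActAux p s .E (TActAux p s .K _)
    rw [T_E_tau hp hs hn, T_K_tau, map_smul, T_E_tau hp hs hn, map_add, map_smul, map_smul,
      T_K_tau, T_K_beta, show s - 1 - 2 * (n - 1) = (s - 1 - 2 * n) + 2 by ring,
      show -s - 1 - 2 * (n + p - s - 1) = (s - 1 - 2 * n) + 2 - 2 * p by ring,
      q_zpow_sub_two_mul hp, zpow_add₀ hq]
    module
  · change TActAux p s .K (TActAux p s .E _) = q p ^ 2 • TActAux p s .E (TActAux p s .K _)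
    rw [T_E_beta hp, T_K_beta, map_smul, map_smul, T_E_beta hp, T_K_beta,
      show -s - 1 - 2 * (n - 1) = (-s - 1 - 2 * n) + 2 by ring, zpow_add₀ hq]
    module
  · change TActAux p s .K (TActAux p s .F _) = q p ^ (-2) • TActAux p s .F (TActAux p s .K _)
    rw [T_F_tau hn, T_K_tau, T_K_tau, map_smul, T_F_tau hn,
      show s - 1 - 2 * (n + 1) = (s - 1 - 2 * n) + (-2) by ring, zpow_add₀ hq]
    module
  · change TActAux p s .K (TActAux p s .F _) = q p ^ (-2) • TActAux p s .F (TActAux p s .K _)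
    rw [T_F_beta hn, T_K_beta, T_K_beta, map_smul, T_F_beta hn,
      show -s - 1 - 2 * (n + 1) = (-s - 1 - 2 * n) + (-2) by ring, zpow_add₀ hq]
    module
  · change (TActAux p s .K ^ _) _ = _
    rw [pow_smul_vec (T_K_tau n), ← zpow_natCast, ← zpow_mul, mul_comm, zpow_mul, Nat.cast_mul,
      Nat.cast_two, q_zpow_two_mul hp, one_zpow, one_smul, Module.End.one_apply]
  · change (TActAux p s .K ^ _) _ = _
    rw [pow_smul_vec (T_K_beta n), ← zpow_natCast, ← zpow_mul, mul_comm, zpow_mul, Nat.cast_mul,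
      Nat.cast_two, q_zpow_two_mul hp, one_zpow, one_smul, Module.End.one_apply]

end T

/-- A homomorphism out of `T_s`, given by the images of the basis vectors. -/
theorem exists_hom_T (hp : 2 ≤ p) {s : ℤ} (hs : 0 ≤ s) (hsp : s ≤ p) {W : GenAction}
    (hW : Good p W) (t b : ℤ → W.V) (ht0 : ∀ n : ℤ, p ≤ n → t n = 0)
    (hb0 : ∀ n : ℤ, p ≤ n → b n = 0)
    (hKt : ∀ n : ℤ, 0 ≤ n → n < p → W.act .K (t n) = q p ^ (s - 1 - 2 * n) • t n)
    (hKb : ∀ n : ℤ, 0 ≤ n → n < p → W.act .K (b n) = q p ^ (-s - 1 - 2 * n) • b n)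
    (hEt : ∀ n : ℤ, 0 ≤ n → n < p → W.act .E (t n) =
      (qInt p n * qInt p (s - n)) • t (n - 1) + gConst p s • b (n + p - s - 1))
    (hEb : ∀ n : ℤ, 0 ≤ n → n < p → W.act .E (b n) = (qInt p n * qInt p (-s - n)) • b (n - 1))
    (hFt : ∀ n : ℤ, 0 ≤ n → n < p → W.act .F (t n) = t (n + 1))
    (hFb : ∀ n : ℤ, 0 ≤ n → n < p → W.act .F (b n) = b (n + 1))
    (het : ∀ n : ℤ, 0 ≤ n → n < p → W.act .e (t n) = if n < s then 0 else b (n - s))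
    (heb : ∀ n : ℤ, 0 ≤ n → n < p → W.act .e (b n) = 0)
    (hft : ∀ n : ℤ, 0 ≤ n → n < p → W.act .f (t n) = 0)
    (hfb : ∀ n : ℤ, 0 ≤ n → n < p → W.act .f (b n) = t (n + s)) :
    ∃ φ : Span (TLabel p) →ₗ[ℂ] W.V, IsHom (T p s) W φ ∧
      ∀ n, 0 ≤ n → φ (tau p n) = t n ∧ φ (beta p n) = b n := by
  let φ : Span (TLabel p) →ₗ[ℂ] W.V :=
    Finsupp.linearCombination ℂ fun i : {i // TLabel p i} => (cond i.1.1 b t) i.1.2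
  have hφt : ∀ n, 0 ≤ n → φ (tau p n) = t n := by
    intro n hn
    by_cases h : n < p
    · exact linearCombination_vec (fun i : Bool × ℤ => (cond i.1 b t) i.2)
        (i := (false, n)) ⟨hn, by dsimp only; omega⟩
    · rw [tau_eq_zero (by omega), map_zero, ht0 n (by omega)]
  have hφb : ∀ n, 0 ≤ n → φ (beta p n) = b n := by
    intro n hn
    by_cases h : n < p
    · exact linearCombination_vec (fun i : Bool × ℤ => (cond i.1 b t) i.2)
        (i := (true, n)) ⟨hn, by dsimp only; omega⟩
    · rw [beta_eq_zero (by omega), map_zero, hb0 n (by omega)]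
  refine ⟨φ, IsHom.of_good (good_T hp hsp) hW fun g hg v => ?_, fun n hn => ⟨hφt n hn, hφb n hn⟩⟩
  refine LinearMap.congr_fun (f := φ ∘ₗ (T p s).act g) (g := W.act g ∘ₗ φ) ?_ v
  have hEφ : ∀ n, 0 ≤ n → gConst p s • φ (beta p (n + p - s - 1)) =
      gConst p s • b (n + p - s - 1) := by
    intro n hn
    rcases eq_or_ne s p with rfl | h
    · rw [gConst_self hp, zero_smul, zero_smul]
    · rw [hφb _ (by omega)]
  refine span_hom_ext (TLabel_cases ?_ ?_) <;> intro n hn hn' <;>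
    rw [LinearMap.comp_apply, LinearMap.comp_apply]
  · change _ = W.act g (φ (tau p n))
    rw [hφt n hn]
    match g with
    | .K => rw [hKt n hn hn', ← hφt n hn, ← map_smul]; exact congrArg φ (T_K_tau (s := s) n)
    | .E =>
      refine (congrArg φ (T_E_tau hp hsp hn)).trans ?_
      rw [hEt n hn hn', map_add, map_smul, map_smul, hEφ n hn]
      by_cases h : n = 0
      · simp [h, qInt_zero]
      · rw [hφt _ (by omega)]
    | .F => exact (congrArg φ (T_F_tau (s := s) hn)).trans (by rw [hFt n hn hn', hφt _ (by omega)])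
    | .e =>
      refine (congrArg φ (T_e_tau hn' hs)).trans ?_
      rw [het n hn hn']
      split_ifs with h
      · rw [beta_eq_zero (by omega), map_zero]
      · rw [hφb _ (by omega)]
    | .f => exact (congrArg φ (T_f_tau (s := s) n)).trans (by rw [hft n hn hn', map_zero])
  · change _ = W.act g (φ (beta p n))
    rw [hφb n hn]
    match g with
    | .K => rw [hKb n hn hn', ← hφb n hn, ← map_smul]; exact congrArg φ (T_K_beta (s := s) n)
    | .E =>
      refine (congrArg φ (T_E_beta hp n)).trans ?_
      rw [hEb n hn hn', map_smul]
      by_cases h : n = 0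
      · simp [h, qInt_zero]
      · rw [hφb _ (by omega)]
    | .F => exact (congrArg φ (T_F_beta (s := s) hn)).trans (by rw [hFb n hn hn', hφb _ (by omega)])
    | .e => exact (congrArg φ (T_e_beta (s := s) n)).trans (by rw [heb n hn hn', map_zero])
    | .f =>
      exact (congrArg φ (T_f_beta hn hs)).trans (by rw [hfb n hn hn', hφt _ (by omega)])

end

noncomputable section

open GenAction

variable {p : ℕ}

/-! ### Auxiliary tools -/

/-- Cramer's rule. It recovers two basis vectors from one vector of each of two families sharing a
weight space. -/
theorem mem_of_det_ne_zero {V : Type} [AddCommGroup V] [Module ℂ V] {W : Submodule ℂ V} {u v : V}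
    {a b c d : ℂ} (h1 : a • u + b • v ∈ W) (h2 : c • u + d • v ∈ W) (h : a * d - b * c ≠ 0) :
    u ∈ W ∧ v ∈ W := by
  constructor
  · have := W.smul_mem (a * d - b * c)⁻¹ (W.sub_mem (W.smul_mem d h1) (W.smul_mem b h2))
    rwa [show d • (a • u + b • v) - b • (c • u + d • v) = (a * d - b * c) • u by module,
      inv_smul_smul₀ h] at this
  · have := W.smul_mem (a * d - b * c)⁻¹ (W.sub_mem (W.smul_mem a h2) (W.smul_mem c h1))
    rwa [show a • (c • u + d • v) - c • (a • u + b • v) = (a * d - b * c) • v by module,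
      inv_smul_smul₀ h] at this

namespace GenAction

/-- It suffices that the two images together span: a surjection between spaces of equal dimension is
bijective. -/
theorem iso_add_of_isHom {A B M : GenAction} (hA : Good p A) (hB : Good p B) (hM : Good p M)
    {φ : A.V →ₗ[ℂ] M.V} {ψ : B.V →ₗ[ℂ] M.V} (hφ : IsHom A M φ) (hψ : IsHom B M ψ)
    (h : ∀ W : Submodule ℂ M.V, (∀ a, φ a ∈ W) → (∀ b, ψ b ∈ W) → W = ⊤)
    (hd : Module.finrank ℂ A.V + Module.finrank ℂ B.V = Module.finrank ℂ M.V) :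
    Iso M (add A B) := by
  have := hA.fin
  have := hB.fin
  have := hM.fin
  refine Iso.symm (iso_of_surjective (φ := φ.coprod ψ) (M := add A B) (fun g v => ?_) ?_ ?_)
  · change φ (A.act g v.1) + ψ (B.act g v.2) = M.act g (φ v.1 + ψ v.2)
    rw [hφ, hψ, map_add]
  · exact LinearMap.range_eq_top.1 (h _ (fun a => ⟨(a, 0), by simp⟩) (fun b => ⟨(0, b), by simp⟩))
  · rw [← hd]; exact Module.finrank_prod

theorem iso_of_isHom {A M : GenAction} (hA : Good p A) (hM : Good p M)
    {φ : A.V →ₗ[ℂ] M.V} (hφ : IsHom A M φ)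
    (h : ∀ W : Submodule ℂ M.V, (∀ a, φ a ∈ W) → W = ⊤)
    (hd : Module.finrank ℂ A.V = Module.finrank ℂ M.V) : Iso A M := by
  have := hA.fin
  have := hM.fin
  exact iso_of_surjective hφ (LinearMap.range_eq_top.1 (h _ fun a => ⟨a, rfl⟩)) hd

theorem finrank_tensor (M N : GenAction) : Module.finrank ℂ (tensor p M N).V =
    Module.finrank ℂ M.V * Module.finrank ℂ N.V := Module.finrank_tensorProduct

end GenAction

/-! ### The simple modules with one trivial index -/

theorem sgn_mul (α β : ℤˣ) : sgn (α * β) = sgn α * sgn β := by simp [sgn]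

theorem sgn_ne_zero (α : ℤˣ) : sgn α ≠ 0 := fun h => by simpa [h] using sgn_mul_self α

theorem sgn_inv (α : ℤˣ) : (sgn α)⁻¹ = sgn α := inv_eq_of_mul_eq_one_left (sgn_mul_self α)

theorem finrank_X' {s r : ℤ} (hs : 0 ≤ s) (hr : 0 ≤ r) :
    (Module.finrank ℂ (Span (XLabel s r)) : ℤ) = s * r := by
  lift s to ℕ using hs
  lift r to ℕ using hr
  exact_mod_cast (finrank_X s r).2

theorem X_K' (α : ℤˣ) (s r n m : ℤ) :
    XAct p α s r .K (vec _ (n, m)) = (sgn α * q p ^ (s - 1 - 2 * n)) • vec _ (n, m) := by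
  by_cases h : XLabel s r (n, m)
  · exact X_K α ⟨h.1, h.2.1⟩ h.2.2
  · rw [vec_of_not_mem h, map_zero, smul_zero]

theorem X_E_one (α : ℤˣ) (r : ℤ) : XAct p α 1 r .E = 0 := by
  refine span_hom_ext ?_
  rintro ⟨n, m⟩ h
  have : n = 0 := le_antisymm (by simpa using h.2.1) h.1
  rw [X_E α ⟨h.1, h.2.1⟩ h.2.2, this, qInt_zero]
  simp

theorem X_F_one (α : ℤˣ) (r : ℤ) : XAct p α 1 r .F = 0 := by
  refine span_hom_ext ?_
  rintro ⟨n, m⟩ h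
  rw [X_F α ⟨h.1, h.2.1⟩ h.2.2, vec_of_not_mem, LinearMap.zero_apply]
  intro h'
  have := h'.2.1
  have := h.1
  dsimp only at *
  omega

theorem X_e_one (α : ℤˣ) (s : ℤ) : XAct p α s 1 .e = 0 := by
  refine span_hom_ext ?_
  rintro ⟨n, m⟩ h
  have : m = 0 := le_antisymm (by simpa using h.2.2.2) h.2.2.1
  rw [X_e α ⟨h.1, h.2.1⟩ h.2.2, this]
  simp

theorem X_f_one (α : ℤˣ) (s : ℤ) : XAct p α s 1 .f = 0 := by
  refine span_hom_ext ?_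
  rintro ⟨n, m⟩ h
  rw [X_f α ⟨h.1, h.2.1⟩ h.2.2, vec_of_not_mem, LinearMap.zero_apply]
  intro h'
  have := h'.2.2.2
  have := h.2.2.1
  dsimp only at *
  omega

theorem X_E_one_apply (α : ℤˣ) (r : ℤ) (v) : XAct p α 1 r .E v = 0 := by
  rw [X_E_one, LinearMap.zero_apply]

theorem X_F_one_apply (α : ℤˣ) (r : ℤ) (v) : XAct p α 1 r .F v = 0 := by
  rw [X_F_one, LinearMap.zero_apply]

theorem X_e_one_apply (α : ℤˣ) (s : ℤ) (v) : XAct p α s 1 .e v = 0 := by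
  rw [X_e_one, LinearMap.zero_apply]

theorem X_f_one_apply (α : ℤˣ) (s : ℤ) (v) : XAct p α s 1 .f v = 0 := by
  rw [X_f_one, LinearMap.zero_apply]

theorem X_K_pow (α : ℤˣ) (s r n m : ℤ) (k : ℕ) :
    (XAct p α s r .K ^ k) (vec _ (n, m)) = (sgn α * q p ^ (s - 1 - 2 * n)) ^ k • vec _ (n, m) :=
  pow_smul_vec (X_K' α s r n m) k

theorem sgn_pow_two_mul_sub_one (hp : 2 ≤ p) (α : ℤˣ) : sgn α ^ (2 * p - 1) = sgn α := by
  obtain ⟨k, rfl⟩ : ∃ k, p = k + 1 := ⟨p - 1, by omega⟩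
  rw [show 2 * (k + 1) - 1 = 2 * k + 1 by omega, pow_succ, pow_mul, pow_two, sgn_mul_self, one_pow,
    one_mul]

/-- The eigenvalue of `K^p` on `X^α_{s,r}`. -/
def kpSign (p : ℕ) (α : ℤˣ) (s : ℤ) : ℂ := sgn α ^ p * (-1) ^ (s - 1)

theorem kpSign_mul_self (α : ℤˣ) (s : ℤ) : kpSign p α s * kpSign p α s = 1 := by
  rw [kpSign, mul_mul_mul_comm, ← mul_pow, sgn_mul_self, ← mul_zpow]
  simp

theorem kpSign_ne_zero (α : ℤˣ) (s : ℤ) : kpSign p α s ≠ 0 := fun h => by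
  simpa [h] using kpSign_mul_self (p := p) α s

theorem q_zpow_mul_self (hp : 2 ≤ p) (n : ℤ) : q p ^ (n * p) = (-1) ^ n := by
  rw [mul_comm, zpow_mul, zpow_natCast, q_pow_self hp]

theorem neg_one_zpow_sub_two_mul (a b : ℤ) : (-1 : ℂ) ^ (a - 2 * b) = (-1) ^ a := by
  rw [zpow_sub₀ (by norm_num), zpow_mul]
  simp

theorem X_K_pow_self (hp : 2 ≤ p) (α : ℤˣ) (s r n m : ℤ) :
    (XAct p α s r .K ^ p) (vec _ (n, m)) = kpSign p α s • vec _ (n, m) := by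
  rw [X_K_pow, mul_pow, ← zpow_natCast (q p ^ _), ← zpow_mul, q_zpow_mul_self hp,
    neg_one_zpow_sub_two_mul, kpSign]

/-- With `E = F = 0` on the right factor and `e = f = 0` on the left one, `Δ(e)` and `Δ(f)` reduce
to `K^p ⊗ e` and `K^p ⊗ f`. Since `K^p` is a sign on the left factor, rescaling the vectors of index
`m` by the `m`-th power of that sign absorbs it. -/
theorem X_tensor_X_iso (hp : 2 ≤ p) (α β : ℤˣ) {s r : ℤ} (hs : 0 ≤ s) (hr : 0 ≤ r) :
    Iso (tensor p (X p α s 1) (X p β 1 r)) (X p (α * β) s r) := by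
  have hMN := (good_X hp α hs zero_le_one).tensor (good_X hp β zero_le_one hr)
  have hc := kpSign_ne_zero (p := p) α s
  refine (exists_hom_X hp (α * β) hs hr hMN
    (fun n m => kpSign p α s ^ m • (vec (XLabel s 1) (n, 0) ⊗ₜ vec (XLabel 1 r) (0, m)))
    (fun n m h => ?_) ?_ ?_ ?_ ?_ ?_).elim
      fun φ h => h.elim fun hφ hφ' => ?_
  rotate_right
  · refine (iso_of_isHom (good_X hp _ hs hr) hMN hφ (fun W h => ?_) ?_).symm
    · refine eq_top_of_vec_tmul_vec_mem ?_
      rintro ⟨n, m⟩ ⟨n', m'⟩ h1 h2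
      obtain ⟨h1, -, h3, h4⟩ := h1
      obtain ⟨h5, h6, h7, -⟩ := h2
      dsimp only at *
      obtain rfl : m = 0 := by omega
      obtain rfl : n' = 0 := by omega
      have := W.smul_mem (kpSign p α s ^ m')⁻¹ (h (vec _ (n, m')))
      rw [hφ' n m' h1 h7] at this
      rwa [inv_smul_smul₀ (zpow_ne_zero _ hc)] at this
    · rw [finrank_tensor]
      zify
      rw [finrank_X' hs hr, finrank_X' hs zero_le_one, finrank_X' zero_le_one hr]
      ring
  · rcases h with h | h
    · rw [vec_of_not_mem (i := (n, 0)) (fun h' => by have := h'.2.1; dsimp only at this; omega),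
        TensorProduct.zero_tmul, smul_zero]
    · rw [vec_of_not_mem (i := (0, m)) (fun h' => by have := h'.2.2.2; dsimp only at this; omega),
        TensorProduct.tmul_zero, smul_zero]
  all_goals
    intro n m hn hm hn' hm'
    rw [map_smul]
  · rw [tensor_K_tmul, X_K', X_K', TensorProduct.smul_tmul_smul, smul_comm, sgn_mul]
    congr 1
    simp; ring
  · rw [tensor_E_tmul, X_E_one_apply, X_K', X_E α (by omega) (by omega),
      TensorProduct.tmul_zero, zero_add, TensorProduct.smul_tmul_smul, smul_comm, sgn_mul]
    congr 1
    simp; ring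
  · rw [tensor_F_tmul, X_F_one_apply, X_F α (by omega) (by omega),
      TensorProduct.tmul_zero, zero_add]
  · rw [tensor_e_tmul_of_right (X_E_one (p := p) β r), X_e_one_apply, X_K_pow_self hp,
      X_e β (by omega) (by omega),
      TensorProduct.zero_tmul, zero_add,
      TensorProduct.smul_tmul_smul, smul_smul, smul_smul, zpow_sub_one₀ hc,
      inv_eq_of_mul_eq_one_left (kpSign_mul_self α s)]
    congr 1; ring
  · rw [tensor_f_tmul_of_right (X_F_one (p := p) β r), X_f_one_apply, X_K_pow_self hp,
      X_f β (by omega) (by omega),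
      TensorProduct.zero_tmul, zero_add,
      TensorProduct.smul_tmul, TensorProduct.tmul_smul, smul_smul, zpow_add_one₀ hc]

/-- In this order the sign comes from `Δ(F) = K⁻¹ ⊗ F` and depends on `n` instead of `m`. Since the
target is the one of `X_tensor_X_iso`, the two factors commute up to isomorphism; no braiding is
involved. -/
theorem X_tensor_X_iso' (hp : 2 ≤ p) (α β : ℤˣ) {s r : ℤ} (hs : 0 ≤ s) (hr : 0 ≤ r) :
    Iso (tensor p (X p β 1 r) (X p α s 1)) (X p (α * β) s r) := by
  have hMN := (good_X hp β zero_le_one hr).tensor (good_X hp α hs zero_le_one)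
  have hc := sgn_ne_zero β
  refine (exists_hom_X hp (α * β) hs hr hMN
    (fun n m => sgn β ^ n • (vec (XLabel 1 r) (0, m) ⊗ₜ vec (XLabel s 1) (n, 0)))
    (fun n m h => ?_) ?_ ?_ ?_ ?_ ?_).elim
      fun φ h => h.elim fun hφ hφ' => ?_
  rotate_right
  · refine (iso_of_isHom (good_X hp _ hs hr) hMN hφ (fun W h => ?_) ?_).symm
    · refine eq_top_of_vec_tmul_vec_mem ?_
      rintro ⟨n', m'⟩ ⟨n, m⟩ h2 h1
      obtain ⟨h1, -, h3, h4⟩ := h1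
      obtain ⟨h5, h6, h7, -⟩ := h2
      dsimp only at *
      obtain rfl : m = 0 := by omega
      obtain rfl : n' = 0 := by omega
      have := W.smul_mem (sgn β ^ n)⁻¹ (h (vec _ (n, m')))
      rw [hφ' n m' h1 h7] at this
      rwa [inv_smul_smul₀ (zpow_ne_zero _ hc)] at this
    · rw [finrank_tensor]
      zify
      rw [finrank_X' hs hr, finrank_X' hs zero_le_one, finrank_X' zero_le_one hr]
      ring
  · rcases h with h | h
    · rw [vec_of_not_mem (i := (n, 0)) (fun h' => by have := h'.2.1; dsimp only at this; omega),
        TensorProduct.tmul_zero, smul_zero]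
    · rw [vec_of_not_mem (i := (0, m)) (fun h' => by have := h'.2.2.2; dsimp only at this; omega),
        TensorProduct.zero_tmul, smul_zero]
  all_goals
    intro n m hn hm hn' hm'
    rw [map_smul]
  · rw [tensor_K_tmul, X_K', X_K', TensorProduct.smul_tmul_smul, smul_comm, sgn_mul]
    congr 1
    simp; ring
  · rw [tensor_E_tmul, X_E_one_apply, X_E α (by omega) (by omega),
      TensorProduct.zero_tmul, add_zero, TensorProduct.tmul_smul, sgn_mul, smul_smul, smul_smul,
      zpow_sub_one₀ hc, sgn_inv]
    congr 1
    linear_combination (-sgn β ^ n * sgn α * qInt p n * qInt p (s - n)) * sgn_mul_self β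
  · rw [tensor_F_tmul, X_F_one_apply, X_K_pow, X_F α (by omega) (by omega),
      TensorProduct.zero_tmul, add_zero, TensorProduct.smul_tmul, TensorProduct.tmul_smul,
      zpow_add_one₀ hc, smul_smul]
    simp [sgn_pow_two_mul_sub_one hp]
  · rw [tensor_e_tmul_of_left (X_E_one (p := p) β r), X_e_one_apply, X_e β (by omega) (by omega),
      TensorProduct.tmul_zero, add_zero, TensorProduct.smul_tmul, TensorProduct.tmul_smul, smul_comm]
  · rw [tensor_f_tmul_of_left (X_F_one (p := p) β r), X_f_one_apply, X_f β (by omega) (by omega),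
      TensorProduct.tmul_zero, add_zero]

theorem X_one_one_iso_triv (hp : 2 ≤ p) : Iso (X p 1 1 1) triv := by
  refine (exists_hom_X hp 1 zero_le_one zero_le_one (good_triv (p := p))
    (fun n m => if n = 0 ∧ m = 0 then (1 : ℂ) else 0) (fun n m h => ?_) ?_ ?_ ?_ ?_ ?_).elim
      fun φ h => h.elim fun hφ hφ' => ?_
  rotate_right
  · refine iso_of_isHom (good_X hp 1 zero_le_one zero_le_one) good_triv hφ (fun W h => ?_) ?_
    · have := h (vec _ (0, 0))
      rw [hφ' 0 0 le_rfl le_rfl, if_pos ⟨rfl, rfl⟩] at this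
      refine eq_top_iff.2 fun z _ => ?_
      have h2 := W.smul_mem (show ℂ from z) this
      rwa [smul_eq_mul, mul_one] at h2
    · zify
      rw [finrank_X' zero_le_one zero_le_one]
      change (1 : ℤ) * 1 = Module.finrank ℂ ℂ
      simp
  · exact if_neg (by omega)
  all_goals
    intro n m h1 h2 h3 h4
    obtain rfl : n = 0 := by omega
    obtain rfl : m = 0 := by omega
    simp [triv, qInt_zero, sgn]

/-- A homomorphism out of `X^α_{1,r}`. -/
theorem exists_hom_X_one_left (hp : 2 ≤ p) (α : ℤˣ) {r : ℤ} (hr : 0 ≤ r) {W : GenAction}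
    (hW : Good p W) (w : ℤ → W.V) (h0 : ∀ m, r ≤ m → w m = 0)
    (hK : ∀ m, 0 ≤ m → m < r → W.act .K (w m) = sgn α • w m)
    (hE : ∀ m, 0 ≤ m → m < r → W.act .E (w m) = 0)
    (hF : ∀ m, 0 ≤ m → m < r → W.act .F (w m) = 0)
    (he : ∀ m, 0 ≤ m → m < r → W.act .e (w m) = ((m : ℂ) * (r - m)) • w (m - 1))
    (hf : ∀ m, 0 ≤ m → m < r → W.act .f (w m) = w (m + 1)) :
    ∃ φ : Span (XLabel 1 r) →ₗ[ℂ] W.V, IsHom (X p α 1 r) W φ ∧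
      ∀ m, 0 ≤ m → φ (vec _ (0, m)) = w m := by
  refine (exists_hom_X hp α zero_le_one hr hW (fun n m => if n = 0 then w m else 0)
    (fun n m h => by split_ifs with h'; exacts [h0 m (by omega), rfl]) ?_ ?_ ?_ ?_ ?_).elim
      fun φ h => h.elim fun h1 h2 => ?_
  rotate_right
  · exact ⟨φ, h1, fun m hm => (h2 0 m le_rfl hm).trans (if_pos rfl)⟩
  all_goals
    intro n m hn hm hn' hm'
    obtain rfl : n = 0 := by omega
  · simp [hK m hm hm']
  · simp [hE m hm hm', qInt_zero]
  · simp [hF m hm hm']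
  · simp [he m hm hm']
  · simp [hf m hm hm']

/-- A homomorphism out of `X^α_{s,1}`. -/
theorem exists_hom_X_one_right (hp : 2 ≤ p) (α : ℤˣ) {s : ℤ} (hs : 0 ≤ s) {W : GenAction}
    (hW : Good p W) (a : ℤ → W.V) (h0 : ∀ n, s ≤ n → a n = 0)
    (hK : ∀ n, 0 ≤ n → n < s → W.act .K (a n) = (sgn α * q p ^ (s - 1 - 2 * n)) • a n)
    (hE : ∀ n, 0 ≤ n → n < s → W.act .E (a n) = (sgn α * qInt p n * qInt p (s - n)) • a (n - 1))
    (hF : ∀ n, 0 ≤ n → n < s → W.act .F (a n) = a (n + 1))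
    (he : ∀ n, 0 ≤ n → n < s → W.act .e (a n) = 0)
    (hf : ∀ n, 0 ≤ n → n < s → W.act .f (a n) = 0) :
    ∃ φ : Span (XLabel s 1) →ₗ[ℂ] W.V, IsHom (X p α s 1) W φ ∧
      ∀ n, 0 ≤ n → φ (vec _ (n, 0)) = a n := by
  refine (exists_hom_X hp α hs zero_le_one hW (fun n m => if m = 0 then a n else 0)
    (fun n m h => by split_ifs with h'; exacts [h0 n (by omega), rfl]) ?_ ?_ ?_ ?_ ?_).elim
      fun φ h => h.elim fun h1 h2 => ?_
  rotate_right
  · exact ⟨φ, h1, fun n hn => (h2 n 0 hn le_rfl).trans (if_pos rfl)⟩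
  all_goals
    intro n m hn hm hn' hm'
    obtain rfl : m = 0 := by omega
  · simp [hK n hn hn']
  · simp [hE n hn hn']
  · simp [hF n hn hn']
  · simp [he n hn hn']
  · simp [hf n hn hn']

/-- The basis vector of `X^α_{1,r}`. -/
abbrev wv (r m : ℤ) : Span (XLabel 1 r) := vec _ (0, m)

/-- The basis vector of `X^α_{s,1}`. -/
abbrev av (s n : ℤ) : Span (XLabel s 1) := vec _ (n, 0)

theorem wv_eq_zero {r m : ℤ} (h : m < 0 ∨ r ≤ m) : wv r m = 0 :=
  vec_of_not_mem fun h' => by obtain ⟨-, -, h1, h2⟩ := h'; dsimp only at *; omega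

theorem av_eq_zero {s n : ℤ} (h : n < 0 ∨ s ≤ n) : av s n = 0 :=
  vec_of_not_mem fun h' => by obtain ⟨h1, h2, -⟩ := h'; dsimp only at *; omega

theorem eq_top_of_wv_tmul_wv {r r' : ℤ} {W : Submodule ℂ (Span (XLabel 1 r) ⊗[ℂ] Span (XLabel 1 r'))}
    (h : ∀ m m', 0 ≤ m → m < r → 0 ≤ m' → m' < r' → wv r m ⊗ₜ wv r' m' ∈ W) : W = ⊤ := by
  refine eq_top_of_vec_tmul_vec_mem ?_
  rintro ⟨n, m⟩ ⟨n', m'⟩ ⟨h1, h2, h3, h4⟩ ⟨h5, h6, h7, h8⟩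
  dsimp only at *
  obtain rfl : n = 0 := by omega
  obtain rfl : n' = 0 := by omega
  exact h m m' h3 (by omega) h7 (by omega)

theorem wv_K (α : ℤˣ) (r m : ℤ) : XAct p α 1 r .K (wv r m) = sgn α • wv r m := by
  rw [X_K']; simp

theorem wv_e (α : ℤˣ) (r m : ℤ) :
    XAct p α 1 r .e (wv r m) = ((m : ℂ) * (r - m)) • wv r (m - 1) := by
  by_cases h : XLabel 1 r (0, m)
  · exact X_e α ⟨h.1, h.2.1⟩ h.2.2
  · rw [wv, vec_of_not_mem h, map_zero]
    have : m < 0 ∨ r ≤ m := by simp only [XLabel] at h; omega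
    rcases eq_or_ne m r with rfl | h2
    · simp
    · rw [wv_eq_zero (by omega), smul_zero]

theorem wv_f (α : ℤˣ) {r m : ℤ} (hm : m ≠ -1) : XAct p α 1 r .f (wv r m) = wv r (m + 1) := by
  by_cases h : XLabel 1 r (0, m)
  · exact X_f α ⟨h.1, h.2.1⟩ h.2.2
  · rw [wv, vec_of_not_mem h, map_zero, wv_eq_zero]
    simp only [XLabel] at h; omega

/-- Clebsch–Gordan for `sl(2)`: here `E = F = 0` and `K^p = 1`, so `e` and `f` act by the Leibniz
rule. The two families of vectors arise by applying `f` repeatedly to the highest weight vectors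
`w_0 ⊗ w_0` and `w_0 ⊗ w_1 + (1-r) w_1 ⊗ w_0`. -/
theorem X_one_two_tensor_iso (hp : 2 ≤ p) {r : ℤ} (hr : 1 ≤ r) :
    Iso (tensor p (X p 1 1 2) (X p 1 1 r)) (add (X p 1 1 (r + 1)) (X p 1 1 (r - 1))) := by
  have hX : ∀ r : ℤ, 0 ≤ r → Good p (X p 1 1 r) := fun r hr => good_X hp 1 zero_le_one hr
  have hMN := (hX 2 (by omega)).tensor (hX r (by omega))
  have hs : sgn 1 = 1 := by simp [sgn]
  have w1 : wv 2 (1 + 1) = 0 := wv_eq_zero (by omega)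
  have w2 : wv 2 (0 - 1) = 0 := wv_eq_zero (by omega)
  have hk : ∀ m, (XAct p 1 1 2 .K ^ p) (wv 2 m) = wv 2 m := fun m => by
    rw [X_K_pow_self hp, kpSign]; simp [hs]
  have tK : ∀ m n, tensorAct p (X p 1 1 2) (X p 1 1 r) .K (wv 2 m ⊗ₜ wv r n) =
      wv 2 m ⊗ₜ wv r n := fun m n => by
    rw [tensor_K_tmul, wv_K, wv_K, hs, one_smul, one_smul]
  have tE : ∀ z, tensorAct p (X p 1 1 2) (X p 1 1 r) .E z = 0 := by
    refine fun z => LinearMap.congr_fun (g := 0) (TensorProduct.ext' fun u v => ?_) z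
    rw [tensor_E_tmul]; simp [X_E_one_apply]
  have tF : ∀ z, tensorAct p (X p 1 1 2) (X p 1 1 r) .F z = 0 := by
    refine fun z => LinearMap.congr_fun (g := 0) (TensorProduct.ext' fun u v => ?_) z
    rw [tensor_F_tmul]; simp [X_F_one_apply]
  have te0 : ∀ n, tensorAct p (X p 1 1 2) (X p 1 1 r) .e (wv 2 0 ⊗ₜ wv r n) =
      ((n : ℂ) * (r - n)) • wv 2 0 ⊗ₜ wv r (n - 1) := fun n => by
    rw [tensor_e_tmul_of_left (X_E_one (p := p) 1 2), wv_e, wv_e, hk]; simp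
  have te1 : ∀ n, tensorAct p (X p 1 1 2) (X p 1 1 r) .e (wv 2 1 ⊗ₜ wv r n) =
      wv 2 0 ⊗ₜ wv r n + ((n : ℂ) * (r - n)) • wv 2 1 ⊗ₜ wv r (n - 1) := fun n => by
    rw [tensor_e_tmul_of_left (X_E_one (p := p) 1 2), wv_e, wv_e, hk, TensorProduct.tmul_smul]
    norm_num
  have tf0 : ∀ n, n ≠ -1 → tensorAct p (X p 1 1 2) (X p 1 1 r) .f (wv 2 0 ⊗ₜ wv r n) =
      wv 2 1 ⊗ₜ wv r n + wv 2 0 ⊗ₜ wv r (n + 1) := fun n hn => by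
    rw [tensor_f_tmul_of_left (X_F_one (p := p) 1 2), wv_f _ (by omega), wv_f _ hn, hk, zero_add]
  have tf1 : ∀ n, n ≠ -1 → tensorAct p (X p 1 1 2) (X p 1 1 r) .f (wv 2 1 ⊗ₜ wv r n) =
      wv 2 1 ⊗ₜ wv r (n + 1) := fun n hn => by
    rw [tensor_f_tmul_of_left (X_F_one (p := p) 1 2), wv_f _ (by omega), wv_f _ hn, hk, w1,
      TensorProduct.zero_tmul, zero_add]
  refine (exists_hom_X_one_left hp 1 (r := r + 1) (by omega) hMN
    (fun m => wv 2 0 ⊗ₜ wv r m + (m : ℂ) • wv 2 1 ⊗ₜ wv r (m - 1)) ?_ ?_ ?_ ?_ ?_ ?_).elim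
      fun φ h => h.elim fun hφ hφ' => ?_
  rotate_right
  · refine (exists_hom_X_one_left hp 1 (r := r - 1) (by omega) hMN
      (fun m => wv 2 0 ⊗ₜ wv r (m + 1) + ((m : ℂ) + 1 - r) • wv 2 1 ⊗ₜ wv r m) ?_ ?_ ?_ ?_ ?_ ?_).elim
      fun ψ h => h.elim fun hψ hψ' => ?_
    rotate_right
    · refine iso_add_of_isHom (hX _ (by omega)) (hX _ (by omega)) hMN hφ hψ (fun W h1 h2 => ?_) ?_
      · have hr0 : (r : ℂ) ≠ 0 := by exact_mod_cast (by omega : r ≠ 0)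
        have key : ∀ m, 1 ≤ m → m < r → wv 2 0 ⊗ₜ wv r m ∈ W ∧ wv 2 1 ⊗ₜ wv r (m - 1) ∈ W := by
          intro m hm hm'
          have e1 := h1 (vec _ (0, m))
          have e2 := h2 (vec _ (0, m - 1))
          rw [hφ' m (by omega)] at e1
          rw [hψ' (m - 1) (by omega), sub_add_cancel] at e2
          refine mem_of_det_ne_zero (a := 1) (b := m) (c := 1) (d := ((m - 1 : ℤ) : ℂ) + 1 - r)
            (by rwa [one_smul]) (by rwa [one_smul]) ?_
          -- In each two-dimensional weight space the two families have determinant `-r`.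
          rw [show (1 : ℂ) * (((m - 1 : ℤ) : ℂ) + 1 - r) - m * 1 = -r by push_cast; ring]
          exact neg_ne_zero.2 hr0
        refine eq_top_of_wv_tmul_wv fun m m' h3 h4 h5 h6 => ?_
        obtain rfl | rfl : m = 0 ∨ m = 1 := by omega
        · rcases h5.eq_or_lt with rfl | h5
          · have := h1 (vec _ (0, 0))
            rw [hφ' 0 le_rfl] at this
            simpa using this
          · exact (key m' h5 h6).1
        · rcases eq_or_ne m' (r - 1) with rfl | h7
          · have := W.smul_mem (r : ℂ)⁻¹ (h1 (vec _ (0, r)))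
            rw [hφ' r (by omega), wv_eq_zero (m := r) (by omega),
      TensorProduct.tmul_zero, zero_add,
              inv_smul_smul₀ hr0] at this
            exact this
          · have := (key (m' + 1) (by omega) (by omega)).2
            rwa [add_sub_cancel_right] at this
      · rw [finrank_tensor]
        zify
        rw [finrank_X' zero_le_one (by omega), finrank_X' zero_le_one (by omega),
          finrank_X' zero_le_one (by omega), finrank_X' zero_le_one (by omega)]
        ring
    · intro m hm
      dsimp only
      rw [wv_eq_zero (m := m + 1) (by omega),
      TensorProduct.tmul_zero, zero_add]
      rcases eq_or_ne m (r - 1) with rfl | h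
      · simp
      · rw [wv_eq_zero (r := r) (m := m) (by omega)]; simp
    · intro m h1 h2
      rw [map_add, map_smul, tK, tK, hs, one_smul]
    · intro m h1 h2
      rw [tE]
    · intro m h1 h2
      rw [tF]
    · intro m h1 h2
      rw [map_add, map_smul, te0, te1, add_sub_cancel_right, sub_add_cancel]
      push_cast
      module
    · intro m h1 h2
      rw [map_add, map_smul, tf0 _ (by omega), tf1 _ (by omega)]
      push_cast
      module
  · intro m hm
    dsimp only
    rw [wv_eq_zero (r := r) (m := m) (by omega), wv_eq_zero (m := m - 1) (by omega)]
    simp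
  · intro m h1 h2
    rw [map_add, map_smul, tK, tK, hs, one_smul]
  · intro m h1 h2
    rw [tE]
  · intro m h1 h2
    rw [tF]
  · intro m h1 h2
    rw [map_add, map_smul, te0, te1]
    push_cast
    module
  · intro m h1 h2
    rw [map_add, map_smul, tf0 _ (by omega), add_sub_cancel_right]
    rcases eq_or_ne m 0 with rfl | h
    · simp; abel
    · rw [tf1 _ (by omega), sub_add_cancel]
      push_cast
      module

end

noncomputable section

open GenAction

variable {p : ℕ}

theorem q_sq_sub_one_ne_zero (hp : 2 ≤ p) : q p ^ 2 - 1 ≠ 0 := by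
  have h := q_sub_inv_ne_zero hp
  intro h'
  have hq := q_ne_zero p
  apply h
  field_simp
  rw [h', mul_zero]

/-! ### Tensoring with the two-dimensional module -/

/-- The two-dimensional module. -/
abbrev X2 (p : ℕ) : GenAction := X p 1 2 1

theorem good_X2 (hp : 2 ≤ p) : Good p (X2 p) := good_X hp 1 (by norm_num) (by norm_num)

section UpDown

variable (p) (M : GenAction)

/-- The map `u ↦ a_0 ⊗ u`. -/
def up : M.V →ₗ[ℂ] (tensor p (X2 p) M).V := TensorProduct.mk ℂ (Span (XLabel 2 1)) M.V (av 2 0)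

/-- The map `u ↦ a_1 ⊗ u`. -/
def dn : M.V →ₗ[ℂ] (tensor p (X2 p) M).V := TensorProduct.mk ℂ (Span (XLabel 2 1)) M.V (av 2 1)

theorem eq_top_of_up_dn {ι : Type} {S : ι → Prop} {a : Gen → Module.End ℂ (Span S)}
    {W : Submodule ℂ (tensor p (X2 p) ⟨Span S, a⟩).V}
    (h : ∀ i, S i → up p ⟨Span S, a⟩ (vec S i) ∈ W ∧ dn p ⟨Span S, a⟩ (vec S i) ∈ W) : W = ⊤ := by
  refine eq_top_of_vec_tmul_vec_mem ?_
  rintro ⟨n, m⟩ i ⟨h1, h2, h3, h4⟩ hi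
  dsimp only at *
  obtain rfl : m = 0 := by omega
  obtain rfl | rfl : n = 0 ∨ n = 1 := by omega
  · exact (h i hi).1
  · exact (h i hi).2

theorem finrank_X2_tensor : Module.finrank ℂ (tensor p (X2 p) M).V =
    2 * Module.finrank ℂ M.V := by
  rw [finrank_tensor]
  congr 1
  zify
  rw [finrank_X' (by norm_num) (by norm_num)]
  norm_num

theorem av2_E (hp : 2 ≤ p) : XAct p 1 2 1 .E (av 2 0) = 0 ∧ XAct p 1 2 1 .E (av 2 1) = av 2 0 := by
  rw [X_E 1 (by omega) (by omega), X_E 1 (by omega) (by omega)]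
  norm_num [qInt_zero, qInt_one hp, sgn]

theorem av2_F : XAct p 1 2 1 .F (av 2 0) = av 2 1 ∧ XAct p 1 2 1 .F (av 2 1) = 0 := by
  rw [X_F 1 (by omega) (by omega), X_F 1 (by omega) (by omega)]
  exact ⟨rfl, av_eq_zero (by omega)⟩

theorem av2_K_pow (k : ℕ) : (XAct p 1 2 1 .K ^ k) (av 2 0) = q p ^ k • av 2 0 ∧
    (XAct p 1 2 1 .K ^ k) (av 2 1) = q p ^ (-k : ℤ) • av 2 1 := by
  rw [X_K_pow, X_K_pow]
  norm_num [sgn]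

variable {M} (u : M.V)

theorem up_K : tensorAct p (X2 p) M .K (up p M u) = q p • up p M (M.act .K u) := by
  change XAct p 1 2 1 .K (av 2 0) ⊗ₜ[ℂ] M.act .K u = _
  have := (av2_K_pow p 1).1
  rw [pow_one, pow_one] at this
  rw [this]
  rfl

theorem dn_K : tensorAct p (X2 p) M .K (dn p M u) = (q p)⁻¹ • dn p M (M.act .K u) := by
  change XAct p 1 2 1 .K (av 2 1) ⊗ₜ[ℂ] M.act .K u = _
  have := (av2_K_pow p 1).2
  rw [pow_one, Nat.cast_one, zpow_neg_one] at this
  rw [this]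
  rfl

theorem up_E (hp : 2 ≤ p) : tensorAct p (X2 p) M .E (up p M u) = up p M (M.act .E u) := by
  refine (tensor_E_tmul (M := X2 p) (N := M) (av 2 0) u).trans ?_
  change _ + XAct p 1 2 1 .E (av 2 0) ⊗ₜ[ℂ] M.act .K u = _
  rw [(av2_E p hp).1, TensorProduct.zero_tmul, add_zero]
  rfl

theorem dn_E (hp : 2 ≤ p) : tensorAct p (X2 p) M .E (dn p M u) = dn p M (M.act .E u) + up p M (M.act .K u) := by
  refine (tensor_E_tmul (M := X2 p) (N := M) (av 2 1) u).trans ?_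
  change _ + XAct p 1 2 1 .E (av 2 1) ⊗ₜ[ℂ] M.act .K u = _
  rw [(av2_E p hp).2]
  rfl

theorem q_pow_two_mul_sub_one (hp : 2 ≤ p) : q p ^ (2 * p - 1) = (q p)⁻¹ := by
  have h := q_pow_self hp
  refine eq_inv_of_mul_eq_one_left ?_
  rw [← pow_succ, Nat.sub_add_cancel (by omega), mul_comm, pow_mul, h]
  norm_num

theorem up_F (hp : 2 ≤ p) : tensorAct p (X2 p) M .F (up p M u) =
    (q p)⁻¹ • up p M (M.act .F u) + dn p M u := by
  refine (tensor_F_tmul (M := X2 p) (N := M) (av 2 0) u).trans ?_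
  change (XAct p 1 2 1 .K ^ _) (av 2 0) ⊗ₜ[ℂ] _ + XAct p 1 2 1 .F (av 2 0) ⊗ₜ[ℂ] u = _
  rw [(av2_K_pow p _).1, (av2_F p).1, q_pow_two_mul_sub_one p hp]
  rfl

theorem dn_F (hp : 2 ≤ p) : tensorAct p (X2 p) M .F (dn p M u) = q p • dn p M (M.act .F u) := by
  refine (tensor_F_tmul (M := X2 p) (N := M) (av 2 1) u).trans ?_
  change (XAct p 1 2 1 .K ^ _) (av 2 1) ⊗ₜ[ℂ] _ + XAct p 1 2 1 .F (av 2 1) ⊗ₜ[ℂ] u = _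
  rw [(av2_K_pow p _).2, (av2_F p).2, zpow_neg, zpow_natCast, q_pow_two_mul_sub_one p hp, inv_inv,
    TensorProduct.zero_tmul, add_zero]
  rfl

theorem X2_nilpotent (hp : 2 ≤ p) {k : ℕ} (hk : 2 ≤ k) :
    XAct p 1 2 1 .E ^ k = 0 ∧ XAct p 1 2 1 .F ^ k = 0 := by
  have key : ∀ A : Module.End ℂ (Span (XLabel 2 1)), A (A (av 2 0)) = 0 → A (A (av 2 1)) = 0 →
      A ^ k = 0 := by
    intro A h0 h1
    obtain ⟨j, rfl⟩ := Nat.exists_eq_add_of_le hk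
    rw [pow_add, show A ^ 2 = 0 from ?_, zero_mul]
    refine span_hom_ext ?_
    rintro ⟨n, m⟩ ⟨h1, h2, h3, h4⟩
    dsimp only at *
    obtain rfl : m = 0 := by omega
    rw [pow_two, Module.End.mul_apply]
    obtain rfl | rfl : n = 0 ∨ n = 1 := by omega
    · exact h0
    · assumption
  constructor
  · exact key _ (by rw [(av2_E p hp).1, map_zero]) (by rw [(av2_E p hp).2, (av2_E p hp).1])
  · exact key _ (by rw [(av2_F p).1, (av2_F p).2]) (by rw [(av2_F p).2, map_zero])

theorem up_e (hp : 2 ≤ p) : tensorAct p (X2 p) M .e (up p M u) = -up p M (M.act .e u) := by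
  refine (tensor_e_tmul (M := X2 p) (N := M) (av 2 0) u).trans ?_
  change XAct p 1 2 1 .e (av 2 0) ⊗ₜ[ℂ] u + (XAct p 1 2 1 .K ^ p) (av 2 0) ⊗ₜ[ℂ] _ + _ • ∑ r ∈ _,
    _ • (XAct p 1 2 1 .K ^ p) ((XAct p 1 2 1 .E ^ (p - r)) (av 2 0)) ⊗ₜ[ℂ] _ = _
  rw [X_e_one_apply, TensorProduct.zero_tmul, zero_add, (av2_K_pow p p).1, q_pow_self hp,
    Finset.sum_eq_zero, smul_zero, add_zero, neg_one_smul, TensorProduct.neg_tmul]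
  · rfl
  · intro r hr
    rw [Finset.mem_Icc] at hr
    obtain ⟨k, hk⟩ : ∃ k, p - r = k + 1 := ⟨p - r - 1, by omega⟩
    rw [hk, pow_succ, Module.End.mul_apply, (av2_E p hp).1, map_zero, map_zero,
      TensorProduct.zero_tmul, smul_zero]

/-- Since `E² = 0` on the two-dimensional module, only the summand `r = p - 1` of `Δ(e)` survives;
the sign in front comes from `q^p = -1`. -/
theorem dn_e (hp : 2 ≤ p) : tensorAct p (X2 p) M .e (dn p M u) = -dn p M (M.act .e u) +
    ((q p)⁻¹ / qFact p (p - 1)) •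
      up p M ((M.act .E ^ (p - 1)) ((M.act .K ^ ((2 * p - 1) * (p - 1))) u)) := by
  refine (tensor_e_tmul (M := X2 p) (N := M) (av 2 1) u).trans ?_
  change XAct p 1 2 1 .e (av 2 1) ⊗ₜ[ℂ] u + (XAct p 1 2 1 .K ^ p) (av 2 1) ⊗ₜ[ℂ] _ + _ • ∑ r ∈ _,
    _ • (XAct p 1 2 1 .K ^ p) ((XAct p 1 2 1 .E ^ (p - r)) (av 2 1)) ⊗ₜ[ℂ] _ = _
  have h1 : q p ^ (p - 1) = -(q p)⁻¹ := by
    rw [← neg_eq_iff_eq_neg]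
    refine eq_inv_of_mul_eq_one_left ?_
    rw [neg_mul, ← pow_succ, Nat.sub_add_cancel (by omega), q_pow_self hp, neg_neg]
  have h2 : qInt p (p - 1 : ℕ) = 1 := by
    rw [Nat.cast_sub (by omega), Nat.cast_one, qInt_self_sub hp, qInt_one hp]
  rw [X_e_one_apply, TensorProduct.zero_tmul, zero_add, (av2_K_pow p p).2, zpow_neg,
    zpow_natCast, q_pow_self hp,
    Finset.sum_eq_single (p - 1)]
  · rw [show p - (p - 1) = 1 by omega, pow_one, (av2_E p hp).2, (av2_K_pow p p).1, q_pow_self hp,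
      mul_one, h1, h2, div_one, TensorProduct.smul_tmul', TensorProduct.smul_tmul', smul_smul,
      smul_smul]
    rw [show ((-1 : ℂ))⁻¹ = -1 by norm_num, neg_one_smul, TensorProduct.neg_tmul]
    congr 1
    rw [show 1 / qFact p (p - 1) * -(q p)⁻¹ * -1 = (q p)⁻¹ / qFact p (p - 1) by ring]
    rfl
  · intro r hr hr'
    rw [Finset.mem_Icc] at hr
    rw [(X2_nilpotent p hp (by omega)).1, LinearMap.zero_apply, map_zero,
      TensorProduct.zero_tmul, smul_zero]
  · intro h
    exact absurd (Finset.mem_Icc.2 ⟨by omega, le_rfl⟩) h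

/-- Since `F² = 0` on the two-dimensional module, only the summand `s = 1` of `Δ(f)` survives. -/
theorem up_f (hp : 2 ≤ p) : tensorAct p (X2 p) M .f (up p M u) = -up p M (M.act .f u) +
    ((-1) ^ p / qFact p (p - 1)) • dn p M ((M.act .F ^ (p - 1)) u) := by
  refine (tensor_f_tmul (M := X2 p) (N := M) (av 2 0) u).trans ?_
  change XAct p 1 2 1 .f (av 2 0) ⊗ₜ[ℂ] u + (XAct p 1 2 1 .K ^ p) (av 2 0) ⊗ₜ[ℂ] _ + _ • ∑ r ∈ _,
    _ • (XAct p 1 2 1 .K ^ (p + r)) ((XAct p 1 2 1 .F ^ r) (av 2 0)) ⊗ₜ[ℂ] _ = _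
  have h1 : (q p)⁻¹ ^ (p - 1) = -q p := by
    rw [inv_pow, inv_eq_iff_eq_inv]
    refine eq_inv_of_mul_eq_one_left ?_
    rw [mul_neg, ← pow_succ, Nat.sub_add_cancel (by omega), q_pow_self hp, neg_neg]
  rw [X_f_one_apply, TensorProduct.zero_tmul, zero_add, (av2_K_pow p p).1, q_pow_self hp,
    Finset.sum_eq_single 1]
  · rw [pow_one, (av2_F p).1, (av2_K_pow p _).2, one_mul, h1, Nat.cast_one, qInt_one hp, div_one,
      zpow_neg, zpow_natCast, pow_succ, q_pow_self hp, TensorProduct.smul_tmul',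
      TensorProduct.smul_tmul', smul_smul, smul_smul, neg_one_smul, TensorProduct.neg_tmul]
    congr 1
    have hq := q_ne_zero p
    rw [show (-1) ^ p / qFact p (p - 1) * -q p * (-1 * q p)⁻¹ = (-1) ^ p / qFact p (p - 1) by
      field_simp]
    rfl
  · intro r hr hr'
    rw [Finset.mem_Icc] at hr
    rw [(X2_nilpotent p hp (by omega)).2, LinearMap.zero_apply, map_zero,
      TensorProduct.zero_tmul, smul_zero]
  · intro h
    exact absurd (Finset.mem_Icc.2 ⟨le_rfl, by omega⟩) h

theorem dn_f (hp : 2 ≤ p) : tensorAct p (X2 p) M .f (dn p M u) = -dn p M (M.act .f u) := by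
  refine (tensor_f_tmul (M := X2 p) (N := M) (av 2 1) u).trans ?_
  change XAct p 1 2 1 .f (av 2 1) ⊗ₜ[ℂ] u + (XAct p 1 2 1 .K ^ p) (av 2 1) ⊗ₜ[ℂ] _ + _ • ∑ r ∈ _,
    _ • (XAct p 1 2 1 .K ^ (p + r)) ((XAct p 1 2 1 .F ^ r) (av 2 1)) ⊗ₜ[ℂ] _ = _
  rw [X_f_one_apply, TensorProduct.zero_tmul, zero_add, (av2_K_pow p p).2, zpow_neg,
    zpow_natCast, q_pow_self hp,
    Finset.sum_eq_zero, smul_zero, add_zero, show ((-1 : ℂ))⁻¹ = -1 by norm_num, neg_one_smul,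
    TensorProduct.neg_tmul]
  · rfl
  · intro r hr
    rw [Finset.mem_Icc] at hr
    obtain ⟨k, rfl⟩ : ∃ k, r = k + 1 := ⟨r - 1, by omega⟩
    rw [pow_succ, Module.End.mul_apply, (av2_F p).2, map_zero, map_zero,
      TensorProduct.zero_tmul, smul_zero]

end UpDown

/-! ### Powers of `E` and `F` on modules with a basis of weight vectors -/

theorem pow_apply_of_forall {V : Type} [AddCommGroup V] [Module ℂ V] {A : Module.End ℂ V}
    {v : ℤ → V} {c : ℤ → ℂ} (h : ∀ n, A (v n) = c n • v (n - 1)) (k : ℕ) (n : ℤ) :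
    (A ^ k) (v n) = (∏ j ∈ Finset.range k, c (n - j)) • v (n - k) := by
  induction k with
  | zero => simp
  | succ k ih =>
    rw [pow_succ', Module.End.mul_apply, ih, map_smul, h, smul_smul, Finset.prod_range_succ]
    push_cast
    rw [sub_sub]

theorem pow_apply_of_forall_nonneg {V : Type} [AddCommGroup V] [Module ℂ V] {A : Module.End ℂ V}
    {v : ℤ → V} (h : ∀ n, 0 ≤ n → A (v n) = v (n + 1)) (k : ℕ) {n : ℤ} (hn : 0 ≤ n) :
    (A ^ k) (v n) = v (n + k) := by
  induction k with
  | zero => simp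
  | succ k ih =>
    rw [pow_succ', Module.End.mul_apply, ih, h _ (by omega)]
    push_cast
    rw [add_assoc]

theorem prod_qInt_range (k : ℕ) : ∏ j ∈ Finset.range k, qInt p (j + 1) = qFact p k := by
  induction k with
  | zero => simp [qFact_zero]
  | succ k ih => rw [Finset.prod_range_succ, ih, qFact_succ]

theorem prod_qInt_range' (k : ℕ) : ∏ j ∈ Finset.range k, qInt p (k - j) = qFact p k := by
  rw [← prod_qInt_range, ← Finset.prod_range_reflect]
  refine Finset.prod_congr rfl fun j hj => ?_
  rw [Finset.mem_range] at hj
  congr 1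
  omega

theorem av_K (α : ℤˣ) (s n : ℤ) :
    XAct p α s 1 .K (av s n) = (sgn α * q p ^ (s - 1 - 2 * n)) • av s n := X_K' α s 1 n 0

theorem av_E (α : ℤˣ) (s n : ℤ) :
    XAct p α s 1 .E (av s n) = (sgn α * qInt p n * qInt p (s - n)) • av s (n - 1) := by
  by_cases h : XLabel s 1 (n, 0)
  · exact X_E α ⟨h.1, h.2.1⟩ h.2.2
  · rw [av, vec_of_not_mem h, map_zero]
    simp only [XLabel] at h
    rcases eq_or_ne n s with rfl | h2
    · simp [qInt_zero]
    · rw [av_eq_zero (by omega), smul_zero]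

theorem av_F (α : ℤˣ) {s n : ℤ} (hn : n ≠ -1) : XAct p α s 1 .F (av s n) = av s (n + 1) := by
  by_cases h : XLabel s 1 (n, 0)
  · exact X_F α ⟨h.1, h.2.1⟩ h.2.2
  · rw [av, vec_of_not_mem h, map_zero, av_eq_zero]
    simp only [XLabel] at h; omega

theorem av_F_pow (α : ℤˣ) {s n : ℤ} (hn : 0 ≤ n) (k : ℕ) :
    (XAct p α s 1 .F ^ k) (av s n) = av s (n + k) :=
  pow_apply_of_forall_nonneg (fun n hn => av_F α (by omega)) k hn

theorem av_E_pow (α : ℤˣ) (s n : ℤ) (k : ℕ) : (XAct p α s 1 .E ^ k) (av s n) =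
    (∏ j ∈ Finset.range k, (sgn α * qInt p (n - j) * qInt p (s - (n - j)))) • av s (n - k) :=
  pow_apply_of_forall (fun n => av_E α s n) k n

theorem mem_of_eq_smul {V : Type} [AddCommGroup V] [Module ℂ V] {W : Submodule ℂ V} {u v : V}
    (hu : u ∈ W) {c : ℂ} (hc : c ≠ 0) (h : u = c • v) : v ∈ W := by
  rw [h] at hu
  exact (W.smul_mem_iff hc).1 hu

/-- The quantum Clebsch–Gordan rule. Its determinant is `-[s]`, which is nonzero precisely because
`s < p`; at `s = p` the splitting breaks down and `X2_tensor_X_self_iso` takes its place. Both `e`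
and `f` act by zero, since `E^(p-1)` and `F^(p-1)` vanish on a string of fewer than `p` vectors. -/
theorem X2_tensor_X_iso (hp : 2 ≤ p) {s : ℤ} (hs : 1 ≤ s) (hsp : s < p) :
    Iso (tensor p (X2 p) (X p 1 s 1)) (add (X p 1 (s + 1) 1) (X p 1 (s - 1) 1)) := by
  have hX : ∀ r : ℤ, 0 ≤ r → Good p (X p 1 r 1) := fun r hr => good_X hp 1 hr zero_le_one
  have hMN := (good_X2 hp).tensor (hX s (by omega))
  have h1 : sgn 1 = 1 := by simp [sgn]
  have hq := q_ne_zero p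
  have hd := q_sq_sub_one_ne_zero hp
  have hK : ∀ n, (X p 1 s 1).act .K (av s n) = q p ^ (s - 1 - 2 * n) • av s n := fun n => by
    rw [av_K, h1, one_mul]
  have hE : ∀ n, (X p 1 s 1).act .E (av s n) = (qInt p n * qInt p (s - n)) • av s (n - 1) :=
    fun n => by rw [av_E, h1, one_mul]
  have hF : ∀ n, 0 ≤ n → (X p 1 s 1).act .F (av s n) = av s (n + 1) := fun n hn => by
    rw [av_F _ (by omega)]
  have he : ∀ v, (X p 1 s 1).act .e v = 0 := fun v => X_e_one_apply (p := p) 1 s v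
  have hf : ∀ v, (X p 1 s 1).act .f v = 0 := fun v => X_f_one_apply (p := p) 1 s v
  have hE' : ∀ n, ((X p 1 s 1).act .E ^ (p - 1)) (av s n) = 0 := by
    intro n
    rcases lt_or_ge n s with h | h
    · refine (av_E_pow 1 s n (p - 1)).trans ?_
      rw [av_eq_zero (by omega), smul_zero]
    · rw [av_eq_zero (Or.inr h), map_zero]
  have hE'' : ∀ n k, ((X p 1 s 1).act .E ^ (p - 1)) (((X p 1 s 1).act .K ^ k) (av s n)) = 0 := by
    intro n k
    rw [pow_smul_vec (hK n), map_smul, hE', smul_zero]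
  have hF' : ∀ n, 0 ≤ n → ((X p 1 s 1).act .F ^ (p - 1)) (av s n) = 0 := by
    intro n hn
    refine (av_F_pow (p := p) 1 hn (p - 1)).trans ?_
    rw [av_eq_zero (by omega)]
  have hFq : ∀ n, 0 ≤ n → qInt p n • dn p (X p 1 s 1) ((X p 1 s 1).act .F (av s (n - 1))) =
      qInt p n • dn p _ (av s n) := by
    intro n hn
    rcases eq_or_ne n 0 with rfl | h
    · simp [qInt_zero]
    · rw [hF _ (by omega), sub_add_cancel]
  -- The image of `a_n` is `F^n (a_0 ⊗ a_0)`.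
  refine (exists_hom_X_one_right hp 1 (s := s + 1) (by omega) hMN
    (fun n => q p ^ (-n) • up p (X p 1 s 1) (av s n) + qInt p n • dn p (X p 1 s 1) (av s (n - 1)))
    (fun n hn => ?_) (fun n hn hn' => ?_) (fun n hn hn' => ?_) (fun n hn hn' => ?_)
    (fun n hn hn' => ?_) (fun n hn hn' => ?_)).elim fun φ h => h.elim fun hφ hφ' => ?_
  rotate_right
  -- This string starts at the second vector killed by `E`, namely `q^(s-1) a_0 ⊗ a_1 + [1-s] a_1 ⊗
  -- a_0`.
  · refine (exists_hom_X_one_right hp 1 (s := s - 1) (by omega) hMN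
      (fun n => q p ^ (s - 1 - n) • up p (X p 1 s 1) (av s (n + 1)) +
        qInt p (n + 1 - s) • dn p (X p 1 s 1) (av s n))
      (fun n hn => ?_) (fun n hn hn' => ?_) (fun n hn hn' => ?_) (fun n hn hn' => ?_)
      (fun n hn hn' => ?_) (fun n hn hn' => ?_)).elim fun ψ h => h.elim fun hψ hψ' => ?_
    rotate_right
    · refine iso_add_of_isHom (hX _ (by omega)) (hX _ (by omega)) hMN hφ hψ (fun W h1 h2 => ?_) ?_
      · have key : ∀ n, 0 ≤ n → n + 1 < s → up p (X p 1 s 1) (av s (n + 1)) ∈ W ∧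
            dn p (X p 1 s 1) (av s n) ∈ W := by
          intro n hn hn'
          have e1 := h1 (vec _ (n + 1, 0))
          have e2 := h2 (vec _ (n, 0))
          rw [hφ' (n + 1) (by omega), add_sub_cancel_right] at e1
          rw [hψ' n (by omega)] at e2
          refine mem_of_det_ne_zero e1 e2 ?_
          rw [show q p ^ (-(n + 1)) * qInt p (n + 1 - s) - qInt p (n + 1) * q p ^ (s - 1 - n) =
            -qInt p s by
              simp only [qInt, neg_sub, neg_add, neg_neg, two_mul, zpow_add₀ hq, zpow_sub₀ hq,
                zpow_neg, zpow_one]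
              field_simp
              ring]
          exact neg_ne_zero.2 (qInt_ne_zero hp (by omega) hsp)
        refine eq_top_of_up_dn p ?_
        rintro ⟨n, m⟩ ⟨h3, h4, h5, h6⟩
        dsimp only at *
        obtain rfl : m = 0 := by omega
        constructor
        · rcases h3.eq_or_lt with rfl | h3
          · have := h1 (vec _ (0, 0))
            rw [hφ' 0 le_rfl] at this
            simpa [qInt_zero] using this
          · have := (key (n - 1) (by omega) (by omega)).1
            rwa [sub_add_cancel] at this
        · rcases h4.eq_or_lt with rfl | h4
          · refine mem_of_eq_smul (h1 (vec _ (s, 0)))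
              (qInt_ne_zero hp (n := s) (by omega) hsp) ?_
            rw [hφ' s (by omega), av_eq_zero (n := s) (by omega), map_zero, smul_zero, zero_add]
          · exact (key n h3 (by omega)).2
      · rw [finrank_X2_tensor]
        zify
        rw [finrank_X' (by omega) zero_le_one, finrank_X' (by omega) zero_le_one,
          finrank_X' (by omega) zero_le_one]
        ring
    · dsimp only
      rw [av_eq_zero (n := n + 1) (by omega), map_zero, smul_zero, zero_add]
      rcases eq_or_ne n (s - 1) with rfl | h
      · simp [qInt_zero]
      · rw [av_eq_zero (by omega), map_zero, smul_zero]
    · rw [map_add, map_smul, map_smul, up_K, dn_K, hK, hK, map_smul, map_smul]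
      match_scalars <;>
      · simp only [h1, qInt, neg_sub, neg_add, neg_neg, two_mul, zpow_add₀ hq, zpow_sub₀ hq,
          zpow_neg, zpow_one]
        field_simp
    · rw [map_add, map_smul, map_smul, up_E _ _ hp, dn_E _ _ hp, hE, hE, hK, map_smul, map_smul,
        map_smul, add_sub_cancel_right, sub_add_cancel]
      match_scalars <;>
      · simp only [h1, qInt, neg_sub, neg_add, neg_neg, two_mul, zpow_add₀ hq, zpow_sub₀ hq,
          zpow_neg, zpow_one]
        field_simp
        ring
    · rw [map_add, map_smul, map_smul, up_F _ _ hp, dn_F _ _ hp, hF _ (by omega), hF _ (by omega)]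
      match_scalars <;>
      · simp only [qInt, neg_sub, neg_add, neg_neg, two_mul, zpow_add₀ hq, zpow_sub₀ hq,
          zpow_neg, zpow_one]
        field_simp
        try ring
    · rw [map_add, map_smul, map_smul, up_e _ _ hp, dn_e _ _ hp, he, he, hE'']
      simp
    · rw [map_add, map_smul, map_smul, up_f _ _ hp, dn_f _ _ hp, hf, hf, hF' _ (by omega)]
      simp
  · dsimp only
    rw [av_eq_zero (n := n) (by omega), av_eq_zero (n := n - 1) (by omega)]
    simp
  · rw [map_add, map_smul, map_smul, up_K, dn_K, hK, hK, map_smul, map_smul]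
    match_scalars <;>
    · simp only [h1, qInt, neg_sub, neg_add, neg_neg, two_mul, zpow_add₀ hq, zpow_sub₀ hq,
        zpow_neg, zpow_one]
      field_simp
  · rw [map_add, map_smul, map_smul, up_E _ _ hp, dn_E _ _ hp, hE, hE, hK, map_smul, map_smul,
      map_smul]
    match_scalars <;>
    · simp only [h1, qInt, neg_sub, neg_add, neg_neg, two_mul, zpow_add₀ hq, zpow_sub₀ hq,
        zpow_neg, zpow_one]
      field_simp
      try ring
  · rw [map_add, map_smul, map_smul, up_F _ _ hp, dn_F _ _ hp, hF _ (by omega), smul_comm, hFq n hn,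
      add_sub_cancel_right]
    match_scalars <;>
    · simp only [qInt, neg_sub, neg_add, neg_neg, two_mul, zpow_add₀ hq, zpow_sub₀ hq,
        zpow_neg, zpow_one]
      field_simp
      try ring
  · rw [map_add, map_smul, map_smul, up_e _ _ hp, dn_e _ _ hp, he, he, hE'']
    simp
  · rw [map_add, map_smul, map_smul, up_f _ _ hp, dn_f _ _ hp, hf, hf, hF' _ (by omega)]
    simp

end

noncomputable section

open GenAction

variable {p : ℕ}

/-! ### Powers of `E` on the modules `T_s` -/

/-- The coefficients in the powers of an operator acting by a Jordan block of size two along a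
string of weight vectors. -/
def couplingCoeff (a : ℕ → ℂ) : ℕ → ℂ
  | 0 => 0
  | k + 1 => ∏ j ∈ Finset.range k, a j + a k * couplingCoeff a k

/-- The coefficient is the sum, over the places where the coupling may occur, of the product of the
remaining factors. A vanishing factor `a i` leaves only the term in which that very factor is
omitted. -/
theorem couplingCoeff_add {a : ℕ → ℂ} {i : ℕ} (h : a i = 0) (m : ℕ) :
    couplingCoeff a (i + 1 + m) =
      (∏ j ∈ Finset.range i, a j) * ∏ j ∈ Finset.range m, a (i + 1 + j) := by
  induction m with
  | zero => simp [couplingCoeff, h]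
  | succ m ih =>
    rw [← add_assoc, couplingCoeff, ih, Finset.prod_range_succ _ m,
      Finset.prod_eq_zero (i := i) (Finset.mem_range.2 (by omega)) h]
    ring

/-- Along the string, `E` lowers `τ` and the coupled `β` with the same coefficients, because quantum
integers change sign under a shift by `p`. It is thus a Jordan block of size two, and the coupling
is used at exactly one of the `k` steps. -/
theorem tau_E_pow (hp : 2 ≤ p) {s : ℤ} (hs : s ≤ p) {n : ℤ} (hn : 0 ≤ n) (k : ℕ) :
    (TActAux p s .E ^ k) (tau p n) =
      (∏ j ∈ Finset.range k, (qInt p (n - j) * qInt p (s - (n - j)))) • tau p (n - k) +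
      (gConst p s * couplingCoeff (fun j => qInt p (n - j) * qInt p (s - (n - j))) k) •
        beta p (n - k + p - s) := by
  induction k with
  | zero => simp [couplingCoeff]
  | succ k ih =>
    rw [pow_succ', Module.End.mul_apply, ih, map_add, map_smul, map_smul, T_E_beta hp,
      Finset.prod_range_succ, couplingCoeff]
    have h1 : qInt p (n - k + p - s) * qInt p (-s - (n - k + p - s)) =
        qInt p (n - k) * qInt p (s - (n - k)) := by
      rw [show n - k + p - s = n - k - s + p by ring, qInt_add_self hp,
        show -s - (n - k - s + p) = -((n - k) + p) by ring, qInt_neg p (n - k + p),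
        qInt_add_self hp, neg_neg, show n - k - s = -(s - (n - k)) by ring, qInt_neg]
      ring
    rw [h1]
    push_cast
    rw [show n - k + p - s - 1 = n - (k + 1) + p - s by ring]
    by_cases hk : (k : ℤ) ≤ n
    · rw [T_E_tau hp hs (n := n - k) (by omega), show n - k - 1 = n - (k + 1) by ring,
        show n - k + p - s - 1 = n - (k + 1) + p - s by ring]
      module
    -- Once the string of `τ` has been left, the product contains the factor `[0]`.
    · have h0 : ∏ j ∈ Finset.range k, (qInt p (n - j) * qInt p (s - (n - j))) = 0 := by
        refine Finset.prod_eq_zero (i := n.toNat) (Finset.mem_range.2 (by omega)) ?_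
        rw [Int.toNat_of_nonneg hn, sub_self, qInt_zero, zero_mul]
      rw [h0]
      module

theorem prod_range_neg_qInt (k : ℕ) :
    ∏ j ∈ Finset.range k, qInt p (-1 - j) = (-1) ^ k * qFact p k := by
  rw [← prod_qInt_range]
  induction k with
  | zero => simp
  | succ k ih =>
    rw [Finset.prod_range_succ, Finset.prod_range_succ, ih, show (-1 - k : ℤ) = -(k + 1) by ring,
      qInt_neg]
    ring

/-- Only `n = p - 1` keeps the target within range, and on the way down from there a factor `[-p] =
0` is met. -/
theorem beta_E_pow (hp : 2 ≤ p) {s : ℤ} (hs : 1 ≤ s) (hsp : s < p) (n : ℤ) :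
    (TActAux p s .E ^ (p - 1)) (beta p n) = 0 := by
  rcases ne_or_eq n (p - 1) with h | rfl
  · rw [pow_apply_of_forall (T_E_beta hp)]
    rcases lt_or_ge n p with h' | h'
    · rw [beta_eq_zero (by omega), smul_zero]
    · obtain rfl | h1 := eq_or_ne n p
      · rw [Finset.prod_eq_zero (i := 0) (Finset.mem_range.2 (by omega)) (by simp [qInt_self hp]),
          zero_smul]
      · obtain ⟨k, hk⟩ : ∃ k, p - 1 = k + 1 := ⟨p - 2, by omega⟩
        rw [← pow_apply_of_forall (T_E_beta hp), beta_eq_zero (Or.inr h'), map_zero]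
  · rw [pow_apply_of_forall (T_E_beta hp), Finset.prod_eq_zero (i := (s - 1).toNat)
      (Finset.mem_range.2 (by omega)), zero_smul]
    rw [Int.toNat_of_nonneg (by omega), show -s - ((p : ℤ) - 1 - (s - 1)) = -p by ring, qInt_neg,
      qInt_self hp, neg_zero, mul_zero]

/-- Here `[s-1]! [p-s-1]! = [p-1]!/[s]`. Both nonzero values of `E^(p-1)` on `τ` have the left side
as coefficient; the normalisation of the coupling constant makes them match the relation for
`[F,e]`. -/
theorem gConst_mul (hp : 2 ≤ p) {s : ℤ} (hs : 1 ≤ s) (hsp : s < p) {σ ρ : ℕ} (h1 : s = σ + 1)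
    (h2 : p = σ + ρ + 2) : gConst p s * ((-1) ^ ρ * (qFact p σ * qFact p ρ) ^ 2) =
      (-1) ^ (s - 1) * qFact p (p - 1) / qInt p s := by
  have hs0 := qInt_ne_zero hp (n := s) (by omega) hsp
  have hf := qFact_ne_zero hp (n := p - 1) (by omega)
  have h3 : qFact p σ * qFact p ρ = qFact p (p - 1) / qInt p s := by
    rw [eq_div_iff hs0, ← qFact_mul_qFact hp (a := σ + 1) (b := ρ) (by omega), qFact_succ, h1]
    ring
  have h4 : (-1 : ℂ) ^ (s - 1) = (-1) ^ p * (-1) ^ ρ := by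
    rw [h1, add_sub_cancel_right, zpow_natCast, ← pow_add, show p + ρ = σ + 2 * (ρ + 1) by omega,
      pow_add, pow_mul]
    norm_num
  rw [h3, h4, gConst]
  field_simp

/-- The vanishing factor is the one at `j = s - 1`, where `[n-j] = 0`. Omitting it leaves `[σ]!²`
above and `(-1)^ρ [ρ]!²` below, with `σ = s - 1` and `ρ = p - s - 1`. -/
theorem tau_E_pow_of_eq (hp : 2 ≤ p) {s : ℤ} (hs : 1 ≤ s) (hsp : s < p) :
    (TActAux p s .E ^ (p - 1)) (tau p (s - 1)) =
      ((-1) ^ (s - 1) * qFact p (p - 1) / qInt p s) • beta p 0 := by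
  obtain ⟨σ, hσ⟩ : ∃ σ : ℕ, s = σ + 1 := ⟨(s - 1).toNat, by omega⟩
  obtain ⟨ρ, hρ⟩ : ∃ ρ : ℕ, p = σ + ρ + 2 := ⟨p - σ - 2, by omega⟩
  rw [tau_E_pow hp hsp.le (by omega), tau_eq_zero (by omega), smul_zero, zero_add,
    show p - 1 = σ + 1 + ρ by omega, couplingCoeff_add, ← show p - 1 = σ + 1 + ρ by omega,
    ← gConst_mul hp hs hsp hσ hρ]
  · congr 2
    · have e1 : ∏ j ∈ Finset.range σ, (qInt p (s - 1 - j) * qInt p (s - (s - 1 - j))) =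
          qFact p σ * qFact p σ := by
        rw [Finset.prod_mul_distrib]
        nth_rw 1 [← prod_qInt_range']
        rw [← prod_qInt_range]
        congr 1 <;> refine Finset.prod_congr rfl fun j _ => ?_ <;> congr 1 <;> omega
      have e2 : ∏ j ∈ Finset.range ρ, (qInt p (s - 1 - (σ + 1 + j : ℕ)) *
          qInt p (s - (s - 1 - (σ + 1 + j : ℕ)))) = (-1) ^ ρ * qFact p ρ * qFact p ρ := by
        rw [Finset.prod_mul_distrib, ← prod_range_neg_qInt, ← prod_qInt_range']
        congr 1 <;> refine Finset.prod_congr rfl fun j _ => ?_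
        · congr 1; omega
        · rw [← qInt_self_sub hp]; congr 1; omega
      rw [e1, e2]
      ring
    · omega
  · have : s - 1 - (σ : ℤ) = 0 := by omega
    rw [this, qInt_zero, zero_mul]

/-- Now the vanishing factor is at `j = ρ = p - s - 1`, through `[s-n+j] = 0`. The remaining product
is the same, with its two parts in the opposite order. -/
theorem tau_E_pow_of_eq' (hp : 2 ≤ p) {s : ℤ} (hs : 1 ≤ s) (hsp : s < p) :
    (TActAux p s .E ^ (p - 1)) (tau p (p - 1)) =
      ((-1) ^ (s - 1) * qFact p (p - 1) / qInt p s) • beta p (p - s) := by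
  obtain ⟨σ, hσ⟩ : ∃ σ : ℕ, s = σ + 1 := ⟨(s - 1).toNat, by omega⟩
  obtain ⟨ρ, hρ⟩ : ∃ ρ : ℕ, p = σ + ρ + 2 := ⟨p - σ - 2, by omega⟩
  have h0 : qInt p (s - (p - 1 - (ρ : ℤ))) = 0 := by
    rw [show s - (p - 1 - (ρ : ℤ)) = 0 by omega, qInt_zero]
  rw [tau_E_pow hp hsp.le (by omega), Finset.prod_eq_zero (i := ρ) (Finset.mem_range.2 (by omega))
    (by rw [h0, mul_zero]), zero_smul, zero_add,
    show p - 1 = ρ + 1 + σ by omega, couplingCoeff_add, ← show p - 1 = ρ + 1 + σ by omega,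
    ← gConst_mul hp hs hsp hσ hρ]
  · congr 2
    · have e1 : ∏ j ∈ Finset.range ρ, (qInt p (p - 1 - j) * qInt p (s - (p - 1 - j))) =
          (-1) ^ ρ * qFact p ρ * qFact p ρ := by
        have ha : ∏ j ∈ Finset.range ρ, qInt p (p - 1 - j) = qFact p ρ := by
          rw [← prod_qInt_range]
          refine Finset.prod_congr rfl fun j _ => ?_
          rw [← qInt_self_sub hp (j + 1)]
          congr 1; ring
        have hb : ∏ j ∈ Finset.range ρ, qInt p (s - (p - 1 - j)) = (-1) ^ ρ * qFact p ρ := by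
          rw [← prod_qInt_range', ← Finset.card_range ρ, ← Finset.prod_const, Finset.card_range,
            ← Finset.prod_mul_distrib]
          refine Finset.prod_congr rfl fun j _ => ?_
          rw [neg_one_mul, ← qInt_neg]
          congr 1; omega
        rw [Finset.prod_mul_distrib, ha, hb]
        ring
      have e2 : ∏ j ∈ Finset.range σ, (qInt p (p - 1 - (ρ + 1 + j : ℕ)) *
          qInt p (s - (p - 1 - (ρ + 1 + j : ℕ)))) = qFact p σ * qFact p σ := by
        rw [Finset.prod_mul_distrib]
        nth_rw 1 [← prod_qInt_range']
        rw [← prod_qInt_range]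
        congr 1 <;> refine Finset.prod_congr rfl fun j _ => ?_ <;> congr 1 <;> omega
      rw [e1, e2]
      ring
    · congr 1; omega
  · rw [h0, mul_zero]

/-- For `n < s - 1` the target `β` is out of range. For `s ≤ n < p - 1` two factors of the string
vanish, so omitting one of them still gives zero. -/
theorem tau_E_pow_of_ne (hp : 2 ≤ p) {s : ℤ} (hs : 1 ≤ s) (hsp : s < p) {n : ℤ} (hn : 0 ≤ n)
    (hnp : n < p) (h1 : n ≠ s - 1) (h2 : n ≠ p - 1) :
    (TActAux p s .E ^ (p - 1)) (tau p n) = 0 := by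
  rw [tau_E_pow hp hsp.le hn, tau_eq_zero (by omega), smul_zero, zero_add]
  rcases lt_or_ge n s with h | h
  · rw [beta_eq_zero (by omega), smul_zero]
  · obtain ⟨i, hi⟩ : ∃ i : ℕ, n = s + i := ⟨(n - s).toNat, by omega⟩
    rw [show p - 1 = i + 1 + (p - 2 - i) by omega, couplingCoeff_add, Finset.prod_eq_zero
      (s := Finset.range (p - 2 - i)) (i := (s - 1).toNat) (Finset.mem_range.2 (by omega)),
      mul_zero, mul_zero, zero_smul]
    · rw [show n - ((i + 1 + (s - 1).toNat : ℕ) : ℤ) = 0 by omega, qInt_zero, zero_mul]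
    · rw [show s - (n - (i : ℤ)) = 0 by omega, qInt_zero, mul_zero]

theorem q_zpow_pow (hp : 2 ≤ p) (a : ℤ) :
    (q p ^ a) ^ ((2 * p - 1) * (p - 1)) = (-1) ^ a * q p ^ a := by
  have hq := q_ne_zero p
  rw [← zpow_natCast, ← zpow_mul]
  push_cast
  rw [Nat.cast_sub (by omega), Nat.cast_sub (by omega)]
  push_cast
  rw [show a * ((2 * p - 1) * ((p : ℤ) - 1)) = a * (2 * p - 3) * p + a by ring, zpow_add₀ hq,
    q_zpow_mul_self hp, show a * (2 * (p : ℤ) - 3) = a - 2 * (2 * a - a * p) by ring,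
    neg_one_zpow_sub_two_mul]

/-- This evaluates the term of `dn_e` that is not diagonal; the exponent of `K` stands for `-(p-1)`.
-/
theorem tau_E_pow_K_pow (hp : 2 ≤ p) {s : ℤ} (hs : 1 ≤ s) (hsp : s < p) {n : ℤ} (hn : 0 ≤ n)
    (hnp : n < p) : ((q p)⁻¹ / qFact p (p - 1)) • (TActAux p s .E ^ (p - 1))
      ((TActAux p s .K ^ ((2 * p - 1) * (p - 1))) (tau p n)) =
      if n = s - 1 then (q p ^ (-s) / qInt p s) • beta p 0
      else if n = p - 1 then (q p ^ s / qInt p s) • beta p (p - s) else 0 := by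
  have hq := q_ne_zero p
  have hs0 := qInt_ne_zero hp (n := s) (by omega) hsp
  have hf := qFact_ne_zero hp (n := p - 1) (by omega)
  have h1 : ((-1 : ℂ) ^ s) * (-1) ^ s = 1 := by rw [← mul_zpow]; simp
  rw [pow_smul_vec (T_K_tau n), q_zpow_pow hp, map_smul]
  split_ifs with e1 e2
  · rw [e1, tau_E_pow_of_eq hp hs hsp, smul_smul, smul_smul,
      show s - 1 - 2 * (s - 1) = 1 - s by ring]
    congr 1
    rw [zpow_sub₀ hq, zpow_sub₀ (by norm_num), zpow_sub₀ (by norm_num), zpow_neg]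
    field_simp
  · rw [e2, tau_E_pow_of_eq' hp hs hsp, smul_smul, smul_smul,
      show s - 1 - 2 * (p - 1 : ℤ) = s + 1 - 2 * p by ring, q_zpow_sub_two_mul hp,
      neg_one_zpow_sub_two_mul]
    congr 1
    rw [zpow_add₀ hq, zpow_sub₀ (by norm_num), zpow_add₀ (by norm_num)]
    field_simp
    linear_combination h1
  · rw [tau_E_pow_of_ne hp hs hsp hn hnp e1 e2, smul_zero, smul_zero]

theorem beta_E_pow_K_pow (hp : 2 ≤ p) {s : ℤ} (hs : 1 ≤ s) (hsp : s < p) (n : ℤ) (k : ℕ) :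
    (TActAux p s .E ^ (p - 1)) ((TActAux p s .K ^ k) (beta p n)) = 0 := by
  rw [pow_smul_vec (T_K_beta n), map_smul, beta_E_pow hp hs hsp, smul_zero]

theorem tau_F_pow {s n : ℤ} (hn : 0 ≤ n) (k : ℕ) :
    (TActAux p s .F ^ k) (tau p n) = tau p (n + k) :=
  pow_apply_of_forall_nonneg (fun _ hn => T_F_tau hn) k hn

theorem beta_F_pow {s n : ℤ} (hn : 0 ≤ n) (k : ℕ) :
    (TActAux p s .F ^ k) (beta p n) = beta p (n + k) :=
  pow_apply_of_forall_nonneg (fun _ hn => T_F_beta hn) k hn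

/-! ### The boundary cases `T_0` and `T_p` -/

/-- At `s = p` the coupling constant contains `[p] = 0`, and `e`, `f` shift indices by `p` and so
vanish: the two strings separate. -/
theorem T_self_iso (hp : 2 ≤ p) : Iso (T p p) (add (X p 1 p 1) (X p 1 p 1)) := by
  have hT := good_T hp (le_refl (p : ℤ))
  have hX := good_X hp 1 (s := p) (r := 1) (by omega) (by omega)
  have h1 : sgn 1 = 1 := by simp [sgn]
  refine (exists_hom_X_one_right hp 1 (s := p) (by omega) hT (tau p)
    (fun n hn => tau_eq_zero (Or.inr hn)) (fun n hn hn' => ?_) (fun n hn hn' => ?_)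
    (fun n hn hn' => T_F_tau (s := p) hn) (fun n hn hn' => ?_)
    (fun n hn hn' => T_f_tau (s := p) n)).elim fun φ h => h.elim fun hφ hφ' => ?_
  rotate_right
  · refine (exists_hom_X_one_right hp 1 (s := p) (by omega) hT (beta p)
      (fun n hn => beta_eq_zero (Or.inr hn)) (fun n hn hn' => ?_) (fun n hn hn' => ?_)
      (fun n hn hn' => T_F_beta (s := p) hn) (fun n hn hn' => T_e_beta (s := p) n)
      (fun n hn hn' => ?_)).elim fun ψ h => h.elim fun hψ hψ' => ?_
    rotate_right
    · refine iso_add_of_isHom hX hX hT hφ hψ (fun W h1 h2 => ?_) ?_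
      · refine eq_top_of_vec_mem (TLabel_cases (fun n hn hn' => ?_) (fun n hn hn' => ?_))
        · have := h1 (vec _ (n, 0)); rwa [hφ' n hn] at this
        · have := h2 (vec _ (n, 0)); rwa [hψ' n hn] at this
      · rw [(finrank_T p).2]
        zify
        rw [finrank_X' (by omega) zero_le_one]
        ring
    · refine (T_K_beta n).trans ?_
      rw [h1, one_mul, show (p : ℤ) - 1 - 2 * n = -p - 1 - 2 * n + 2 * p by ring,
        ← q_zpow_sub_two_mul hp (-p - 1 - 2 * n + 2 * p), add_sub_cancel_right]
    · refine (T_E_beta hp n).trans ?_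
      rw [h1, one_mul, qInt_self_sub hp, show -(p : ℤ) - n = -(n + p) by ring, qInt_neg,
        qInt_add_self hp, neg_neg]
    · refine (T_f_beta hn (by omega)).trans (tau_eq_zero (by omega))
  · refine (T_K_tau n).trans ?_
    rw [h1, one_mul]
  · refine (T_E_tau hp le_rfl hn).trans ?_
    rw [h1, one_mul, gConst_self hp, zero_smul, add_zero]
  · refine (T_e_tau hn' (by omega)).trans (beta_eq_zero (by omega))

/-- At `s = 0` the coupling vanishes too, but `e` and `f` now exchange `τ_n` and `β_n`, which form a
doublet of `sl(2)`. The sign of the target comes from `q^(-1-2n) = -q^(p-1-2n)`. This is the source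
of the relation between `x` and `σ v` in the class ring. -/
theorem T_zero_iso (hp : 2 ≤ p) : Iso (T p 0) (X p (-1) p 2) := by
  have hT := good_T hp (show (0 : ℤ) ≤ p by omega)
  have hX := good_X hp (-1) (s := p) (r := 2) (by omega) (by omega)
  have h1 : sgn (-1) = -1 := by simp [sgn]
  refine (exists_hom_X hp (-1) (s := p) (r := 2) (by omega) (by omega) hT
    (fun n m => if m = 0 then beta p n else if m = 1 then tau p n else 0)
    (fun n m h => ?_) ?_ ?_ ?_ ?_ ?_).elim fun φ h => h.elim fun hφ hφ' => ?_
  rotate_right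
  · refine (iso_of_isHom hX hT hφ (fun W h => ?_) ?_).symm
    · refine eq_top_of_vec_mem (TLabel_cases (fun n hn hn' => ?_) (fun n hn hn' => ?_))
      · have := h (vec _ (n, 1))
        rw [hφ' n 1 hn (by omega)] at this
        simpa using this
      · have := h (vec _ (n, 0))
        rw [hφ' n 0 hn (by omega)] at this
        simpa using this
    · rw [(finrank_T p).2]
      zify
      rw [finrank_X' (by omega) (by omega)]
      ring
  · rcases h with h | h
    · split_ifs
      exacts [beta_eq_zero (Or.inr h), tau_eq_zero (Or.inr h), rfl]
    · rw [if_neg (by omega), if_neg (by omega)]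
  all_goals
    intro n m hn hm hn' hm'
    obtain rfl | rfl : m = 0 ∨ m = 1 := by omega
  · simp only [if_true]
    refine (T_K_beta n).trans ?_
    rw [h1, show (p : ℤ) - 1 - 2 * n = p + (0 - 1 - 2 * n) by ring, zpow_add₀ (q_ne_zero p),
      q_zpow_self hp]
    norm_num
  · simp only [one_ne_zero, if_false, if_true]
    refine (T_K_tau n).trans ?_
    rw [h1, show (p : ℤ) - 1 - 2 * n = p + (0 - 1 - 2 * n) by ring, zpow_add₀ (q_ne_zero p),
      q_zpow_self hp]
    norm_num
  · simp only [if_true]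
    refine (T_E_beta hp n).trans ?_
    rw [h1, qInt_self_sub hp, neg_zero, zero_sub, qInt_neg]
    ring_nf
  · simp only [one_ne_zero, if_false, if_true]
    refine (T_E_tau hp (by omega) hn).trans ?_
    rw [h1, qInt_self_sub hp, zero_sub, qInt_neg, show gConst p 0 = 0 by simp [gConst, qInt_zero],
      zero_smul, add_zero]
    ring_nf
  · simp only [if_true]
    exact T_F_beta hn
  · simp only [one_ne_zero, if_false, if_true]
    exact T_F_tau hn
  · simp only [if_true]
    refine (T_e_beta n).trans ?_
    simp
  · simp only [one_ne_zero, if_false, if_true]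
    refine (T_e_tau hn' le_rfl).trans ?_
    norm_num
  · simp only [if_true]
    refine (T_f_beta hn le_rfl).trans ?_
    norm_num
  · simp only [one_ne_zero, if_false, if_true]
    refine (T_f_tau n).trans ?_
    norm_num

end

noncomputable section

open GenAction

variable {p : ℕ}

/-! ### Tensoring projective modules with the two-dimensional module -/

theorem av_E_pow_self (hp : 2 ≤ p) {n : ℤ} (hnp : n < p) :
    ((q p)⁻¹ / qFact p (p - 1)) • (XAct p 1 p 1 .E ^ (p - 1))
      ((XAct p 1 p 1 .K ^ ((2 * p - 1) * (p - 1))) (av p n)) =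
      if n = p - 1 then ((-1) ^ p * qFact p (p - 1)) • av p 0 else 0 := by
  have hq := q_ne_zero p
  have hf := qFact_ne_zero hp (n := p - 1) (by omega)
  have h1 : sgn 1 = 1 := by simp [sgn]
  rw [X_K_pow, h1, one_mul, q_zpow_pow hp, map_smul, av_E_pow, h1]
  split_ifs with h
  · have e1 : ∏ j ∈ Finset.range (p - 1), (1 * qInt p (n - j) * qInt p (p - (n - j))) =
        qFact p (p - 1) * qFact p (p - 1) := by
      rw [Finset.prod_mul_distrib]
      nth_rw 1 [← prod_qInt_range']
      rw [← prod_qInt_range]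
      congr 1 <;> refine Finset.prod_congr rfl fun j _ => ?_
      · rw [one_mul]; congr 1; omega
      · congr 1; omega
    rw [e1, smul_smul, smul_smul, show n - ((p - 1 : ℕ) : ℤ) = 0 by omega,
      show (p : ℤ) - 1 - 2 * n = 1 + p - 2 * p by omega, q_zpow_sub_two_mul hp,
      neg_one_zpow_sub_two_mul, zpow_add₀ hq, q_zpow_self hp, zpow_add₀ (by norm_num), zpow_natCast]
    congr 1
    field_simp
  · rw [av_eq_zero (by omega), smul_zero, smul_zero, smul_zero]

/-- At `s = p` the determinant `[s]` is zero and the two families of `X2_tensor_X_iso` become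
dependent. The vectors `F^n (a_0 ⊗ a_0)` form the string of `β`, and multiples of `a_1 ⊗ a_n` the
string of `τ`. Their scale is dictated by `f β_0 = τ_{p-1}`. -/
theorem X2_tensor_X_self_iso (hp : 2 ≤ p) : Iso (tensor p (X2 p) (X p 1 p 1)) (T p (p - 1)) := by
  have hX := good_X hp 1 (s := p) (r := 1) (by omega) (by omega)
  have hT := good_T hp (show (p : ℤ) - 1 ≤ p by omega)
  have hMN := (good_X2 hp).tensor hX
  have hf0 := qFact_ne_zero hp (n := p - 1) (by omega)
  have h1 : sgn 1 = 1 := by simp [sgn]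
  have hq := q_ne_zero p
  have hd := q_sq_sub_one_ne_zero hp
  have hg : gConst p (p - 1) = (-1) ^ p / qFact p (p - 1) := by
    rw [gConst, qInt_self_sub hp, qInt_one hp, mul_one]
  have hK : ∀ n, (X p 1 p 1).act .K (av p n) = q p ^ ((p : ℤ) - 1 - 2 * n) • av p n := fun n => by
    rw [av_K, h1, one_mul]
  have hE : ∀ n, (X p 1 p 1).act .E (av p n) = (qInt p n * qInt p n) • av p (n - 1) :=
    fun n => by rw [av_E, h1, one_mul, qInt_self_sub hp]
  have hF : ∀ n, 0 ≤ n → (X p 1 p 1).act .F (av p n) = av p (n + 1) := fun n hn => by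
    rw [av_F _ (by omega)]
  have he : ∀ v, (X p 1 p 1).act .e v = 0 := fun v => X_e_one_apply (p := p) 1 p v
  have hf : ∀ v, (X p 1 p 1).act .f v = 0 := fun v => X_f_one_apply (p := p) 1 p v
  have hE' : ∀ n : ℤ, 0 ≤ n → n < p → ((q p)⁻¹ / qFact p (p - 1)) • ((X p 1 p 1).act .E ^ (p - 1))
      (((X p 1 p 1).act .K ^ ((2 * p - 1) * (p - 1))) (av p n)) = _ :=
    fun n _ hn' => av_E_pow_self hp hn'
  have hF' : ∀ n, 0 ≤ n → ((X p 1 p 1).act .F ^ (p - 1)) (av p n) = av p (n + (p - 1 : ℕ)) :=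
    fun n hn => av_F_pow (p := p) 1 hn (p - 1)
  have hFq : ∀ n, 0 ≤ n → qInt p n • dn p (X p 1 p 1) ((X p 1 p 1).act .F (av p (n - 1))) =
      qInt p n • dn p _ (av p n) := by
    intro n hn
    rcases eq_or_ne n 0 with rfl | h
    · simp [qInt_zero]
    · rw [hF _ (by omega), sub_add_cancel]
  have he' : ∀ n : ℤ, 0 ≤ n → n < p → tensorAct p (X2 p) (X p 1 p 1) .e (dn p _ (av p n)) =
      if n = p - 1 then ((-1) ^ p * qFact p (p - 1)) • up p (X p 1 p 1) (av p 0) else 0 := by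
    intro n hn hn'
    rw [dn_e _ _ hp, he, map_zero, neg_zero, zero_add, ← map_smul, hE' n hn hn']
    split_ifs
    · rw [map_smul]
    · rw [map_zero]
  refine (exists_hom_T hp (s := p - 1) (by omega) (by omega) hMN
    (fun n => (-((-1) ^ p / qFact p (p - 1)) * q p ^ (n + 1)) • dn p (X p 1 p 1) (av p n))
    (fun n => q p ^ (-n) • up p (X p 1 p 1) (av p n) + qInt p n • dn p (X p 1 p 1) (av p (n - 1)))
    (fun n hn => ?_) (fun n hn => ?_) (fun n hn hn' => ?_) (fun n hn hn' => ?_)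
    (fun n hn hn' => ?_) (fun n hn hn' => ?_) (fun n hn hn' => ?_) (fun n hn hn' => ?_)
    (fun n hn hn' => ?_) (fun n hn hn' => ?_) (fun n hn hn' => ?_)
    (fun n hn hn' => ?_)).elim fun φ h => h.elim fun hφ hφ' => ?_
  rotate_right
  · refine (iso_of_isHom hT hMN hφ (fun W h => ?_) ?_).symm
    · have hdn : ∀ n, 0 ≤ n → dn p (X p 1 p 1) (av p n) ∈ W := by
        intro n hn
        refine mem_of_eq_smul (h (tau p n)) ?_ (hφ' n hn).1
        exact mul_ne_zero (neg_ne_zero.2 (div_ne_zero (pow_ne_zero _ (by norm_num)) hf0))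
          (zpow_ne_zero _ hq)
      refine eq_top_of_up_dn p ?_
      rintro ⟨n, m⟩ ⟨h3, h4, h5, h6⟩
      dsimp only at *
      obtain rfl : m = 0 := by omega
      refine ⟨?_, hdn n h3⟩
      have h7 := h (beta p n)
      rw [(hφ' n h3).2] at h7
      have h8 : qInt p n • dn p (X p 1 p 1) (av p (n - 1)) ∈ W := by
        rcases h3.eq_or_lt with rfl | h3
        · simp [qInt_zero]
        · exact W.smul_mem _ (hdn _ (by omega))
      exact (W.smul_mem_iff (zpow_ne_zero (-n) hq)).1 ((W.add_mem_iff_left h8).1 h7)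
    · rw [finrank_X2_tensor, (finrank_T p).2]
      zify
      rw [finrank_X' (by omega) zero_le_one, mul_one]
  · dsimp only
    rw [av_eq_zero (Or.inr hn), map_zero, smul_zero]
  · dsimp only
    rw [av_eq_zero (Or.inr hn), map_zero, smul_zero, zero_add]
    rcases eq_or_ne n p with rfl | h
    · rw [qInt_self hp, zero_smul]
    · rw [av_eq_zero (by omega), map_zero, smul_zero]
  · rw [map_smul, dn_K, hK, map_smul]
    match_scalars
    simp only [qInt, neg_sub, neg_add, neg_neg, two_mul, zpow_add₀ hq, zpow_sub₀ hq,
      zpow_neg, zpow_one, q_zpow_self hp]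
    field_simp
  · rw [map_add, map_smul, map_smul, up_K, dn_K, hK, hK, map_smul, map_smul]
    match_scalars <;>
    · simp only [qInt, neg_sub, neg_add, neg_neg, two_mul, zpow_add₀ hq, zpow_sub₀ hq,
        zpow_neg, zpow_one, q_zpow_self hp]
      field_simp
      try norm_num
  · rw [map_smul, dn_E _ _ hp, hE, hK, map_smul, map_smul, hg,
      show n + p - ((p : ℤ) - 1) - 1 = n by ring]
    match_scalars <;>
    · simp only [qInt, neg_sub, neg_add, neg_neg, two_mul, zpow_add₀ hq, zpow_sub₀ hq,
        zpow_neg, zpow_one, q_zpow_self hp]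
      field_simp
      try ring
  · rw [map_add, map_smul, map_smul, up_E _ _ hp, dn_E _ _ hp, hE, hE, hK, map_smul, map_smul,
      map_smul]
    match_scalars <;>
    · simp only [qInt, neg_sub, neg_add, neg_neg, two_mul, zpow_add₀ hq, zpow_sub₀ hq,
        zpow_neg, zpow_one, q_zpow_self hp]
      field_simp
      try ring
  · rw [map_smul, dn_F _ _ hp, hF _ hn, smul_smul, zpow_add_one₀ hq (n + 1), mul_assoc]
  · rw [map_add, map_smul, map_smul, up_F _ _ hp, dn_F _ _ hp, hF _ (by omega), smul_comm, hFq n hn,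
      add_sub_cancel_right]
    match_scalars <;>
    · simp only [qInt, neg_sub, neg_add, neg_neg, two_mul, zpow_add₀ hq, zpow_sub₀ hq,
        zpow_neg, zpow_one]
      field_simp
      try ring
  · rw [map_smul, he' n hn hn']
    rcases eq_or_ne n (p - 1) with rfl | h
    · rw [if_pos rfl, if_neg (by omega), sub_self, neg_zero, zpow_zero, qInt_zero, zero_smul,
        one_smul, add_zero, smul_smul, sub_add_cancel, q_zpow_self hp]
      have : (-1 : ℂ) ^ p * (-1) ^ p = 1 := by rw [← mul_pow]; norm_num
      rw [show -((-1) ^ p / qFact p (p - 1)) * -1 * ((-1) ^ p * qFact p (p - 1)) =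
        (-1 : ℂ) ^ p * (-1) ^ p by field_simp, this, one_smul]
    · rw [if_neg h, if_pos (by omega), smul_zero]
  · rw [map_add, map_smul, map_smul, up_e _ _ hp, he, map_zero, neg_zero, smul_zero, zero_add]
    rcases eq_or_ne n 0 with rfl | h
    · rw [qInt_zero, zero_smul]
    · rw [he' _ (by omega) (by omega), if_neg (by omega), smul_zero]
  · rw [map_smul, dn_f _ _ hp, hf, map_zero, neg_zero, smul_zero]
  · rw [map_add, map_smul, map_smul, up_f _ _ hp, dn_f _ _ hp, hf, hf, map_zero, map_zero, neg_zero,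
      smul_zero, zero_add, add_zero, hF' n hn, smul_smul]
    rcases eq_or_ne n 0 with rfl | h
    · rw [neg_zero, zpow_zero, one_mul, show 0 + ((p : ℤ) - 1) + 1 = p by ring, q_zpow_self hp,
        show (0 : ℤ) + (p - 1 : ℕ) = 0 + (p - 1) by omega]
      congr 1
      ring
    · rw [av_eq_zero (by omega), av_eq_zero (by omega), map_zero, smul_zero, smul_zero]

/-- The recurrence for the classes of the projective modules, uniform up to the boundary cases `T_p`
and `T_0`. On the `β`-strings the vectors are those of the quantum Clebsch–Gordan rule, up to sign;
on the `τ`-strings they are corrected by multiples of `a_1 ⊗ β`. The delicate relations are those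
for `e`, where `E^(p-1)` acts on `τ_{s-1}` and `τ_{p-1}`. -/
theorem X2_tensor_T_iso (hp : 2 ≤ p) {s : ℤ} (hs : 1 ≤ s) (hsp : s < p) :
    Iso (tensor p (X2 p) (T p s)) (add (T p (s + 1)) (T p (s - 1))) := by
  have hT := fun {r : ℤ} (hr : r ≤ p) => good_T hp hr
  have hMN := (good_X2 hp).tensor (hT hsp.le)
  have hf0 := qFact_ne_zero hp (n := p - 1) (by omega)
  have hs0 := qInt_ne_zero hp (n := s) (by omega) hsp
  have hq := q_ne_zero p
  have hd := q_sq_sub_one_ne_zero hp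
  obtain ⟨c, hc⟩ : ∃ c, c = (-1) ^ p / qFact p (p - 1) := ⟨_, rfl⟩
  have hg : ∀ r, gConst p r = c * qInt p r := fun r => by rw [gConst, hc]; ring
  have hKt : ∀ n : ℤ, (T p s).act .K (tau p n) = q p ^ (s - 1 - 2 * n) • tau p n := T_K_tau
  have hKb : ∀ n : ℤ, (T p s).act .K (beta p n) = q p ^ (-s - 1 - 2 * n) • beta p n := T_K_beta
  have hEt : ∀ n : ℤ, 0 ≤ n → (T p s).act .E (tau p n) = (qInt p n * qInt p (s - n)) • tau p (n - 1) +
      (c * qInt p s) • beta p (n + p - s - 1) := fun n hn => by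
    rw [← hg]; exact T_E_tau hp hsp.le hn
  have hEb : ∀ n : ℤ, (T p s).act .E (beta p n) = (qInt p n * qInt p (-s - n)) • beta p (n - 1) :=
    T_E_beta hp
  have hFt : ∀ n : ℤ, 0 ≤ n → (T p s).act .F (tau p n) = tau p (n + 1) := fun n hn => T_F_tau (s := s) hn
  have hFb : ∀ n : ℤ, 0 ≤ n → (T p s).act .F (beta p n) = beta p (n + 1) := fun n hn => T_F_beta (s := s) hn
  have het : ∀ n : ℤ, n < p → (T p s).act .e (tau p n) = beta p (n - s) :=
    fun n hn => T_e_tau hn (by omega)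
  have heb : ∀ n : ℤ, (T p s).act .e (beta p n) = 0 := T_e_beta (s := s)
  have hft : ∀ n : ℤ, (T p s).act .f (tau p n) = 0 := T_f_tau (s := s)
  have hfb : ∀ n : ℤ, 0 ≤ n → (T p s).act .f (beta p n) = tau p (n + s) :=
    fun n hn => T_f_beta hn (by omega)
  have hFt' : ∀ n : ℤ, 0 ≤ n → ((T p s).act .F ^ (p - 1)) (tau p n) = tau p (n + (p - 1)) :=
    fun n hn => by
      have := tau_F_pow (p := p) (s := s) hn (p - 1)
      rwa [Nat.cast_sub (by omega), Nat.cast_one] at this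
  have hFb' : ∀ n : ℤ, 0 ≤ n → ((T p s).act .F ^ (p - 1)) (beta p n) = beta p (n + (p - 1)) :=
    fun n hn => by
      have := beta_F_pow (p := p) (s := s) hn (p - 1)
      rwa [Nat.cast_sub (by omega), Nat.cast_one] at this
  have edb : ∀ n : ℤ, tensorAct p (X2 p) (T p s) .e (dn p _ (beta p n)) = 0 := fun n => by
    rw [dn_e _ _ hp, heb, map_zero, neg_zero, zero_add, ← map_smul]
    refine (congrArg (up p (T p s)) ?_).trans (map_zero _)
    refine (congrArg _ (beta_E_pow_K_pow hp hs hsp n _)).trans (smul_zero _)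
  have edt : ∀ n : ℤ, 0 ≤ n → n < p → tensorAct p (X2 p) (T p s) .e (dn p _ (tau p n)) =
      -dn p _ (beta p (n - s)) +
      up p (T p s) (if n = s - 1 then (q p ^ (-s) / qInt p s) • beta p 0
        else if n = p - 1 then (q p ^ s / qInt p s) • beta p (p - s) else 0) := fun n hn hn' => by
    rw [dn_e _ _ hp, het n hn', ← map_smul]
    refine congrArg _ (congrArg (up p (T p s)) (tau_E_pow_K_pow hp hs hsp hn hn'))
  have fut : ∀ n : ℤ, 0 ≤ n → tensorAct p (X2 p) (T p s) .f (up p _ (tau p n)) =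
      c • dn p (T p s) (tau p (n + (p - 1))) := fun n hn => by
    rw [up_f _ _ hp, hft, map_zero, neg_zero, zero_add, hFt' n hn, ← hc]
  have fub : ∀ n : ℤ, 0 ≤ n → tensorAct p (X2 p) (T p s) .f (up p _ (beta p n)) =
      -up p _ (tau p (n + s)) + c • dn p (T p s) (beta p (n + (p - 1))) := fun n hn => by
    rw [up_f _ _ hp, hfb _ hn, hFb' n hn, ← hc]
  have fdt : ∀ n : ℤ, tensorAct p (X2 p) (T p s) .f (dn p _ (tau p n)) = 0 := fun n => by
    rw [dn_f _ _ hp, hft, map_zero, neg_zero]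
  have fdb : ∀ n : ℤ, 0 ≤ n → tensorAct p (X2 p) (T p s) .f (dn p _ (beta p n)) =
      -dn p _ (tau p (n + s)) := fun n hn => by
    rw [dn_f _ _ hp, hfb _ hn]
  -- The correction with coefficient `c q^n` makes `f` vanish on the image of `τ_0`: it cancels the
  -- multiple of `a_1 ⊗ τ_{p-1}` that `f` creates from `a_0 ⊗ τ_0`.
  refine (exists_hom_T hp (s := s + 1) (by omega) (by omega) hMN
    (fun n => q p ^ (-n) • up p (T p s) (tau p n) + qInt p n • dn p (T p s) (tau p (n - 1)) +
      (c * q p ^ n) • dn p (T p s) (beta p (n + p - s - 1)))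
    (fun n => -(q p ^ (-(s + 1 + n)) • up p (T p s) (beta p (n + 1)) +
      qInt p (s + 1 + n) • dn p (T p s) (beta p n)))
    (fun n hn => ?_) (fun n hn => ?_) (fun n hn hn' => ?_) (fun n hn hn' => ?_)
    (fun n hn hn' => ?_) (fun n hn hn' => ?_) (fun n hn hn' => ?_) (fun n hn hn' => ?_)
    (fun n hn hn' => ?_) (fun n hn hn' => ?_) (fun n hn hn' => ?_)
    (fun n hn hn' => ?_)).elim fun φ h => h.elim fun hφ hφ' => ?_
  rotate_right
  -- Here the correction adjusts the coupling in `E`: the first terms bring in `c [s]`, and `c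
  -- [s-1]` is required.
  · refine (exists_hom_T hp (s := s - 1) (by omega) (by omega) hMN
      (fun n => -(q p ^ (s - 1 - n) • up p (T p s) (tau p (n + 1)) +
        qInt p (n + 1 - s) • dn p (T p s) (tau p n)) +
        (c * q p ^ (n + 1 - s)) • dn p (T p s) (beta p (n + p - s)))
      (fun n => q p ^ (-n) • up p (T p s) (beta p n) + qInt p n • dn p (T p s) (beta p (n - 1)))
      (fun n hn => ?_) (fun n hn => ?_) (fun n hn hn' => ?_) (fun n hn hn' => ?_)
      (fun n hn hn' => ?_) (fun n hn hn' => ?_) (fun n hn hn' => ?_) (fun n hn hn' => ?_)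
      (fun n hn hn' => ?_) (fun n hn hn' => ?_) (fun n hn hn' => ?_)
      (fun n hn hn' => ?_)).elim fun ψ h => h.elim fun hψ hψ' => ?_
    rotate_right
    · refine iso_add_of_isHom (hT (by omega)) (hT (by omega)) hMN hφ hψ (fun W h1 h2 => ?_) ?_
      · have hdet : ∀ n : ℤ, q p ^ (-(s + 1 + n)) * qInt p (n + 1) -
            qInt p (s + 1 + n) * q p ^ (-(n + 1)) = -qInt p s := by
          intro n
          simp only [qInt, neg_sub, neg_add, neg_neg, two_mul, zpow_add₀ hq, zpow_sub₀ hq,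
            zpow_neg, zpow_one]
          field_simp
          ring
        have hdet' : ∀ n : ℤ, q p ^ (-(n + 1)) * qInt p (n + 1 - s) -
            qInt p (n + 1) * q p ^ (s - 1 - n) = -qInt p s := by
          intro n
          simp only [qInt, neg_sub, neg_add, neg_neg, two_mul, zpow_add₀ hq, zpow_sub₀ hq,
            zpow_neg, zpow_one]
          field_simp
          ring
        have key : ∀ n : ℤ, 0 ≤ n → up p (T p s) (beta p (n + 1)) ∈ W ∧
            dn p (T p s) (beta p n) ∈ W := by
          intro n hn
          have e1 := h1 (beta p n)
          have e2 := h2 (beta p (n + 1))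
          rw [(hφ' n (by omega)).2, W.neg_mem_iff] at e1
          rw [(hψ' (n + 1) (by omega)).2, add_sub_cancel_right] at e2
          refine mem_of_det_ne_zero e1 e2 ?_
          rw [hdet]
          exact neg_ne_zero.2 hs0
        -- The system is triangular: the vectors with `τ` are found modulo those with `β`, which are
        -- already in `W`. Both determinants are `-[s]`.
        have key' : ∀ n : ℤ, 0 ≤ n → up p (T p s) (tau p (n + 1)) ∈ W ∧
            dn p (T p s) (tau p n) ∈ W := by
          intro n hn
          have e1 := h1 (tau p (n + 1))
          have e2 := h2 (tau p n)
          rw [(hφ' (n + 1) (by omega)).1, add_sub_cancel_right,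
            W.add_mem_iff_left (W.smul_mem _ (key _ (by omega)).2)] at e1
          rw [(hψ' n (by omega)).1, W.add_mem_iff_left (W.smul_mem _ (key _ (by omega)).2),
            W.neg_mem_iff] at e2
          refine mem_of_det_ne_zero e1 e2 ?_
          rw [hdet']
          exact neg_ne_zero.2 hs0
        refine eq_top_of_up_dn p (TLabel_cases (fun n hn hn' => ⟨?_, (key' n hn).2⟩)
          (fun n hn hn' => ⟨?_, (key n hn).2⟩))
        · rcases hn.eq_or_lt with rfl | hn
          · have := h1 (tau p 0)
            rw [(hφ' 0 le_rfl).1, W.add_mem_iff_left (W.smul_mem _ (key _ (by omega)).2)] at this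
            simpa [qInt_zero] using this
          · have := (key' (n - 1) (by omega)).1
            rwa [sub_add_cancel] at this
        · rcases hn.eq_or_lt with rfl | hn
          · have := h2 (beta p 0)
            rw [(hψ' 0 le_rfl).2] at this
            simpa [qInt_zero] using this
          · have := (key (n - 1) (by omega)).1
            rwa [sub_add_cancel] at this
      · rw [finrank_X2_tensor, (finrank_T p).2]
        ring
    · dsimp only
      rw [tau_eq_zero (n := n) (by omega), tau_eq_zero (n := n + 1) (by omega),
        beta_eq_zero (by omega)]
      simp
    · dsimp only
      rw [beta_eq_zero (n := n) (by omega), map_zero, smul_zero, zero_add]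
      rcases eq_or_ne n p with rfl | h
      · rw [qInt_self hp, zero_smul]
      · rw [beta_eq_zero (by omega), map_zero, smul_zero]
    · rw [map_add, map_neg, map_add, map_smul, map_smul, map_smul, up_K, dn_K, dn_K, hKt, hKt, hKb,
        map_smul, map_smul, map_smul]
      match_scalars <;>
      · simp only [qInt, neg_sub, neg_add, neg_neg, two_mul, zpow_add₀ hq, zpow_sub₀ hq,
          zpow_neg, zpow_one, q_zpow_self hp]
        field_simp
        try norm_num
    · rw [map_add, map_smul, map_smul, up_K, dn_K, hKb, hKb, map_smul, map_smul]
      match_scalars <;>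
      · simp only [qInt, neg_sub, neg_add, neg_neg, two_mul, zpow_add₀ hq, zpow_sub₀ hq,
          zpow_neg, zpow_one]
        field_simp
    · rw [map_add, map_neg, map_add, map_smul, map_smul, map_smul, up_E _ _ hp, dn_E _ _ hp,
        dn_E _ _ hp, hEt _ (by omega), hEt _ hn, hEb, hKt, hKb, hg,
        show n + 1 + p - s - 1 = n + p - s by ring, show n + 1 - 1 = n by ring,
        show n - 1 + 1 = n by ring, show n + p - (s - 1) - 1 = n + p - s by ring,
        show n - 1 + p - s = n + p - s - 1 by ring]
      simp only [map_add, map_smul]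
      match_scalars <;>
      · simp only [qInt, neg_sub, neg_add, neg_neg, two_mul, zpow_add₀ hq, zpow_sub₀ hq,
          zpow_neg, zpow_one, q_zpow_self hp]
        field_simp
        try ring
    · rw [map_add, map_smul, map_smul, up_E _ _ hp, dn_E _ _ hp, hEb, hEb, hKb, map_smul, map_smul,
        map_smul]
      match_scalars <;>
      · simp only [qInt, neg_sub, neg_add, neg_neg, two_mul, zpow_add₀ hq, zpow_sub₀ hq,
          zpow_neg, zpow_one]
        field_simp
        try ring
    · rw [map_add, map_neg, map_add, map_smul, map_smul, map_smul, up_F _ _ hp, dn_F _ _ hp,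
        dn_F _ _ hp, hFt _ (by omega), hFt _ hn, hFb _ (by omega),
        show n + p - s + 1 = n + 1 + p - s by ring]
      match_scalars <;>
      · simp only [qInt, neg_sub, neg_add, neg_neg, two_mul, zpow_add₀ hq, zpow_sub₀ hq,
          zpow_neg, zpow_one]
        field_simp
        try ring
    · rw [map_add, map_smul, map_smul, up_F _ _ hp, dn_F _ _ hp, hFb _ hn, add_sub_cancel_right]
      rcases eq_or_ne n 0 with rfl | h
      · simp [qInt_zero, qInt_one hp]
      · rw [hFb _ (by omega), sub_add_cancel]
        match_scalars <;>
        · simp only [qInt, neg_sub, neg_add, neg_neg, two_mul, zpow_add₀ hq, zpow_sub₀ hq,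
            zpow_neg, zpow_one]
          field_simp
          try ring
    · rw [map_add, map_neg, map_add, map_smul, map_smul, map_smul, up_e _ _ hp, edb, edt n hn hn',
        smul_zero, add_zero]
      rcases lt_trichotomy n (s - 1) with h | rfl | h
      · rw [if_pos h, if_neg (show n ≠ s - 1 by omega), if_neg (show n ≠ p - 1 by omega),
          het _ (by omega),
          beta_eq_zero (n := n + 1 - s) (by omega), beta_eq_zero (n := n - s) (by omega)]
        simp
      · rw [if_neg (lt_irrefl _), if_pos rfl, het _ (by omega), sub_add_cancel, sub_self, sub_self,
          qInt_zero]
        simp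
      · rw [if_neg (show n ≠ s - 1 by omega), if_neg (show ¬n < s - 1 by omega)]
        rcases eq_or_ne n (p - 1) with rfl | h'
        · rw [if_pos rfl, sub_add_cancel, tau_eq_zero (Or.inr le_rfl), map_zero, map_zero, map_smul,
            show (p : ℤ) - 1 - (s - 1) - 1 = p - 1 - s by ring,
            show (p : ℤ) - 1 - (s - 1) = p - s by ring]
          have e : q p ^ (-((p : ℤ) - s)) = -q p ^ s := by
            rw [neg_sub, zpow_sub₀ hq, q_zpow_self hp, div_neg, div_one]
          rw [qInt_self_sub hp, smul_add (qInt p s), smul_smul (qInt p s), mul_div_cancel₀ _ hs0, e]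
          module
        · rw [if_neg h', het _ (by omega), map_zero, add_zero,
            show n - (s - 1) = n + 1 - s by ring, show n + 1 - s - 1 = n - s by ring]
          match_scalars <;>
          · simp only [qInt, neg_sub, neg_add, neg_neg, two_mul, zpow_add₀ hq, zpow_sub₀ hq,
              zpow_neg, zpow_one]
            field_simp
    · rw [map_add, map_smul, map_smul, up_e _ _ hp, edb, heb]
      simp
    · rw [map_add, map_neg, map_add, map_smul, map_smul, map_smul, fut _ (by omega), fdt,
        fdb _ (by omega), tau_eq_zero (by omega), tau_eq_zero (by omega)]
      simp
    · rw [map_add, map_smul, map_smul, fub _ hn, show n + (s - 1) + 1 - s = n by ring,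
        show n + (s - 1) + 1 = n + s by ring, show s - 1 - (n + (s - 1)) = -n by ring,
        show n + (s - 1) + p - s = n + (p - 1) by ring]
      rcases eq_or_ne n 0 with rfl | h
      · simp [qInt_zero]
      · rw [fdb _ (by omega), beta_eq_zero (n := n + (p - 1)) (by omega),
          show n - 1 + s = n + (s - 1) by ring]
        simp only [map_zero, smul_zero, add_zero]
        module
  · dsimp only
    rw [tau_eq_zero (n := n) (by omega), beta_eq_zero (by omega)]
    rcases eq_or_ne n p with rfl | h
    · simp [qInt_self hp]
    · rw [tau_eq_zero (by omega)]
      simp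
  · dsimp only
    rw [beta_eq_zero (n := n) (by omega), beta_eq_zero (by omega)]
    simp
  · rw [map_add, map_add, map_smul, map_smul, map_smul, up_K, dn_K, dn_K, hKt, hKt, hKb,
      map_smul, map_smul, map_smul]
    match_scalars <;>
    · simp only [qInt, neg_sub, neg_add, neg_neg, two_mul, zpow_add₀ hq, zpow_sub₀ hq,
        zpow_neg, zpow_one, q_zpow_self hp]
      field_simp
      try norm_num
  · rw [map_neg, map_add, map_smul, map_smul, up_K, dn_K, hKb, hKb, map_smul, map_smul]
    match_scalars <;>
    · simp only [qInt, neg_sub, neg_add, neg_neg, two_mul, zpow_add₀ hq, zpow_sub₀ hq,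
        zpow_neg, zpow_one]
      field_simp
  · have h1 : qInt p n • dn p (T p s) ((T p s).act .E (tau p (n - 1))) =
        qInt p n • dn p _ ((qInt p (n - 1) * qInt p (s - (n - 1))) • tau p (n - 1 - 1) +
          (c * qInt p s) • beta p (n + p - s - 1 - 1)) := by
      rcases eq_or_ne n 0 with rfl | h
      · simp [qInt_zero]
      · rw [hEt _ (by omega)]
        congr 4
        ring_nf
    rw [map_add, map_add, map_smul, map_smul, map_smul, up_E _ _ hp, dn_E _ _ hp,
      dn_E _ _ hp, smul_add (qInt p n), h1, hEt _ hn, hEb, hKt, hKb, hg,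
      show n + p - (s + 1) - 1 + 1 = n + p - s - 1 by ring,
      show n + p - (s + 1) - 1 = n + p - s - 1 - 1 by ring,
      show n - 1 + p - s - 1 = n + p - s - 1 - 1 by ring]
    simp only [map_add, map_smul]
    match_scalars <;>
    · simp only [qInt, neg_sub, neg_add, neg_neg, two_mul, zpow_add₀ hq, zpow_sub₀ hq,
        zpow_neg, zpow_one, q_zpow_self hp]
      field_simp
      try ring
  · rw [map_neg, map_add, map_smul, map_smul, up_E _ _ hp, dn_E _ _ hp, hEb, hEb, hKb, map_smul,
      map_smul, map_smul, add_sub_cancel_right, sub_add_cancel]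
    match_scalars <;>
    · simp only [qInt, neg_sub, neg_add, neg_neg, two_mul, zpow_add₀ hq, zpow_sub₀ hq,
        zpow_neg, zpow_one]
      field_simp
      try ring
  · have h1 : qInt p n • dn p (T p s) ((T p s).act .F (tau p (n - 1))) =
        qInt p n • dn p _ (tau p n) := by
      rcases eq_or_ne n 0 with rfl | h
      · simp [qInt_zero]
      · rw [hFt _ (by omega), sub_add_cancel]
    rw [map_add, map_add, map_smul, map_smul, map_smul, up_F _ _ hp, dn_F _ _ hp,
      dn_F _ _ hp, smul_comm (qInt p n), h1, hFt _ hn, hFb _ (by omega), add_sub_cancel_right,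
      show n + p - s - 1 + 1 = n + 1 + p - s - 1 by ring]
    match_scalars <;>
    · simp only [qInt, neg_sub, neg_add, neg_neg, two_mul, zpow_add₀ hq, zpow_sub₀ hq,
        zpow_neg, zpow_one]
      field_simp
      try ring
  · rw [map_neg, map_add, map_smul, map_smul, up_F _ _ hp, dn_F _ _ hp, hFb _ hn, hFb _ (by omega)]
    match_scalars <;>
    · simp only [qInt, neg_sub, neg_add, neg_neg, two_mul, zpow_add₀ hq, zpow_sub₀ hq,
        zpow_neg, zpow_one]
      field_simp
      try ring
  · rw [map_add, map_add, map_smul, map_smul, map_smul, up_e _ _ hp, edb, het n hn',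
      smul_zero, add_zero]
    rcases eq_or_ne n 0 with rfl | h0
    · rw [if_pos (by omega), beta_eq_zero (by omega), qInt_zero]
      simp
    rw [edt _ (by omega) (by omega), if_neg (show n - 1 ≠ p - 1 by omega)]
    rcases lt_trichotomy n s with h | rfl | h
    · rw [if_neg (show n - 1 ≠ s - 1 by omega), if_pos (show n < s + 1 by omega),
        beta_eq_zero (n := n - s) (by omega), beta_eq_zero (n := n - 1 - s) (by omega)]
      simp
    · rw [if_pos rfl, if_pos (show n < n + 1 by omega), sub_self, beta_eq_zero (n := n - 1 - n) (by omega),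
        map_smul, map_zero, neg_zero, zero_add, smul_smul, mul_div_cancel₀ _ hs0, smul_neg,
        neg_add_cancel]
    · rw [if_neg (show n - 1 ≠ s - 1 by omega), if_neg (show ¬n < s + 1 by omega), map_zero,
        add_zero, show s + 1 + (n - (s + 1)) = n by ring, show n - (s + 1) + 1 = n - s by ring,
        show n - (s + 1) = n - 1 - s by ring]
      module
  · rw [map_neg, map_add, map_smul, map_smul, up_e _ _ hp, edb, heb]
    simp
  · rw [map_add, map_add, map_smul, map_smul, map_smul, fut _ hn, fdt, fdb _ (by omega),
      show n + p - s - 1 + s = n + (p - 1) by ring]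
    rcases eq_or_ne n 0 with rfl | h
    · simp
    · rw [tau_eq_zero (by omega)]
      simp
  · rw [map_neg, map_add, map_smul, map_smul, fub _ (by omega), fdb _ hn,
      beta_eq_zero (n := n + 1 + (p - 1)) (by omega),
      beta_eq_zero (n := n + (s + 1) + p - s - 1) (by omega),
      show n + (s + 1) - 1 = n + s by ring, show n + 1 + s = n + (s + 1) by ring,
      show s + 1 + n = n + (s + 1) by ring]
    simp only [map_zero, smul_zero, add_zero]
    module

end

noncomputable section

open GenAction

variable {p : ℕ}

/-! ### The projective modules as tensor products -/

/-- A version of `IsHom.of_good` that asks only for the formula for `h`. The other properties of the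
projective modules are not known at this point; they are transported back along `P_iso`. -/
theorem GenAction.IsHom.of_h_eq {M N : GenAction}
    (hM : M.act .h = (1 / 2 : ℂ) • (M.act .e * M.act .f - M.act .f * M.act .e))
    (hN : N.act .h = (1 / 2 : ℂ) • (N.act .e * N.act .f - N.act .f * N.act .e))
    {φ : M.V →ₗ[ℂ] N.V} (h : ∀ g, g ≠ .h → ∀ v, φ (M.act g v) = N.act g (φ v)) :
    IsHom M N φ := by
  intro g v
  by_cases hg : g = .h
  · have he := h .e (by simp)
    have hf := h .f (by simp)
    rw [hg, hM, hN]
    simp only [LinearMap.smul_apply, LinearMap.sub_apply, Module.End.mul_apply, map_smul, map_sub,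
      he, hf]
  · exact h g hg v

section P

variable (α : ℤˣ) {s r n m : ℤ}

theorem P_f {c : Part} (h : PLabel p s r (c, n, m)) :
    PAct p α s r .f (vec _ (c, n, m)) = vec _ (c, n, m + 1) :=
  (opOf_vec _ h).trans (by cases c <;> rfl)

/-- The coefficient in the action of `e`. -/
def pCoeff (r : ℤ) (c : Part) (m : ℤ) : ℂ :=
  match c with
  | .t => (m : ℂ) * (r - m)
  | .b => (m : ℂ) * (r - m)
  | .l => ((m : ℂ) - 1) * (r - m)
  | .r => (m : ℂ) * (r + 1 - m)

theorem P_e {c : Part} (h : PLabel p s r (c, n, m)) :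
    PAct p α s r .e (vec _ (c, n, m)) = pCoeff r c m • vec _ (c, n, m - 1) :=
  (opOf_vec _ h).trans (by cases c <;> rfl)

theorem P_h_eq : (PNonSimple p α s r).act .h = (1 / 2 : ℂ) •
    ((PNonSimple p α s r).act .e * (PNonSimple p α s r).act .f -
      (PNonSimple p α s r).act .f * (PNonSimple p α s r).act .e) := by
  refine span_hom_ext ?_
  rintro ⟨c, n, m⟩ h
  have h1 : PAct p α s r .e (PAct p α s r .f (vec _ (c, n, m))) =
      pCoeff r c (m + 1) • vec _ (c, n, m) := by
    rw [P_f α h]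
    by_cases h' : PLabel p s r (c, n, m + 1)
    · rw [P_e α h', add_sub_cancel_right]
    · rw [vec_of_not_mem h', map_zero]
      have hz : pCoeff r c (m + 1) = 0 := by
        cases c <;> simp only [PLabel] at h h'
        · rw [show m = r - 1 by omega]; simp [pCoeff]
        · rw [show m = r - 1 by omega]; simp [pCoeff]
        · rw [show m = r - 1 by omega]; simp [pCoeff]
        · rw [show m = r by omega]; simp [pCoeff]
      rw [hz, zero_smul]
  have h2 : PAct p α s r .f (PAct p α s r .e (vec _ (c, n, m))) =
      pCoeff r c m • vec _ (c, n, m) := by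
    rw [P_e α h, map_smul]
    by_cases h' : PLabel p s r (c, n, m - 1)
    · rw [P_f α h', sub_add_cancel]
    · have hz : pCoeff r c m = 0 := by
        cases c <;> simp only [PLabel] at h h'
        · rw [show m = 0 by omega]; simp [pCoeff]
        · rw [show m = 0 by omega]; simp [pCoeff]
        · rw [show m = 1 by omega]; simp [pCoeff]
        · rw [show m = 0 by omega]; simp [pCoeff]
      rw [hz, zero_smul, zero_smul]
  change PAct p α s r .h (vec _ (c, n, m)) = (1 / 2 : ℂ) •
    (PAct p α s r .e (PAct p α s r .f (vec _ (c, n, m))) -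
      PAct p α s r .f (PAct p α s r .e (vec _ (c, n, m))))
  rw [h1, h2, ← sub_smul, smul_smul]
  refine (opOf_vec _ h).trans ?_
  cases c <;> simp only [pCoeff] <;> congr 1 <;> push_cast <;> ring

/-- An upper bound suffices, as the surjection in `P_iso` supplies the lower one; so the four parts
need not be shown disjoint. -/
theorem finrank_P_le (hs : 1 ≤ s) (hsp : s < p) (hr : 1 ≤ r) :
    FiniteDimensional ℂ (Span (PLabel p s r)) ∧
    (Module.finrank ℂ (Span (PLabel p s r)) : ℤ) ≤ 2 * p * r := by
  classical
  let A : Finset (ℤ × ℤ) := Finset.Icc 0 (s - 1) ×ˢ Finset.Icc 0 (r - 1)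
  let B : Finset (ℤ × ℤ) := Finset.Icc 0 (p - s - 1) ×ˢ Finset.Icc 1 (r - 1)
  let C : Finset (ℤ × ℤ) := Finset.Icc 0 (p - s - 1) ×ˢ Finset.Icc 0 r
  let S : Finset (Part × ℤ × ℤ) := (A.image (Prod.mk .t) ∪ A.image (Prod.mk .b)) ∪
    (B.image (Prod.mk .l) ∪ C.image (Prod.mk .r))
  have hS : ∀ i, PLabel p s r i ↔ i ∈ S := by
    rintro ⟨c, n, m⟩
    cases c <;> simp [S, A, B, C, PLabel, and_assoc]
  obtain ⟨h1, h2⟩ := finrank_span S hS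
  refine ⟨h1, ?_⟩
  rw [h2]
  have hA : (A.card : ℤ) = s * r := by
    simp only [A, Finset.card_product, Int.card_Icc, sub_zero, sub_add_cancel]
    push_cast
    rw [Int.toNat_of_nonneg (by omega), Int.toNat_of_nonneg (by omega)]
  have hB : (B.card : ℤ) = (p - s) * (r - 1) := by
    simp only [B, Finset.card_product, Int.card_Icc, sub_zero, sub_add_cancel]
    push_cast
    rw [Int.toNat_of_nonneg (by omega), Int.toNat_of_nonneg (by omega)]
  have hC : (C.card : ℤ) = (p - s) * (r + 1) := by
    simp only [C, Finset.card_product, Int.card_Icc, sub_zero, sub_add_cancel]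
    push_cast
    rw [Int.toNat_of_nonneg (by omega), Int.toNat_of_nonneg (by omega)]
  have h3 : S.card ≤ (A.card + A.card) + (B.card + C.card) :=
    (Finset.card_union_le _ _).trans (add_le_add
      ((Finset.card_union_le _ _).trans (add_le_add Finset.card_image_le Finset.card_image_le))
      ((Finset.card_union_le _ _).trans (add_le_add Finset.card_image_le Finset.card_image_le)))
  have h4 : (S.card : ℤ) ≤ (A.card + A.card) + (B.card + C.card) := by exact_mod_cast h3
  rw [hA, hB, hC] at h4
  linarith

end P

theorem T_K_pow_tau (hp : 2 ≤ p) (s n : ℤ) :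
    (TActAux p s .K ^ p) (tau p n) = (-1 : ℂ) ^ (s - 1) • tau p n := by
  rw [pow_smul_vec (T_K_tau n), ← zpow_natCast, ← zpow_mul, q_zpow_mul_self hp,
    neg_one_zpow_sub_two_mul]

theorem T_K_pow_beta (hp : 2 ≤ p) (s n : ℤ) :
    (TActAux p s .K ^ p) (beta p n) = (-1 : ℂ) ^ (s - 1) • beta p n := by
  rw [pow_smul_vec (T_K_beta n), ← zpow_natCast, ← zpow_mul, q_zpow_mul_self hp,
    neg_one_zpow_sub_two_mul, show -s - 1 = s - 1 - 2 * s by ring, neg_one_zpow_sub_two_mul]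

section TX

variable (α : ℤˣ) (s r n m : ℤ)

/-- The vector `τ_n ⊗ w_m`, with a sign. -/
def tw : (tensor p (T p s) (X p α 1 r)).V :=
  (((-1 : ℂ) ^ (s - 1)) ^ m) • (tau p n ⊗ₜ[ℂ] wv r m)

/-- The vector `β_n ⊗ w_m`, with a sign. -/
def bw : (tensor p (T p s) (X p α 1 r)).V :=
  (((-1 : ℂ) ^ (s - 1)) ^ m) • (beta p n ⊗ₜ[ℂ] wv r m)

variable {s r n m}

theorem tw_eq_zero (h : n < 0 ∨ p ≤ n ∨ m < 0 ∨ r ≤ m) : tw (p := p) α s r n m = 0 := by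
  rw [tw]
  by_cases h' : n < 0 ∨ p ≤ n
  · rw [tau_eq_zero h', TensorProduct.zero_tmul, smul_zero]
  · rw [wv_eq_zero (by omega), TensorProduct.tmul_zero, smul_zero]

theorem bw_eq_zero (h : n < 0 ∨ p ≤ n ∨ m < 0 ∨ r ≤ m) : bw (p := p) α s r n m = 0 := by
  rw [bw]
  by_cases h' : n < 0 ∨ p ≤ n
  · rw [beta_eq_zero h', TensorProduct.zero_tmul, smul_zero]
  · rw [wv_eq_zero (by omega), TensorProduct.tmul_zero, smul_zero]

theorem tw_K : tensorAct p (T p s) (X p α 1 r) .K (tw α s r n m) =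
    (sgn α * q p ^ (s - 1 - 2 * n)) • tw α s r n m := by
  rw [tw, map_smul]
  refine (congrArg _ (congrArg₂ (TensorProduct.tmul ℂ) (T_K_tau (s := s) n) (wv_K α r m))).trans ?_
  rw [TensorProduct.smul_tmul_smul, smul_comm, mul_comm]

theorem bw_K : tensorAct p (T p s) (X p α 1 r) .K (bw α s r n m) =
    (sgn α * q p ^ (-s - 1 - 2 * n)) • bw α s r n m := by
  rw [bw, map_smul]
  refine (congrArg _ (congrArg₂ (TensorProduct.tmul ℂ) (T_K_beta (s := s) n) (wv_K α r m))).trans ?_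
  rw [TensorProduct.smul_tmul_smul, smul_comm, mul_comm]

theorem tw_E (hp : 2 ≤ p) (hs : s ≤ p) (hn : 0 ≤ n) :
    tensorAct p (T p s) (X p α 1 r) .E (tw α s r n m) =
    (sgn α * qInt p n * qInt p (s - n)) • tw α s r (n - 1) m +
      (sgn α * gConst p s) • bw α s r (n + p - s - 1) m := by
  rw [tw, map_smul, tensor_E_tmul, X_E_one_apply, wv_K, TensorProduct.tmul_zero, zero_add]
  refine (congrArg (fun z => _ • z ⊗ₜ[ℂ] _) (T_E_tau hp hs hn)).trans ?_
  dsimp only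
  rw [TensorProduct.add_tmul, TensorProduct.smul_tmul_smul, TensorProduct.smul_tmul_smul, tw, bw]
  module

theorem bw_E (hp : 2 ≤ p) :
    tensorAct p (T p s) (X p α 1 r) .E (bw α s r n m) =
    (sgn α * qInt p n * qInt p (-s - n)) • bw α s r (n - 1) m := by
  rw [bw, map_smul, tensor_E_tmul, X_E_one_apply, wv_K, TensorProduct.tmul_zero, zero_add]
  refine (congrArg (fun z => _ • z ⊗ₜ[ℂ] _) (T_E_beta (s := s) hp n)).trans ?_
  dsimp only
  rw [TensorProduct.smul_tmul_smul, bw]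
  module

theorem tw_F (hn : 0 ≤ n) : tensorAct p (T p s) (X p α 1 r) .F (tw α s r n m) =
    tw α s r (n + 1) m := by
  rw [tw, map_smul, tensor_F_tmul, X_F_one_apply, TensorProduct.tmul_zero, zero_add]
  exact congrArg (fun z => _ • z ⊗ₜ[ℂ] _) (T_F_tau (s := s) hn)

theorem bw_F (hn : 0 ≤ n) : tensorAct p (T p s) (X p α 1 r) .F (bw α s r n m) =
    bw α s r (n + 1) m := by
  rw [bw, map_smul, tensor_F_tmul, X_F_one_apply, TensorProduct.tmul_zero, zero_add]
  exact congrArg (fun z => _ • z ⊗ₜ[ℂ] _) (T_F_beta (s := s) hn)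

theorem neg_one_zpow_ne_zero (a : ℤ) : (-1 : ℂ) ^ a ≠ 0 := zpow_ne_zero _ (by norm_num)

theorem neg_one_zpow_inv (a : ℤ) : ((-1 : ℂ) ^ a)⁻¹ = (-1) ^ a := by
  rw [← inv_zpow]; norm_num

theorem tw_e (hp : 2 ≤ p) (hs : 0 ≤ s) (hn : n < p) :
    tensorAct p (T p s) (X p α 1 r) .e (tw α s r n m) =
    bw α s r (n - s) m + ((m : ℂ) * (r - m)) • tw α s r n (m - 1) := by
  rw [tw, map_smul, tensor_e_tmul_of_right (X_E_one (p := p) α r), wv_e, smul_add]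
  congr 1
  · exact congrArg (fun z => _ • z ⊗ₜ[ℂ] _) (T_e_tau hn hs)
  · refine (congrArg (fun z => _ • z ⊗ₜ[ℂ] _) (T_K_pow_tau hp s n)).trans ?_
    dsimp only
    rw [TensorProduct.smul_tmul_smul, tw, smul_smul, smul_smul,
      zpow_sub_one₀ (neg_one_zpow_ne_zero _), neg_one_zpow_inv]
    congr 1; ring

theorem bw_e (hp : 2 ≤ p) :
    tensorAct p (T p s) (X p α 1 r) .e (bw α s r n m) =
    ((m : ℂ) * (r - m)) • bw α s r n (m - 1) := by
  rw [bw, map_smul, tensor_e_tmul_of_right (X_E_one (p := p) α r), wv_e, smul_add]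
  have h1 : (T p s).act .e (beta p n) ⊗ₜ[ℂ] wv r m = 0 :=
    (congrArg (fun z => z ⊗ₜ[ℂ] wv r m) (T_e_beta (s := s) n)).trans (TensorProduct.zero_tmul _ _)
  rw [h1, smul_zero, zero_add]
  refine (congrArg (fun z => _ • z ⊗ₜ[ℂ] _) (T_K_pow_beta hp s n)).trans ?_
  dsimp only
  rw [TensorProduct.smul_tmul_smul, bw, smul_smul, smul_smul,
    zpow_sub_one₀ (neg_one_zpow_ne_zero _), neg_one_zpow_inv]
  congr 1; ring

theorem tw_f (hp : 2 ≤ p) (hm : m ≠ -1) :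
    tensorAct p (T p s) (X p α 1 r) .f (tw α s r n m) = tw α s r n (m + 1) := by
  rw [tw, map_smul, tensor_f_tmul_of_right (X_F_one (p := p) α r), wv_f α hm]
  have h1 : (T p s).act .f (tau p n) ⊗ₜ[ℂ] wv r m = 0 :=
    (congrArg (fun z => z ⊗ₜ[ℂ] wv r m) (T_f_tau (s := s) n)).trans (TensorProduct.zero_tmul _ _)
  rw [h1, zero_add]
  refine (congrArg (fun z => _ • z ⊗ₜ[ℂ] _) (T_K_pow_tau hp s n)).trans ?_
  dsimp only
  rw [← TensorProduct.smul_tmul', tw, smul_smul, zpow_add_one₀ (neg_one_zpow_ne_zero _)]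

theorem bw_f (hp : 2 ≤ p) (hs : 0 ≤ s) (hn : 0 ≤ n) (hm : m ≠ -1) :
    tensorAct p (T p s) (X p α 1 r) .f (bw α s r n m) =
    tw α s r (n + s) m + bw α s r n (m + 1) := by
  rw [bw, map_smul, tensor_f_tmul_of_right (X_F_one (p := p) α r), wv_f α hm, smul_add]
  congr 1
  · exact congrArg (fun z => _ • z ⊗ₜ[ℂ] _) (T_f_beta hn hs)
  · refine (congrArg (fun z => _ • z ⊗ₜ[ℂ] _) (T_K_pow_beta hp s n)).trans ?_
    dsimp only
    rw [← TensorProduct.smul_tmul', bw, smul_smul, zpow_add_one₀ (neg_one_zpow_ne_zero _)]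

theorem eq_top_of_tw_bw {W : Submodule ℂ (tensor p (T p s) (X p α 1 r)).V}
    (h : ∀ n m : ℤ, 0 ≤ n → n < p → 0 ≤ m → m < r → tw α s r n m ∈ W ∧ bw α s r n m ∈ W) :
    W = ⊤ := by
  have hu : ∀ m : ℤ, ((-1 : ℂ) ^ (s - 1)) ^ m ≠ 0 := fun m =>
    zpow_ne_zero _ (neg_one_zpow_ne_zero _)
  refine eq_top_of_vec_tmul_vec_mem fun i j hi => ?_
  revert i
  refine TLabel_cases (fun n hn hn' => ?_) (fun n hn hn' => ?_) <;> obtain ⟨k, m⟩ := j <;>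
    rintro ⟨h1, h2, h3, h4⟩ <;> dsimp only at * <;> obtain rfl : k = 0 := by omega
  · exact (W.smul_mem_iff (hu m)).1 (h n m hn hn' h3 (by omega)).1
  · exact (W.smul_mem_iff (hu m)).1 (h n m hn hn' h3 (by omega)).2

end TX

/-- Everything about general `r` is reduced to `T_s` and a module of `sl(2)`. In particular
`P^α_{s,r}` is good because the tensor product is. -/
theorem P_iso (hp : 2 ≤ p) (α : ℤˣ) {s r : ℤ} (hs : 1 ≤ s) (hsp : s < p) (hr : 1 ≤ r) :
    Iso (PNonSimple p α s r) (tensor p (T p s) (X p α 1 r)) := by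
  have hT := good_T hp hsp.le
  have hX := good_X hp α zero_le_one (show 0 ≤ r by omega)
  have hN := hT.tensor hX
  have hq := q_ne_zero p
  have hr0 : (r : ℂ) ≠ 0 := by exact_mod_cast (by omega : r ≠ 0)
  have := hN.fin
  have := (finrank_P_le hs hsp hr).1
  -- The first `s` vectors of the string of `τ` are the top, the last `s` of the string of `β` the
  -- bottom. The remaining `β_n` and `τ_{s+n}` form a doublet of `sl(2)`, whose product with the
  -- `r`-dimensional module splits by the formulas of `X_one_two_tensor_iso` into left and right.
  let pv : Part × ℤ × ℤ → (tensor p (T p s) (X p α 1 r)).V := fun i => match i with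
    | (.t, n, m) => tw α s r n m
    | (.b, n, m) => bw α s r (p - s + n) m
    | (.l, n, m) => bw α s r n m + ((m : ℂ) - r) • tw α s r (s + n) (m - 1)
    | (.r, n, m) => bw α s r n m + (m : ℂ) • tw α s r (s + n) (m - 1)
  let φ : Span (PLabel p s r) →ₗ[ℂ] (tensor p (T p s) (X p α 1 r)).V :=
    Finsupp.linearCombination ℂ fun i : {i // PLabel p s r i} => pv i.1
  have hφ : ∀ i, PLabel p s r i → φ (vec _ i) = pv i := fun i hi => linearCombination_vec pv hi
  have ht : ∀ n m, n ≤ s - 1 → φ (vec _ (.t, n, m)) = tw α s r n m := by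
    intro n m hn
    by_cases h : PLabel p s r (.t, n, m)
    · exact hφ _ h
    · rw [vec_of_not_mem h, map_zero, tw_eq_zero]
      simp only [PLabel] at h; omega
  have hb : ∀ n m, 0 ≤ n → φ (vec _ (.b, n, m)) = bw α s r (p - s + n) m := by
    intro n m hn
    by_cases h : PLabel p s r (.b, n, m)
    · exact hφ _ h
    · rw [vec_of_not_mem h, map_zero, bw_eq_zero]
      simp only [PLabel] at h; omega
  have hl : ∀ n m, 0 ≤ n → n ≤ p - s - 1 → 1 ≤ m → φ (vec _ (.l, n, m)) =
      bw α s r n m + ((m : ℂ) - r) • tw α s r (s + n) (m - 1) := by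
    intro n m hn hn' hm
    by_cases h : PLabel p s r (.l, n, m)
    · exact hφ _ h
    · rw [vec_of_not_mem h, map_zero]
      simp only [PLabel] at h
      rw [bw_eq_zero α (by omega)]
      rcases eq_or_ne m r with rfl | h'
      · simp
      · rw [tw_eq_zero α (by omega), smul_zero, add_zero]
  have hrr : ∀ n m, 0 ≤ n → n ≤ p - s - 1 → φ (vec _ (.r, n, m)) =
      bw α s r n m + (m : ℂ) • tw α s r (s + n) (m - 1) := by
    intro n m hn hn'
    by_cases h : PLabel p s r (.r, n, m)
    · exact hφ _ h
    · rw [vec_of_not_mem h, map_zero]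
      simp only [PLabel] at h
      rw [bw_eq_zero α (by omega), tw_eq_zero α (by omega), smul_zero, add_zero]
  have hhom : IsHom (PNonSimple p α s r) (tensor p (T p s) (X p α 1 r)) φ := by
    refine IsHom.of_h_eq (P_h_eq α) rfl fun g hg v => ?_
    refine LinearMap.congr_fun (f := φ ∘ₗ PAct p α s r g)
      (g := tensorAct p (T p s) (X p α 1 r) g ∘ₗ φ) ?_ v
    refine span_hom_ext ?_
    rintro ⟨c, n, m⟩ h
    rw [LinearMap.comp_apply, LinearMap.comp_apply]
    have hlab := h
    have hk1 : ∀ n : ℤ, -sgn α * q p ^ ((p : ℤ) - s - 1 - 2 * n) =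
        sgn α * q p ^ (-s - 1 - 2 * n) := by
      intro n
      rw [show (p : ℤ) - s - 1 - 2 * n = p + (-s - 1 - 2 * n) by ring, zpow_add₀ hq,
        q_zpow_self hp]
      ring
    have hk2 : ∀ n : ℤ, q p ^ (-s - 1 - 2 * (p - s + n)) = q p ^ (s - 1 - 2 * n) := by
      intro n
      rw [show s - 1 - 2 * n = -s - 1 - 2 * (p - s + n) + 2 * p by ring, zpow_add₀ hq,
        q_zpow_two_mul hp, mul_one]
    have hk3 : ∀ n : ℤ, s - 1 - 2 * (s + n) = -s - 1 - 2 * n := fun n => by ring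
    have hc1 : ∀ n : ℤ, qInt p n * qInt p (-s - n) = -(qInt p n * qInt p (p - s - n)) := by
      intro n
      rw [show (p : ℤ) - s - n = p + (-s - n) by ring, add_comm, qInt_add_self hp]
      ring
    have hc2 : ∀ n : ℤ, qInt p (s + n) * qInt p (s - (s + n)) =
        -(qInt p n * qInt p (p - s - n)) := by
      intro n
      rw [show (p : ℤ) - s - n = p - (s + n) by ring, qInt_self_sub hp,
        show s - (s + n) = -n by ring, qInt_neg]
      ring
    have hc3 : ∀ n : ℤ, qInt p (p - s + n) * qInt p (-s - (p - s + n)) =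
        qInt p n * qInt p (s - n) := by
      intro n
      rw [show (p : ℤ) - s + n = p - (s - n) by ring, qInt_self_sub hp,
        show -s - ((p : ℤ) - (s - n)) = -(p + n) by ring, qInt_neg, add_comm, qInt_add_self hp]
      ring
    refine (congrArg φ (opOf_vec _ hlab)).trans ?_
    match c with
    | .t =>
      obtain ⟨h1, h2, h3, h4⟩ := h
      rw [ht n m h2]
      match g with
      | .K =>
        dsimp only
        rw [map_smul, ht n m h2, tw_K]
      | .E =>
        dsimp only
        rw [tw_E α hp hsp.le h1]
        split_ifs with h0
        · subst h0
          rw [map_add, map_smul, map_smul, hrr _ _ (by omega) (by omega), qInt_zero, mul_zero,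
            zero_mul, zero_smul, zero_add, show s + ((p : ℤ) - s - 1) = p - 1 by ring,
            show 0 + (p : ℤ) - s - 1 = p - s - 1 by ring]
          rcases eq_or_ne m 0 with rfl | hm
          · simp only [Int.cast_zero, sub_zero, mul_zero, zero_div, zero_smul, add_zero]
            congr 1
            field_simp
          · rw [hl _ _ (by omega) (by omega) (by omega),
              show s + ((p : ℤ) - s - 1) = p - 1 by ring]
            match_scalars <;> field_simp <;> ring
        · rw [map_add, map_smul, map_smul, ht _ _ (by omega), hb _ _ (by omega),
            show (p : ℤ) - s + (n - 1) = n + p - s - 1 by ring]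
      | .F =>
        dsimp only
        rw [tw_F α h1]
        split_ifs with h0
        · rw [map_sub, map_smul, map_smul, hrr _ _ (by omega) (by omega),
            hl _ _ (by omega) (by omega) (by omega), add_sub_cancel_right, add_zero,
            show n + 1 = s by omega]
          push_cast
          match_scalars <;> field_simp <;> ring
        · rw [ht _ _ (by omega)]
      | .e =>
        dsimp only
        rw [map_smul, ht _ _ h2, tw_e α hp (by omega) (by omega), bw_eq_zero α (by omega), zero_add]
      | .f =>
        dsimp only
        rw [ht _ _ h2, tw_f α hp (by omega)]
    | .b =>
      obtain ⟨h1, h2, h3, h4⟩ := h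
      rw [hb n m h1]
      match g with
      | .K =>
        dsimp only
        rw [map_smul, hb n m h1, bw_K, hk2]
      | .E =>
        dsimp only
        rw [bw_E α hp, map_smul, mul_assoc, mul_assoc, hc3]
        rcases eq_or_ne n 0 with rfl | h0
        · simp only [qInt_zero, zero_mul, mul_zero, zero_smul]
        · rw [hb _ _ (by omega), add_sub_assoc]
      | .F =>
        dsimp only
        rw [bw_F α (by omega), hb _ _ (by omega), add_assoc]
      | .e =>
        dsimp only
        rw [map_smul, hb _ _ h1, bw_e α hp]
      | .f =>
        dsimp only
        rw [hb _ _ h1, bw_f α hp (by omega) (by omega) (by omega), tw_eq_zero α (by omega),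
          zero_add]
    | .l =>
      obtain ⟨h1, h2, h3, h4⟩ := h
      rw [hl n m h1 h2 h3, map_add, map_smul]
      match g with
      | .K =>
        dsimp only
        rw [map_smul, hl n m h1 h2 h3, bw_K, tw_K, hk1, hk3]
        module
      | .E =>
        dsimp only
        rw [bw_E α hp, tw_E α hp hsp.le (by omega),
          mul_assoc (sgn α) (qInt p n) (qInt p (-s - n)), mul_assoc (sgn α) (qInt p (s + n)), hc1, hc2]
        split_ifs with h0
        · subst h0
          rw [map_smul, hb _ _ (by omega), qInt_zero, show (p : ℤ) - s + (s - 1) = p - 1 by ring,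
            show s + 0 + (p : ℤ) - s - 1 = p - 1 by ring]
          module
        · rw [map_smul, hl _ _ (by omega) (by omega) h3, ← add_sub_assoc,
            bw_eq_zero (n := s + n + (p : ℤ) - s - 1) α (by omega)]
          module
      | .F =>
        dsimp only
        rw [bw_F α h1, tw_F α (by omega)]
        split_ifs with h0
        · rw [hb _ _ le_rfl, tw_eq_zero α (by omega), smul_zero, add_zero, h0]
          congr 1; ring
        · rw [hl _ _ (by omega) (by omega) h3, add_assoc]
      | .e =>
        dsimp only
        rw [map_smul, bw_e α hp, tw_e α hp (by omega) (by omega), add_sub_cancel_left]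
        rcases eq_or_ne m 1 with rfl | h0
        · rw [sub_self, tw_eq_zero α (by omega)]
          push_cast
          module
        · rw [hl _ _ h1 h2 (by omega)]
          push_cast
          module
      | .f =>
        dsimp only
        rw [hl _ _ h1 h2 (by omega), bw_f α hp (by omega) h1 (by omega), tw_f α hp (by omega),
          sub_add_cancel, add_sub_cancel_right, add_comm n s]
        push_cast
        module
    | .r =>
      obtain ⟨h1, h2, h3, h4⟩ := h
      rw [hrr n m h1 h2, map_add, map_smul]
      match g with
      | .K =>
        dsimp only
        rw [map_smul, hrr n m h1 h2, bw_K, tw_K, hk1, hk3]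
        module
      | .E =>
        dsimp only
        rw [bw_E α hp, tw_E α hp hsp.le (by omega),
          mul_assoc (sgn α) (qInt p n) (qInt p (-s - n)), mul_assoc (sgn α) (qInt p (s + n)), hc1, hc2]
        split_ifs with h0
        · subst h0
          rw [map_smul, hb _ _ (by omega), qInt_zero, show (p : ℤ) - s + (s - 1) = p - 1 by ring,
            show s + 0 + (p : ℤ) - s - 1 = p - 1 by ring]
          module
        · rw [map_smul, hrr _ _ (by omega) (by omega), ← add_sub_assoc,
            bw_eq_zero (n := s + n + (p : ℤ) - s - 1) α (by omega)]
          module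
      | .F =>
        dsimp only
        rw [bw_F α h1, tw_F α (by omega)]
        split_ifs with h0
        · rw [hb _ _ le_rfl, tw_eq_zero α (by omega), smul_zero, add_zero, h0]
          congr 1; ring
        · rw [hrr _ _ (by omega) (by omega), add_assoc]
      | .e =>
        dsimp only
        rw [map_smul, bw_e α hp, tw_e α hp (by omega) (by omega), add_sub_cancel_left,
          hrr _ _ h1 h2]
        push_cast
        module
      | .f =>
        dsimp only
        rw [hrr _ _ h1 h2, add_sub_cancel_right]
        rcases eq_or_ne m 0 with rfl | h0
        · rw [bw_f α hp (by omega) h1 (by omega), add_comm n s, tw_eq_zero (m := 0 - 1) α (by omega)]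
          push_cast
          simp
          abel
        · rw [bw_f α hp (by omega) h1 (by omega), tw_f α hp (by omega),
            sub_add_cancel, add_comm n s]
          push_cast
          module
  have hsurj : Function.Surjective φ := by
    refine LinearMap.range_eq_top.1 (eq_top_of_tw_bw α fun n m hn hn' hm hm' => ?_)
    have hts : ∀ n m : ℤ, n < p → 0 ≤ m → m < r → s ≤ n → tw α s r n m ∈ LinearMap.range φ := by
      intro n m hn' hm hm' hsn
      have e1 := hrr (n - s) (m + 1) (by omega) (by omega)
      have e2 := hl (n - s) (m + 1) (by omega) (by omega) (by omega)
      refine mem_of_eq_smul (u := (r : ℂ) • tw α s r n m) ?_ hr0 rfl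
      -- In the difference the `β`-parts cancel and the `τ`-part has coefficient `(m+1) - (m+1-r) =
      -- r`.
      refine ⟨vec _ (.r, n - s, m + 1) - vec _ (.l, n - s, m + 1), ?_⟩
      rw [map_sub, e1, e2, add_sub_cancel_right, add_sub_cancel]
      module
    constructor
    · rcases lt_or_ge n s with h | h
      · exact ⟨vec _ (.t, n, m), ht n m (by omega)⟩
      · exact hts n m hn' hm hm' h
    · rcases lt_or_ge n (p - s) with h | h
      · have e1 := hrr n m hn (by omega)
        rcases eq_or_ne m 0 with rfl | h0
        · exact ⟨vec _ (.r, n, 0), by rw [e1]; simp⟩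
        · rw [← sub_eq_iff_eq_add] at e1
          rw [← e1]
          exact Submodule.sub_mem _ ⟨_, rfl⟩
            (Submodule.smul_mem _ _ (hts _ _ (by omega) (by omega) (by omega) (by omega)))
      · exact ⟨vec _ (.b, n - (p - s), m), by rw [hb _ _ (by omega), add_sub_cancel]⟩
  refine iso_of_surjective hhom hsurj (le_antisymm ?_ ?_)
  swap
  · exact (finrank_top ℂ _).symm.trans_le
      ((LinearMap.range_eq_top.2 hsurj) ▸ LinearMap.finrank_range_le φ)
  have h1 := (finrank_P_le hs hsp hr).2
  have h2 : (Module.finrank ℂ (tensor p (T p s) (X p α 1 r)).V : ℤ) = 2 * p * r := by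
    rw [finrank_tensor, (finrank_T p).2]
    push_cast
    rw [finrank_X' zero_le_one (by omega), one_mul]
  zify
  rw [h2]
  exact h1

end

noncomputable section

open GenAction

variable {p : ℕ}

/-! ### Representations of the quantum group in an algebra -/

/-- The family `a` satisfies the relations of the quantum group. -/
def HasAct (p : ℕ) {R : Type} [Ring R] [Algebra ℂ R] (a : Gen → R) : Prop :=
  ∃ π : LU p →ₐ[ℂ] R, ∀ g, π (LU.gen p g) = a g

section HasAct

variable {R S : Type} [Ring R] [Algebra ℂ R] [Ring S] [Algebra ℂ S]

/-- The universal property of the presented algebra: a representation is a finite list of equations,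
one for each constructor of `Rel`. -/
theorem hasAct_iff {a : Gen → R} : HasAct p a ↔
    ∀ u v, Rel p u v → FreeAlgebra.lift ℂ a u = FreeAlgebra.lift ℂ a v := by
  constructor
  · rintro ⟨π, h⟩ u v huv
    have h1 : FreeAlgebra.lift ℂ a = π.comp (RingQuot.mkAlgHom ℂ (Rel p)) := by
      refine FreeAlgebra.hom_ext (funext fun g => ?_)
      simp only [Function.comp_apply, FreeAlgebra.lift_ι_apply]
      exact (h g).symm
    rw [h1, AlgHom.comp_apply, AlgHom.comp_apply, RingQuot.mkAlgHom_rel ℂ huv]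
  · intro h
    refine ⟨RingQuot.liftAlgHom ℂ ⟨FreeAlgebra.lift ℂ a, fun u v huv => h u v huv⟩, fun g => ?_⟩
    exact (RingQuot.liftAlgHom_mkAlgHom_apply ..).trans (FreeAlgebra.lift_ι_apply ..)

theorem HasAct.map {a : Gen → R} (h : HasAct p a) (φ : R →ₐ[ℂ] S) :
    HasAct p fun g => φ (a g) := by
  obtain ⟨π, hπ⟩ := h
  exact ⟨φ.comp π, fun g => congrArg φ (hπ g)⟩

theorem map_invK (φ : R →ₐ[ℂ] S) (K : R) : φ (invK p K) = invK p (φ K) := by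
  simp [invK]

theorem map_shiftedCartan (φ : R →ₐ[ℂ] S) (K : R) :
    φ (shiftedCartan p K) = shiftedCartan p (φ K) := by
  simp [shiftedCartan, map_invK]

theorem map_casimir (φ : R →ₐ[ℂ] S) (E F K : R) :
    φ (casimir p E F K) = casimir p (φ E) (φ F) (φ K) := by
  simp [casimir, map_invK]

theorem map_elementA (φ : R →ₐ[ℂ] S) (E F K : R) :
    φ (elementA p E F K) = elementA p (φ E) (φ F) (φ K) := by
  simp [elementA, ← Polynomial.aeval_algHom_apply, map_casimir]

theorem hasAct_of_relations {a : Gen → R}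
    (KE : a .K * a .E * invK p (a .K) = (q p ^ 2) • a .E)
    (KF : a .K * a .F * invK p (a .K) = (q p ^ (-2 : ℤ)) • a .F)
    (EF : a .E * a .F - a .F * a .E = (q p - (q p)⁻¹)⁻¹ • (a .K - invK p (a .K)))
    (E_pow : a .E ^ p = 0) (F_pow : a .F ^ p = 0) (K_pow : a .K ^ (2 * p) = 1)
    (he : a .h * a .e - a .e * a .h = a .e) (hf : a .h * a .f - a .f * a .h = -a .f)
    (ef : a .e * a .f - a .f * a .e = (2 : ℂ) • a .h)
    (hK : a .h * a .K = a .K * a .h) (Ee : a .E * a .e = a .e * a .E)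
    (Ke : a .K * a .e = a .e * a .K) (Ff : a .F * a .f = a .f * a .F)
    (Kf : a .K * a .f = a .f * a .K)
    (Fe : a .F * a .e - a .e * a .F =
      (1 / qFact p (p - 1)) • (a .K ^ p * shiftedCartan p (a .K) * a .E ^ (p - 1)))
    (Ef : a .E * a .f - a .f * a .E =
      ((-1) ^ (p + 1) / qFact p (p - 1)) • (a .F ^ (p - 1) * shiftedCartan p (a .K)))
    (hE : a .h * a .E - a .E * a .h =
      (1 / 2 : ℂ) • (a .E * elementA p (a .E) (a .F) (a .K)))
    (hF : a .h * a .F - a .F * a .h =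
      (-1 / 2 : ℂ) • (elementA p (a .E) (a .F) (a .K) * a .F)) : HasAct p a := by
  rw [hasAct_iff]
  intro u v huv
  cases huv <;> simp only [map_mul, map_sub, map_smul, map_pow, map_neg, map_zero, map_one, map_invK,
    map_shiftedCartan, map_elementA, FreeAlgebra.lift_ι_apply] <;> assumption

/-- Twisting a representation by a commuting representation of `sl(2)`. -/
theorem HasAct.add_commuting {a b : Gen → R} (ha : HasAct p a) {e f h : R}
    (he : h * e - e * h = e) (hf : h * f - f * h = -f) (hef : e * f - f * e = (2 : ℂ) • h)
    (hca : ∀ g, Commute (a g) e ∧ Commute (a g) f ∧ Commute (a g) h)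
    (hE : b .E = a .E) (hF : b .F = a .F) (hK : b .K = a .K) (hbe : b .e = a .e + e)
    (hbf : b .f = a .f + f) (hbh : b .h = a .h + h) : HasAct p b := by
  rw [hasAct_iff] at ha
  have cE := hca .E
  have cF := hca .F
  have cK := hca .K
  have ce := hca .e
  have cf := hca .f
  have ch := hca .h
  simp only [Commute, SemiconjBy] at cE cF cK ce cf ch
  have r1 := ha _ _ .KE
  have r2 := ha _ _ .KF
  have r3 := ha _ _ .EF
  have r4 := ha _ _ .E_pow
  have r5 := ha _ _ .F_pow
  have r6 := ha _ _ .K_pow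
  have r7 := ha _ _ .he
  have r8 := ha _ _ .hf
  have r9 := ha _ _ .ef
  have r10 := ha _ _ .hK
  have r11 := ha _ _ .Ee
  have r12 := ha _ _ .Ke
  have r13 := ha _ _ .Ff
  have r14 := ha _ _ .Kf
  have r15 := ha _ _ .Fe
  have r16 := ha _ _ .Ef
  have r17 := ha _ _ .hE
  have r18 := ha _ _ .hF
  simp only [map_mul, map_sub, map_smul, map_pow, map_neg, map_zero, map_one, map_invK,
    map_shiftedCartan, map_elementA, FreeAlgebra.lift_ι_apply]
    at r1 r2 r3 r4 r5 r6 r7 r8 r9 r10 r11 r12 r13 r14 r15 r16 r17 r18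
  refine hasAct_of_relations ?_ ?_ ?_ ?_ ?_ ?_ ?_ ?_ ?_ ?_ ?_ ?_ ?_ ?_ ?_ ?_ ?_ ?_ <;>
    simp only [hE, hF, hK, hbe, hbf, hbh, mul_add, add_mul]
  · exact r1
  · exact r2
  · exact r3
  · exact r4
  · exact r5
  · exact r6
  · linear_combination (norm := noncomm_ring) r7 + he + ch.1 - ce.2.2
  · linear_combination (norm := noncomm_ring) r8 + hf + ch.2.1 - cf.2.2
  · rw [smul_add]
    linear_combination (norm := noncomm_ring) r9 + hef + ce.2.1 - cf.1
  · linear_combination (norm := noncomm_ring) r10 - cK.2.2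
  · linear_combination (norm := noncomm_ring) r11 + cE.1
  · linear_combination (norm := noncomm_ring) r12 + cK.1
  · linear_combination (norm := noncomm_ring) r13 + cF.2.1
  · linear_combination (norm := noncomm_ring) r14 + cK.2.1
  · rw [← r15]
    linear_combination (norm := noncomm_ring) cF.1
  · rw [← r16]
    linear_combination (norm := noncomm_ring) cE.2.1
  · rw [← r17]
    linear_combination (norm := noncomm_ring) -cE.2.2
  · rw [← r18]
    linear_combination (norm := noncomm_ring) -cF.2.2

end HasAct

/-! ### The element `A` -/

theorem aeval_apply_of_apply_eq {V : Type} [AddCommGroup V] [Module ℂ V] {K : Module.End ℂ V}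
    {c : ℂ} {v : V} (hv : K v = c • v) (f : Polynomial ℂ) :
    Polynomial.aeval K f v = f.eval c • v := by
  induction f using Polynomial.induction_on with
  | C a => simp [Algebra.algebraMap_eq_smul_one]
  | add f g hf hg => simp [hf, hg, add_smul]
  | monomial n a h => 
    rw [pow_succ, ← mul_assoc, map_mul, Polynomial.aeval_X, Module.End.mul_apply, hv, map_smul, h,
      smul_smul, Polynomial.eval_mul (p := _ * _), Polynomial.eval_X, mul_comm]

section Polynomials

/-- Up to a unit, `β_i - β_j` is `(q^i - q^j)(q^(i+j) - 1)`, and for indices from `0` to `p` neither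
factor vanishes unless `i = j`. -/
theorem casimirValue_inj (hp : 2 ≤ p) {i j : ℤ} (hi : 0 ≤ i) (hip : i ≤ p) (hj : 0 ≤ j)
    (hjp : j ≤ p) (h : casimirValue p i = casimirValue p j) : i = j := by
  have hq := q_ne_zero p
  have h1 : (q p ^ i - q p ^ j) * (q p ^ (i + j) - 1) = 0 := by
    rw [casimirValue, casimirValue] at h
    rw [zpow_neg, zpow_neg] at h
    have hi' := zpow_ne_zero i hq
    have hj' := zpow_ne_zero j hq
    rw [zpow_add₀ hq]
    field_simp at h
    linear_combination h
  rcases mul_eq_zero.1 h1 with h2 | h2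
  · obtain ⟨c, hc⟩ := (q_zpow_eq_iff hp _ _).1 (sub_eq_zero.1 h2)
    have : c = 0 := by
      rcases lt_trichotomy c 0 with h3 | h3 | h3
      · nlinarith
      · exact h3
      · nlinarith
    subst this; linarith
  · obtain ⟨c, hc⟩ := (q_zpow_eq_iff hp (i + j) 0).1 (by rw [sub_eq_zero.1 h2, zpow_zero])
    have h4 : 0 ≤ c := by by_contra h3; nlinarith
    have h5 : c ≤ 1 := by by_contra h3; nlinarith
    obtain rfl | rfl : c = 0 ∨ c = 1 := by omega
    · omega
    · omega

theorem psi_eval_ne_zero (hp : 2 ≤ p) {s : ℕ} (hs : 1 ≤ s) (hsp : s < p) :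
    (psi p s).eval (casimirValue p s) ≠ 0 := by
  simp only [psi, Polynomial.eval_mul, Polynomial.eval_sub, Polynomial.eval_X, Polynomial.eval_C,
    Polynomial.eval_prod, Polynomial.eval_pow]
  refine mul_ne_zero (mul_ne_zero ?_ ?_) (Finset.prod_ne_zero_iff.2 fun j hj => pow_ne_zero _ ?_) <;>
    refine fun h => ?_
  · have := casimirValue_inj hp (by omega) (by omega) (by omega) (by omega) (sub_eq_zero.1 h)
    omega
  · have := casimirValue_inj hp (by omega) (by omega) (by omega) (by omega) (sub_eq_zero.1 h)
    omega
  · simp only [Finset.mem_erase, Finset.mem_Icc] at hj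
    have := casimirValue_inj hp (by omega) (by omega) (by omega) (by omega) (sub_eq_zero.1 h)
    omega

-- The linear correction in the idempotent polynomial gives it value 1 and derivative 0 at `β_s`.
-- Agreement to second order is needed because the Casimir element is not diagonalisable on `T_s`.
open Polynomial in
theorem sq_dvd_idemPoly_sub_one (hp : 2 ≤ p) {s : ℕ} (hs : 1 ≤ s) (hsp : s < p) :
    (Polynomial.X - C (casimirValue p s)) ^ 2 ∣ idemPoly p s - 1 := by
  have h0 := psi_eval_ne_zero hp hs hsp
  have h1 : ∀ f : ℂ[X], f.eval (casimirValue p s) = 0 → f.derivative.eval (casimirValue p s) = 0 →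
      (Polynomial.X - C (casimirValue p s)) ^ 2 ∣ f := by
    intro f hf hf'
    obtain ⟨g, rfl⟩ := dvd_iff_isRoot.2 hf
    simp only [derivative_mul, derivative_sub, derivative_X, derivative_C, eval_add, eval_mul,
      eval_sub, eval_X, eval_C, sub_zero, eval_one, one_mul, sub_self, zero_mul, add_zero] at hf'
    obtain ⟨k, rfl⟩ := dvd_iff_isRoot.2 hf'
    exact ⟨k, by ring⟩
  refine h1 _ ?_ ?_
  · simp only [idemPoly, eval_add, eval_mul, eval_sub, eval_X, eval_C, eval_one]
    field_simp
    ring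
  · simp only [idemPoly, derivative_mul, derivative_sub, derivative_X, derivative_C, eval_add,
      eval_mul, eval_sub, eval_X, eval_C, eval_one, derivative_one, eval_zero]
    field_simp
    ring

open Polynomial in
theorem psi_dvd_idemPoly (s : ℕ) : psi p s ∣ idemPoly p s := by
  rw [idemPoly]
  exact Dvd.dvd.mul_left (dvd_sub dvd_rfl (Dvd.intro_left _ rfl)) _

open Polynomial in
theorem sq_dvd_idemPoly {s j : ℕ} (hj : 1 ≤ j) (hjp : j < p) (hjs : j ≠ s) :
    (Polynomial.X - C (casimirValue p j)) ^ 2 ∣ idemPoly p s := by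
  refine dvd_trans ?_ (psi_dvd_idemPoly s)
  rw [psi]
  exact Dvd.dvd.mul_left (Finset.dvd_prod_of_mem (fun j : ℕ => (Polynomial.X - C (casimirValue p j)) ^ 2)
    (Finset.mem_erase.2 ⟨hjs, Finset.mem_Icc.2 ⟨hj, by omega⟩⟩)) _

open Polynomial in
theorem dvd_idemPoly (s : ℕ) : (Polynomial.X - C (casimirValue p 0)) ∣ idemPoly p s ∧
    (Polynomial.X - C (casimirValue p p)) ∣ idemPoly p s := by
  refine ⟨dvd_trans ?_ (psi_dvd_idemPoly s), dvd_trans ?_ (psi_dvd_idemPoly s)⟩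
  · rw [psi, mul_assoc]; exact Dvd.intro _ rfl
  · rw [psi, mul_comm (Polynomial.X - C _), mul_assoc]; exact Dvd.intro _ rfl

theorem q_zpow_eq_iff_of_lt (hp : 2 ≤ p) {s n m : ℤ} (hn : 0 ≤ n) (hnp : n < p) (hm : 0 ≤ m)
    (hmp : m < p) : q p ^ (s - 1 - 2 * n) = q p ^ (s - 1 - 2 * m) ↔ n = m := by
  refine ⟨fun h => ?_, fun h => by rw [h]⟩
  obtain ⟨c, hc⟩ := (q_zpow_eq_iff hp _ _).1 h
  have h1 : c < 1 := by by_contra h3; nlinarith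
  have h2 : -1 < c := by by_contra h3; nlinarith
  obtain rfl : c = 0 := by omega
  omega

open Polynomial in
theorem uPoly_eval (hp : 2 ≤ p) {s : ℕ} {n : ℤ} (hn : 0 ≤ n) (hnp : n < p) :
    (uPoly p s).eval (q p ^ ((s : ℤ) - 1 - 2 * n)) = 0 ↔ n ≠ 0 ∧ n ≠ s := by
  simp only [uPoly, eval_prod, Finset.prod_eq_zero_iff, eval_sub, eval_X, eval_C, sub_eq_zero,
    Finset.mem_erase, Finset.mem_Icc]
  constructor
  · rintro ⟨m, ⟨h1, h2, h3⟩, h4⟩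
    rw [q_zpow_eq_iff_of_lt hp hn hnp (by omega) (by omega)] at h4
    omega
  · rintro ⟨h1, h2⟩
    refine ⟨n.toNat, by omega, ?_⟩
    rw [Int.toNat_of_nonneg hn]

-- Lagrange interpolation: among the weights of index `0` to `p - 1`, the polynomial `u_s` is
-- nonzero only at `n = 0` and `n = s`, and the linear factor takes the values `1/u_s` at these two
-- points.
open Polynomial in
theorem aPoly_eval (hp : 2 ≤ p) {s : ℕ} (hs : 1 ≤ s) (hsp : s < p) {n : ℤ} (hn : 0 ≤ n)
    (hnp : n < p) : (aPoly p s).eval (q p ^ ((s : ℤ) - 1 - 2 * n)) =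
      if n = 0 ∨ n = s then 1 else 0 := by
  have h0 := uPoly_eval hp (s := s) (n := 0) le_rfl (by omega)
  have h1 := uPoly_eval hp (s := s) (n := s) (by omega) (by omega)
  have h2 := q_zpow_eq_iff_of_lt hp (s := s) (n := 0) (m := s) le_rfl (by omega) (by omega)
    (by omega)
  simp only [show (s : ℤ) - 1 - 2 * s = -s - 1 by ring, show (s : ℤ) - 1 - 2 * 0 = s - 1 by ring]
    at h0 h1 h2
  have h0' : (uPoly p s).eval (q p ^ ((s : ℤ) - 1)) ≠ 0 := fun h => (h0.1 h).1 rfl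
  have h1' : (uPoly p s).eval (q p ^ (-(s : ℤ) - 1)) ≠ 0 := fun h => (h1.1 h).2 rfl
  have h2' : q p ^ ((s : ℤ) - 1) - q p ^ (-(s : ℤ) - 1) ≠ 0 := fun h => by
    have := h2.1 (sub_eq_zero.1 h); omega
  simp only [aPoly, eval_mul, eval_add, eval_X, eval_C]
  split_ifs with h
  · obtain rfl | rfl := h
    · rw [show (s : ℤ) - 1 - 2 * 0 = s - 1 by ring]
      field_simp
      ring
    · rw [show (s : ℤ) - 1 - 2 * s = -s - 1 by ring]
      field_simp
      ring
  · rw [(uPoly_eval hp hn hnp).2 (by tauto), mul_zero]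

end Polynomials

section ElementA

variable {V : Type} [AddCommGroup V] [Module ℂ V] {E F K : Module.End ℂ V}

-- If `(C - β_s)² = 0`, the idempotents `e_t` act by 0 for `t ≠ s` and by 1 for `t = s`. Only one
-- summand of `A` is left, a polynomial in `K`, which is evaluated on the weight vector.
open Polynomial in
theorem elementA_apply (hp : 2 ≤ p) {s : ℕ} (hs : 1 ≤ s) (hsp : s < p)
    (hC : (casimir p E F K - casimirValue p s • 1) ^ 2 = 0) {n : ℤ} (hn : 0 ≤ n) (hnp : n < p)
    {v : V} (hv : K v = q p ^ ((s : ℤ) - 1 - 2 * n) • v) :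
    elementA p E F K v = if n = 0 ∨ n = s then v else 0 := by
  have h0 : aeval (casimir p E F K) ((Polynomial.X - C (casimirValue p s)) ^ 2) = 0 := by
    rw [map_pow, map_sub, aeval_X, aeval_C, Algebra.algebraMap_eq_smul_one, hC]
  have h1 : ∀ t ∈ Finset.Icc 1 (p - 1), aeval (casimir p E F K) (idemPoly p t) =
      if t = s then 1 else 0 := by
    intro t ht
    split_ifs with h
    · subst h
      obtain ⟨g, hg⟩ := sq_dvd_idemPoly_sub_one hp hs hsp
      rw [← sub_eq_zero, ← map_one (aeval (R := ℂ) (casimir p E F K)), ← map_sub, hg, map_mul, h0, zero_mul]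
    · obtain ⟨g, hg⟩ := sq_dvd_idemPoly hs hsp (Ne.symm h)
      rw [hg, map_mul, h0, zero_mul]
  rw [elementA, Finset.sum_congr rfl fun t ht => by rw [h1 t ht, mul_ite, mul_one, mul_zero],
    Finset.sum_ite_eq' _ s, if_pos (Finset.mem_Icc.2 ⟨hs, by omega⟩)]
  rw [aeval_apply_of_apply_eq hv]
  rw [aPoly_eval hp hs hsp hn hnp, ite_smul, one_smul, zero_smul]

-- Every idempotent polynomial vanishes at `β_0` and `β_p`. These factors occur to the first power,
-- so the Casimir element has to be a scalar here.
open Polynomial in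
theorem elementA_eq_zero
    (hC : casimir p E F K = casimirValue p 0 • 1 ∨ casimir p E F K = casimirValue p p • 1) :
    elementA p E F K = 0 := by
  refine Finset.sum_eq_zero fun t ht => ?_
  rcases hC with h | h
  · obtain ⟨g, hg⟩ := (dvd_idemPoly (p := p) t).1
    rw [hg, map_mul, map_sub, aeval_X, aeval_C, Algebra.algebraMap_eq_smul_one, h, sub_self,
      zero_mul, mul_zero]
  · obtain ⟨g, hg⟩ := (dvd_idemPoly (p := p) t).2
    rw [hg, map_mul, map_sub, aeval_X, aeval_C, Algebra.algebraMap_eq_smul_one, h, sub_self,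
      zero_mul, mul_zero]

end ElementA

end

noncomputable section

open GenAction

variable {p : ℕ}

/-! ### The modules are representations of the quantum group -/

section Operators

variable {V : Type} [AddCommGroup V] [Module ℂ V] {E F K : Module.End ℂ V}

theorem invK_apply (hp : 2 ≤ p) {j : ℤ} {v : V} (hv : K v = q p ^ j • v) :
    invK p K v = q p ^ (-j) • v := by
  have h := aeval_apply_of_apply_eq hv (Polynomial.X ^ (2 * p - 1))
  rw [map_pow, Polynomial.aeval_X, Polynomial.eval_pow, Polynomial.eval_X] at h
  rw [invK, h, ← zpow_natCast, ← zpow_mul, Nat.cast_sub (by omega)]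
  push_cast
  rw [show j * (2 * (p : ℤ) - 1) = -j + 2 * p * j by ring, zpow_add₀ (q_ne_zero p), zpow_mul,
    q_zpow_two_mul hp, one_zpow, mul_one]

theorem shiftedCartan_apply (hp : 2 ≤ p) {j : ℤ} {v : V} (hv : K v = q p ^ j • v) :
    shiftedCartan p K v = qInt p (j + 1) • v := by
  have hq := q_ne_zero p
  rw [shiftedCartan, LinearMap.smul_apply, LinearMap.sub_apply, LinearMap.smul_apply,
    LinearMap.smul_apply, invK_apply hp hv, hv, smul_smul, smul_smul, ← sub_smul, smul_smul, qInt,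
    neg_add, zpow_add₀ hq, zpow_add₀ hq, zpow_one, zpow_neg_one]
  congr 1
  ring

theorem invK_sgn_smul (hp : 2 ≤ p) (α : ℤˣ) : invK p (sgn α • K) = sgn α • invK p K := by
  rw [invK, smul_pow, sgn_pow_two_mul_sub_one hp, invK]

theorem shiftedCartan_sgn_smul (hp : 2 ≤ p) (α : ℤˣ) :
    shiftedCartan p (sgn α • K) = sgn α • shiftedCartan p K := by
  rw [shiftedCartan, shiftedCartan, invK_sgn_smul hp]
  module

theorem casimir_sgn_smul (hp : 2 ≤ p) (α : ℤˣ) :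
    casimir p (sgn α • E) F (sgn α • K) = sgn α • casimir p E F K := by
  rw [casimir, casimir, invK_sgn_smul hp, smul_mul_assoc]
  module

/-- The vector `w` is zero on strings that `E F` maps to multiples of themselves. On the string of
`τ` it is the coupling term, responsible for the nilpotent part of the Casimir element. -/
theorem casimir_apply (hp : 2 ≤ p) {s n : ℤ} {v w : V} (hK : K v = q p ^ (s - 1 - 2 * n) • v)
    (hEF : E (F v) = (qInt p (n + 1) * qInt p (s - (n + 1))) • v + w) :
    casimir p E F K v = casimirValue p s • v + ((q p - (q p)⁻¹) ^ 2) • w := by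
  have hq := q_ne_zero p
  have hd := q_sq_sub_one_ne_zero hp
  rw [casimir, LinearMap.add_apply, LinearMap.add_apply, LinearMap.smul_apply,
    LinearMap.smul_apply, LinearMap.smul_apply, Module.End.mul_apply, invK_apply hp hK, hK, hEF,
    casimirValue]
  have hd' := q_sub_inv_ne_zero hp
  have key : (q p - (q p)⁻¹) ^ 2 * (qInt p (n + 1) * qInt p (s - (n + 1))) +
      ((q p)⁻¹ * q p ^ (s - 1 - 2 * n) + q p * q p ^ (-(s - 1 - 2 * n))) =
      q p ^ s + q p ^ (-s) := by
    simp only [qInt]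
    field_simp
    simp only [neg_sub, neg_add, neg_neg, two_mul, zpow_add₀ hq, zpow_sub₀ hq, zpow_neg, zpow_one]
    field_simp
    ring
  rw [← key]
  module

theorem casimirValue_sub (hp : 2 ≤ p) (s : ℤ) : casimirValue p (p - s) = -casimirValue p s := by
  have hq := q_ne_zero p
  rw [casimirValue, casimirValue, neg_sub, zpow_sub₀ hq, zpow_sub₀ hq, zpow_neg,
    q_zpow_self hp]
  field_simp
  ring

/-- The sign `-1` turns `β_s` into `-β_s = β_{p-s}` and shifts the index of a weight by `s` modulo
`p`. This exchanges the distinguished indices `0` and `s` with those for `p - s`, so `A` acts in the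
same way. -/
theorem elementA_apply_sgn (hp : 2 ≤ p) (α : ℤˣ) {s : ℕ} (hs : 1 ≤ s) (hsp : s < p)
    (hC : (casimir p E F K - casimirValue p s • 1) ^ 2 = 0) {n : ℤ} (hn : 0 ≤ n) (hnp : n < p)
    {v : V} (hv : K v = q p ^ ((s : ℤ) - 1 - 2 * n) • v) :
    elementA p (sgn α • E) F (sgn α • K) v = if n = 0 ∨ n = s then v else 0 := by
  have hq := q_ne_zero p
  rcases Int.units_eq_one_or α with rfl | rfl
  · rw [show sgn 1 = 1 by simp [sgn], one_smul, one_smul]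
    exact elementA_apply hp hs hsp hC hn hnp hv
  · obtain ⟨t, rfl⟩ : ∃ t, p = s + t := ⟨p - s, by omega⟩
    have hC' : (casimir (s + t) (sgn (-1) • E) F (sgn (-1) • K) - casimirValue (s + t) t • 1) ^ 2 =
        0 := by
      have h := casimirValue_sub hp t
      rw [show ((s + t : ℕ) : ℤ) - t = s by push_cast; ring] at h
      rw [casimir_sgn_smul hp, ← neg_neg (casimirValue (s + t) t), ← h]
      simp only [sgn, Units.val_neg, Units.val_one, Int.cast_neg, Int.cast_one]
      rw [neg_smul, neg_smul, one_smul, ← neg_sub', neg_sq, hC]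
    have hv' : ∀ m : ℤ, ((s + t : ℕ) : ℤ) ∣ m - (n - s) → (sgn (-1) • K) v =
        q (s + t) ^ ((t : ℤ) - 1 - 2 * m) • v := by
      rintro m ⟨c, hc⟩
      rw [LinearMap.smul_apply, hv, show (t : ℤ) - 1 - 2 * m =
        ((s : ℤ) - 1 - 2 * n) + (s + t : ℕ) + 2 * (s + t : ℕ) * (-c) by push_cast at hc ⊢; linarith,
        zpow_add₀ hq, zpow_add₀ hq, zpow_mul, q_zpow_two_mul hp, one_zpow, q_zpow_self hp,
        smul_smul]
      simp [sgn]
    rcases lt_or_ge n s with h | h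
    · rw [elementA_apply hp (by omega) (by omega) hC' (n := n - s + (s + t : ℕ)) (by omega)
        (by omega) (hv' _ ⟨1, by ring⟩)]
      exact if_congr (by omega) rfl rfl
    · rw [elementA_apply hp (by omega) (by omega) hC' (n := n - s) (by omega)
        (by omega) (hv' _ ⟨0, by ring⟩)]
      exact if_congr (by omega) rfl rfl

theorem elementA_apply_sgn_of_eq (hp : 2 ≤ p) (α : ℤˣ) {s : ℕ} (hs : 1 ≤ s) (hsp : s < p)
    (hC : casimir p E F K = casimirValue p s • 1) {n : ℤ} (hn : 0 ≤ n) (hnp : n < p)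
    {v : V} (hv : K v = q p ^ ((s : ℤ) - 1 - 2 * n) • v) :
    elementA p (sgn α • E) F (sgn α • K) v = if n = 0 ∨ n = s then v else 0 :=
  elementA_apply_sgn hp α hs hsp (by rw [hC, sub_self, zero_pow two_ne_zero]) hn hnp hv

theorem elementA_sgn_eq_zero (hp : 2 ≤ p) (α : ℤˣ)
    (hC : casimir p E F K = casimirValue p p • 1) :
    elementA p (sgn α • E) F (sgn α • K) = 0 := by
  have h := casimirValue_sub hp p
  rw [sub_self] at h
  rw [elementA_eq_zero]
  rw [casimir_sgn_smul hp, hC, h]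
  rcases Int.units_eq_one_or α with rfl | rfl
  · right; simp [sgn]
  · left
    simp [sgn]

theorem K_pow_apply (hp : 2 ≤ p) {j : ℤ} {v : V} (hv : K v = q p ^ j • v) :
    (K ^ p) v = (-1 : ℂ) ^ j • v := by
  have h := aeval_apply_of_apply_eq hv (Polynomial.X ^ p)
  rw [map_pow, Polynomial.aeval_X, Polynomial.eval_pow, Polynomial.eval_X] at h
  rw [h, ← zpow_natCast, ← zpow_mul, mul_comm, zpow_mul, q_zpow_self hp]

theorem commutator_apply (hp : 2 ≤ p) {s n : ℤ} {v w : V} (hK : K v = q p ^ (s - 1 - 2 * n) • v)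
    (hEF : E (F v) = (qInt p (n + 1) * qInt p (s - (n + 1))) • v + w)
    (hFE : F (E v) = (qInt p n * qInt p (s - n)) • v + w) :
    (E * F - F * E) v = ((q p - (q p)⁻¹)⁻¹ • (K - invK p K)) v := by
  have hq := q_ne_zero p
  have hd := q_sq_sub_one_ne_zero hp
  rw [LinearMap.sub_apply, LinearMap.smul_apply, LinearMap.sub_apply, Module.End.mul_apply,
    Module.End.mul_apply, hEF, hFE, hK, invK_apply hp hK, add_sub_add_right_eq_sub, ← sub_smul,
    ← sub_smul, smul_smul]
  congr 1
  have hd' := q_sub_inv_ne_zero hp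
  simp only [qInt]
  field_simp
  simp only [neg_sub, neg_add, neg_neg, two_mul, zpow_add₀ hq, zpow_sub₀ hq, zpow_neg, zpow_one]
  field_simp
  ring

end Operators

/-- Twisting the operators by a sign. -/
def twist {R : Type} [Ring R] [Algebra ℂ R] (α : ℤˣ) (a : Gen → R) : Gen → R
  | .E => sgn α • a .E
  | .K => sgn α • a .K
  | g => a g

theorem sgn_pow_two_mul (α : ℤˣ) (k : ℕ) : sgn α ^ (2 * k) = 1 := by
  rw [pow_mul, pow_two, sgn_mul_self, one_pow]

/-- Except in `A`, the sign cancels from every relation, since it occurs on both sides or to the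
power `2p`. So the relations have to be checked for `M` itself, with `A` alone formed from the
twisted operators. -/
theorem hasAct_twist (hp : 2 ≤ p) (α : ℤˣ) {M : GenAction} (hM : Good p M)
    (EF : M.act .E * M.act .F - M.act .F * M.act .E =
      (q p - (q p)⁻¹)⁻¹ • (M.act .K - invK p (M.act .K)))
    (E_pow : M.act .E ^ p = 0) (F_pow : M.act .F ^ p = 0)
    (he : M.act .h * M.act .e - M.act .e * M.act .h = M.act .e)
    (hf : M.act .h * M.act .f - M.act .f * M.act .h = -M.act .f)
    (Ee : M.act .E * M.act .e = M.act .e * M.act .E)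
    (Ke : M.act .K * M.act .e = M.act .e * M.act .K)
    (Ff : M.act .F * M.act .f = M.act .f * M.act .F)
    (Kf : M.act .K * M.act .f = M.act .f * M.act .K)
    (Fe : M.act .F * M.act .e - M.act .e * M.act .F = (1 / qFact p (p - 1)) •
      (M.act .K ^ p * shiftedCartan p (M.act .K) * M.act .E ^ (p - 1)))
    (Ef : M.act .E * M.act .f - M.act .f * M.act .E = ((-1) ^ (p + 1) / qFact p (p - 1)) •
      (M.act .F ^ (p - 1) * shiftedCartan p (M.act .K)))
    (hE : M.act .h * M.act .E - M.act .E * M.act .h = (1 / 2 : ℂ) •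
      (M.act .E * elementA p (sgn α • M.act .E) (M.act .F) (sgn α • M.act .K)))
    (hF : M.act .h * M.act .F - M.act .F * M.act .h = (-1 / 2 : ℂ) •
      (elementA p (sgn α • M.act .E) (M.act .F) (sgn α • M.act .K) * M.act .F)) :
    HasAct p (twist α M.act) := by
  have h2 := sgn_mul_self α
  have hK' : ∀ X : Module.End ℂ M.V, X * M.act .K * invK p (M.act .K) = X := by
    intro X
    rw [invK, mul_assoc, ← pow_succ', show 2 * p - 1 + 1 = 2 * p by omega, hM.K_pow, mul_one]
  refine hasAct_of_relations ?_ ?_ ?_ ?_ ?_ ?_ ?_ ?_ ?_ ?_ ?_ ?_ ?_ ?_ ?_ ?_ ?_ ?_ <;>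
    simp only [twist, invK_sgn_smul hp, shiftedCartan_sgn_smul hp, smul_mul_assoc, mul_smul_comm,
      smul_smul, smul_pow, h2, one_smul]
  · rw [hM.KE, smul_mul_assoc, hK', smul_smul, mul_comm, ← zpow_natCast]; rfl
  · rw [hM.KF, smul_mul_assoc, hK']
  · rw [← smul_sub, EF]; module
  · rw [E_pow, smul_zero]
  · exact F_pow
  · rw [hM.K_pow, sgn_pow_two_mul, one_smul]
  · exact he
  · exact hf
  · rw [hM.h_eq]; module
  · congr 1
    rw [hM.h_eq]
    simp only [smul_mul_assoc, mul_smul_comm, sub_mul, mul_sub]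
    rw [mul_assoc, mul_assoc, ← Kf, ← Ke, ← mul_assoc, ← mul_assoc, ← Ke, ← Kf, mul_assoc,
      mul_assoc]
  · rw [Ee]
  · rw [Ke]
  · exact Ff
  · rw [Kf]
  · rw [Fe, show sgn α ^ (p - 1) * (sgn α * sgn α ^ p) = sgn α ^ (2 * p) by
      rw [← pow_succ', ← pow_add]; congr 1; omega, sgn_pow_two_mul, mul_one]
  · rw [← smul_sub, Ef, smul_smul, mul_comm]
  · rw [← smul_sub, hE]
    module
  · exact hF

theorem hasAct_twist_of_eq_zero (hp : 2 ≤ p) (α : ℤˣ) {M : GenAction} (hM : Good p M)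
    (he : M.act .e = 0) (hf : M.act .f = 0)
    (EF : M.act .E * M.act .F - M.act .F * M.act .E =
      (q p - (q p)⁻¹)⁻¹ • (M.act .K - invK p (M.act .K)))
    (E_pow : M.act .E ^ p = 0) (F_pow : M.act .F ^ p = 0)
    (Fe : M.act .K ^ p * shiftedCartan p (M.act .K) * M.act .E ^ (p - 1) = 0)
    (Ef : M.act .F ^ (p - 1) * shiftedCartan p (M.act .K) = 0)
    (hE : M.act .E * elementA p (sgn α • M.act .E) (M.act .F) (sgn α • M.act .K) = 0)
    (hF : elementA p (sgn α • M.act .E) (M.act .F) (sgn α • M.act .K) * M.act .F = 0) :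
    HasAct p (twist α M.act) := by
  have hh : M.act .h = 0 := by rw [hM.h_eq, he, hf, mul_zero, sub_self, smul_zero]
  refine hasAct_twist hp α hM EF E_pow F_pow ?_ ?_ ?_ ?_ ?_ ?_ ?_ ?_ ?_ ?_ <;>
    simp only [he, hf, hh, Fe, Ef, hE, hF, mul_zero, zero_mul, sub_self, neg_zero, smul_zero]

/-- Here `e = f = h = 0`, so the right sides of four relations must vanish. For `s < p` the element
`A` projects to `a_0`, which `E` kills and which is not in the range of `F`; for `s = p` it is zero.
-/
theorem hasAct_twist_X (hp : 2 ≤ p) (α : ℤˣ) {s : ℕ} (hs : 1 ≤ s) (hsp : s ≤ p) :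
    HasAct p (twist α (X p 1 s 1).act) := by
  have h1 : sgn 1 = 1 := by simp [sgn]
  have hX := good_X hp 1 (s := s) (r := 1) (by omega) (by omega)
  have hK : ∀ n : ℤ, XAct p 1 s 1 .K (av s n) = q p ^ ((s : ℤ) - 1 - 2 * n) • av s n :=
    fun n => by rw [av_K, h1, one_mul]
  have hE : ∀ n : ℤ, XAct p 1 s 1 .E (av s n) = (qInt p n * qInt p (s - n)) • av s (n - 1) :=
    fun n => by rw [av_E, h1, one_mul]
  have hF : ∀ n : ℤ, 0 ≤ n → XAct p 1 s 1 .F (av s n) = av s (n + 1) :=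
    fun n hn => av_F 1 (by omega)
  have ext : ∀ {A B : Module.End ℂ (Span (XLabel s 1))},
      (∀ n : ℤ, 0 ≤ n → n < s → A (av s n) = B (av s n)) → A = B := by
    intro A B h
    refine span_hom_ext ?_
    rintro ⟨n, m⟩ ⟨h1, h2, h3, h4⟩
    dsimp only at *
    obtain rfl : m = 0 := by omega
    exact h n h1 (by omega)
  have hC : casimir p (XAct p 1 s 1 .E) (XAct p 1 s 1 .F) (XAct p 1 s 1 .K) =
      casimirValue p s • 1 := by
    refine ext fun n hn hn' => ?_
    rw [casimir_apply hp (w := 0) (hK n) (by rw [hF n hn, hE, add_zero, add_sub_cancel_right])]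
    simp
  have hA : ∀ n : ℤ, 0 ≤ n → n < s → elementA p (sgn α • XAct p 1 s 1 .E) (XAct p 1 s 1 .F)
      (sgn α • XAct p 1 s 1 .K) (av s n) = if n = 0 ∧ s < p then av s n else 0 := by
    intro n hn hn'
    rcases hsp.lt_or_eq with h | h
    · rw [elementA_apply_sgn_of_eq hp α hs h hC hn (by omega) (hK n)]
      exact if_congr (by omega) rfl rfl
    · rw [elementA_sgn_eq_zero hp α (hC.trans (by rw [h])), LinearMap.zero_apply, if_neg (by omega)]
  refine hasAct_twist_of_eq_zero hp α hX (X_e_one (p := p) 1 s) (X_f_one (p := p) 1 s)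
    ?_ ?_ ?_ ?_ ?_ ?_ ?_
  · refine ext fun n hn hn' => ?_
    refine commutator_apply (w := 0) hp (hK n) ?_ ?_
    · rw [hF n hn, hE, add_zero, add_sub_cancel_right]
    · rw [hE, map_smul, add_zero]
      rcases eq_or_ne n 0 with rfl | h
      · simp [qInt_zero]
      · rw [hF _ (by omega), sub_add_cancel]
  · refine ext fun n hn hn' => ?_
    rw [av_E_pow, av_eq_zero (by omega), smul_zero, LinearMap.zero_apply]
  · refine ext fun n hn hn' => ?_
    rw [av_F_pow 1 hn, av_eq_zero (by omega), LinearMap.zero_apply]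
  · refine ext fun n hn hn' => ?_
    rw [LinearMap.zero_apply, Module.End.mul_apply, av_E_pow, map_smul,
      Module.End.mul_apply]
    rcases lt_or_ge n (p - 1) with h | h
    · rw [av_eq_zero (by omega), map_zero, map_zero, smul_zero]
    -- Only `s = p` and `n = p - 1` remain: `E^(p-1)` is not zero there, but the Cartan factor is
    -- `[p] = 0`.
    · rw [shiftedCartan_apply hp (hK _), show (s : ℤ) - 1 - 2 * (n - (p - 1 : ℕ)) + 1 = p by omega,
        qInt_self hp, zero_smul, map_zero, smul_zero]
  · refine ext fun n hn hn' => ?_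
    rw [LinearMap.zero_apply, Module.End.mul_apply,
      shiftedCartan_apply hp (hK _), map_smul, av_F_pow 1 hn]
    by_cases h : n + (p - 1 : ℕ) < s
    · rw [show (s : ℤ) - 1 - 2 * n + 1 = p by omega, qInt_self hp, zero_smul]
    · rw [av_eq_zero (by omega), smul_zero]
  · refine ext fun n hn hn' => ?_
    rw [LinearMap.zero_apply, Module.End.mul_apply, hA n hn hn']
    split_ifs with h
    · rw [hE, h.1, qInt_zero, zero_mul, zero_smul]
    · rw [map_zero]
  · refine ext fun n hn hn' => ?_
    rw [LinearMap.zero_apply, Module.End.mul_apply, hF n hn]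
    rcases lt_or_ge (n + 1) s with h | h
    · rw [hA _ (by omega) h, if_neg (by omega)]
    · rw [av_eq_zero (Or.inr h), map_zero]

theorem T_beta_index (n s : ℤ) : -s - 1 - 2 * n = s - 1 - 2 * (n + s) := by ring

/-- The relations are verified on the vectors `τ_n` and `β_n`. The element `A` marks exactly the
places where `E` and `F` change the eigenvalue of `h`. -/
theorem hasAct_twist_T (hp : 2 ≤ p) (α : ℤˣ) {s : ℕ} (hs : 1 ≤ s) (hsp : s < p) :
    HasAct p (twist α (T p s).act) := by
  have hs' : (1 : ℤ) ≤ s := by omega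
  have hsp' : (s : ℤ) < p := by omega
  have hT := good_T (s := s) hp (by omega)
  have hK : ∀ n : ℤ, TActAux p s .K (tau p n) = q p ^ ((s : ℤ) - 1 - 2 * n) • tau p n := T_K_tau
  have hK' : ∀ n : ℤ, TActAux p s .K (beta p n) = q p ^ ((s : ℤ) - 1 - 2 * (n + s)) • beta p n :=
    fun n => by rw [T_K_beta, T_beta_index]
  -- The weight of `β_n` is that of index `n + s`, or equally of index `n + s - p`. One of the two
  -- lies between `0` and `p - 1`, as the evaluation of `A` requires.
  have hK'' : ∀ n : ℤ, TActAux p s .K (beta p n) =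
      q p ^ ((s : ℤ) - 1 - 2 * (n + s - p)) • beta p n := fun n => by
    rw [hK', show (s : ℤ) - 1 - 2 * (n + s) = s - 1 - 2 * (n + s - p) - 2 * p by ring,
      q_zpow_sub_two_mul hp]
  have hE : ∀ n : ℤ, 0 ≤ n → TActAux p s .E (tau p n) =
      (qInt p n * qInt p (s - n)) • tau p (n - 1) + gConst p s • beta p (n + p - s - 1) :=
    fun n hn => T_E_tau hp hsp'.le hn
  have hE' : ∀ n : ℤ, TActAux p s .E (beta p n) = (qInt p n * qInt p (-s - n)) • beta p (n - 1) :=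
    T_E_beta hp
  have hF : ∀ n : ℤ, 0 ≤ n → TActAux p s .F (tau p n) = tau p (n + 1) := fun n => T_F_tau
  have hF' : ∀ n : ℤ, 0 ≤ n → TActAux p s .F (beta p n) = beta p (n + 1) := fun n => T_F_beta
  have he : ∀ n : ℤ, n < p → TActAux p s .e (tau p n) = beta p (n - s) :=
    fun n hn => T_e_tau hn (by omega)
  have he' : ∀ n : ℤ, TActAux p s .e (beta p n) = 0 := T_e_beta
  have hf : ∀ n : ℤ, TActAux p s .f (tau p n) = 0 := T_f_tau
  have hf' : ∀ n : ℤ, 0 ≤ n → TActAux p s .f (beta p n) = tau p (n + s) :=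
    fun n hn => T_f_beta hn (by omega)
  -- `h` is `-1/2` on `τ_n` with `n ≥ s` and `1/2` on `β_n` with `n < p - s`, which form the doublet
  -- of `sl(2)`; it is zero on all other basis vectors.
  have hh : ∀ n : ℤ, 0 ≤ n → (T p s).act .h (tau p n) =
      (if s ≤ n then (-1 / 2 : ℂ) else 0) • tau p n := by
    intro n hn
    change (1 / 2 : ℂ) • (TActAux p s .e (TActAux p s .f (tau p n)) -
      TActAux p s .f (TActAux p s .e (tau p n))) = _
    rcases lt_or_ge n p with hnp | hnp
    · rw [hf, map_zero, he n hnp]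
      split_ifs with h
      · rw [hf' _ (by omega), sub_add_cancel]
        module
      · rw [beta_eq_zero (by omega), map_zero]
        module
    · rw [tau_eq_zero (Or.inr hnp)]
      simp only [map_zero, sub_zero, smul_zero]
  have hh' : ∀ n : ℤ, 0 ≤ n → (T p s).act .h (beta p n) =
      (if n < p - s then (1 / 2 : ℂ) else 0) • beta p n := by
    intro n hn
    change (1 / 2 : ℂ) • (TActAux p s .e (TActAux p s .f (beta p n)) -
      TActAux p s .f (TActAux p s .e (beta p n))) = _
    rw [he', map_zero, hf' n hn]
    split_ifs with h
    · rw [he _ (by omega), add_sub_cancel_right]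
      module
    · rw [tau_eq_zero (by omega), map_zero]
      module
  have hcoef : ∀ n : ℤ, qInt p (n + s - p) * qInt p (s - (n + s - p)) =
      qInt p n * qInt p (-s - n) := by
    intro n
    rw [show (s : ℤ) - (n + s - p) = -n + p by ring, show -(s : ℤ) - n = -(n + s) by ring,
      qInt_add_self hp, ← neg_sub (p : ℤ) (n + s), qInt_neg p n, qInt_neg p (n + s),
      qInt_neg p (p - (n + s)), qInt_self_sub hp]
    ring
  have hC : ∀ n : ℤ, 0 ≤ n → casimir p (TActAux p s .E) (TActAux p s .F) (TActAux p s .K) (tau p n) =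
      casimirValue p s • tau p n +
        ((q p - (q p)⁻¹) ^ 2) • gConst p s • beta p (n + p - s) := by
    intro n hn
    refine casimir_apply hp (hK n) ?_
    rw [hF n hn, hE _ (by omega), add_sub_cancel_right]
    congr 3; ring
  have hC' : ∀ n : ℤ, 0 ≤ n →
      casimir p (TActAux p s .E) (TActAux p s .F) (TActAux p s .K) (beta p n) =
      casimirValue p s • beta p n := by
    intro n hn
    refine (casimir_apply (w := 0) hp (hK'' n) ?_).trans (by simp)
    rw [hF' n hn, hE', add_sub_cancel_right, add_zero]
    rw [show n + s - p + 1 = n + 1 + s - p by ring, hcoef]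
  -- `C - β_s` maps the string of `τ` to that of `β`, which it kills.
  have hC2 : (casimir p (TActAux p s .E) (TActAux p s .F) (TActAux p s .K) -
      casimirValue p s • 1) ^ 2 = 0 := by
    have h1 : ∀ n : ℤ, 0 ≤ n → (casimir p (TActAux p s .E) (TActAux p s .F) (TActAux p s .K) -
        casimirValue p s • 1) (beta p n) = 0 := by
      intro n hn
      rw [LinearMap.sub_apply, hC' n hn]
      exact sub_self _
    rw [pow_two]
    refine span_hom_ext (TLabel_cases (fun n hn hn' => ?_) (fun n hn hn' => ?_))
    · have h2 : (casimir p (TActAux p s .E) (TActAux p s .F) (TActAux p s .K) -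
          casimirValue p s • 1) (tau p n) =
          ((q p - (q p)⁻¹) ^ 2) • gConst p s • beta p (n + p - s) := by
        rw [LinearMap.sub_apply, hC n hn]
        exact add_sub_cancel_left _ _
      rw [Module.End.mul_apply]
      refine (congrArg _ h2).trans ?_
      rw [map_smul, map_smul, h1 _ (by omega), smul_zero, smul_zero, LinearMap.zero_apply]
    · rw [Module.End.mul_apply]
      refine (congrArg _ (h1 n hn)).trans ?_
      rw [map_zero, LinearMap.zero_apply]
  have hA : ∀ n : ℤ, 0 ≤ n → n < p → elementA p (sgn α • TActAux p s .E) (TActAux p s .F)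
      (sgn α • TActAux p s .K) (tau p n) = if n = 0 ∨ n = s then tau p n else 0 := by
    exact fun n hn hn' => elementA_apply_sgn hp α hs hsp hC2 hn hn' (hK n)
  have hA' : ∀ n : ℤ, 0 ≤ n → n < p → elementA p (sgn α • TActAux p s .E) (TActAux p s .F)
      (sgn α • TActAux p s .K) (beta p n) = if n = 0 ∨ n = p - s then beta p n else 0 := by
    intro n hn hn'
    rcases lt_or_ge (n + s) p with h | h
    · refine (elementA_apply_sgn hp α hs hsp hC2 (by omega) h (hK' n)).trans ?_
      exact if_congr (by omega) rfl rfl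
    · refine (elementA_apply_sgn hp α hs hsp hC2 (by omega) (by omega) (hK'' n)).trans ?_
      exact if_congr (by omega) rfl rfl
  have hEpow : ∀ n : ℤ, 0 ≤ n → n < p → (TActAux p s .E ^ (p - 1)) (tau p n) =
      if n = s - 1 then ((-1) ^ ((s : ℤ) - 1) * qFact p (p - 1) / qInt p s) • beta p 0
      else if n = p - 1 then ((-1) ^ ((s : ℤ) - 1) * qFact p (p - 1) / qInt p s) • beta p (p - s)
      else 0 := by
    intro n hn hn'
    split_ifs with h1 h2
    · rw [h1, tau_E_pow_of_eq hp hs' hsp']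
    · rw [h2, tau_E_pow_of_eq' hp hs' hsp']
    · exact tau_E_pow_of_ne hp hs' hsp' hn hn' h1 h2
  have hEpow' : ∀ n : ℤ, (TActAux p s .E ^ (p - 1)) (beta p n) = 0 := beta_E_pow hp hs' hsp'
  have hs0 := qInt_ne_zero hp (n := s) (by omega) hsp'
  have hf0 := qFact_ne_zero hp (n := p - 1) (by omega)
  have hp1 : TActAux p s .E ^ p = TActAux p s .E * TActAux p s .E ^ (p - 1) := by
    rw [← pow_succ', Nat.sub_add_cancel (by omega)]
  have hone : ((-1 : ℂ) ^ ((s : ℤ) - 1)) * (-1) ^ ((s : ℤ) - 1) = 1 := by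
    rw [← mul_zpow]; norm_num
  refine hasAct_twist hp α hT ?_ ?_ ?_ ?_ ?_ ?_ ?_ ?_ ?_ ?_ ?_ ?_ ?_ <;>
    refine span_hom_ext (TLabel_cases (fun n hn hn' => ?_) (fun n hn hn' => ?_))
  -- `E` and `F`
  · refine commutator_apply (w := gConst p s • beta p (n + p - s)) hp (hK n) ?_ ?_
    · change TActAux p s .E (TActAux p s .F (tau p n)) = _
      rw [hF n hn, hE _ (by omega), add_sub_cancel_right]
      congr 3; ring
    · change TActAux p s .F (TActAux p s .E (tau p n)) = _
      rw [hE _ hn, map_add, map_smul, map_smul, hF' _ (by omega)]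
      congr 1
      · rcases eq_or_ne n 0 with rfl | h
        · simp only [qInt_zero, zero_mul, zero_smul]
        · rw [hF _ (by omega), sub_add_cancel]
      · congr 2; ring
  · refine commutator_apply (w := 0) hp (hK'' n) ?_ ?_
    · change TActAux p s .E (TActAux p s .F (beta p n)) = _
      rw [hF' n hn, hE', add_sub_cancel_right, add_zero,
        show n + s - p + 1 = n + 1 + s - p by ring, hcoef]
    · change TActAux p s .F (TActAux p s .E (beta p n)) = _
      rw [hE', hcoef, map_smul, add_zero]
      rcases eq_or_ne n 0 with rfl | h
      · simp only [qInt_zero, zero_mul, zero_smul]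
      · rw [hF' _ (by omega), sub_add_cancel]
  -- the powers of `E` and `F`
  · change (TActAux p s .E ^ p) (tau p n) = 0
    rw [hp1, Module.End.mul_apply, hEpow n hn hn']
    split_ifs
    · rw [map_smul, hE', qInt_zero, zero_mul, zero_smul, smul_zero]
    · rw [map_smul, hE', show -(s : ℤ) - (p - s) = -p by ring, qInt_neg, qInt_self hp, neg_zero,
        mul_zero, zero_smul, smul_zero]
    · rw [map_zero]
  · change (TActAux p s .E ^ p) (beta p n) = 0
    rw [hp1, Module.End.mul_apply, hEpow', map_zero]
  · change (TActAux p s .F ^ p) (tau p n) = 0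
    rw [tau_F_pow hn, tau_eq_zero (by omega)]
  · change (TActAux p s .F ^ p) (beta p n) = 0
    rw [beta_F_pow hn, beta_eq_zero (by omega)]
  -- `h` and `e`
  · change (T p s).act .h (TActAux p s .e (tau p n)) - TActAux p s .e ((T p s).act .h (tau p n)) =
      TActAux p s .e (tau p n)
    rw [hh n hn, map_smul, he n hn']
    split_ifs with h
    · rw [hh' _ (by omega), if_pos (by omega)]
      module
    · rw [beta_eq_zero (by omega), map_zero]
      simp
  · change (T p s).act .h (TActAux p s .e (beta p n)) - TActAux p s .e ((T p s).act .h (beta p n)) =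
      TActAux p s .e (beta p n)
    rw [hh' n hn, map_smul, he', map_zero, smul_zero, sub_zero]
  -- `h` and `f`
  · change (T p s).act .h (TActAux p s .f (tau p n)) - TActAux p s .f ((T p s).act .h (tau p n)) =
      -TActAux p s .f (tau p n)
    rw [hh n hn, map_smul, hf, map_zero, smul_zero, sub_zero, neg_zero]
  · change (T p s).act .h (TActAux p s .f (beta p n)) - TActAux p s .f ((T p s).act .h (beta p n)) =
      -TActAux p s .f (beta p n)
    rw [hh' n hn, map_smul, hf' n hn, hh _ (by omega), if_pos (by omega)]
    split_ifs with h
    · module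
    · rw [tau_eq_zero (by omega)]
      simp
  -- `E` and `e`
  · change TActAux p s .E (TActAux p s .e (tau p n)) = TActAux p s .e (TActAux p s .E (tau p n))
    rw [he n hn', hE n hn, hE', map_add, map_smul, map_smul, he', he _ (by omega), smul_zero,
      add_zero, show -(s : ℤ) - (n - s) = -n by ring, ← neg_sub (s : ℤ) n, qInt_neg, qInt_neg,
      neg_mul_neg, mul_comm]
    congr 2; ring
  · change TActAux p s .E (TActAux p s .e (beta p n)) = TActAux p s .e (TActAux p s .E (beta p n))
    rw [hE', map_smul, he', he', map_zero, smul_zero]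
  -- `K` and `e`
  · change TActAux p s .K (TActAux p s .e (tau p n)) = TActAux p s .e (TActAux p s .K (tau p n))
    rw [hK, map_smul, he n hn', hK', sub_add_cancel]
  · change TActAux p s .K (TActAux p s .e (beta p n)) = TActAux p s .e (TActAux p s .K (beta p n))
    rw [hK', map_smul, he', map_zero, smul_zero]
  -- `F` and `f`
  · change TActAux p s .F (TActAux p s .f (tau p n)) = TActAux p s .f (TActAux p s .F (tau p n))
    rw [hF n hn, hf, hf, map_zero]
  · change TActAux p s .F (TActAux p s .f (beta p n)) = TActAux p s .f (TActAux p s .F (beta p n))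
    rw [hF' n hn, hf' n hn, hf' _ (by omega), hF _ (by omega)]
    congr 1; ring
  -- `K` and `f`
  · change TActAux p s .K (TActAux p s .f (tau p n)) = TActAux p s .f (TActAux p s .K (tau p n))
    rw [hK, map_smul, hf, map_zero, smul_zero]
  · change TActAux p s .K (TActAux p s .f (beta p n)) = TActAux p s .f (TActAux p s .K (beta p n))
    rw [hK', map_smul, hf' n hn, hK]
  -- `F` and `e`
  · change TActAux p s .F (TActAux p s .e (tau p n)) - TActAux p s .e (TActAux p s .F (tau p n)) =
      (1 / qFact p (p - 1)) • (TActAux p s .K ^ p) (shiftedCartan p (TActAux p s .K)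
        ((TActAux p s .E ^ (p - 1)) (tau p n)))
    rw [he n hn', hF n hn, hEpow n hn hn']
    split_ifs with h1 h2
    · rw [beta_eq_zero (n := n - s) (by omega), map_zero, he _ (by omega),
        show n + 1 - s = 0 by omega, map_smul, map_smul, shiftedCartan_apply hp (hK' 0), map_smul,
        K_pow_apply hp (hK' 0), neg_one_zpow_sub_two_mul,
        show (s : ℤ) - 1 - 2 * (0 + s) + 1 = -s by ring, qInt_neg]
      match_scalars
      field_simp
      linear_combination hone
    · rw [tau_eq_zero (by omega), map_zero, sub_zero, hF' _ (by omega),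
        show n - s + 1 = p - s by omega, map_smul, map_smul, shiftedCartan_apply hp (hK'' _),
        map_smul, K_pow_apply hp (hK'' _), neg_one_zpow_sub_two_mul,
        show (s : ℤ) - 1 - 2 * (p - s + s - p) + 1 = s by ring]
      match_scalars
      field_simp
      linear_combination -hone
    · rw [map_zero, map_zero, smul_zero, he _ (by omega)]
      rcases lt_or_ge n s with h | h
      · rw [beta_eq_zero (by omega), beta_eq_zero (by omega), map_zero, sub_zero]
      · rw [hF' _ (by omega), sub_eq_zero]
        congr 1; ring
  · change TActAux p s .F (TActAux p s .e (beta p n)) - TActAux p s .e (TActAux p s .F (beta p n)) =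
      (1 / qFact p (p - 1)) • (TActAux p s .K ^ p) (shiftedCartan p (TActAux p s .K)
        ((TActAux p s .E ^ (p - 1)) (beta p n)))
    rw [hEpow', map_zero, map_zero, smul_zero, hF' n hn, he', he', map_zero, sub_zero]
  -- `E` and `f`
  · change TActAux p s .E (TActAux p s .f (tau p n)) - TActAux p s .f (TActAux p s .E (tau p n)) =
      ((-1) ^ (p + 1) / qFact p (p - 1)) • (TActAux p s .F ^ (p - 1)) (shiftedCartan p
        (TActAux p s .K) (tau p n))
    rw [hf, map_zero, hE n hn, map_add, map_smul, map_smul, hf, hf' _ (by omega),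
      shiftedCartan_apply hp (hK n), map_smul, tau_F_pow hn]
    rcases eq_or_ne n 0 with rfl | h
    · rw [show 0 + (p : ℤ) - s - 1 + s = 0 + (p - 1 : ℕ) by omega,
        show (s : ℤ) - 1 - 2 * 0 + 1 = s by ring, gConst, pow_succ]
      module
    · rw [tau_eq_zero (n := n + p - s - 1 + s) (by omega), tau_eq_zero (n := n + _) (by omega)]
      simp
  · change TActAux p s .E (TActAux p s .f (beta p n)) - TActAux p s .f (TActAux p s .E (beta p n)) =
      ((-1) ^ (p + 1) / qFact p (p - 1)) • (TActAux p s .F ^ (p - 1)) (shiftedCartan p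
        (TActAux p s .K) (beta p n))
    have h1 : TActAux p s .f (TActAux p s .E (beta p n)) =
        (qInt p n * qInt p (-s - n)) • tau p (n + s - 1) := by
      rw [hE', map_smul]
      rcases eq_or_ne n 0 with rfl | h
      · simp only [qInt_zero, zero_mul, zero_smul]
      · rw [hf' _ (by omega)]
        congr 2; ring
    rw [h1, hf' n hn, hE _ (by omega), shiftedCartan_apply hp (hK' n), map_smul, beta_F_pow hn,
      show (s : ℤ) - (n + s) = -n by ring, show -(s : ℤ) - n = -(n + s) by ring, qInt_neg, qInt_neg]
    rcases eq_or_ne n 0 with rfl | h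
    · rw [show 0 + (s : ℤ) + p - s - 1 = 0 + (p - 1 : ℕ) by omega,
        show (s : ℤ) - 1 - 2 * (0 + s) + 1 = -s by ring, gConst, qInt_neg, pow_succ,
        qInt_zero]
      module
    · rw [beta_eq_zero (n := n + s + p - s - 1) (by omega), beta_eq_zero (n := n + _) (by omega)]
      module
  -- `h` and `E`
  · change (T p s).act .h (TActAux p s .E (tau p n)) - TActAux p s .E ((T p s).act .h (tau p n)) =
      (1 / 2 : ℂ) • TActAux p s .E (elementA p (sgn α • TActAux p s .E) (TActAux p s .F)
        (sgn α • TActAux p s .K) (tau p n))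
    rw [hA n hn hn', hh n hn, map_smul, hE n hn, map_add, map_smul, map_smul,
      hh' _ (by omega)]
    have h1 : (qInt p n * qInt p (s - n)) • (T p s).act .h (tau p (n - 1)) =
        (qInt p n * qInt p (s - n)) • (if s ≤ n then (-1 / 2 : ℂ) else 0) • tau p (n - 1) := by
      rcases eq_or_ne n 0 with rfl | h
      · simp only [qInt_zero, zero_mul, zero_smul]
      rcases eq_or_ne n s with rfl | h'
      · simp only [sub_self, qInt_zero, mul_zero, zero_smul]
      · rw [hh _ (by omega)]
        congr 2
        exact if_congr (by omega) rfl rfl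
    rw [h1]
    rcases eq_or_ne n 0 with rfl | h
    · rw [if_neg (show ¬ (s : ℤ) ≤ 0 by omega), if_pos (by omega), if_pos (by omega), hE 0 le_rfl,
        qInt_zero]
      module
    rcases eq_or_ne n s with rfl | h'
    · rw [if_pos le_rfl, if_neg (by omega), if_pos (by omega), hE _ hn, sub_self, qInt_zero]
      module
    rw [if_neg (show ¬ (n = 0 ∨ n = s) by omega), map_zero]
    rcases lt_or_ge n s with h2 | h2
    · rw [if_neg (show ¬ (s : ℤ) ≤ n by omega), if_neg (by omega)]
      module
    · rw [beta_eq_zero (by omega)]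
      module
  · change (T p s).act .h (TActAux p s .E (beta p n)) - TActAux p s .E ((T p s).act .h (beta p n)) =
      (1 / 2 : ℂ) • TActAux p s .E (elementA p (sgn α • TActAux p s .E) (TActAux p s .F)
        (sgn α • TActAux p s .K) (beta p n))
    rw [hA' n hn hn', hh' n hn, map_smul]
    rcases eq_or_ne n 0 with rfl | h
    · rw [if_pos (by omega), if_pos (by omega), hE', qInt_zero]
      simp only [zero_mul, zero_smul, map_zero, smul_zero, sub_zero]
    rcases eq_or_ne n (p - s) with rfl | h'
    · rw [if_pos (Or.inr rfl), hE', show -(s : ℤ) - (p - s) = -p by ring, qInt_neg, qInt_self hp]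
      simp only [neg_zero, mul_zero, zero_smul, map_zero, smul_zero, sub_zero]
    rw [if_neg (show ¬ (n = 0 ∨ n = p - s) by omega), map_zero, smul_zero, sub_eq_zero, hE',
      map_smul, hh' _ (by omega), smul_comm]
    congr 1
    exact if_congr (by omega) rfl rfl
  -- `h` and `F`
  · change (T p s).act .h (TActAux p s .F (tau p n)) - TActAux p s .F ((T p s).act .h (tau p n)) =
      (-1 / 2 : ℂ) • elementA p (sgn α • TActAux p s .E) (TActAux p s .F)
        (sgn α • TActAux p s .K) (TActAux p s .F (tau p n))
    rw [hh n hn, map_smul, hF n hn, hh _ (by omega)]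
    rcases lt_or_ge (n + 1) p with h | h
    · rw [hA _ (by omega) h]
      rcases eq_or_ne (n + 1) s with h' | h'
      · rw [if_pos (by omega), if_neg (by omega), if_pos (by omega)]
        module
      · rw [if_neg (show ¬ (n + 1 = 0 ∨ n + 1 = s) by omega), ← sub_smul, smul_zero,
          if_congr (show (s : ℤ) ≤ n + 1 ↔ (s : ℤ) ≤ n by omega) rfl rfl, sub_self, zero_smul]
    · rw [tau_eq_zero (Or.inr h), map_zero, smul_zero, smul_zero, smul_zero, sub_zero]
  · change (T p s).act .h (TActAux p s .F (beta p n)) - TActAux p s .F ((T p s).act .h (beta p n)) =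
      (-1 / 2 : ℂ) • elementA p (sgn α • TActAux p s .E) (TActAux p s .F)
        (sgn α • TActAux p s .K) (TActAux p s .F (beta p n))
    rw [hh' n hn, map_smul, hF' n hn, hh' _ (by omega)]
    rcases lt_or_ge (n + 1) p with h | h
    · rw [hA' _ (by omega) h]
      rcases eq_or_ne (n + 1) (p - s) with h' | h'
      · rw [if_neg (by omega), if_pos (by omega), if_pos (by omega)]
        module
      · rw [if_neg (show ¬ (n + 1 = 0 ∨ n + 1 = p - s) by omega), ← sub_smul, smul_zero,
          if_congr (show n + 1 < p - s ↔ n < p - s by omega) rfl rfl, sub_self, zero_smul]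
    · rw [beta_eq_zero (Or.inr h), map_zero, smul_zero, smul_zero, smul_zero, sub_zero]

end

/-! ### Module structures for general `r`, by adding a commuting action of `sl(2)`. -/

noncomputable section

open GenAction

variable {p : ℕ}

theorem X_one_h_e (α : ℤˣ) (r : ℤ) :
    XAct p α 1 r .h * XAct p α 1 r .e - XAct p α 1 r .e * XAct p α 1 r .h = XAct p α 1 r .e := by
  refine span_hom_ext ?_
  rintro ⟨n, m⟩ h
  obtain ⟨h1, h2, h3, h4⟩ := h
  dsimp only at h1 h2 h3 h4
  rw [LinearMap.sub_apply, Module.End.mul_apply, Module.End.mul_apply, X_h α ⟨h1, h2⟩ ⟨h3, h4⟩,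
    map_smul, X_e α ⟨h1, h2⟩ ⟨h3, h4⟩, map_smul]
  rcases eq_or_ne m 0 with rfl | h
  · simp
  · rw [X_h α ⟨h1, h2⟩ ⟨by omega, by omega⟩]
    push_cast
    module

theorem X_one_h_f (α : ℤˣ) (r : ℤ) :
    XAct p α 1 r .h * XAct p α 1 r .f - XAct p α 1 r .f * XAct p α 1 r .h = -XAct p α 1 r .f := by
  refine span_hom_ext ?_
  rintro ⟨n, m⟩ h
  obtain ⟨h1, h2, h3, h4⟩ := h
  dsimp only at h1 h2 h3 h4
  rw [LinearMap.sub_apply, Module.End.mul_apply, Module.End.mul_apply, X_h α ⟨h1, h2⟩ ⟨h3, h4⟩,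
    map_smul, LinearMap.neg_apply, X_f α ⟨h1, h2⟩ ⟨h3, h4⟩]
  by_cases h : m + 1 ≤ r - 1
  · rw [X_h α ⟨h1, h2⟩ ⟨by omega, h⟩]
    push_cast
    module
  · rw [vec_of_not_mem (fun h' : XLabel 1 r (n, m + 1) => h h'.2.2.2)]
    simp

theorem X_one_K (α : ℤˣ) (r : ℤ) : XAct p α 1 r .K = sgn α • 1 := by
  refine span_hom_ext ?_
  rintro ⟨n, m⟩ h
  rw [X_K', show n = 0 by have := h.1; have := h.2.1; dsimp only at *; omega]
  simp

theorem GenAction.Iso.isModule {M N : GenAction} (h : Iso M N) (hN : HasAct p N.act) :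
    IsModule p M := by
  obtain ⟨φ, hφ⟩ := h
  have h2 := hN.map (φ.symm.conjAlgEquiv ℂ : Module.End ℂ N.V ≃ₐ[ℂ] Module.End ℂ M.V).toAlgHom
  have h3 : (fun g => (φ.symm.conjAlgEquiv ℂ : Module.End ℂ N.V ≃ₐ[ℂ] Module.End ℂ M.V).toAlgHom
      (N.act g)) = M.act := by
    funext g
    ext v
    change φ.symm (N.act g (φ v)) = _
    rw [← hφ, LinearEquiv.symm_apply_apply]
  rw [h3] at h2
  exact h2

/-- If `ζ = ±1` and `(e, f, h)` satisfies the relations of `sl(2)`, so does `(ζ e, ζ f, h)`. The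
formula for `h` as half a commutator makes the added term for `h` automatic. -/
theorem HasAct.add_smul_commuting {R : Type} [Ring R] [Algebra ℂ R] {a b : Gen → R}
    (ha : HasAct p a) {e f h : R} {ζ : ℂ} (hζ : ζ * ζ = 1) (he : h * e - e * h = e)
    (hf : h * f - f * h = -f) (hef : e * f - f * e = (2 : ℂ) • h)
    (hca : ∀ g, Commute (a g) e ∧ Commute (a g) f ∧ Commute (a g) h)
    (hah : a .h = (1 / 2 : ℂ) • (a .e * a .f - a .f * a .e))
    (hE : b .E = a .E) (hF : b .F = a .F) (hK : b .K = a .K) (hbe : b .e = a .e + ζ • e)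
    (hbf : b .f = a .f + ζ • f) (hbh : b .h = (1 / 2 : ℂ) • (b .e * b .f - b .f * b .e)) :
    HasAct p b := by
  refine ha.add_commuting (e := ζ • e) (f := ζ • f) (h := h) ?_ ?_ ?_
    (fun g => ⟨(hca g).1.smul_right ζ, (hca g).2.1.smul_right ζ, (hca g).2.2⟩) hE hF hK hbe hbf ?_
  · rw [mul_smul_comm, smul_mul_assoc, ← smul_sub, he]
  · rw [mul_smul_comm, smul_mul_assoc, ← smul_sub, hf, smul_neg]
  · rw [smul_mul_smul_comm, smul_mul_smul_comm, hζ, one_smul, one_smul, hef]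
  · have h1 : h = (1 / 2 : ℂ) • (e * f - f * e) := by rw [hef]; module
    rw [hbh, hbe, hbf, hah, h1]
    simp only [mul_add, add_mul, smul_mul_assoc, mul_smul_comm, smul_smul, hζ, one_smul,
      (hca .e).2.1.eq, (hca .f).1.eq]
    match_scalars <;>
      first | ring1 | linear_combination (1 / 2 : ℂ) * hζ | linear_combination (-1 / 2 : ℂ) * hζ

/-- On `X^α_{1,r}` one has `E = F = 0` and `K = α`. The tensor product therefore carries the twisted
action of `M`, with `ζ` times the commuting operators `1 ⊗ e` and `1 ⊗ f` added, where `ζ` is the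
value of `K^p` on `M`. -/
theorem hasAct_tensor (hp : 2 ≤ p) (α : ℤˣ) {r : ℤ} (hr : 0 ≤ r) {M : GenAction} (hM : Good p M)
    (h : HasAct p (twist α M.act)) {ζ : ℂ} (hζ : ζ * ζ = 1) (hK : M.act .K ^ p = ζ • 1) :
    HasAct p (tensor p M (X p α 1 r)).act := by
  have hN := good_X hp α zero_le_one hr
  generalize hX : X p α 1 r = N at hN ⊢
  have kE : N.act .E = 0 := by rw [← hX]; exact X_E_one (p := p) α r
  have kF : N.act .F = 0 := by rw [← hX]; exact X_F_one (p := p) α r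
  have kK : N.act .K = sgn α • 1 := by rw [← hX]; exact X_one_K α r
  have khe : N.act .h * N.act .e - N.act .e * N.act .h = N.act .e := by
    rw [← hX]; exact X_one_h_e (p := p) α r
  have khf : N.act .h * N.act .f - N.act .f * N.act .h = -N.act .f := by
    rw [← hX]; exact X_one_h_f (p := p) α r
  have hef : N.act .e * N.act .f - N.act .f * N.act .e = (2 : ℂ) • N.act .h := by
    rw [hN.h_eq]; module
  let φ : Module.End ℂ M.V →ₐ[ℂ] Module.End ℂ (M.V ⊗[ℂ] N.V) := Module.End.rTensorAlgHom ℂ M.V N.V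
  let ψ : Module.End ℂ N.V →ₐ[ℂ] Module.End ℂ (M.V ⊗[ℂ] N.V) := Module.End.lTensorAlgHom ℂ N.V M.V
  have hφ : ∀ A, φ A = TensorProduct.map A 1 := fun A => rfl
  have hψ : ∀ A, ψ A = TensorProduct.map 1 A := fun A => rfl
  have hc : ∀ A B, φ A * ψ B = ψ B * φ A := by
    intro A B
    rw [hφ, hψ, ← TensorProduct.map_mul, ← TensorProduct.map_mul, one_mul, mul_one, one_mul,
      mul_one]
  have h1 : tensorAct p M N .e = φ (M.act .e) + ζ • ψ (N.act .e) := by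
    refine TensorProduct.ext' fun u v => ?_
    rw [tensor_e_tmul_of_right kE, hK]
    simp [hφ, hψ, TensorProduct.smul_tmul']
  have h2 : tensorAct p M N .f = φ (M.act .f) + ζ • ψ (N.act .f) := by
    refine TensorProduct.ext' fun u v => ?_
    rw [tensor_f_tmul_of_right kF, hK]
    simp [hφ, hψ, TensorProduct.smul_tmul']
  refine (h.map φ).add_smul_commuting (e := ψ (N.act .e)) (f := ψ (N.act .f)) (h := ψ (N.act .h))
    hζ ?_ ?_ ?_ (fun g => ⟨hc _ _, hc _ _, hc _ _⟩) ?_ ?_ ?_ ?_ h1 h2 rfl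
  · rw [← map_mul, ← map_mul, ← map_sub, khe]
  · rw [← map_mul, ← map_mul, ← map_sub, khf, map_neg]
  · rw [← map_mul, ← map_mul, ← map_sub, hef, map_smul]
  · rw [← map_mul, ← map_mul, ← map_sub, ← map_smul]
    exact congrArg φ hM.h_eq
  · change TensorProduct.map 1 (N.act .E) + TensorProduct.map (M.act .E) (N.act .K) = _
    rw [kE, kK, TensorProduct.map_zero_right, zero_add, TensorProduct.map_smul_right,
      ← TensorProduct.map_smul_left]
    rfl
  · change TensorProduct.map (invK p (M.act .K)) (N.act .F) + TensorProduct.map (M.act .F) 1 = _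
    rw [kF, TensorProduct.map_zero_right, zero_add]
    rfl
  · change TensorProduct.map (M.act .K) (N.act .K) = _
    rw [kK, TensorProduct.map_smul_right, ← TensorProduct.map_smul_left]
    rfl

/-- The sign is carried by the factor `X^α_{1,r}`, so that the other factor is the module with
positive sign for which the twisted relations were checked. -/
theorem isModule_X (hp : 2 ≤ p) (α : ℤˣ) {s r : ℤ} (hs : 1 ≤ s) (hsp : s ≤ p) (hr : 1 ≤ r) :
    IsModule p (X p α s r) := by
  obtain ⟨s, rfl⟩ := Int.eq_ofNat_of_zero_le (show 0 ≤ s by omega)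
  have h := X_tensor_X_iso (s := s) (r := r) hp 1 α (by omega) (by omega)
  rw [one_mul] at h
  refine h.symm.isModule (hasAct_tensor hp α (by omega) (good_X hp 1 (by omega) zero_le_one)
    (hasAct_twist_X hp α (by omega) (by omega)) (ζ := kpSign p 1 s) (kpSign_mul_self _ _) ?_)
  refine span_hom_ext ?_
  rintro ⟨n, m⟩ -
  exact X_K_pow_self hp 1 s 1 n m

theorem isModule_P (hp : 2 ≤ p) (α : ℤˣ) {s r : ℤ} (hs : 1 ≤ s) (hsp : s ≤ p) (hr : 1 ≤ r) :
    IsModule p (P p α s r) := by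
  rw [P, if_neg (by omega)]
  split_ifs with h
  · exact isModule_X hp α hs hsp hr
  obtain ⟨s, rfl⟩ := Int.eq_ofNat_of_zero_le (show 0 ≤ s by omega)
  refine (P_iso hp α hs (by omega) hr).isModule (hasAct_tensor hp α (by omega)
    (good_T hp hsp) (hasAct_twist_T hp α (by omega) (by omega))
    (ζ := (-1) ^ ((s : ℤ) - 1)) (by rw [← mul_zpow]; norm_num) ?_)
  exact span_hom_ext (TLabel_cases (fun n hn hn' => T_K_pow_tau hp s n)
    (fun n hn hn' => T_K_pow_beta hp s n))

end

noncomputable section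

/-! ### Identities of Chebyshev polynomials -/

section Chebyshev

variable {R : Type*} [CommRing R] {x : R}

/-- The Chebyshev polynomial of the second kind (rescaled) with `n` terms, evaluated at `x`. -/
def chebY (x : R) (n : ℤ) : R := (Polynomial.Chebyshev.S R (n - 1)).eval x

/-- The rescaled Chebyshev polynomial of the first kind, evaluated at `x`. -/
def chebC (x : R) (n : ℤ) : R := (Polynomial.Chebyshev.C R n).eval x

theorem chebY_add_one (x : R) (n : ℤ) : chebY x (n + 1) = x * chebY x n - chebY x (n - 1) := by
  have h := congrArg (Polynomial.eval x) (Polynomial.Chebyshev.S_add_two R (n - 2))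
  simp only [Polynomial.eval_sub, Polynomial.eval_mul, Polynomial.eval_X] at h
  rw [chebY, chebY, chebY, show n + 1 - 1 = n - 2 + 2 by ring, h, show n - 2 + 1 = n - 1 by ring,
    show n - 1 - 1 = n - 2 by ring]

theorem chebC_add_one (x : R) (n : ℤ) : chebC x (n + 1) = x * chebC x n - chebC x (n - 1) := by
  have h := congrArg (Polynomial.eval x) (Polynomial.Chebyshev.C_add_two R (n - 1))
  simp only [Polynomial.eval_sub, Polynomial.eval_mul, Polynomial.eval_X] at h
  rw [chebC, chebC, chebC, show n + 1 = n - 1 + 2 by ring, h, show n - 1 + 1 = n by ring]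

theorem chebY_zero (x : R) : chebY x 0 = 0 := by simp [chebY]

theorem chebY_one (x : R) : chebY x 1 = 1 := by simp [chebY]

theorem chebY_two (x : R) : chebY x 2 = x := by simp [chebY]

theorem chebC_zero (x : R) : chebC x 0 = 2 := by simp [chebC]

theorem chebC_one (x : R) : chebC x 1 = x := by simp [chebC]

/-- The recurrence can be run in both directions, so two consecutive values determine a sequence on
all of `ℤ`. Negative indices are essential for the folding arguments below. -/
theorem eq_of_recurrence {f g : ℤ → R} (hf : ∀ n, f (n + 1) = x * f n - f (n - 1))
    (hg : ∀ n, g (n + 1) = x * g n - g (n - 1)) (h0 : f 0 = g 0) (h1 : f 1 = g 1) (n : ℤ) :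
    f n = g n := by
  suffices f n = g n ∧ f (n + 1) = g (n + 1) from this.1
  induction n using Int.induction_on with
  | zero => exact ⟨h0, h1⟩
  | succ n ih =>
    refine ⟨ih.2, ?_⟩
    rw [hf, hg, ih.2, add_sub_cancel_right, ih.1]
  | pred n ih =>
    rw [sub_add_cancel]
    refine ⟨?_, ih.1⟩
    have h2 := hf (-n)
    have h3 := hg (-n)
    rw [ih.1, ih.2] at h2
    linear_combination h2 - h3

theorem chebY_neg (x : R) (n : ℤ) : chebY x (-n) = -chebY x n := by
  refine eq_of_recurrence (x := x) (f := fun n => chebY x (-n)) (g := fun n => -chebY x n)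
    (fun n => ?_) (fun n => ?_) ?_ ?_ n
  · have := chebY_add_one x (-n)
    rw [show -(n + 1) = -n - 1 by ring, show -(n - 1) = -n + 1 by ring, this]
    ring
  · linear_combination -chebY_add_one x n
  · simp [chebY_zero]
  · have := chebY_add_one x 0
    rw [chebY_zero] at this
    simp only [zero_add, zero_sub] at this
    linear_combination this

theorem chebY_mul_sub (x : R) (a b : ℤ) :
    chebY x a * chebY x b - chebY x (a - 1) * chebY x (b - 1) = chebY x (a + b - 1) := by
  refine eq_of_recurrence (x := x)
    (f := fun a => chebY x a * chebY x b - chebY x (a - 1) * chebY x (b - 1))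
    (g := fun a => chebY x (a + b - 1)) (fun n => ?_) (fun n => ?_) ?_ ?_ a
  · have h1 := chebY_add_one x n
    have h2 := chebY_add_one x (n - 1)
    rw [sub_add_cancel] at h2
    rw [add_sub_cancel_right]
    linear_combination chebY x b * h1 - chebY x (b - 1) * h2
  · rw [show n + 1 + b - 1 = n + b - 1 + 1 by ring, chebY_add_one]
    congr 2; ring
  · rw [zero_sub, chebY_neg, chebY_zero, chebY_one, zero_add]; ring
  · rw [sub_self, chebY_zero, chebY_one, add_sub_cancel_left]; ring

theorem chebC_eq (x : R) (n : ℤ) : chebC x n = chebY x (n + 1) - chebY x (n - 1) := by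
  refine eq_of_recurrence (x := x) (f := chebC x)
    (g := fun n => chebY x (n + 1) - chebY x (n - 1)) (chebC_add_one x) (fun n => ?_) ?_ ?_ n
  · have h1 := chebY_add_one x (n + 1)
    have h2 := chebY_add_one x (n - 1)
    rw [add_sub_cancel_right] at h1
    rw [sub_add_cancel] at h2
    rw [add_sub_cancel_right, sub_add_cancel]
    linear_combination h1 - h2
  · rw [zero_add, zero_sub, chebY_neg, chebC_zero, chebY_one]; ring
  · rw [sub_self, one_add_one_eq_two, chebY_zero, chebC_one, chebY_two, sub_zero]

/-- The analogue of `2 sin a cos j = sin(a+j) + sin(a-j)`. -/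
theorem chebY_mul_chebC (x : R) (a j : ℤ) :
    chebY x a * chebC x j = chebY x (a + j) + chebY x (a - j) := by
  refine eq_of_recurrence (x := x) (f := fun a => chebY x a * chebC x j)
    (g := fun a => chebY x (a + j) + chebY x (a - j)) (fun n => ?_) (fun n => ?_) ?_ ?_ a
  · linear_combination chebC x j * chebY_add_one x n
  · have h1 := chebY_add_one x (n + j)
    have h2 := chebY_add_one x (n - j)
    rw [show n + 1 + j = n + j + 1 by ring, show n + 1 - j = n - j + 1 by ring,
      show n - 1 + j = n + j - 1 by ring, show n - 1 - j = n - j - 1 by ring]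
    linear_combination h1 + h2
  · rw [chebY_zero, zero_add, zero_sub, chebY_neg]; ring
  · rw [chebY_one, chebC_eq, ← neg_sub j 1, chebY_neg, add_comm j 1]; ring

/-! ### Sums in steps of two -/

theorem mem_stepTwo {a b i : ℤ} : i ∈ stepTwo a b ↔ (a ≤ i ∧ i ≤ b) ∧ (i - a) % 2 = 0 := by
  rw [stepTwo, Finset.mem_filter, Finset.mem_Icc]

theorem stepTwo_eq_empty {a b : ℤ} (h : b < a) : stepTwo a b = ∅ := by
  ext i
  simp only [mem_stepTwo, Finset.notMem_empty, iff_false]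
  omega

theorem sum_stepTwo_add_two {M : Type*} [AddCommMonoid M] {a b : ℤ} (f : ℤ → M) (h : a ≤ b + 2)
    (hab : (b - a) % 2 = 0) :
    ∑ i ∈ stepTwo a (b + 2), f i = ∑ i ∈ stepTwo a b, f i + f (b + 2) := by
  have h1 : stepTwo a (b + 2) = insert (b + 2) (stepTwo a b) := by
    ext i
    simp only [mem_stepTwo, Finset.mem_insert]
    omega
  rw [h1, Finset.sum_insert (by simp only [mem_stepTwo]; omega), add_comm]

theorem stepTwo_induction {P : ℤ → Prop} {a : ℤ} (h0 : P (a - 2))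
    (hs : ∀ b, a ≤ b + 2 → (b - a) % 2 = 0 → P b → P (b + 2)) {b : ℤ} (h : a ≤ b + 2)
    (hab : (b - a) % 2 = 0) : P b := by
  obtain ⟨k, rfl⟩ : ∃ k : ℕ, b = a - 2 + 2 * k := ⟨((b + 2 - a) / 2).toNat, by omega⟩
  clear h hab
  induction k with
  | zero => simpa using h0
  | succ k ih =>
    have := hs _ (by omega) (by omega) ih
    rwa [show a - 2 + 2 * ((k + 1 : ℕ) : ℤ) = a - 2 + 2 * k + 2 by push_cast; ring]

theorem sum_stepTwo_telescope {M : Type*} [AddCommGroup M] (f : ℤ → M) {a b : ℤ} (h : a ≤ b + 2)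
    (hab : (b - a) % 2 = 0) :
    ∑ i ∈ stepTwo a b, (f (i + 1) - f (i - 1)) = f (b + 1) - f (a - 1) := by
  refine stepTwo_induction
    (P := fun b => ∑ i ∈ stepTwo a b, (f (i + 1) - f (i - 1)) = f (b + 1) - f (a - 1)) ?_ ?_ h hab
  · rw [stepTwo_eq_empty (by omega), Finset.sum_empty, show a - 2 + 1 = a - 1 by ring, sub_self]
  · intro b hb hab ih
    rw [sum_stepTwo_add_two _ hb hab, ih, show b + 2 - 1 = b + 1 by ring]
    abel

theorem sum_stepTwo_split {M : Type*} [AddCommMonoid M] (f : ℤ → M) {a b c : ℤ} (h : a ≤ b + 2)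
    (hbc : b ≤ c) (hab : (b - a) % 2 = 0) (hcb : (c - b) % 2 = 0) :
    ∑ i ∈ stepTwo a b, f i + ∑ i ∈ stepTwo (b + 2) c, f i = ∑ i ∈ stepTwo a c, f i := by
  refine stepTwo_induction (a := b + 2) (P := fun c =>
    ∑ i ∈ stepTwo a b, f i + ∑ i ∈ stepTwo (b + 2) c, f i = ∑ i ∈ stepTwo a c, f i) ?_ ?_
    (b := c) (by omega) (by omega)
  · rw [stepTwo_eq_empty (show b + 2 - 2 < b + 2 by omega), Finset.sum_empty, add_zero,
      add_sub_cancel_right]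
  · intro c hc hbc ih
    rw [sum_stepTwo_add_two _ hc hbc, ← add_assoc, ih, sum_stepTwo_add_two _ (by omega) (by omega)]

/-- Replacing `(a, b)` by `(a-1, b-1)` keeps the lower limit and removes the top term `Y_{a+b-1}`,
which is `Y_a Y_b - Y_{a-1} Y_{b-1}`. -/
theorem sum_chebY_of_le (x : R) {a b : ℤ} (hb : 0 ≤ b) (hab : b ≤ a) :
    ∑ i ∈ stepTwo (a - b + 1) (a + b - 1), chebY x i = chebY x a * chebY x b := by
  obtain ⟨k, rfl⟩ := Int.eq_ofNat_of_zero_le hb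
  induction k generalizing a with
  | zero =>
    rw [stepTwo_eq_empty (by push_cast; omega), Finset.sum_empty, Nat.cast_zero, chebY_zero,
      mul_zero]
  | succ k ih =>
    have h1 := ih (a := a - 1) (by omega) (by push_cast at hab; omega)
    have h2 := chebY_mul_sub x a (k + 1)
    push_cast at hab ⊢
    rw [add_sub_cancel_right] at h2
    rw [show a + ((k : ℤ) + 1) - 1 = (a - 1 + k - 1) + 2 by ring,
      show a - ((k : ℤ) + 1) + 1 = a - 1 - k + 1 by ring,
      sum_stepTwo_add_two _ (by omega) (by omega), h1, show a - 1 + (k : ℤ) - 1 + 2 =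
      a + (k + 1) - 1 by ring, ← h2]
    ring

theorem sum_chebY (x : R) {a b : ℤ} (ha : 0 ≤ a) (hb : 0 ≤ b) :
    ∑ i ∈ stepTwo (|a - b| + 1) (a + b - 1), chebY x i = chebY x a * chebY x b := by
  rcases le_total b a with h | h
  · rw [abs_of_nonneg (by omega), sum_chebY_of_le x hb h]
  · rw [abs_of_nonpos (by omega), neg_sub, add_comm a, sum_chebY_of_le x ha h, mul_comm]

end Chebyshev

/-! ### Sums over classes of projective modules -/

section Fusion

variable {R : Type*} [CommRing R] (x : R) (p : ℕ)

/-- The polynomial in the class of the two-dimensional module that gives the class of the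
projective module `P^+_{s,1}`. -/
def projY (s : ℤ) : R :=
  if s = p then chebY x p else chebC x (p - s) * chebY x p

variable {x p}

/-- Below `s = p` each term is `(Y_{p-s+1} - Y_{p-s-1}) Y_p`, so the sum telescopes. -/
theorem sum_projY_eq {c b : ℤ} (hcb : c ≤ b + 2) (hb : b < p) (h : (b - c) % 2 = 0) :
    ∑ s ∈ stepTwo c b, projY x p s =
      (chebY x (p - c + 1) - chebY x (p - b - 1)) * chebY x p := by
  have h1 : ∀ s ∈ stepTwo c b, projY x p s =
      -(chebY x (p - (s + 1)) * chebY x p) - -(chebY x (p - (s - 1)) * chebY x p) := by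
    intro s hs
    rw [mem_stepTwo] at hs
    rw [projY, if_neg (by omega), chebC_eq, show (p : ℤ) - (s + 1) = p - s - 1 by ring,
      show (p : ℤ) - (s - 1) = p - s + 1 by ring]
    ring
  rw [Finset.sum_congr rfl h1,
    sum_stepTwo_telescope (fun t => -(chebY x (p - t) * chebY x p)) hcb h,
    show (p : ℤ) - (b + 1) = p - b - 1 by ring, show (p : ℤ) - (c - 1) = p - c + 1 by ring]
  ring

/-- Both parities of the upper limit give one formula. If the sum stops at `p - 1`, the boundary
term is `Y_0 = 0`; if it reaches `p`, the last term is `Y_p` rather than `C_0 Y_p = 2 Y_p` and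
cancels the boundary term `-Y_1 Y_p`. -/
theorem sum_projY_top {c γ : ℤ} (hc : c ≤ p + 1) (hγ : 0 ≤ γ) (hγ' : γ ≤ 1)
    (h : (p - γ - c) % 2 = 0) :
    ∑ s ∈ stepTwo c (p - γ), projY x p s = chebY x (p - c + 1) * chebY x p := by
  obtain rfl | rfl : γ = 0 ∨ γ = 1 := by omega
  · rw [show (p : ℤ) - 0 = p - 2 + 2 by ring, sum_stepTwo_add_two _ (by omega) (by omega),
      sum_projY_eq (by omega) (by omega) (by omega), sub_add_cancel, projY, if_pos rfl,
      show (p : ℤ) - (p - 2) - 1 = 1 by ring, chebY_one]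
    ring
  · rw [sum_projY_eq (by omega) (by omega) (by omega), show (p : ℤ) - (p - 1) - 1 = 0 by ring,
      chebY_zero, sub_zero]

/-- The untruncated Clebsch–Gordan sum runs up to `s₁ + s₂ - 1`. If `s₁ + s₂ > p`, the sum over
projective modules is `Y_{s₁+s₂-p} Y_p`, which is exactly the truncated tail. -/
theorem chebY_mul_chebY_eq {s₁ s₂ : ℤ} (h1 : 1 ≤ s₁) (h1p : s₁ ≤ p) (h2 : 1 ≤ s₂) (h2p : s₂ ≤ p) :
    ∑ s ∈ stepTwo (|s₁ - s₂| + 1) (min (s₁ + s₂ - 1) (2 * p - s₁ - s₂ - 1)), chebY x s +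
      ∑ s ∈ stepTwo (2 * p - s₁ - s₂ + 1) (p - (s₁ + s₂ + p + 1) % 2), projY x p s =
    chebY x s₁ * chebY x s₂ := by
  rw [← sum_chebY x (by omega) (by omega)]
  rcases le_or_gt (s₁ + s₂) p with h | h
  · rw [min_eq_left (by omega), stepTwo_eq_empty (show _ < 2 * (p : ℤ) - s₁ - s₂ + 1 by omega),
      Finset.sum_empty, add_zero]
  · rw [min_eq_right (by omega), sum_projY_top (by omega) (by omega) (by omega) (by omega),
      mul_comm (chebY x _), ← sum_chebY_of_le x (by omega) (by omega),
      ← sum_stepTwo_split (c := s₁ + s₂ - 1) (b := 2 * p - s₁ - s₂ - 1) (chebY x)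
      (by cases abs_cases (s₁ - s₂) <;> omega) (by omega)
      (by cases abs_cases (s₁ - s₂) <;> omega) (by omega)]
    congr 3 <;> ring

/-- The contribution common to the second and third decompositions. The term `Y_{s₁+s₂-p}` with its
sign reconciles the cases: it is negative of a boundary term for `s₁ + s₂ ≤ p`, and the doubled sum
supplies it otherwise. -/
theorem sum_projY_middle {s₁ s₂ : ℤ} (h1 : 1 ≤ s₁) (h1p : s₁ ≤ p) (h2 : 1 ≤ s₂) (h2p : s₂ < p) :
    ∑ s ∈ stepTwo (|s₁ - s₂| + 1) (min (s₁ + s₂ - 1) (2 * p - s₁ - s₂ - 1)), projY x p s +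
      2 * ∑ s ∈ stepTwo (2 * p - s₁ - s₂ + 1) (p - (s₁ + s₂ + p + 1) % 2), projY x p s =
    (chebY x (p - |s₁ - s₂|) + chebY x (s₁ + s₂ - p)) * chebY x p := by
  have ha := abs_cases (s₁ - s₂)
  rcases le_or_gt (s₁ + s₂) p with h | h
  · rw [min_eq_left (by omega), stepTwo_eq_empty (show _ < 2 * (p : ℤ) - s₁ - s₂ + 1 by omega),
      Finset.sum_empty, mul_zero, add_zero, sum_projY_eq (by omega) (by omega) (by omega),
      show s₁ + s₂ - p = -(p - (s₁ + s₂ - 1) - 1) by ring, chebY_neg,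
      show (p : ℤ) - (|s₁ - s₂| + 1) + 1 = p - |s₁ - s₂| by ring]
    ring
  · rw [min_eq_right (by omega), sum_projY_top (by omega) (by omega) (by omega) (by omega),
      sum_projY_eq (by omega) (by omega) (by omega),
      show (p : ℤ) - (|s₁ - s₂| + 1) + 1 = p - |s₁ - s₂| by ring,
      show (p : ℤ) - (2 * p - s₁ - s₂ - 1) - 1 = s₁ + s₂ - p by ring,
      show (p : ℤ) - (2 * p - s₁ - s₂ + 1) + 1 = s₁ + s₂ - p by ring]
    ring

/-- The relation that comes from the isomorphism between `T_0` and `X^-_{p,2}`. -/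
theorem chebY_relation {w : R} (hw : chebC x p * chebY x p = w * chebY x p) (n : ℤ) :
    w * (chebY x n * chebY x p) = (chebY x (p + n) - chebY x (p - n)) * chebY x p := by
  have h := chebY_mul_chebC x n p
  rw [← neg_sub (p : ℤ) n, chebY_neg, add_comm n] at h
  linear_combination chebY x p * h - chebY x n * hw

/-- The product is `(Y_{p+s₁-s₂} + Y_{s₁+s₂-p}) Y_p`. Its first index exceeds `p` when `s₁ > s₂`,
and folding it by `chebY_relation` yields the sum with coefficient `w`. -/
theorem chebY_mul_projY_eq {w : R} (hw : chebC x p * chebY x p = w * chebY x p) {s₁ s₂ : ℤ}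
    (h1 : 1 ≤ s₁) (h1p : s₁ ≤ p) (h2 : 1 ≤ s₂) (h2p : s₂ < p) :
    ∑ s ∈ stepTwo (|s₁ - s₂| + 1) (min (s₁ + s₂ - 1) (2 * p - s₁ - s₂ - 1)), projY x p s +
      2 * ∑ s ∈ stepTwo (2 * p - s₁ - s₂ + 1) (p - (s₁ + s₂ + p + 1) % 2), projY x p s +
      w * ∑ s ∈ stepTwo (p - s₁ + s₂ + 1) (p - (s₁ + s₂ + 1) % 2), projY x p s =
    chebY x s₁ * projY x p s₂ := by
  have h3 := chebY_mul_chebC x s₁ (p - s₂)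
  rw [sum_projY_middle h1 h1p h2 h2p, projY, if_neg (by omega), ← mul_assoc, h3,
    show s₁ - (p - s₂) = s₁ + s₂ - p by ring]
  rcases lt_or_ge s₁ s₂ with h | h
  · rw [stepTwo_eq_empty (show _ < (p : ℤ) - s₁ + s₂ + 1 by omega), Finset.sum_empty,
      abs_of_neg (by omega), show s₁ + (p - s₂) = p - -(s₁ - s₂) by ring]
    ring
  · rw [sum_projY_top (by omega) (by omega) (by omega) (by omega), chebY_relation hw,
      abs_of_nonneg (by omega), show (p : ℤ) - (p - s₁ + s₂ + 1) + 1 = s₁ - s₂ by ring,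
      show s₁ + (p - s₂) = p + (s₁ - s₂) by ring]
    ring

/-- Expanding `C_{p-s₁} C_{p-s₂} Y_p` by the product-to-sum formula gives four terms next to a
factor `Y_p`. Indices above `p` are folded by `chebY_relation`, and the largest, `3p - s₁ - s₂`, has
to be folded twice if `s₁ + s₂ ≤ p`; hence `w²`. -/
theorem projY_mul_projY_eq {w : R} (hw : chebC x p * chebY x p = w * chebY x p) {s₁ s₂ : ℤ}
    (h1 : 1 ≤ s₁) (h1p : s₁ < p) (h2 : 1 ≤ s₂) (h2p : s₂ < p) :
    2 * (∑ s ∈ stepTwo (|s₁ - s₂| + 1) (min (s₁ + s₂ - 1) (2 * p - s₁ - s₂ - 1)), projY x p s +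
      2 * ∑ s ∈ stepTwo (2 * p - s₁ - s₂ + 1) (p - (s₁ + s₂ + p + 1) % 2), projY x p s) +
      w * (∑ s ∈ stepTwo (|p - s₁ - s₂| + 1) (min (p - s₁ + s₂ - 1) (p + s₁ - s₂ - 1)),
          projY x p s +
        2 * ∑ s ∈ stepTwo (min (p - s₁ + s₂ + 1) (p + s₁ - s₂ + 1)) (p - (s₁ + s₂ + 1) % 2),
          projY x p s) +
      w ^ 2 * ∑ s ∈ stepTwo (s₁ + s₂ + 1) (p - (s₁ + s₂ + p + 1) % 2), projY x p s =
    projY x p s₁ * projY x p s₂ := by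
  have h3 : projY x p s₁ * projY x p s₂ =
      (chebY x (3 * p - s₁ - s₂) + chebY x (s₁ + s₂ - p) + chebY x (p + (s₁ - s₂)) +
        chebY x (p - (s₁ - s₂))) * chebY x p := by
    have e1 := chebY_mul_chebC x p (p - s₁)
    have e2 := chebY_mul_chebC x (p + (p - s₁)) (p - s₂)
    have e3 := chebY_mul_chebC x (p - (p - s₁)) (p - s₂)
    rw [show (p : ℤ) + (p - s₁) + (p - s₂) = 3 * p - s₁ - s₂ by ring,
      show (p : ℤ) + (p - s₁) - (p - s₂) = p - (s₁ - s₂) by ring] at e2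
    rw [show (p : ℤ) - (p - s₁) + (p - s₂) = p + (s₁ - s₂) by ring,
      show (p : ℤ) - (p - s₁) - (p - s₂) = s₁ + s₂ - p by ring] at e3
    rw [projY, projY, if_neg (by omega), if_neg (by omega)]
    linear_combination chebY x p * (chebC x (p - s₂) * e1 + e2 + e3)
  have hd : chebY x (p + (s₁ - s₂)) + chebY x (p - (s₁ - s₂)) =
      chebY x (p + |s₁ - s₂|) + chebY x (p - |s₁ - s₂|) := by
    rcases abs_cases (s₁ - s₂) with ⟨h, -⟩ | ⟨h, -⟩
    · rw [h]
    · rw [h, add_comm, sub_neg_eq_add, sub_eq_add_neg]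
  have hm : min (p - s₁ + s₂ - 1) (p + s₁ - s₂ - 1) = p - |s₁ - s₂| - 1 := by
    rcases abs_cases (s₁ - s₂) with h | h <;> omega
  have hm' : min (p - s₁ + s₂ + 1) (p + s₁ - s₂ + 1) = p - |s₁ - s₂| + 1 := by
    rcases abs_cases (s₁ - s₂) with h | h <;> omega
  have hw' := chebY_relation hw
  have ha := abs_cases (s₁ - s₂)
  have hb := abs_cases (p - s₁ - s₂)
  rw [h3, sum_projY_middle h1 h1p.le h2 h2p, hm, hm', sum_projY_eq (by omega) (by omega) (by omega),
    sum_projY_top (c := p - |s₁ - s₂| + 1) (by omega) (by omega) (by omega) (by omega)]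
  rw [show (p : ℤ) - (|p - s₁ - s₂| + 1) + 1 = p - |p - s₁ - s₂| by ring,
    show (p : ℤ) - (p - |s₁ - s₂| - 1) - 1 = |s₁ - s₂| by ring,
    show (p : ℤ) - (p - |s₁ - s₂| + 1) + 1 = |s₁ - s₂| by ring]
  have e1 := hw' |s₁ - s₂|
  rcases le_or_gt (s₁ + s₂) p with h | h
  · rw [sum_projY_top (by omega) (by omega) (by omega) (by omega),
      abs_of_nonneg (show 0 ≤ (p : ℤ) - s₁ - s₂ by omega),
      show (p : ℤ) - (s₁ + s₂ + 1) + 1 = p - s₁ - s₂ by ring]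
    -- The largest index is `2p + e`: the first fold leaves `w Y_{p+e}`, and the second leaves `w²
    -- Y_e`.
    obtain ⟨e, he⟩ : ∃ e : ℤ, e = p - s₁ - s₂ := ⟨_, rfl⟩
    rw [← he, show s₁ + s₂ - p = -e by omega, show 3 * p - s₁ - s₂ = p + (p + e) by omega, chebY_neg]
    have e2 := hw' e
    have e3 := hw' (p + e)
    rw [show (p : ℤ) - (p + e) = -e by ring, chebY_neg] at e3
    linear_combination e1 + w * e2 + e3 - chebY x p * hd
  · rw [stepTwo_eq_empty (show _ < s₁ + s₂ + 1 by omega), Finset.sum_empty,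
      abs_of_neg (show (p : ℤ) - s₁ - s₂ < 0 by omega)]
    -- The largest index is `2p - e`; a single fold gives `w Y_{p-e} + Y_e`, and no term with `w²`
    -- arises.
    obtain ⟨e, he⟩ : ∃ e : ℤ, e = -(p - s₁ - s₂) := ⟨_, rfl⟩
    rw [← he, show s₁ + s₂ - p = e by omega, show 3 * p - s₁ - s₂ = p + (p - e) by omega]
    have e3 := hw' (p - e)
    rw [sub_sub_cancel] at e3
    linear_combination e1 + e3 - chebY x p * hd

end Fusion

end

noncomputable section

/-! ### Multiplicities -/

section Multiplicity

variable {R : Type*} [CommRing R]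

/-- Shifted sums are written over one common range with indicator coefficients, so that
multiplicities can be compared term by term. -/
theorem sum_stepTwo_shift (f : ℤ → R) {a b m k : ℤ} (h1 : -m ≤ k) (h2 : k ≤ m)
    (h : (m + k) % 2 = 0) : ∑ r ∈ stepTwo (a + m) (b - m), f (r + k) =
      ∑ r ∈ stepTwo a b, if a + m + k ≤ r ∧ r ≤ b - m + k then f r else 0 := by
  rw [← Finset.sum_filter]
  refine Finset.sum_bij' (fun r _ => r + k) (fun r _ => r - k) ?_ ?_ ?_ ?_ ?_
  · intro r hr
    rw [mem_stepTwo] at hr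
    rw [Finset.mem_filter, mem_stepTwo]
    omega
  · intro r hr
    rw [Finset.mem_filter, mem_stepTwo] at hr
    rw [mem_stepTwo]
    omega
  · intro r _; exact add_sub_cancel_right r k
  · intro r _; exact sub_add_cancel r k
  · intro r _; rfl

/-- The class of the `r`-dimensional module of `sl(2)`, with the convention that it vanishes for
negative `r`. -/
def slY (v : R) (r : ℤ) : R := if r ≤ 0 then 0 else chebY v r

theorem slY_of_nonneg (v : R) {r : ℤ} (hr : 0 ≤ r) : slY v r = chebY v r := by
  rw [slY]
  split_ifs with h
  · rw [show r = 0 by omega, chebY_zero]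
  · rfl

/-- Multiplication by `v` replaces each `Y_r` by `Y_{r+1} + Y_{r-1}`: interior indices are hit
twice, the two end points once. -/
theorem sum_twicePrime (v : R) {r₁ r₂ : ℤ} (h1 : 1 ≤ r₁) (h2 : 1 ≤ r₂) :
    ∑ r ∈ stepTwo |r₁ - r₂| (r₁ + r₂), (twicePrime |r₁ - r₂| (r₁ + r₂) r : R) * slY v r =
      v * (chebY v r₁ * chebY v r₂) := by
  have ha := abs_cases (r₁ - r₂)
  obtain ⟨a, hA⟩ : ∃ a : ℤ, a = |r₁ - r₂| := ⟨_, rfl⟩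
  rw [← sum_chebY v (by omega) (by omega), Finset.mul_sum, ← hA]
  have h3 : ∀ r, v * chebY v r = chebY v (r + 1) + chebY v (r + -1) := fun r => by
    rw [chebY_add_one, ← sub_eq_add_neg]; ring
  simp only [h3]
  rw [Finset.sum_add_distrib, sum_stepTwo_shift _ (by omega) (by omega) (by omega),
    sum_stepTwo_shift _ (by omega) (by omega) (by omega), ← Finset.sum_add_distrib]
  refine Finset.sum_congr rfl fun r hr => ?_
  rw [mem_stepTwo] at hr
  rw [slY_of_nonneg v (by omega), twicePrime]
  by_cases e1 : r = a
  · rw [if_pos e1, if_neg (show ¬ r = r₁ + r₂ by omega), if_neg (by omega), if_pos (by omega)]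
    norm_num
  by_cases e2 : r = r₁ + r₂
  · rw [if_neg e1, if_pos e2, if_pos (by omega), if_neg (by omega)]
    norm_num
  · rw [if_neg e1, if_neg e2, if_pos (by omega), if_pos (by omega),
      show ((2 : ℤ) - 0 - 0).toNat = 2 from rfl]
    push_cast
    ring

/-- Multiplication by `v²` replaces each `Y_r` by `Y_{r+2} + 2 Y_r + Y_{r-2}`. For `r = 1` this
contains `Y_{-1} = -1`, whereas the module with index `-1` is zero by convention; moving this `-1`
to `r = 1` accounts for the extra `δ_{a,-1}` in the multiplicity. -/
theorem sum_fourTimesDoublePrime (v : R) {r₁ r₂ : ℤ} (h1 : 1 ≤ r₁) (h2 : 1 ≤ r₂) :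
    ∑ r ∈ stepTwo (|r₁ - r₂| - 1) (r₁ + r₂ + 1),
      (fourTimesDoublePrime (|r₁ - r₂| - 1) (r₁ + r₂ + 1) r : R) * slY v r =
      v ^ 2 * (chebY v r₁ * chebY v r₂) := by
  have ha := abs_cases (r₁ - r₂)
  obtain ⟨a, hA⟩ : ∃ a : ℤ, a = |r₁ - r₂| - 1 := ⟨_, rfl⟩
  obtain ⟨b, hB⟩ : ∃ b : ℤ, b = r₁ + r₂ + 1 := ⟨_, rfl⟩
  rw [← sum_chebY v (by omega) (by omega), Finset.mul_sum, ← hA, ← hB,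
    show |r₁ - r₂| + 1 = a + 2 by omega, show r₁ + r₂ - 1 = b - 2 by omega]
  -- the summand with a negative index is replaced by a correction term
  have h3 : ∀ r ∈ stepTwo (a + 2) (b - 2), v ^ 2 * chebY v r =
      slY v (r + 2) + (slY v (r + 0) + slY v (r + 0)) + slY v (r + -2) - if r = 1 then 1 else 0 := by
    intro r hr
    rw [mem_stepTwo] at hr
    have e1 := chebY_add_one v (r + 1)
    have e2 := chebY_add_one v r
    have e3 := chebY_add_one v (r - 1)
    rw [add_sub_cancel_right, add_assoc, one_add_one_eq_two] at e1
    rw [sub_add_cancel, sub_sub, one_add_one_eq_two] at e3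
    have e4 : slY v (r + -2) = chebY v (r - 2) + if r = 1 then 1 else 0 := by
      rw [← sub_eq_add_neg]
      split_ifs with h
      · rw [h, show (1 : ℤ) - 2 = -1 by norm_num, chebY_neg, chebY_one, slY, if_pos (by norm_num)]
        ring
      · rw [slY_of_nonneg v (by omega), add_zero]
    rw [e4, slY_of_nonneg v (by omega), slY_of_nonneg v (by omega), add_zero]
    linear_combination -e1 - v * e2 - e3
  rw [Finset.sum_congr rfl h3]
  rw [Finset.sum_sub_distrib, Finset.sum_add_distrib, Finset.sum_add_distrib,
    Finset.sum_add_distrib, sum_stepTwo_shift _ (by omega) (by omega) (by omega),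
    sum_stepTwo_shift _ (by omega) (by omega) (by omega),
    sum_stepTwo_shift _ (by omega) (by omega) (by omega)]
  -- The value `r = 1` occurs in the range exactly if `a = -1`, that is, if `r₁ = r₂`.
  have h4 : ∑ r ∈ stepTwo (a + 2) (b - 2), (if r = 1 then (1 : R) else 0) =
      ∑ r ∈ stepTwo a b, if r = 1 ∧ a = -1 then slY v r else 0 := by
    rw [Finset.sum_ite_eq']
    by_cases h : a = -1
    · rw [if_pos (by rw [mem_stepTwo]; omega), Finset.sum_eq_single 1, if_pos ⟨rfl, h⟩,
        slY_of_nonneg v zero_le_one, chebY_one]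
      · intro r _ hr; rw [if_neg (by tauto)]
      · intro h'; rw [mem_stepTwo] at h'; omega
    · rw [if_neg (by rw [mem_stepTwo]; omega), Finset.sum_eq_zero]
      intro r _; rw [if_neg (by tauto)]
  rw [h4, ← Finset.sum_add_distrib, ← Finset.sum_add_distrib, ← Finset.sum_add_distrib,
    ← Finset.sum_sub_distrib]
  refine Finset.sum_congr rfl fun r hr => ?_
  rw [mem_stepTwo] at hr
  rcases le_or_gt r 0 with h | h
  · have : slY v r = 0 := by rw [slY, if_pos h]
    simp [this]
  -- For positive `r` the multiplicity is an identity of indicators, including the cases of short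
  -- ranges where end points and their neighbours coincide.
  have h5 : (fourTimesDoublePrime a b r : ℤ) = (if a + 2 + 2 ≤ r ∧ r ≤ b - 2 + 2 then 1 else 0) +
      ((if a + 2 + 0 ≤ r ∧ r ≤ b - 2 + 0 then 1 else 0) +
        (if a + 2 + 0 ≤ r ∧ r ≤ b - 2 + 0 then 1 else 0)) +
      (if a + 2 + -2 ≤ r ∧ r ≤ b - 2 + -2 then 1 else 0) - if r = 1 ∧ a = -1 then 1 else 0 := by
    rw [fourTimesDoublePrime]
    split_ifs <;> omega
  have h6 := congrArg (Int.cast (R := R)) h5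
  push_cast at h6
  rw [h6]
  simp only [add_mul, sub_mul, ite_mul, one_mul, zero_mul]

end Multiplicity

end

noncomputable section

open GenAction

/-! ### The classes of the modules -/

-- The ring acting on the Grothendieck group is not commutative, but the polynomial identities
-- require commutativity. Three commuting elements generate a commutative subring.
universe u in
theorem exists_commRing_of_commute {A : Type u} [Ring A] {a b c : A} (hab : a * b = b * a)
    (hac : a * c = c * a) (hbc : b * c = c * b) :
    ∃ (R : Type u) (_ : CommRing R) (ι : R →+* A) (x y z : R),
      Function.Injective ι ∧ ι x = a ∧ ι y = b ∧ ι z = c := by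
  have h : ∀ u ∈ ({a, b, c} : Set A), ∀ w ∈ ({a, b, c} : Set A), u * w = w * u := by
    rintro u (rfl | rfl | rfl) w (rfl | rfl | rfl) <;> first | rfl | assumption | (symm; assumption)
  have hc := Subring.isMulCommutative_closure h
  let _ : CommRing (Subring.closure {a, b, c}) :=
    { (inferInstance : Ring (Subring.closure {a, b, c})) with
      mul_comm := fun y z => hc.is_comm.comm y z }
  exact ⟨Subring.closure {a, b, c}, inferInstance, (Subring.closure {a, b, c}).subtype,
    ⟨a, Subring.subset_closure (by simp)⟩, ⟨b, Subring.subset_closure (by simp)⟩,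
    ⟨c, Subring.subset_closure (by simp)⟩, Subtype.val_injective, rfl, rfl, rfl⟩

variable {p : ℕ}

/-- Both orders give `X^{αβ}_{s,r}`. -/
theorem X_mul_comm [hp : Fact (2 ≤ p)] (α β : ℤˣ) {s r : ℤ} (hs : 0 ≤ s) (hr : 0 ≤ r) :
    cl p (X p α s 1) * cl p (X p β 1 r) = cl p (X p β 1 r) * cl p (X p α s 1) := by
  have h1 := good_X hp.out α hs zero_le_one
  have h2 := good_X hp.out β zero_le_one hr
  rw [← cl_tensor h1 h2, ← cl_tensor h2 h1, cl_congr (h1.tensor h2) (X_tensor_X_iso hp.out α β hs hr),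
    cl_congr (h2.tensor h1) (X_tensor_X_iso' hp.out α β hs hr)]

theorem cl_X_eq_mul [hp : Fact (2 ≤ p)] (α β : ℤˣ) {s r : ℤ} (hs : 0 ≤ s) (hr : 0 ≤ r) :
    cl p (X p (α * β) s r) = cl p (X p α s 1) * cl p (X p β 1 r) := by
  have h1 := good_X hp.out α hs zero_le_one
  have h2 := good_X hp.out β zero_le_one hr
  rw [← cl_tensor h1 h2, cl_congr (h1.tensor h2) (X_tensor_X_iso hp.out α β hs hr)]

theorem cl_X_zero [hp : Fact (2 ≤ p)] (α : ℤˣ) {s r : ℤ} (h : s = 0 ∨ r = 0) :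
    cl p (X p α s r) = 0 := by
  have : Subsingleton (X p α s r).V := by
    have : IsEmpty {i // XLabel s r i} := ⟨fun i => by
      obtain ⟨i, h1, h2, h3, h4⟩ := i
      omega⟩
    exact inferInstanceAs (Subsingleton ({i // XLabel s r i} →₀ ℂ))
  rw [← cl_zero, ← cl_congr good_zero (iso_zero_of_subsingleton (X p α s r)).symm]

theorem cl_X_one_one [hp : Fact (2 ≤ p)] : cl p (X p 1 1 1) = 1 := by
  rw [← cl_triv, cl_congr (good_X hp.out 1 zero_le_one zero_le_one) (X_one_one_iso_triv hp.out)]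

theorem good_P (hp : 2 ≤ p) (α : ℤˣ) {s : ℤ} (r : ℤ) (hs : 1 ≤ s) (hsp : s ≤ p) :
    Good p (P p α s r) := by
  rw [P]
  split_ifs with h1 h2
  · exact good_zero
  · exact good_X hp α (by omega) (by omega)
  · exact ((good_T hp hsp).tensor (good_X hp α zero_le_one (by omega))).of_iso
      (P_iso hp α hs (by omega) (by omega)).symm

/-- The commutative ring generated by the classes of `X^+_{2,1}`, `X^-_{1,1}` and `X^+_{1,2}`. -/
structure ClassModel (p : ℕ) [Fact (2 ≤ p)] (R : Type*) [CommRing R] where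
  ι : R →+* ClassRing p
  x : R
  σ : R
  v : R
  injective : Function.Injective ι
  hx : ι x = cl p (X p 1 2 1)
  hσ : ι σ = cl p (X p (-1) 1 1)
  hv : ι v = cl p (X p 1 1 2)

namespace ClassModel

variable [hp : Fact (2 ≤ p)] {R : Type*} [CommRing R] (S : ClassModel p R)

/-- The class of `X^α_{1,1}`. -/
def sig (α : ℤˣ) : R := if α = 1 then 1 else S.σ

theorem cl_sig (α : ℤˣ) : cl p (X p α 1 1) = S.ι (S.sig α) := by
  rcases Int.units_eq_one_or α with rfl | rfl
  · rw [sig, if_pos rfl, map_one, cl_X_one_one]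
  · rw [sig, if_neg (by decide), S.hσ]

theorem sig_mul (α β : ℤˣ) : S.sig (α * β) = S.sig α * S.sig β := by
  apply S.injective
  rw [map_mul, ← cl_sig, ← cl_sig, ← cl_sig, cl_X_eq_mul α β zero_le_one zero_le_one]

theorem sig_neg (α : ℤˣ) : S.sig (-α) = S.σ * S.sig α := by
  rw [← neg_one_mul, sig_mul]
  congr 1

theorem σ_sq : S.σ ^ 2 = 1 := by
  have h := S.sig_mul (-1) (-1)
  simp only [neg_mul_neg, mul_one, sig] at h
  rw [pow_two]
  simpa using h.symm

theorem cl_X_one {r : ℤ} (hr : 0 ≤ r) : cl p (X p 1 1 r) = S.ι (chebY S.v r) := by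
  obtain ⟨r, rfl⟩ := Int.eq_ofNat_of_zero_le hr
  suffices cl p (X p 1 1 r) = S.ι (chebY S.v r) ∧
    cl p (X p 1 1 (r + 1)) = S.ι (chebY S.v (r + 1)) from this.1
  clear hr
  induction r with
  | zero =>
    rw [Nat.cast_zero, zero_add, chebY_zero, chebY_one, map_zero, map_one, cl_X_one_one,
      cl_X_zero 1 (Or.inr rfl)]
    exact ⟨rfl, rfl⟩
  | succ r ih =>
    push_cast
    refine ⟨ih.2, ?_⟩
    have hg : ∀ r : ℤ, 0 ≤ r → Good p (X p 1 1 r) := fun r hr => good_X hp.out 1 zero_le_one hr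
    have h := cl_congr ((hg 2 (by omega)).tensor (hg (r + 1) (by omega)))
      (X_one_two_tensor_iso hp.out (r := r + 1) (by omega))
    rw [cl_tensor (hg 2 (by omega)) (hg _ (by omega)), cl_add (hg _ (by omega)) (hg _ (by omega)),
      add_sub_cancel_right, ih.1, ih.2, ← S.hv] at h
    rw [chebY_add_one, add_sub_cancel_right, map_sub, map_mul, h, add_sub_cancel_right]

/-- The recurrence comes from `X2_tensor_X_iso` and is available only below `p`; beyond that
`Y_s(x)` need not be the class of a module of this kind. -/
theorem cl_X_two {s : ℤ} (hs : 0 ≤ s) (hsp : s ≤ p) :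
    cl p (X p 1 s 1) = S.ι (chebY S.x s) := by
  obtain ⟨s, rfl⟩ := Int.eq_ofNat_of_zero_le hs
  suffices cl p (X p 1 s 1) = S.ι (chebY S.x s) ∧ (s < p →
    cl p (X p 1 (s + 1) 1) = S.ι (chebY S.x (s + 1))) from this.1
  clear hs
  induction s with
  | zero =>
    rw [Nat.cast_zero, zero_add, chebY_zero, chebY_one, map_zero, map_one, cl_X_one_one,
      cl_X_zero 1 (Or.inl rfl)]
    exact ⟨rfl, fun _ => rfl⟩
  | succ s ih =>
    push_cast at hsp ⊢
    have ih := ih (by omega)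
    have ih2 := ih.2 (by omega)
    refine ⟨ih2, fun hlt => ?_⟩
    have hg : ∀ s : ℤ, 0 ≤ s → Good p (X p 1 s 1) := fun r hr => good_X hp.out 1 hr zero_le_one
    have h := cl_congr ((hg 2 (by omega)).tensor (hg (s + 1) (by omega)))
      (X2_tensor_X_iso hp.out (s := s + 1) (by omega) (by omega))
    rw [cl_tensor (hg 2 (by omega)) (hg _ (by omega)), cl_add (hg _ (by omega)) (hg _ (by omega)),
      add_sub_cancel_right, ih.1, ih2, ← S.hx] at h
    rw [chebY_add_one, add_sub_cancel_right, map_sub, map_mul, h, add_sub_cancel_right]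

theorem cl_X (α : ℤˣ) {s r : ℤ} (hs : 0 ≤ s) (hsp : s ≤ p) (hr : 0 ≤ r) :
    cl p (X p α s r) = S.ι (S.sig α * (chebY S.x s * chebY S.v r)) := by
  have h1 := cl_X_eq_mul (p := p) 1 α hs hr
  have h2 := cl_X_eq_mul (p := p) α 1 zero_le_one hr
  rw [one_mul] at h1
  rw [mul_one] at h2
  rw [h1, h2, S.cl_X_two hs hsp, S.cl_X_one hr, S.cl_sig, ← map_mul, ← map_mul]
  congr 1
  ring

/-- Induction downwards from `s = p`. The initial values `2 Y_p` and `x Y_p` are those of `C_0` and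
`C_1`, and `X2_tensor_T_iso` is the recurrence. -/
theorem cl_T {s : ℤ} (hs : 0 ≤ s) (hsp : s ≤ p) :
    cl p (T p s) = S.ι (chebC S.x (p - s) * chebY S.x p) := by
  have hX2 : Good p (X p 1 2 1) := good_X hp.out 1 (by norm_num) zero_le_one
  have hXp : Good p (X p 1 p 1) := good_X hp.out 1 (by omega) zero_le_one
  have hT : ∀ s : ℤ, s ≤ p → Good p (T p s) := fun s h => good_T hp.out h
  obtain ⟨j, hj⟩ : ∃ j : ℕ, s = p - j := ⟨(p - s).toNat, by omega⟩
  subst hj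
  suffices cl p (T p (p - j)) = S.ι (chebC S.x j * chebY S.x p) ∧ (j < p →
      cl p (T p (p - j - 1)) = S.ι (chebC S.x (j + 1) * chebY S.x p)) by
    rw [sub_sub_cancel]; exact this.1
  clear hsp
  induction j with
  | zero =>
    rw [Nat.cast_zero, sub_zero, zero_add, chebC_zero, chebC_one]
    constructor
    · rw [cl_congr (hT p le_rfl) (T_self_iso hp.out), cl_add hXp hXp, S.cl_X_two (by omega) le_rfl,
        two_mul, map_add]
    · intro _
      rw [← cl_congr (hX2.tensor hXp) (X2_tensor_X_self_iso hp.out), cl_tensor hX2 hXp,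
        S.cl_X_two (by omega) le_rfl, ← S.hx, map_mul]
  | succ j ih =>
    push_cast at hs ⊢
    have ih := ih (by omega)
    have ih2 := ih.2 (by omega)
    rw [sub_add_eq_sub_sub]
    refine ⟨ih2, fun hlt => ?_⟩
    have h := cl_congr (hX2.tensor (hT (p - j - 1) (by omega)))
      (X2_tensor_T_iso hp.out (s := p - j - 1) (by omega) (by omega))
    rw [cl_tensor hX2 (hT _ (by omega)), cl_add (hT _ (by omega)) (hT _ (by omega)),
      sub_add_cancel, ih.1, ih2, ← S.hx, ← map_mul] at h
    rw [chebC_add_one, add_sub_cancel_right, sub_mul, map_sub, mul_assoc, h, add_sub_cancel_left]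

/-- The class of `T_0` computed in two ways: as the end of the recurrence for `T_s`, and as the
simple module `X^-_{p,2}`. -/
theorem relation : chebC S.x p * chebY S.x p = S.σ * S.v * chebY S.x p := by
  apply S.injective
  have h1 := S.cl_T (s := 0) le_rfl (by omega)
  have h2 := cl_congr (good_T hp.out (show (0 : ℤ) ≤ p by omega)) (T_zero_iso hp.out)
  rw [sub_zero] at h1
  rw [← h1, h2, S.cl_X (-1) (by omega) le_rfl (by norm_num), chebY_two, sig, if_neg (by decide)]
  congr 1
  ring

theorem cl_P (α : ℤˣ) {s : ℤ} (r : ℤ) (hs : 1 ≤ s) (hsp : s ≤ p) :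
    cl p (P p α s r) = S.ι (S.sig α * (projY S.x p s * slY S.v r)) := by
  by_cases h1 : r ≤ 0
  · rw [P, if_pos h1, slY, if_pos h1, cl_zero, mul_zero, mul_zero, map_zero]
  by_cases h2 : s = p
  · rw [P, if_neg h1, if_pos h2, projY, if_pos h2, slY, if_neg h1,
      S.cl_X α (by omega) hsp (by omega), h2]
  · have hT := good_T hp.out hsp
    have hX := good_X hp.out α zero_le_one (show 0 ≤ r by omega)
    rw [P, if_neg h1, if_neg h2, projY, if_neg h2, slY, if_neg h1,
      ← cl_congr (hT.tensor hX) (P_iso hp.out α hs (by omega) (by omega)).symm, cl_tensor hT hX,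
      S.cl_T (by omega) hsp, S.cl_X α zero_le_one (by omega) (by omega), ← map_mul, chebY_one]
    congr 1
    ring

/-- The module `M` is good, and its class is the image of `y`. -/
def HasClass (M : GenAction) (y : R) : Prop := Good p M ∧ cl p M = S.ι y

variable {S}

/-- The way back from the commutative ring: equal polynomials in the classes give isomorphic
modules. -/
theorem HasClass.iso {M N : GenAction} {y z : R} (hM : S.HasClass M y) (hN : S.HasClass N z)
    (h : z = y) : Iso M N :=
  (cl_eq_iff hM.1 hN.1).1 (by rw [hM.2, hN.2, h])

theorem HasClass.add {M N : GenAction} {y z : R} (hM : S.HasClass M y) (hN : S.HasClass N z) :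
    S.HasClass (GenAction.add M N) (y + z) :=
  ⟨hM.1.add hN.1, by rw [cl_add hM.1 hN.1, hM.2, hN.2, map_add]⟩

theorem HasClass.tensor {M N : GenAction} {y z : R} (hM : S.HasClass M y) (hN : S.HasClass N z) :
    S.HasClass (GenAction.tensor p M N) (y * z) :=
  ⟨hM.1.tensor hN.1, by rw [cl_tensor hM.1 hN.1, hM.2, hN.2, map_mul]⟩

theorem HasClass.copies {M : GenAction} {y : R} (n : ℕ) (hM : S.HasClass M y) :
    S.HasClass (GenAction.copies n M) (n * y) :=
  ⟨(good_and_cl_copies n hM.1).1, by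
    rw [(good_and_cl_copies n hM.1).2, hM.2, map_mul, map_natCast]⟩

theorem HasClass.sum {ι : Type} {A : Finset ι} {M : ι → GenAction} {y : ι → R}
    (h : ∀ i ∈ A, S.HasClass (M i) (y i)) : S.HasClass (GenAction.sum A M) (∑ i ∈ A, y i) :=
  ⟨(good_and_cl_sum A M fun i hi => (h i hi).1).1, by
    rw [(good_and_cl_sum A M fun i hi => (h i hi).1).2, map_sum]
    exact Finset.sum_congr rfl fun i hi => (h i hi).2⟩

variable (S)

theorem hasClass_X (α : ℤˣ) {s r : ℤ} (hs : 0 ≤ s) (hsp : s ≤ p) (hr : 0 ≤ r) :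
    S.HasClass (X p α s r) (S.sig α * (chebY S.x s * chebY S.v r)) :=
  ⟨good_X hp.out α hs hr, S.cl_X α hs hsp hr⟩

theorem hasClass_P (α : ℤˣ) {s : ℤ} (r : ℤ) (hs : 1 ≤ s) (hsp : s ≤ p) :
    S.HasClass (P p α s r) (S.sig α * (projY S.x p s * slY S.v r)) :=
  ⟨good_P hp.out α r hs hsp, S.cl_P α r hs hsp⟩

theorem hasClass_sum_X (α : ℤˣ) (A : Finset ℤ) {r : ℤ} (hA : ∀ s ∈ A, 0 ≤ s ∧ s ≤ p)
    (hr : 0 ≤ r) : S.HasClass (GenAction.sum A fun s => X p α s r)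
      (S.sig α * ((∑ s ∈ A, chebY S.x s) * slY S.v r)) := by
  have h := HasClass.sum fun s hs => S.hasClass_X α (hA s hs).1 (hA s hs).2 hr
  rwa [← Finset.mul_sum, ← Finset.sum_mul, ← slY_of_nonneg S.v hr] at h

theorem hasClass_sum_P (α : ℤˣ) (A : Finset ℤ) (r : ℤ) (hA : ∀ s ∈ A, 1 ≤ s ∧ s ≤ p) :
    S.HasClass (GenAction.sum A fun s => P p α s r)
      (S.sig α * ((∑ s ∈ A, projY S.x p s) * slY S.v r)) := by
  have h := HasClass.sum fun s hs => S.hasClass_P α r (hA s hs).1 (hA s hs).2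
  rwa [← Finset.mul_sum, ← Finset.sum_mul] at h

end ClassModel

theorem sum_slY {R : Type*} [CommRing R] (v : R) {r₁ r₂ : ℤ} (h1 : 1 ≤ r₁) (h2 : 1 ≤ r₂) :
    ∑ r ∈ stepTwo (|r₁ - r₂| + 1) (r₁ + r₂ - 1), slY v r = chebY v r₁ * chebY v r₂ := by
  rw [← sum_chebY v (by omega) (by omega)]
  refine Finset.sum_congr rfl fun r hr => slY_of_nonneg v ?_
  rw [mem_stepTwo] at hr
  have := abs_nonneg (r₁ - r₂)
  omega

theorem exists_classModel (p : ℕ) [hp : Fact (2 ≤ p)] :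
    ∃ (R : Type 1) (_ : CommRing R), Nonempty (ClassModel p R) := by
  obtain ⟨R, _, ι, x, σ, v, h1, h2, h3, h4⟩ := exists_commRing_of_commute
    (X_mul_comm (p := p) 1 (-1) (s := 2) (r := 1) (by norm_num) zero_le_one)
    (X_mul_comm (p := p) 1 1 (s := 2) (r := 2) (by norm_num) (by norm_num))
    (X_mul_comm (p := p) (-1) 1 (s := 1) (r := 2) (by norm_num) (by norm_num))
  exact ⟨R, _, ⟨⟨ι, x, σ, v, h1, h2, h3, h4⟩⟩⟩

end

end LusztigLimit

/-! ### The three decompositions, read off from the identities in the class ring. -/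

open LusztigLimit LusztigLimit.GenAction in
theorem theorem1p1 (p : ℕ) (hp : 2 ≤ p) :
    -- the listed objects are modules over the quantum group
    (∀ (α : ℤˣ) (s r : ℤ), 1 ≤ s → s ≤ p → 1 ≤ r →
      IsModule p (X p α s r) ∧ IsModule p (P p α s r)) ∧
    -- irreducible with irreducible
    (∀ (α β : ℤˣ) (s₁ s₂ r₁ r₂ : ℤ),
      1 ≤ s₁ → s₁ ≤ p → 1 ≤ s₂ → s₂ ≤ p → 1 ≤ r₁ → 1 ≤ r₂ →
      Iso (tensor p (X p α s₁ r₁) (X p β s₂ r₂))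
        (sum (stepTwo (|r₁ - r₂| + 1) (r₁ + r₂ - 1)) fun r =>
          add
            (sum (stepTwo (|s₁ - s₂| + 1) (min (s₁ + s₂ - 1) (2 * p - s₁ - s₂ - 1))) fun s =>
              X p (α * β) s r)
            (sum (stepTwo (2 * p - s₁ - s₂ + 1) (p - (s₁ + s₂ + p + 1) % 2)) fun s =>
              P p (α * β) s r))) ∧
    -- irreducible with projective
    (∀ (α β : ℤˣ) (s₁ s₂ r₁ r₂ : ℤ),
      1 ≤ s₁ → s₁ ≤ p → 1 ≤ s₂ → s₂ ≤ p - 1 → 1 ≤ r₁ → 1 ≤ r₂ →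
      Iso (tensor p (X p α s₁ r₁) (P p β s₂ r₂))
        (add
          (sum (stepTwo (|r₁ - r₂| + 1) (r₁ + r₂ - 1)) fun r =>
            add
              (sum (stepTwo (|s₁ - s₂| + 1) (min (s₁ + s₂ - 1) (2 * p - s₁ - s₂ - 1))) fun s =>
                P p (α * β) s r)
              (copies 2
                (sum (stepTwo (2 * p - s₁ - s₂ + 1) (p - (s₁ + s₂ + p + 1) % 2)) fun s =>
                  P p (α * β) s r)))
          (sum (stepTwo |r₁ - r₂| (r₁ + r₂)) fun r =>
            copies (twicePrime |r₁ - r₂| (r₁ + r₂) r)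
              (sum (stepTwo (p - s₁ + s₂ + 1) (p - (s₁ + s₂ + 1) % 2)) fun s =>
                P p (-(α * β)) s r)))) ∧
    -- projective with projective
    (∀ (α β : ℤˣ) (s₁ s₂ r₁ r₂ : ℤ),
      1 ≤ s₁ → s₁ ≤ p - 1 → 1 ≤ s₂ → s₂ ≤ p - 1 → 1 ≤ r₁ → 1 ≤ r₂ →
      Iso (tensor p (P p α s₁ r₁) (P p β s₂ r₂))
        (add
          (add
            (copies 2
              (sum (stepTwo (|r₁ - r₂| + 1) (r₁ + r₂ - 1)) fun r =>
                add
                  (sum (stepTwo (|s₁ - s₂| + 1)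
                      (min (s₁ + s₂ - 1) (2 * p - s₁ - s₂ - 1))) fun s =>
                    P p (α * β) s r)
                  (copies 2
                    (sum (stepTwo (2 * p - s₁ - s₂ + 1) (p - (s₁ + s₂ + p + 1) % 2)) fun s =>
                      P p (α * β) s r))))
            (sum (stepTwo |r₁ - r₂| (r₁ + r₂)) fun r =>
              copies (twicePrime |r₁ - r₂| (r₁ + r₂) r)
                (add
                  (sum (stepTwo (|p - s₁ - s₂| + 1)
                      (min (p - s₁ + s₂ - 1) (p + s₁ - s₂ - 1))) fun s =>
                    P p (-(α * β)) s r)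
                  (copies 2
                    (sum (stepTwo (min (p - s₁ + s₂ + 1) (p + s₁ - s₂ + 1))
                        (p - (s₁ + s₂ + 1) % 2)) fun s =>
                      P p (-(α * β)) s r)))))
          (sum (stepTwo (|r₁ - r₂| - 1) (r₁ + r₂ + 1)) fun r =>
            copies (fourTimesDoublePrime (|r₁ - r₂| - 1) (r₁ + r₂ + 1) r)
              (sum (stepTwo (s₁ + s₂ + 1) (p - (s₁ + s₂ + p + 1) % 2)) fun s =>
                P p (α * β) s r)))) := by
  have : Fact (2 ≤ p) := ⟨hp⟩
  obtain ⟨R, _, ⟨S⟩⟩ := exists_classModel p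
  have hσ := S.σ_sq
  have hw := S.relation
  refine ⟨fun α s r h1 h2 h3 => ⟨isModule_X hp α h1 h2 h3, isModule_P hp α h1 h2 h3⟩, ?_, ?_, ?_⟩
  · intro α β s₁ s₂ r₁ r₂ h1 h1p h2 h2p hr1 hr2
    have hs := abs_cases (s₁ - s₂)
    have hr := abs_nonneg (r₁ - r₂)
    have hR := ClassModel.HasClass.sum (S := S) fun r (h : r ∈ stepTwo (|r₁ - r₂| + 1) (r₁ + r₂ - 1)) =>
      (S.hasClass_sum_X (α * β)
        (stepTwo (|s₁ - s₂| + 1) (min (s₁ + s₂ - 1) (2 * p - s₁ - s₂ - 1))) (r := r)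
        (fun s h => by rw [mem_stepTwo] at h; omega) (by rw [mem_stepTwo] at h; omega)).add
      (S.hasClass_sum_P (α * β) (stepTwo (2 * p - s₁ - s₂ + 1) (p - (s₁ + s₂ + p + 1) % 2)) r
        (fun s h => by rw [mem_stepTwo] at h; omega))
    refine ((S.hasClass_X α (by omega) h1p (by omega)).tensor
      (S.hasClass_X β (by omega) h2p (by omega))).iso hR ?_
    simp_rw [← mul_add, ← add_mul]
    rw [← Finset.mul_sum, ← Finset.mul_sum, sum_slY S.v hr1 hr2,
      -- The sums over `r` and `s` separate, so the identity is a product of one in `x` and one in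
      -- `v`.
      chebY_mul_chebY_eq h1 h1p h2 h2p, S.sig_mul]
    ring
  · intro α β s₁ s₂ r₁ r₂ h1 h1p h2 h2p hr1 hr2
    have hs := abs_cases (s₁ - s₂)
    have hr := abs_nonneg (r₁ - r₂)
    have hR := (ClassModel.HasClass.sum (S := S)
      fun r (_ : r ∈ stepTwo (|r₁ - r₂| + 1) (r₁ + r₂ - 1)) =>
        (S.hasClass_sum_P (α * β)
          (stepTwo (|s₁ - s₂| + 1) (min (s₁ + s₂ - 1) (2 * p - s₁ - s₂ - 1))) r
          (fun s h => by rw [mem_stepTwo] at h; omega)).add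
        ((S.hasClass_sum_P (α * β) (stepTwo (2 * p - s₁ - s₂ + 1) (p - (s₁ + s₂ + p + 1) % 2)) r
          (fun s h => by rw [mem_stepTwo] at h; omega)).copies 2)).add
      (ClassModel.HasClass.sum (S := S) fun r (_ : r ∈ stepTwo |r₁ - r₂| (r₁ + r₂)) =>
        (S.hasClass_sum_P (-(α * β)) (stepTwo (p - s₁ + s₂ + 1) (p - (s₁ + s₂ + 1) % 2)) r
          (fun s h => by rw [mem_stepTwo] at h; omega)).copies
            (twicePrime |r₁ - r₂| (r₁ + r₂) r))
    refine ((S.hasClass_X α (by omega) h1p (by omega)).tensor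
      (S.hasClass_P β r₂ h2 (by omega))).iso hR ?_
    have e := chebY_mul_projY_eq hw h1 h1p h2 (by omega)
    have e1 := sum_slY S.v hr1 hr2
    have e2 := sum_twicePrime S.v hr1 hr2
    rw [slY_of_nonneg S.v (show 0 ≤ r₂ by omega), S.sig_neg, S.sig_mul]
    -- The sums over `s` are made opaque: they depend neither on `r` nor on `v`, so each sum over
    -- `r` pulls out as a factor.
    generalize ∑ s ∈ stepTwo (|s₁ - s₂| + 1) (min (s₁ + s₂ - 1) (2 * p - s₁ - s₂ - 1)),
      projY S.x p s = A at e ⊢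
    generalize ∑ s ∈ stepTwo (2 * p - s₁ - s₂ + 1) (p - (s₁ + s₂ + p + 1) % 2),
      projY S.x p s = B at e ⊢
    generalize ∑ s ∈ stepTwo (p - s₁ + s₂ + 1) (p - (s₁ + s₂ + 1) % 2),
      projY S.x p s = C at e ⊢
    rw [Finset.sum_congr (s₁ := stepTwo (|r₁ - r₂| + 1) (r₁ + r₂ - 1)) rfl fun r _ =>
        show _ = S.sig α * S.sig β * (A + 2 * B) * slY S.v r by
        push_cast; ring,
      Finset.sum_congr (s₁ := stepTwo |r₁ - r₂| (r₁ + r₂)) rfl fun r _ =>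
        show _ = S.σ * (S.sig α * S.sig β) * C *
        ((twicePrime |r₁ - r₂| (r₁ + r₂) r : R) * slY S.v r) by ring,
      ← Finset.mul_sum, ← Finset.mul_sum, e1, e2]
    linear_combination S.sig α * S.sig β * (chebY S.v r₁ * chebY S.v r₂) * e
  · intro α β s₁ s₂ r₁ r₂ h1 h1p h2 h2p hr1 hr2
    have hs := abs_cases (s₁ - s₂)
    have hs' := abs_cases (p - s₁ - s₂)
    have hr := abs_nonneg (r₁ - r₂)
    have hR := (((ClassModel.HasClass.sum (S := S)
      fun r (_ : r ∈ stepTwo (|r₁ - r₂| + 1) (r₁ + r₂ - 1)) =>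
        (S.hasClass_sum_P (α * β)
          (stepTwo (|s₁ - s₂| + 1) (min (s₁ + s₂ - 1) (2 * p - s₁ - s₂ - 1))) r
          (fun s h => by rw [mem_stepTwo] at h; omega)).add
        ((S.hasClass_sum_P (α * β) (stepTwo (2 * p - s₁ - s₂ + 1) (p - (s₁ + s₂ + p + 1) % 2)) r
          (fun s h => by rw [mem_stepTwo] at h; omega)).copies 2)).copies 2).add
      (ClassModel.HasClass.sum (S := S) fun r (_ : r ∈ stepTwo |r₁ - r₂| (r₁ + r₂)) =>
        ((S.hasClass_sum_P (-(α * β)) (stepTwo (|p - s₁ - s₂| + 1)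
            (min (p - s₁ + s₂ - 1) (p + s₁ - s₂ - 1))) r
          (fun s h => by rw [mem_stepTwo] at h; omega)).add
        ((S.hasClass_sum_P (-(α * β)) (stepTwo (min (p - s₁ + s₂ + 1) (p + s₁ - s₂ + 1))
            (p - (s₁ + s₂ + 1) % 2)) r
          (fun s h => by rw [mem_stepTwo] at h; omega)).copies 2)).copies
            (twicePrime |r₁ - r₂| (r₁ + r₂) r))).add
      (ClassModel.HasClass.sum (S := S) fun r (_ : r ∈ stepTwo (|r₁ - r₂| - 1) (r₁ + r₂ + 1)) =>
        (S.hasClass_sum_P (α * β) (stepTwo (s₁ + s₂ + 1) (p - (s₁ + s₂ + p + 1) % 2)) r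
          (fun s h => by rw [mem_stepTwo] at h; omega)).copies
            (fourTimesDoublePrime (|r₁ - r₂| - 1) (r₁ + r₂ + 1) r))
    refine ((S.hasClass_P α r₁ h1 (by omega)).tensor
      (S.hasClass_P β r₂ h2 (by omega))).iso hR ?_
    have e := projY_mul_projY_eq hw h1 (by omega) h2 (by omega)
    have e1 := sum_slY S.v hr1 hr2
    have e2 := sum_twicePrime S.v hr1 hr2
    have e3 := sum_fourTimesDoublePrime S.v hr1 hr2
    rw [slY_of_nonneg S.v (show 0 ≤ r₁ by omega), slY_of_nonneg S.v (show 0 ≤ r₂ by omega),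
      S.sig_neg, S.sig_mul]
    generalize ∑ s ∈ stepTwo (|s₁ - s₂| + 1) (min (s₁ + s₂ - 1) (2 * p - s₁ - s₂ - 1)),
      projY S.x p s = A at e ⊢
    generalize ∑ s ∈ stepTwo (2 * p - s₁ - s₂ + 1) (p - (s₁ + s₂ + p + 1) % 2),
      projY S.x p s = B at e ⊢
    generalize ∑ s ∈ stepTwo (|p - s₁ - s₂| + 1) (min (p - s₁ + s₂ - 1) (p + s₁ - s₂ - 1)),
      projY S.x p s = C at e ⊢
    generalize ∑ s ∈ stepTwo (min (p - s₁ + s₂ + 1) (p + s₁ - s₂ + 1)) (p - (s₁ + s₂ + 1) % 2),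
      projY S.x p s = D at e ⊢
    generalize ∑ s ∈ stepTwo (s₁ + s₂ + 1) (p - (s₁ + s₂ + p + 1) % 2),
      projY S.x p s = G at e ⊢
    rw [Finset.sum_congr (s₁ := stepTwo (|r₁ - r₂| + 1) (r₁ + r₂ - 1)) rfl fun r _ =>
        show _ = S.sig α * S.sig β * (A + 2 * B) * slY S.v r by
        push_cast; ring,
      Finset.sum_congr (s₁ := stepTwo |r₁ - r₂| (r₁ + r₂)) rfl fun r _ =>
        show _ = S.σ * (S.sig α * S.sig β) * (C + 2 * D) *
        ((twicePrime |r₁ - r₂| (r₁ + r₂) r : R) * slY S.v r) by push_cast; ring,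
      Finset.sum_congr (s₁ := stepTwo (|r₁ - r₂| - 1) (r₁ + r₂ + 1)) rfl fun r _ =>
        show _ = S.sig α * S.sig β * G *
        ((fourTimesDoublePrime (|r₁ - r₂| - 1) (r₁ + r₂ + 1) r : R) * slY S.v r) by ring,
      ← Finset.mul_sum, ← Finset.mul_sum, ← Finset.mul_sum, e1, e2, e3]
    push_cast
    -- With `w = σ v`, the doubly primed sum arises with the factor `w² = σ² v²`; `σ² = 1` explains
    -- why its sign is again `αβ`.
    linear_combination S.sig α * S.sig β * (chebY S.v r₁ * chebY S.v r₂) * e -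
      S.sig α * S.sig β * (chebY S.v r₁ * chebY S.v r₂) * S.v ^ 2 * G * hσ
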